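/- Let $X$ be a smooth quasi-projective complex curve with structure sheaf $\mathcal O$ and tangent sheaf $\mathcal T$. Let $0\to\mathcal O\to\mathcal D^1\to\mathcal T\to 0$ be either (1) a Lie algebroid of twisted first-order differential operators, that is, a Lie algebroid on $X$ whose anchor is the projection $\mathcal D^1\to\mathcal T$ and in which $1\in\mathcal O$ is central, or (2) an extension of vector bundles, with zero bracket and anchor. Let $\mathcal D$ be the quotient of the enveloping algebra of $\mathcal D^1$ that identifies $1\in\mathcal O\subset\mathcal D^1$ with the unit (in case (2), $\mathcal D=\operatorname{Sym}(\mathcal D^1)/(1-\mathbf 1)$), filtered by the images $\mathcal D^n$ of $(\mathcal D^1)^{n}$, and let $\mathcal R=\mathcal R(\mathcal D)=\bigoplus_{n\ge 0}\mathcal D^n t^n$ be its Rees algebra. Let $\operatorname{Gr}\mathcal R$ be the category of graded left $\mathcal R$-modules that are quasi-coherent over $\mathcal O$. A module is irrelevant if every local section is annihilated by $\mathcal R_n$ for all large $n$. Let $\pi:\operatorname{Gr}\mathcal R\to\operatorname{Qgr}\mathcal R$ be the quotient by the irrelevant modules. Write $\mathcal R(k)_n=\mathcal R_{n+k}$; tensor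 products below are over $\mathcal O$, and $\mathcal D^1$ and $\mathcal R$ are tensored through their right $\mathcal O$-module structures. Then $\mathcal R(k)\otimes-$, $\mathcal D^1\otimes-$ and $\mathcal T\otimes-$ preserve quasi-coherence, $\pi$ has a right adjoint $\omega$, and $\operatorname{Qgr}\mathcal R$ has enough injectives. For a complex $M$ in $\operatorname{Gr}\mathcal R$ let $\mathbb B(M)$ and $\mathbb B'(M)$ be the total complexes of $$\mathcal R(-1)\otimes\mathcal T\otimes M_{-1}\xrightarrow{\ \alpha\ }\mathcal R\otimes M_0,\qquad \mathcal R(-1)\otimes M_{-1}\to\mathcal R(-1)\otimes\mathcal D^1\otimes M_{-1}\xrightarrow{\ \alpha\ }\mathcal R\otimes M_0,$$ with $\mathcal R\otimes M_0$ placed in column $0$. Here the map $\alpha$ of the second complex is $a\otimes Z\otimes m\mapsto aZ\otimes tm-at\otimes Zm$ (with $Z$ acting as $Zt\in\mathcal R_1$); it vanishes on $\mathcal O\subset\mathcal D^1$ and so induces the map $\alpha$ of the first; the remaining map is $a\otimes m\mapsto a\otimes 1\otimes m$. (These are the complexes $(\delta\otimes_{\mathcal R}M)_{\bullet,0}$ and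 $(\delta'\otimes_{\mathcal R}M)_{\bullet,0}$ for the resolutions $\delta,\delta'$ of the diagonal bimodule of $\mathcal R$.) Let $D_{dg}(\mathbf P_{\mathcal D})$ be the dg category of bounded below complexes of injective objects of $\operatorname{Qgr}\mathcal R$ with bounded cohomology, a dg enhancement of $D^b(\operatorname{Qgr}\mathcal R)$. The Beilinson transforms of $M$ are $\pi\mathbb B(R\omega M)$ and $\pi\mathbb B'(R\omega M)$. Theorem. Both Beilinson transforms are isomorphic to the identity functor on $D_{dg}(\mathbf P_{\mathcal D})$: for $B=\mathbb B$ and for $B=\mathbb B'$ there is a closed natural transformation of degree $0$ of dg functors from $\pi\circ B\circ\omega$ to the identity which is a quasi-isomorphism at every object of $D_{dg}(\mathbf P_{\mathcal D})$; moreover $B$ descends to the derived category of $\operatorname{Gr}\mathcal R$, and $\pi\circ B\circ R\omega$ is isomorphic to the identity functor on $D^b(\operatorname{Qgr}\mathcal R)$. Consequently $\pi\mathcal R\oplus\pi\mathcal R(1)$ generates the derived category: every object of $D^b(\operatorname{Qgr}\mathcal R)$ lies in the smallest triangulated subcategory, closed under direct summands, that contains all $\pi(\mathcal R\otimes V)$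 and $\pi(\mathcal R(1)\otimes V)$ with $V$ a quasi-coherent sheaf on $X$; and if $X$ is affine, every $M\in D^b(\operatorname{Qgr}\mathcal R)$ with $\operatorname{Hom}(\pi\mathcal R\oplus\pi\mathcal R(1),M[n])=0$ for all $n\in\mathbb Z$ is zero. -/

import Mathlib

open CategoryTheory AlgebraicGeometry Limits TensorProduct

namespace NCBeilinson

variable {X : Scheme.{0}} {s : X ⟶ Spec (CommRingCat.of ℂ)}

section Curve

variable {X : Scheme.{0}} (s : X ⟶ Spec (CommRingCat.of ℂ))

/-- A smooth complex curve: smooth of relative dimension one, separated and of finite type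
over `ℂ`. (Every such curve is quasi-projective; connectedness is not needed.) -/
class IsSmoothCurve : Prop where
  smooth : SmoothOfRelativeDimension 1 s
  separated : IsSeparated s
  quasiCompact : QuasiCompact s

/-- The ring `O(U)` of sections over an affine open `U`, as a `ℂ`-algebra through `s`. -/
def Sec (_ : X ⟶ Spec (CommRingCat.of ℂ)) (U : X.affineOpens) : Type := Γ(X, U.1)

instance (U : X.affineOpens) : CommRing (Sec s U) := inferInstanceAs (CommRing Γ(X, U.1))

noncomputable instance (U : X.affineOpens) : Algebra ℂ (Sec s U) :=
  RingHom.toAlgebra (((Scheme.ΓSpecIso (CommRingCat.of ℂ)).inv ≫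
    s.appLE ⊤ U.1 le_top).hom : ℂ →+* Γ(X, U.1))

/-- Restriction of functions. -/
def resO {U V : X.affineOpens} (h : V ≤ U) : Sec s U →+* Sec s V :=
  (X.presheaf.map (homOfLE (show V.1 ≤ U.1 from h)).op).hom

lemma resO_self {U : X.affineOpens} (h : U ≤ U) (f : Sec s U) : resO s h f = f := by
  change (X.presheaf.map (𝟙 _)).hom f = f
  rw [X.presheaf.map_id]; rfl

lemma resO_resO {U V W : X.affineOpens} (h : V ≤ U) (h' : W ≤ V) (f : Sec s U) :
    resO s h' (resO s h f) = resO s (h'.trans h) f := by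
  change (X.presheaf.map _ ≫ X.presheaf.map _).hom f = _
  rw [← X.presheaf.map_comp]; rfl

/-- The basic affine open `{f ≠ 0}` of an affine open. -/
def bas {U : X.affineOpens} (f : Sec s U) : X.affineOpens := X.affineBasicOpen (U := U) f

lemma bas_le {U : X.affineOpens} (f : Sec s U) : bas s f ≤ U := X.affineBasicOpen_le (V := U) f

end Curve

/-- The data of `D¹`: a quasi-coherent extension `0 → O → D¹ → T → 0` of the tangent sheaf of `X` by
the structure sheaf, with a Lie algebroid structure in which `1` is central, and such that either
* the anchor is the projection `D¹ → T` (a Lie algebroid of twisted first order differential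
  operators), or
* anchor and bracket vanish (an extension of vector bundles, regarded as a bimodule that is
  supported on the diagonal).
Quasi-coherent sheaves are given by their sections over affine opens. The `O`-module structure of
the fields is the left one; the right one is `Z · f = f Z + anchor(Z)(f) · 1`. -/
structure FirstOrder {X : Scheme.{0}} (s : X ⟶ Spec (CommRingCat.of ℂ)) where
  E : X.affineOpens → Type
  [grp : ∀ U, AddCommGroup (E U)]
  [mod : ∀ U, Module (Sec s U) (E U)]
  res : ∀ {U V : X.affineOpens}, V ≤ U → (E U →+ E V)
  res_self : ∀ {U : X.affineOpens} (h : U ≤ U) (z : E U), res h z = z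
  res_res : ∀ {U V W : X.affineOpens} (h : V ≤ U) (h' : W ≤ V) (z : E U),
    res h' (res h z) = res (h'.trans h) z
  res_smul : ∀ {U V : X.affineOpens} (h : V ≤ U) (f : Sec s U) (z : E U),
    res h (f • z) = resO s h f • res h z
  /-- quasi-coherence: `E(U)_f = E(U_f)` -/
  loc_surj : ∀ {U : X.affineOpens} (f : Sec s U) (y : E (bas s f)), ∃ (k : ℕ) (x : E U),
    (resO s (bas_le s f) f) ^ k • y = res (bas_le s f) x
  loc_inj : ∀ {U : X.affineOpens} (f : Sec s U) (x : E U), res (bas_le s f) x = 0 →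
    ∃ k : ℕ, f ^ k • x = 0
  /-- the section `1` of `O ⊆ D¹` -/
  one : ∀ U, E U
  res_one : ∀ {U V : X.affineOpens} (h : V ≤ U), res h (one U) = one V
  /-- the projection to the tangent sheaf -/
  symbol : ∀ U, E U →ₗ[Sec s U] Derivation ℂ (Sec s U) (Sec s U)
  symbol_res : ∀ {U V : X.affineOpens} (h : V ≤ U) (z : E U) (f : Sec s U),
    symbol V (res h z) (resO s h f) = resO s h (symbol U z f)
  smul_one_injective : ∀ (U : X.affineOpens) (f : Sec s U), f • one U = 0 → f = 0
  symbol_eq_zero_iff : ∀ (U : X.affineOpens) (z : E U),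
    symbol U z = 0 ↔ ∃ f : Sec s U, z = f • one U
  symbol_surjective : ∀ U, Function.Surjective (symbol U)
  /-- the anchor of the Lie algebroid -/
  anchor : ∀ U, E U →ₗ[Sec s U] Derivation ℂ (Sec s U) (Sec s U)
  anchor_res : ∀ {U V : X.affineOpens} (h : V ≤ U) (z : E U) (f : Sec s U),
    anchor V (res h z) (resO s h f) = resO s h (anchor U z f)
  bracket : ∀ U, E U →+ E U →+ E U
  bracket_res : ∀ {U V : X.affineOpens} (h : V ≤ U) (z w : E U),
    res h (bracket U z w) = bracket V (res h z) (res h w)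
  bracket_self : ∀ (U : X.affineOpens) (z : E U), bracket U z z = 0
  jacobi : ∀ (U : X.affineOpens) (x y z : E U), bracket U x (bracket U y z) =
    bracket U (bracket U x y) z + bracket U y (bracket U x z)
  bracket_smul : ∀ (U : X.affineOpens) (z w : E U) (f : Sec s U),
    bracket U z (f • w) = f • bracket U z w + anchor U z f • w
  anchor_bracket : ∀ (U : X.affineOpens) (z w : E U) (f : Sec s U),
    anchor U (bracket U z w) f = anchor U z (anchor U w f) - anchor U w (anchor U z f)
  bracket_one : ∀ (U : X.affineOpens) (z : E U), bracket U z (one U) = 0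
  anchor_eq : (∀ U, anchor U = symbol U) ∨ (∀ U, anchor U = 0 ∧ bracket U = 0)

attribute [instance] FirstOrder.grp FirstOrder.mod

namespace FirstOrder

variable (𝓔 : FirstOrder s)

lemma anchor_one (U : X.affineOpens) : 𝓔.anchor U (𝓔.one U) = 0 := by
  rcases 𝓔.anchor_eq with h | h
  · rw [h, 𝓔.symbol_eq_zero_iff]; exact ⟨1, (one_smul _ _).symm⟩
  · rw [(h U).1]; rfl

lemma bracket_smul_one (U : X.affineOpens) (z : 𝓔.E U) (f : Sec s U) :
    𝓔.bracket U z (f • 𝓔.one U) = 𝓔.anchor U z f • 𝓔.one U := by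
  rw [𝓔.bracket_smul, 𝓔.bracket_one, smul_zero, zero_add]

/-- The relations of the enveloping algebra of `D¹(U)`. -/
inductive Rel (U : X.affineOpens) : FreeAlgebra ℤ (𝓔.E U) → FreeAlgebra ℤ (𝓔.E U) → Prop
  | add (z w : 𝓔.E U) : Rel U (FreeAlgebra.ι ℤ (z + w)) (FreeAlgebra.ι ℤ z + FreeAlgebra.ι ℤ w)
  | one : Rel U (FreeAlgebra.ι ℤ (𝓔.one U)) 1
  | smul (f : Sec s U) (z : 𝓔.E U) : Rel U (FreeAlgebra.ι ℤ (f • z))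
      (FreeAlgebra.ι ℤ (f • 𝓔.one U) * FreeAlgebra.ι ℤ z)
  | bracket (z w : 𝓔.E U) : Rel U
      (FreeAlgebra.ι ℤ z * FreeAlgebra.ι ℤ w) (FreeAlgebra.ι ℤ w * FreeAlgebra.ι ℤ z +
        FreeAlgebra.ι ℤ (𝓔.bracket U z w))

/-- The ring `D(U)`: the quotient of the enveloping algebra of the Lie algebroid `D¹` which
identifies `1 ∈ O ⊆ D¹` with `1`. If anchor and bracket vanish, this is `Sym(D¹)/(1 - 𝟏)`. -/
def D (U : X.affineOpens) : Type := RingQuot (𝓔.Rel U)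

noncomputable instance (U : X.affineOpens) : Ring (𝓔.D U) :=
  inferInstanceAs (Ring (RingQuot (𝓔.Rel U)))

/-- The quotient map from the free algebra. -/
noncomputable def quo (U : X.affineOpens) : FreeAlgebra ℤ (𝓔.E U) →+* 𝓔.D U :=
  RingQuot.mkRingHom (𝓔.Rel U)

lemma quo_rel {U : X.affineOpens} {a b : FreeAlgebra ℤ (𝓔.E U)} (h : 𝓔.Rel U a b) :
    𝓔.quo U a = 𝓔.quo U b := RingQuot.mkRingHom_rel h

/-- The map `D¹ → D`. -/
noncomputable def ιE (U : X.affineOpens) : 𝓔.E U →+ 𝓔.D U :=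
  AddMonoidHom.mk' (fun z => 𝓔.quo U (FreeAlgebra.ι ℤ z)) (fun z w => by
    rw [𝓔.quo_rel (.add z w), map_add])

lemma ιE_one (U : X.affineOpens) : 𝓔.ιE U (𝓔.one U) = 1 :=
  (𝓔.quo_rel .one).trans (map_one _)

lemma ιE_smul' (U : X.affineOpens) (f : Sec s U) (z : 𝓔.E U) :
    𝓔.ιE U (f • z) = 𝓔.ιE U (f • 𝓔.one U) * 𝓔.ιE U z :=
  (𝓔.quo_rel (.smul f z)).trans (map_mul _ _ _)

/-- The map `O → D`. -/
noncomputable def ιO (U : X.affineOpens) : Sec s U →+* 𝓔.D U where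
  toFun f := 𝓔.ιE U (f • 𝓔.one U)
  map_one' := by rw [one_smul, ιE_one]
  map_mul' f g := by rw [mul_smul, ιE_smul']
  map_zero' := by rw [zero_smul, map_zero]
  map_add' f g := by rw [add_smul, map_add]

lemma ιE_smul (U : X.affineOpens) (f : Sec s U) (z : 𝓔.E U) :
    𝓔.ιE U (f • z) = 𝓔.ιO U f * 𝓔.ιE U z := 𝓔.ιE_smul' U f z

lemma ιE_mul_ιE (U : X.affineOpens) (z w : 𝓔.E U) :
    𝓔.ιE U z * 𝓔.ιE U w = 𝓔.ιE U w * 𝓔.ιE U z + 𝓔.ιE U (𝓔.bracket U z w) := by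
  have := 𝓔.quo_rel (.bracket z w)
  simp only [map_mul, map_add] at this
  exact this

lemma ιE_mul_ιO (U : X.affineOpens) (z : 𝓔.E U) (f : Sec s U) :
    𝓔.ιE U z * 𝓔.ιO U f = 𝓔.ιE U (f • z + 𝓔.anchor U z f • 𝓔.one U) := by
  change 𝓔.ιE U z * 𝓔.ιE U (f • 𝓔.one U) = _
  rw [ιE_mul_ιE, bracket_smul_one, ← ιE_smul', ← map_add]

/-- Restriction `D(U) → D(V)`. -/
noncomputable def resD {U V : X.affineOpens} (h : V ≤ U) : 𝓔.D U →+* 𝓔.D V :=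
  RingQuot.lift ⟨(FreeAlgebra.lift ℤ (fun z => 𝓔.ιE V (𝓔.res h z)) :
    FreeAlgebra ℤ (𝓔.E U) →ₐ[ℤ] 𝓔.D V).toRingHom, by
      intro a b hab
      induction hab with
      | add z w => simp
      | one => simp [𝓔.res_one, ιE_one]
      | smul f z => simp [𝓔.res_smul, 𝓔.res_one, ιE_smul' _ _ _ (𝓔.res h z)]
      | bracket z w => simp [𝓔.bracket_res, ιE_mul_ιE _ _ (𝓔.res h z)]⟩

lemma resD_ιE {U V : X.affineOpens} (h : V ≤ U) (z : 𝓔.E U) :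
    𝓔.resD h (𝓔.ιE U z) = 𝓔.ιE V (𝓔.res h z) := by
  refine (RingQuot.lift_mkRingHom_apply _ _ _).trans ?_
  simp

lemma resD_ιO {U V : X.affineOpens} (h : V ≤ U) (f : Sec s U) :
    𝓔.resD h (𝓔.ιO U f) = 𝓔.ιO V (resO s h f) := by
  change 𝓔.resD h (𝓔.ιE U _) = 𝓔.ιE V _
  rw [resD_ιE, 𝓔.res_smul, 𝓔.res_one]

lemma D_hom_ext {U : X.affineOpens} {A : Type} [Ring A] {φ ψ : 𝓔.D U →+* A}
    (h : ∀ z, φ (𝓔.ιE U z) = ψ (𝓔.ιE U z)) : φ = ψ := by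
  apply RingQuot.ringQuot_ext
  have : (φ.comp (𝓔.quo U)).toIntAlgHom = (ψ.comp (𝓔.quo U)).toIntAlgHom := by
    ext z; exact h z
  ext x
  exact DFunLike.congr_fun this x

lemma resD_self {U : X.affineOpens} (h : U ≤ U) (d : 𝓔.D U) : 𝓔.resD h d = d := by
  have : 𝓔.resD h = RingHom.id _ := 𝓔.D_hom_ext (fun z => by simp [resD_ιE, 𝓔.res_self])
  rw [this]; rfl

lemma resD_resD {U V W : X.affineOpens} (h : V ≤ U) (h' : W ≤ V) (d : 𝓔.D U) :
    𝓔.resD h' (𝓔.resD h d) = 𝓔.resD (h'.trans h) d := by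
  have : (𝓔.resD h').comp (𝓔.resD h) = 𝓔.resD (h'.trans h) :=
    𝓔.D_hom_ext (fun z => by simp [resD_ιE, 𝓔.res_res])
  rw [← this]; rfl

/-- The image of `O` in `D`. -/
noncomputable def imO (U : X.affineOpens) : Submodule ℤ (𝓔.D U) :=
  LinearMap.range (𝓔.ιO U).toAddMonoidHom.toIntLinearMap

/-- The image of `D¹` in `D`. -/
noncomputable def imE (U : X.affineOpens) : Submodule ℤ (𝓔.D U) :=
  LinearMap.range (𝓔.ιE U).toIntLinearMap

/-- The filtration of `D` by order: `Dⁿ = O · (D¹)ⁿ` for `n ≥ 0` and `Dⁿ = 0` for `n < 0`.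
The Rees algebra `R = ∑ Dⁿ tⁿ` has `Dⁿ tⁿ` as its component of degree `n`. -/
noncomputable def fil (U : X.affineOpens) (n : ℤ) : Submodule ℤ (𝓔.D U) :=
  if 0 ≤ n then 𝓔.imO U * 𝓔.imE U ^ n.toNat else ⊥

lemma fil_natCast (U : X.affineOpens) (n : ℕ) :
    𝓔.fil U n = 𝓔.imO U * 𝓔.imE U ^ n := by simp [fil]

lemma fil_neg (U : X.affineOpens) {n : ℤ} (h : n < 0) : 𝓔.fil U n = ⊥ := by
  simp [fil, not_le.2 h]

lemma imO_mul_imO (U : X.affineOpens) : 𝓔.imO U * 𝓔.imO U ≤ 𝓔.imO U := by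
  rw [Submodule.mul_le]
  rintro _ ⟨f, rfl⟩ _ ⟨g, rfl⟩
  exact ⟨f * g, map_mul (𝓔.ιO U) f g⟩

lemma imE_mul_imO (U : X.affineOpens) : 𝓔.imE U * 𝓔.imO U ≤ 𝓔.imE U := by
  rw [Submodule.mul_le]
  rintro _ ⟨z, rfl⟩ _ ⟨f, rfl⟩
  exact ⟨_, (𝓔.ιE_mul_ιO U z f).symm⟩

lemma one_le_imO (U : X.affineOpens) : 1 ≤ 𝓔.imO U := by
  rw [Submodule.one_le]; exact ⟨1, map_one (𝓔.ιO U)⟩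

lemma imE_pow_mul_imO (U : X.affineOpens) (n : ℕ) :
    𝓔.imE U ^ n * 𝓔.imO U ≤ 𝓔.imO U * 𝓔.imE U ^ n := by
  cases n with
  | zero => simp
  | succ n =>
    rw [pow_succ, mul_assoc]
    refine (mul_le_mul' le_rfl (𝓔.imE_mul_imO U)).trans ?_
    calc _ = 1 * (𝓔.imE U ^ n * 𝓔.imE U) := (one_mul _).symm
      _ ≤ _ := mul_le_mul' (𝓔.one_le_imO U) le_rfl

lemma fil_mul_le (U : X.affineOpens) (m n : ℤ) : 𝓔.fil U m * 𝓔.fil U n ≤ 𝓔.fil U (m + n) := by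
  rcases lt_or_ge m 0 with hm | hm
  · rw [𝓔.fil_neg U hm]; simp
  rcases lt_or_ge n 0 with hn | hn
  · rw [𝓔.fil_neg U hn]; simp
  obtain ⟨m, rfl⟩ := Int.eq_ofNat_of_zero_le hm
  obtain ⟨n, rfl⟩ := Int.eq_ofNat_of_zero_le hn
  rw [← Nat.cast_add, fil_natCast, fil_natCast, fil_natCast, pow_add]
  calc _ = 𝓔.imO U * (𝓔.imE U ^ m * 𝓔.imO U) * 𝓔.imE U ^ n := by simp only [mul_assoc]
    _ ≤ 𝓔.imO U * (𝓔.imO U * 𝓔.imE U ^ m) * 𝓔.imE U ^ n :=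
        mul_le_mul' (mul_le_mul' le_rfl (𝓔.imE_pow_mul_imO U m)) le_rfl
    _ = (𝓔.imO U * 𝓔.imO U) * (𝓔.imE U ^ m * 𝓔.imE U ^ n) := by simp only [mul_assoc]
    _ ≤ _ := mul_le_mul' (𝓔.imO_mul_imO U) le_rfl

lemma mul_mem_fil {U : X.affineOpens} {m n k : ℤ} (h : m + n = k) {a b : 𝓔.D U}
    (ha : a ∈ 𝓔.fil U m) (hb : b ∈ 𝓔.fil U n) : a * b ∈ 𝓔.fil U k :=
  h ▸ 𝓔.fil_mul_le U m n (Submodule.mul_mem_mul ha hb)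

lemma ιO_mem_fil {U : X.affineOpens} (f : Sec s U) : 𝓔.ιO U f ∈ 𝓔.fil U 0 := by
  have := 𝓔.fil_natCast U 0
  rw [Nat.cast_zero, pow_zero, mul_one] at this
  rw [this]; exact ⟨f, rfl⟩

lemma ιE_mem_fil {U : X.affineOpens} (z : 𝓔.E U) : 𝓔.ιE U z ∈ 𝓔.fil U 1 := by
  have := 𝓔.fil_natCast U 1
  rw [Nat.cast_one, pow_one] at this
  rw [this, ← one_mul (𝓔.ιE U z)]
  exact Submodule.mul_mem_mul (Submodule.one_le.1 (𝓔.one_le_imO U)) ⟨z, rfl⟩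

lemma one_mem_fil_zero (U : X.affineOpens) : (1 : 𝓔.D U) ∈ 𝓔.fil U 0 := by
  simpa using 𝓔.ιO_mem_fil (U := U) 1

/-- The element `t` of the Rees algebra is `1`, placed in degree one. -/
lemma one_mem_fil_one (U : X.affineOpens) : (1 : 𝓔.D U) ∈ 𝓔.fil U 1 := by
  simpa [ιE_one] using 𝓔.ιE_mem_fil (U := U) (𝓔.one U)

lemma resD_mem_fil {U V : X.affineOpens} (h : V ≤ U) {n : ℤ} {d : 𝓔.D U} (hd : d ∈ 𝓔.fil U n) :
    𝓔.resD h d ∈ 𝓔.fil V n := by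
  rcases lt_or_ge n 0 with hn | hn
  · rw [𝓔.fil_neg U hn, Submodule.mem_bot] at hd
    rw [hd, map_zero]; exact zero_mem _
  obtain ⟨n, rfl⟩ := Int.eq_ofNat_of_zero_le hn
  rw [fil_natCast] at hd ⊢
  have key : (𝓔.imO U * 𝓔.imE U ^ n).map (𝓔.resD h).toIntAlgHom.toLinearMap ≤
      𝓔.imO V * 𝓔.imE V ^ n := by
    rw [Submodule.map_mul, Submodule.map_pow]
    refine mul_le_mul' ?_ (pow_le_pow_left' ?_ n)
    · rintro _ ⟨_, ⟨f, rfl⟩, rfl⟩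
      exact ⟨_, (𝓔.resD_ιO h f).symm⟩
    · rintro _ ⟨_, ⟨z, rfl⟩, rfl⟩
      exact ⟨_, (𝓔.resD_ιE h z).symm⟩
  exact key ⟨d, hd, rfl⟩

end FirstOrder

section QuasiCoherent

/-- The affine opens of `X`, with the morphisms `U ⟶ V` for `V ≤ U` given by the sections of `O`
over `V`: the composite of a restriction and a multiplication. -/
structure OCat (_ : X ⟶ Spec (CommRingCat.of ℂ)) where
  U : X.affineOpens

/-- Restrict to `V`, then multiply by `val`. -/
@[ext]
structure OCat.Hom (x y : OCat s) where
  sub : y.U ≤ x.U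
  val : Sec s y.U

instance : Category (OCat s) where
  Hom := OCat.Hom
  id x := ⟨le_rfl, 1⟩
  comp f g := ⟨g.sub.trans f.sub, g.val * resO s g.sub f.val⟩
  id_comp f := by ext; simp
  comp_id f := by ext; simp [resO_self]
  assoc f g h := by ext; simp [resO_resO, mul_assoc]

/-- Multiplication by a section. -/
def OCat.mul (U : X.affineOpens) (f : Sec s U) : (⟨U⟩ : OCat s) ⟶ ⟨U⟩ := ⟨le_rfl, f⟩

/-- Restriction. -/
def OCat.restr {U V : X.affineOpens} (h : V ≤ U) : (⟨U⟩ : OCat s) ⟶ ⟨V⟩ := ⟨h, 1⟩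

/-- A functor `V : OCat s ⥤ Ab` is a presheaf of `O`-modules on the affine opens of `X` as
soon as the action of `O` is additive. -/
def isOMod : ObjectProperty (OCat s ⥤ AddCommGrpCat.{0}) := fun V =>
  ∀ ⦃x y : OCat s⦄ (h : y.U ≤ x.U) (a b : Sec s y.U),
    V.map (X := x) (Y := y) ⟨h, a + b⟩ =
      V.map (X := x) (Y := y) ⟨h, a⟩ + V.map (X := x) (Y := y) ⟨h, b⟩

/-- Quasi-coherence: `V(U)_f = V(U_f)` for all affine opens `U` and all `f ∈ O(U)`. -/
def isQCoh : ObjectProperty (OCat s ⥤ AddCommGrpCat.{0}) := fun V =>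
  isOMod V ∧ ∀ (U : X.affineOpens) (f : Sec s U),
    (∀ y : V.obj ⟨bas s f⟩, ∃ (k : ℕ) (x : V.obj ⟨U⟩),
      V.map (OCat.mul _ (resO s (bas_le s f) f ^ k)) y = V.map (OCat.restr (bas_le s f)) x) ∧
    (∀ x : V.obj ⟨U⟩, V.map (OCat.restr (bas_le s f)) x = 0 →
      ∃ k : ℕ, V.map (OCat.mul U (f ^ k)) x = 0)

variable (s) in
/-- Presheaves of `O`-modules on the affine opens of `X`. -/
abbrev OMod := (isOMod (s := s)).FullSubcategory

variable (s) in
/-- Quasi-coherent sheaves on `X`, given by their modules of sections over affine opens. -/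
abbrev QCoh := (isQCoh (s := s)).FullSubcategory

lemma isQCoh_le_isOMod : isQCoh (s := s) ≤ isOMod := fun _ h => h.1

end QuasiCoherent

section Graded

/-- The homogeneous elements of the Rees algebra `R = ⊕ Dⁿ tⁿ`: the objects are pairs of an
affine open `U` and a degree, a morphism `(U, n) ⟶ (V, m)` for `V ≤ U` is an element of
`R_{m-n}(V) = D^{m-n}(V)`: the composite of a restriction and a multiplication. -/
structure RCat (𝓔 : FirstOrder s) where
  U : X.affineOpens
  deg : ℤ

variable {𝓔 : FirstOrder s}

/-- Restrict to `V`, then multiply by `val`. -/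
@[ext]
structure RCat.Hom (x y : RCat 𝓔) where
  sub : y.U ≤ x.U
  val : 𝓔.D y.U
  mem : val ∈ 𝓔.fil y.U (y.deg - x.deg)

noncomputable instance : Category (RCat 𝓔) where
  Hom := RCat.Hom
  id x := ⟨le_rfl, 1, by rw [sub_self]; exact 𝓔.one_mem_fil_zero _⟩
  comp f g := ⟨g.sub.trans f.sub, g.val * 𝓔.resD g.sub f.val,
    𝓔.mul_mem_fil (by ring) g.mem (𝓔.resD_mem_fil g.sub f.mem)⟩
  id_comp f := by ext; simp
  comp_id f := by ext; simp [𝓔.resD_self]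
  assoc f g h := by ext; simp [𝓔.resD_resD, mul_assoc]

@[simp] lemma RCat.comp_val {x y z : RCat 𝓔} (f : x ⟶ y) (g : y ⟶ z) :
    (f ≫ g).val = g.val * 𝓔.resD g.sub f.val := rfl

@[simp] lemma RCat.id_val (x : RCat 𝓔) : RCat.Hom.val (𝟙 x) = 1 := rfl

variable (𝓔) in
/-- The part of degree `k`: the functor along which the component `M_k` of a graded `R`-module is
an `O`-module. -/
noncomputable def degFun (k : ℤ) : OCat s ⥤ RCat 𝓔 where
  obj x := ⟨x.U, k⟩
  map f := ⟨f.sub, 𝓔.ιO _ f.val, by dsimp; rw [sub_self]; exact 𝓔.ιO_mem_fil _⟩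
  map_id x := by
    apply RCat.Hom.ext
    exact map_one (𝓔.ιO _)
  map_comp f g := by
    apply RCat.Hom.ext
    change 𝓔.ιO _ (g.val * resO s g.sub f.val) = 𝓔.ιO _ g.val * 𝓔.resD g.sub (𝓔.ιO _ f.val)
    rw [map_mul, 𝓔.resD_ιO]

/-- A functor `M : RCat 𝓔 ⥤ Ab` is a graded left `R`-module (a presheaf of such on the
affine opens of `X`) as soon as the action of `R` is additive. -/
def isGMod : ObjectProperty (RCat 𝓔 ⥤ AddCommGrpCat.{0}) := fun M =>
  ∀ ⦃x y : RCat 𝓔⦄ (h : y.U ≤ x.U) (a b : 𝓔.D y.U) (ha : a ∈ 𝓔.fil y.U (y.deg - x.deg))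
    (hb : b ∈ 𝓔.fil y.U (y.deg - x.deg)),
    M.map (X := x) (Y := y) ⟨h, a + b, add_mem ha hb⟩ =
      M.map (X := x) (Y := y) ⟨h, a, ha⟩ + M.map (X := x) (Y := y) ⟨h, b, hb⟩

/-- Graded left `R`-modules that are quasi-coherent as `O`-modules. -/
def isGr : ObjectProperty (RCat 𝓔 ⥤ AddCommGrpCat.{0}) := fun M =>
  isGMod M ∧ ∀ k : ℤ, isQCoh (degFun 𝓔 k ⋙ M)

lemma isGr_le_isGMod : isGr (𝓔 := 𝓔) ≤ isGMod := fun _ h => h.1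

variable (𝓔) in
/-- Presheaves of graded left `R`-modules on the affine opens of `X`. -/
abbrev GMod := (isGMod (𝓔 := 𝓔)).FullSubcategory

variable (𝓔) in
/-- The category `Gr R` of graded left `R`-modules that are quasi-coherent over `O`. -/
abbrev Gr := (isGr (𝓔 := 𝓔)).FullSubcategory

end Graded

section Abelian

variable {𝓔 : FirstOrder s}

/-! `Gr R` is closed under kernels, cokernels and finite products. -/

lemma OCat.map_mul_mul (M : OCat s ⥤ AddCommGrpCat.{0}) {U : X.affineOpens} (a b : Sec s U)
    (x : M.obj ⟨U⟩) : M.map (OCat.mul U a) (M.map (OCat.mul U b) x) =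
      M.map (OCat.mul U (a * b)) x := by
  have : (OCat.mul U (a * b) : (⟨U⟩ : OCat s) ⟶ _) = OCat.mul U b ≫ OCat.mul U a := by
    apply OCat.Hom.ext
    change a * b = a * resO s le_rfl b
    rw [resO_self]
  rw [this, M.map_comp]; rfl

lemma OCat.map_mul_restr (M : OCat s ⥤ AddCommGrpCat.{0}) {U V : X.affineOpens} (h : V ≤ U)
    (a : Sec s U) (x : M.obj ⟨U⟩) : M.map (OCat.restr h) (M.map (OCat.mul U a) x) =
      M.map (OCat.mul V (resO s h a)) (M.map (OCat.restr h) x) := by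
  have : (OCat.mul U a ≫ OCat.restr h : (⟨U⟩ : OCat s) ⟶ _) =
      OCat.restr h ≫ OCat.mul V (resO s h a) := by
    apply OCat.Hom.ext
    change 1 * resO s _ a = resO s _ a * resO s _ 1
    simp
  rw [← ConcreteCategory.comp_apply, ← M.map_comp, this, M.map_comp]; rfl

lemma isQCoh_of_kernel {K M N : OCat s ⥤ AddCommGrpCat.{0}} (i : K ⟶ M) (p : M ⟶ N)
    (hi : ∀ x, Function.Injective (i.app x)) (hip : ∀ x, Function.Exact (i.app x) (p.app x))
    (hM : isQCoh M) (hN : isQCoh N) : isQCoh K := by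
  have ei : ∀ {x y : OCat s} (g : x ⟶ y) u, i.app y (K.map g u) = M.map g (i.app x u) :=
    fun g u => ConcreteCategory.congr_hom (i.naturality g) u
  have ep : ∀ {x y : OCat s} (g : x ⟶ y) u, p.app y (M.map g u) = N.map g (p.app x u) :=
    fun g u => ConcreteCategory.congr_hom (p.naturality g) u
  refine ⟨fun x y h a b => ?_, fun U f => ⟨fun y => ?_, fun x hx => ?_⟩⟩
  · ext u
    apply hi
    erw [ei, map_add, ei, ei, hM.1]
    rfl
  · obtain ⟨k, x, hx⟩ := (hM.2 U f).1 (i.app _ y)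
    have h0 : N.map (OCat.restr (bas_le s f)) (p.app _ x) = 0 := by
      rw [← ep, ← hx, ep, (hip _ _).2 ⟨y, rfl⟩, map_zero]
    obtain ⟨l, hl⟩ := (hN.2 U f).2 _ h0
    rw [← ep] at hl
    obtain ⟨w, hw⟩ := (hip _ _).1 hl
    refine ⟨l + k, w, hi _ ?_⟩
    rw [ei, ei, hw, OCat.map_mul_restr, ← hx, OCat.map_mul_mul, map_pow, pow_add]
  · obtain ⟨k, hk⟩ := (hM.2 U f).2 (i.app _ x) (by rw [← ei, hx, map_zero])
    exact ⟨k, hi _ (by rw [ei, hk, map_zero])⟩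

lemma isQCoh_of_cokernel {L M N : OCat s ⥤ AddCommGrpCat.{0}} (i : L ⟶ M) (p : M ⟶ N)
    (hp : ∀ x, Function.Surjective (p.app x)) (hip : ∀ x, Function.Exact (i.app x) (p.app x))
    (hL : isQCoh L) (hM : isQCoh M) : isQCoh N := by
  have ei : ∀ {x y : OCat s} (g : x ⟶ y) u, i.app y (L.map g u) = M.map g (i.app x u) :=
    fun g u => ConcreteCategory.congr_hom (i.naturality g) u
  have ep : ∀ {x y : OCat s} (g : x ⟶ y) u, p.app y (M.map g u) = N.map g (p.app x u) :=
    fun g u => ConcreteCategory.congr_hom (p.naturality g) u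
  refine ⟨fun x y h a b => ?_, fun U f => ⟨fun y => ?_, fun x hx => ?_⟩⟩
  · ext u
    obtain ⟨u, rfl⟩ := hp x u
    erw [← ep, hM.1, map_add, ep, ep]
    rfl
  · obtain ⟨y, rfl⟩ := hp _ y
    obtain ⟨k, x, hx⟩ := (hM.2 U f).1 y
    exact ⟨k, p.app _ x, by rw [← ep, ← ep, hx]⟩
  · obtain ⟨x, rfl⟩ := hp _ x
    rw [← ep] at hx
    obtain ⟨y, hy⟩ := (hip _ _).1 hx
    obtain ⟨k, w, hw⟩ := (hL.2 U f).1 y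
    have h0 : M.map (OCat.restr (bas_le s f)) (M.map (OCat.mul U (f ^ k)) x - i.app _ w) = 0 := by
      rw [map_sub, ← ei, ← hw, ei, hy, OCat.map_mul_restr, map_pow, sub_self]
    obtain ⟨l, hl⟩ := (hM.2 U f).2 _ h0
    refine ⟨l + k, ?_⟩
    rw [map_sub, sub_eq_zero] at hl
    rw [← ep, pow_add, ← OCat.map_mul_mul, hl, ep, (hip _ _).2 ⟨w, rfl⟩, map_zero]

lemma isGr_of_kernel {K M N : RCat 𝓔 ⥤ AddCommGrpCat.{0}} (i : K ⟶ M) (p : M ⟶ N)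
    (hi : ∀ x, Function.Injective (i.app x)) (hip : ∀ x, Function.Exact (i.app x) (p.app x))
    (hM : isGr M) (hN : isGr N) : isGr K := by
  have ei : ∀ {x y : RCat 𝓔} (g : x ⟶ y) u, i.app y (K.map g u) = M.map g (i.app x u) :=
    fun g u => ConcreteCategory.congr_hom (i.naturality g) u
  refine ⟨fun x y h a b ha hb => ?_, fun k => isQCoh_of_kernel
    (Functor.whiskerLeft (degFun 𝓔 k) i) (Functor.whiskerLeft (degFun 𝓔 k) p)
    (fun _ => hi _) (fun _ => hip _) (hM.2 k) (hN.2 k)⟩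
  ext u
  apply hi
  erw [ei, map_add, ei, ei, hM.1 h a b ha hb]
  rfl

lemma isGr_of_cokernel {L M N : RCat 𝓔 ⥤ AddCommGrpCat.{0}} (i : L ⟶ M) (p : M ⟶ N)
    (hp : ∀ x, Function.Surjective (p.app x)) (hip : ∀ x, Function.Exact (i.app x) (p.app x))
    (hL : isGr L) (hM : isGr M) : isGr N := by
  have ep : ∀ {x y : RCat 𝓔} (g : x ⟶ y) u, p.app y (M.map g u) = N.map g (p.app x u) :=
    fun g u => ConcreteCategory.congr_hom (p.naturality g) u
  refine ⟨fun x y h a b ha hb => ?_, fun k => isQCoh_of_cokernel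
    (Functor.whiskerLeft (degFun 𝓔 k) i) (Functor.whiskerLeft (degFun 𝓔 k) p)
    (fun _ => hp _) (fun _ => hip _) (hL.2 k) (hM.2 k)⟩
  ext u
  obtain ⟨u, rfl⟩ := hp x u
  erw [← ep, hM.1 h a b ha hb, map_add, ep, ep]
  rfl

lemma app_exact {J : Type} [SmallCategory J] {S : ShortComplex (J ⥤ AddCommGrpCat.{0})}
    (hS : S.Exact) (x : J) : Function.Exact (S.f.app x) (S.g.app x) :=
  (ShortComplex.ab_exact_iff_function_exact _).1
    (hS.map ((evaluation J AddCommGrpCat.{0}).obj x))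

lemma app_injective {J : Type} [SmallCategory J] {M N : J ⥤ AddCommGrpCat.{0}} (i : M ⟶ N)
    [Mono i] (x : J) : Function.Injective (i.app x) :=
  (AddCommGrpCat.mono_iff_injective _).1 inferInstance

lemma app_surjective {J : Type} [SmallCategory J] {M N : J ⥤ AddCommGrpCat.{0}} (p : M ⟶ N)
    [Epi p] (x : J) : Function.Surjective (p.app x) :=
  (AddCommGrpCat.epi_iff_surjective _).1 inferInstance

instance : (isGr (𝓔 := 𝓔)).IsClosedUnderKernels where
  kernels_le := by
    rintro _ ⟨f, k, hk, hf⟩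
    have : Mono k.ι := mono_of_isLimit_fork hk
    exact isGr_of_kernel k.ι f (app_injective _)
      (app_exact (S := ShortComplex.mk k.ι f k.condition)
        (ShortComplex.exact_of_f_is_kernel _ (hk.ofIsoLimit (Fork.ext (Iso.refl _)))))
      hf.1 hf.2

instance : (isGr (𝓔 := 𝓔)).IsClosedUnderCokernels where
  cokernels_le := by
    rintro _ ⟨f, k, hk, hf⟩
    have : Epi k.π := epi_of_isColimit_cofork hk
    exact isGr_of_cokernel f k.π (app_surjective _)
      (app_exact (S := ShortComplex.mk f k.π k.condition)
        (ShortComplex.exact_of_g_is_cokernel _ (hk.ofIsoColimit (Cofork.ext (Iso.refl _)))))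
      hf.1 hf.2

end Abelian

section Abelian

variable {𝓔 : FirstOrder s}

lemma isQCoh_of_prod {P M N : OCat s ⥤ AddCommGrpCat.{0}} (p : P ⟶ M) (q : P ⟶ N)
    (hi : ∀ x (u v : P.obj x), p.app x u = p.app x v → q.app x u = q.app x v → u = v)
    (hs : ∀ x (m : M.obj x) (n : N.obj x), ∃ u, p.app x u = m ∧ q.app x u = n)
    (hM : isQCoh M) (hN : isQCoh N) : isQCoh P := by
  have ep : ∀ {x y : OCat s} (g : x ⟶ y) u, p.app y (P.map g u) = M.map g (p.app x u) :=
    fun g u => ConcreteCategory.congr_hom (p.naturality g) u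
  have eq : ∀ {x y : OCat s} (g : x ⟶ y) u, q.app y (P.map g u) = N.map g (q.app x u) :=
    fun g u => ConcreteCategory.congr_hom (q.naturality g) u
  refine ⟨fun x y h a b => ?_, fun U f => ⟨fun y => ?_, fun x hx => ?_⟩⟩
  · ext u
    apply hi
    · erw [ep, map_add, ep, ep, hM.1]; rfl
    · erw [eq, map_add, eq, eq, hN.1]; rfl
  · obtain ⟨k, a, ha⟩ := (hM.2 U f).1 (p.app _ y)
    obtain ⟨l, b, hb⟩ := (hN.2 U f).1 (q.app _ y)
    obtain ⟨u, hu, hu'⟩ := hs _ (M.map (OCat.mul U (f ^ l)) a) (N.map (OCat.mul U (f ^ k)) b)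
    refine ⟨l + k, u, hi _ _ _ ?_ ?_⟩
    · rw [ep, ep, hu, OCat.map_mul_restr, ← ha, OCat.map_mul_mul, map_pow, pow_add]
    · rw [eq, eq, hu', OCat.map_mul_restr, ← hb, OCat.map_mul_mul, map_pow, add_comm, pow_add]
  · obtain ⟨k, hk⟩ := (hM.2 U f).2 (p.app _ x) (by rw [← ep, hx, map_zero])
    obtain ⟨l, hl⟩ := (hN.2 U f).2 (q.app _ x) (by rw [← eq, hx, map_zero])
    refine ⟨l + k, hi _ _ _ ?_ ?_⟩
    · rw [ep, pow_add, ← OCat.map_mul_mul, hk, map_zero, map_zero]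
    · rw [eq, add_comm, pow_add, ← OCat.map_mul_mul, hl, map_zero, map_zero]

lemma isGr_of_prod {P M N : RCat 𝓔 ⥤ AddCommGrpCat.{0}} (p : P ⟶ M) (q : P ⟶ N)
    (hi : ∀ x (u v : P.obj x), p.app x u = p.app x v → q.app x u = q.app x v → u = v)
    (hs : ∀ x (m : M.obj x) (n : N.obj x), ∃ u, p.app x u = m ∧ q.app x u = n)
    (hM : isGr M) (hN : isGr N) : isGr P := by
  have ep : ∀ {x y : RCat 𝓔} (g : x ⟶ y) u, p.app y (P.map g u) = M.map g (p.app x u) :=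
    fun g u => ConcreteCategory.congr_hom (p.naturality g) u
  have eq : ∀ {x y : RCat 𝓔} (g : x ⟶ y) u, q.app y (P.map g u) = N.map g (q.app x u) :=
    fun g u => ConcreteCategory.congr_hom (q.naturality g) u
  refine ⟨fun x y h a b ha hb => ?_, fun k => isQCoh_of_prod
    (Functor.whiskerLeft (degFun 𝓔 k) p) (Functor.whiskerLeft (degFun 𝓔 k) q)
    (fun _ => hi _) (fun _ => hs _) (hM.2 k) (hN.2 k)⟩
  ext u
  apply hi
  · erw [ep, map_add, ep, ep, hM.1 h a b ha hb]; rfl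
  · erw [eq, map_add, eq, eq, hN.1 h a b ha hb]; rfl

instance : (isGr (𝓔 := 𝓔)).IsClosedUnderLimitsOfShape (Discrete WalkingPair) where
  limitsOfShape_le := by
    rintro P ⟨h⟩
    let c : BinaryFan (h.diag.obj ⟨.left⟩) (h.diag.obj ⟨.right⟩) :=
      BinaryFan.mk (h.π.app ⟨.left⟩) (h.π.app ⟨.right⟩)
    have hc : IsLimit c := by
      refine BinaryFan.isLimitMk (fun t => h.isLimit.lift ⟨t.pt, ⟨fun j => match j with
        | ⟨.left⟩ => t.fst | ⟨.right⟩ => t.snd, ?_⟩⟩) ?_ ?_ ?_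
      · rintro ⟨(_ | _)⟩ ⟨(_ | _)⟩ ⟨⟨⟨⟩⟩⟩ 
        · exact (Category.id_comp _).trans ((congrArg _ (h.diag.map_id _)).trans
            (Category.comp_id _)).symm
        · exact (Category.id_comp _).trans ((congrArg _ (h.diag.map_id _)).trans
            (Category.comp_id _)).symm
      · exact fun t => h.isLimit.fac _ _
      · exact fun t => h.isLimit.fac _ _
      · intro t m h1 h2
        apply h.isLimit.hom_ext
        rintro ⟨(_ | _)⟩
        · rw [h.isLimit.fac]; exact h1
        · rw [h.isLimit.fac]; exact h2
    obtain ⟨i, hi1, hi2⟩ := BinaryFan.IsLimit.lift' hc (𝟙 _) 0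
    obtain ⟨j, hj1, hj2⟩ := BinaryFan.IsLimit.lift' hc 0 (𝟙 _)
    let p : P ⟶ h.diag.obj ⟨.left⟩ := c.fst
    let q : P ⟶ h.diag.obj ⟨.right⟩ := c.snd
    let i : h.diag.obj ⟨.left⟩ ⟶ P := i
    let j : h.diag.obj ⟨.right⟩ ⟶ P := j
    have tot : p ≫ i + q ≫ j = 𝟙 P := by
      apply BinaryFan.IsLimit.hom_ext hc
      · change (p ≫ i + q ≫ j) ≫ p = 𝟙 P ≫ p
        rw [Preadditive.add_comp, Category.assoc, Category.assoc, show i ≫ p = 𝟙 _ from hi1,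
          show j ≫ p = 0 from hj1]; simp
      · change (p ≫ i + q ≫ j) ≫ q = 𝟙 P ≫ q
        rw [Preadditive.add_comp, Category.assoc, Category.assoc, show i ≫ q = 0 from hi2,
          show j ≫ q = 𝟙 _ from hj2]; simp
    have tot' : ∀ x (u : P.obj x), i.app x (p.app x u) + j.app x (q.app x u) = u :=
      fun x u => ConcreteCategory.congr_hom (congr_app tot x) u
    refine isGr_of_prod p q (fun x u v h1 h2 => ?_) (fun x m n => ?_)
      (h.prop_diag_obj ⟨.left⟩) (h.prop_diag_obj ⟨.right⟩)
    · rw [← tot' x u, ← tot' x v, h1, h2]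
    · have a1 : p.app x (i.app x m) = m := ConcreteCategory.congr_hom (congr_app hi1 x) m
      have a2 : q.app x (i.app x m) = 0 := ConcreteCategory.congr_hom (congr_app hi2 x) m
      have a3 : p.app x (j.app x n) = 0 := ConcreteCategory.congr_hom (congr_app hj1 x) n
      have a4 : q.app x (j.app x n) = n := ConcreteCategory.congr_hom (congr_app hj2 x) n
      exact ⟨i.app x m + j.app x n, by rw [map_add, a1, a3, add_zero],
        by rw [map_add, a2, a4, zero_add]⟩

lemma isGr_of_subsingleton (Z : RCat 𝓔 ⥤ AddCommGrpCat.{0}) (h : ∀ x, Subsingleton (Z.obj x)) :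
    isGr Z :=
  ⟨fun x y _ _ _ _ _ => by ext u; exact Subsingleton.elim _ _, fun k =>
    ⟨fun x y _ _ _ => by ext u; exact (h ⟨y.U, k⟩).elim _ _, fun U f =>
      ⟨fun y => ⟨0, 0, (h ⟨_, k⟩).elim _ _⟩, fun x _ => ⟨0, (h ⟨_, k⟩).elim _ _⟩⟩⟩⟩

instance : (isGr (𝓔 := 𝓔)).ContainsZero where
  exists_zero := by
    obtain ⟨Z, hZ⟩ := HasZeroObject.zero (C := RCat 𝓔 ⥤ AddCommGrpCat.{0})
    exact ⟨Z, hZ, isGr_of_subsingleton _ fun x =>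
      AddCommGrpCat.subsingleton_of_isZero (hZ.obj x)⟩

instance : (isGr (𝓔 := 𝓔)).IsClosedUnderIsomorphisms where
  of_iso {M N} e h := isGr_of_kernel e.inv (0 : M ⟶ M) (app_injective _)
    (fun x u => ⟨fun _ => app_surjective e.inv x u, fun _ => rfl⟩) h h

instance : (isGr (𝓔 := 𝓔)).IsClosedUnderFiniteProducts := .mk'

noncomputable instance : Abelian (Gr 𝓔) := inferInstance

end Abelian

section Serre

open scoped Pointwise

variable {𝓔 : FirstOrder s}

lemma finiteType_sec [h : IsSmoothCurve s] (U : X.affineOpens) :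
    Algebra.FiniteType ℂ (Sec s U) := by
  have := h.smooth
  have : Smooth s := SmoothOfRelativeDimension.smooth 1 s
  have h1 := LocallyOfFiniteType.finiteType_appLE s (isAffineOpen_top _) U.2
    (le_top : U.1 ≤ s ⁻¹ᵁ ⊤)
  have h2 : (Scheme.ΓSpecIso (CommRingCat.of ℂ)).inv.hom.FiniteType :=
    RingHom.FiniteType.of_surjective _
      (ConcreteCategory.bijective_of_isIso (Scheme.ΓSpecIso (CommRingCat.of ℂ)).inv).2
  exact h1.comp h2

lemma finite_E [IsSmoothCurve s] (U : X.affineOpens) : Module.Finite (Sec s U) (𝓔.E U) := by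
  have := finiteType_sec (s := s) U
  have : IsNoetherianRing (Sec s U) := Algebra.FiniteType.isNoetherianRing ℂ _
  have : Module.Finite (Sec s U) (Derivation ℂ (Sec s U) (Sec s U)) :=
    Module.Finite.equiv (KaehlerDifferential.linearMapEquivDerivation ℂ (Sec s U))
  refine ⟨Submodule.fg_of_fg_map_of_fg_inf_ker (𝓔.symbol U) ?_ ?_⟩
  · exact IsNoetherian.noetherian _
  · rw [top_inf_eq]
    refine ⟨{𝓔.one U}, le_antisymm ?_ fun z hz => ?_⟩
    · rw [Submodule.span_le]
      intro z hz
      rw [Finset.coe_singleton, Set.mem_singleton_iff] at hz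
      exact (𝓔.symbol_eq_zero_iff U z).2 ⟨1, by rw [hz, one_smul]⟩
    · obtain ⟨f, rfl⟩ := (𝓔.symbol_eq_zero_iff U z).1 hz
      exact Submodule.smul_mem _ _ (Submodule.subset_span (by simp))

lemma fil_finite [IsSmoothCurve s] (U : X.affineOpens) (n : ℕ) : ∃ S : Set (𝓔.D U), S.Finite ∧
    S ⊆ 𝓔.fil U n ∧ 𝓔.fil U n ≤ 𝓔.imO U * Submodule.span ℤ S := by
  obtain ⟨G, hG⟩ := (finite_E (𝓔 := 𝓔) U).fg_top
  have hle : 𝓔.imE U ≤ 𝓔.imO U * Submodule.span ℤ (𝓔.ιE U '' G) := by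
    rintro _ ⟨z, rfl⟩
    have hz : z ∈ Submodule.span (Sec s U) (G : Set (𝓔.E U)) := hG ▸ Submodule.mem_top
    change 𝓔.ιE U z ∈ _
    induction hz using Submodule.span_induction with
    | mem x hx =>
      rw [← one_mul (𝓔.ιE U x)]
      exact Submodule.mul_mem_mul (Submodule.one_le.1 (𝓔.one_le_imO U))
        (Submodule.subset_span ⟨x, hx, rfl⟩)
    | zero => rw [map_zero]; exact zero_mem _
    | add x y _ _ hx hy => rw [map_add]; exact add_mem hx hy
    | smul f x _ hx =>
      rw [𝓔.ιE_smul]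
      have := Submodule.mul_mem_mul (show 𝓔.ιO U f ∈ 𝓔.imO U from ⟨f, rfl⟩) hx
      rw [← mul_assoc] at this
      exact mul_le_mul' (𝓔.imO_mul_imO U) le_rfl this
  refine ⟨(𝓔.ιE U '' G) ^ n, by
    clear hle hG
    induction n with
    | zero => simp
    | succ n ih => rw [pow_succ]; exact ih.mul (G.finite_toSet.image _), ?_, ?_⟩
  · rw [𝓔.fil_natCast]
    intro x hx
    rw [← one_mul x]
    refine Submodule.mul_mem_mul (Submodule.one_le.1 (𝓔.one_le_imO U)) ?_
    have h1 : Submodule.span ℤ (𝓔.ιE U '' G) ≤ 𝓔.imE U := by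
      rw [Submodule.span_le]
      rintro _ ⟨z, -, rfl⟩
      exact ⟨z, rfl⟩
    refine pow_le_pow_left' h1 n ?_
    rw [Submodule.span_pow]
    exact Submodule.subset_span hx
  · rw [𝓔.fil_natCast, ← Submodule.span_pow]
    induction n with
    | zero => simp
    | succ n ih =>
      rw [pow_succ, pow_succ]
      calc _ ≤ 𝓔.imO U * (𝓔.imE U ^ n * (𝓔.imO U * Submodule.span ℤ (𝓔.ιE U '' G))) :=
            mul_le_mul' le_rfl (mul_le_mul' le_rfl hle)
        _ = 𝓔.imO U * (𝓔.imE U ^ n * 𝓔.imO U) * Submodule.span ℤ (𝓔.ιE U '' G) := by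
            simp only [mul_assoc]
        _ ≤ 𝓔.imO U * (𝓔.imO U * 𝓔.imE U ^ n) * Submodule.span ℤ (𝓔.ιE U '' G) :=
            mul_le_mul' (mul_le_mul' le_rfl (𝓔.imE_pow_mul_imO U n)) le_rfl
        _ = 𝓔.imO U * 𝓔.imO U * 𝓔.imE U ^ n * Submodule.span ℤ (𝓔.ιE U '' G) := by
            simp only [mul_assoc]
        _ ≤ 𝓔.imO U * 𝓔.imE U ^ n * Submodule.span ℤ (𝓔.ιE U '' G) :=
            mul_le_mul' (mul_le_mul' (𝓔.imO_mul_imO U) le_rfl) le_rfl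
        _ ≤ 𝓔.imO U * Submodule.span ℤ (𝓔.ιE U '' G) ^ n * Submodule.span ℤ (𝓔.ιE U '' G) :=
            mul_le_mul' ih le_rfl
        _ = _ := by rw [mul_assoc]

lemma fil_le_mul [IsSmoothCurve s] (U : X.affineOpens) (a b : ℕ) : 𝓔.fil U (a + b : ℕ) ≤
    𝓔.fil U a * 𝓔.fil U b := by
  rw [𝓔.fil_natCast, 𝓔.fil_natCast, 𝓔.fil_natCast, pow_add, ← mul_assoc]
  refine mul_le_mul' le_rfl ?_
  calc _ = 1 * 𝓔.imE U ^ b := (one_mul _).symm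
    _ ≤ _ := mul_le_mul' (𝓔.one_le_imO U) le_rfl

/-- The product `r · m ∈ M_j(U)` of `r ∈ R_{j-k}(U)` with `m ∈ M_k(U)`. -/
def act (M : RCat 𝓔 ⥤ AddCommGrpCat.{0}) {U : X.affineOpens} {k : ℤ} (j : ℤ) (r : 𝓔.D U)
    (hr : r ∈ 𝓔.fil U (j - k)) (m : M.obj ⟨U, k⟩) : M.obj ⟨U, j⟩ :=
  M.map (X := ⟨U, k⟩) (Y := ⟨U, j⟩) ⟨le_rfl, r, hr⟩ m

variable (𝓔) in
/-- The irrelevant (locally bounded) modules: for every local section `m` of degree `k` there is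
`n₀` such that `r · m = 0` for all `n = j - k ≥ n₀` and all `r ∈ R_n`. -/
def irrelevant : ObjectProperty (Gr 𝓔) := fun M =>
  ∀ (U : X.affineOpens) (k : ℤ) (m : M.obj.obj ⟨U, k⟩), ∃ n₀ : ℤ, ∀ j : ℤ, n₀ ≤ j - k →
    ∀ (r : 𝓔.D U) (hr : r ∈ 𝓔.fil U (j - k)), act M.obj j r hr m = 0

lemma act_nat {M N : RCat 𝓔 ⥤ AddCommGrpCat.{0}} (p : M ⟶ N) {U : X.affineOpens} {k j : ℤ}
    (r : 𝓔.D U) (hr : r ∈ 𝓔.fil U (j - k)) (m : M.obj ⟨U, k⟩) :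
    p.app _ (act M j r hr m) = act N j r hr (p.app _ m) :=
  ConcreteCategory.congr_hom (p.naturality _) m

lemma act_act (M : RCat 𝓔 ⥤ AddCommGrpCat.{0}) {U : X.affineOpens} {k j i : ℤ} {a b : 𝓔.D U}
    (ha : a ∈ 𝓔.fil U (j - k)) (hb : b ∈ 𝓔.fil U (i - j)) (m : M.obj ⟨U, k⟩) :
    act M i b hb (act M j a ha m) =
      act M i (b * a) (𝓔.mul_mem_fil (by ring) hb ha) m := by
  refine (ConcreteCategory.congr_hom (M.map_comp _ _) m).symm.trans ?_
  unfold act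
  congr 3
  exact RCat.Hom.ext (congrArg (b * ·) (𝓔.resD_self _ _))

lemma act_add {M : RCat 𝓔 ⥤ AddCommGrpCat.{0}} (hM : isGMod M) {U : X.affineOpens} {k j : ℤ}
    {a b : 𝓔.D U} (ha : a ∈ 𝓔.fil U (j - k)) (hb : b ∈ 𝓔.fil U (j - k)) (m : M.obj ⟨U, k⟩) :
    act M j (a + b) (add_mem ha hb) m = act M j a ha m + act M j b hb m :=
  ConcreteCategory.congr_hom (hM (x := ⟨U, k⟩) (y := ⟨U, j⟩) le_rfl a b ha hb) m

/-- The elements of `R` that annihilate `m`. -/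
def ann {M : RCat 𝓔 ⥤ AddCommGrpCat.{0}} (hM : isGMod M) {U : X.affineOpens} {k : ℤ} (j : ℤ)
    (m : M.obj ⟨U, k⟩) : AddSubgroup (𝓔.D U) where
  carrier := {r | ∃ hr : r ∈ 𝓔.fil U (j - k), act M j r hr m = 0}
  zero_mem' := ⟨zero_mem _, by
    have := act_add (j := j) hM (zero_mem (𝓔.fil U (j - k))) (zero_mem _) m
    simpa using this⟩
  add_mem' := by
    rintro a b ⟨ha, ha'⟩ ⟨hb, hb'⟩
    exact ⟨add_mem ha hb, by rw [act_add hM ha hb, ha', hb', add_zero]⟩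
  neg_mem' := by
    rintro a ⟨ha, ha'⟩
    refine ⟨neg_mem ha, ?_⟩
    have h0 := act_add (j := j) hM (zero_mem (𝓔.fil U (j - k))) (zero_mem _) m
    have := act_add hM ha (neg_mem ha) m
    simp only [add_neg_cancel, ha', zero_add] at this
    rw [← this]
    simpa using h0

lemma irrelevant_ext [IsSmoothCurve s] {L M N : Gr 𝓔} (i : L ⟶ M) (p : M ⟶ N)
    (hip : ∀ x, Function.Exact (i.hom.app x) (p.hom.app x))
    (hL : irrelevant 𝓔 L) (hN : irrelevant 𝓔 N) : irrelevant 𝓔 M := by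
  intro U k m
  obtain ⟨n₀, hn₀⟩ := hN U k (p.hom.app _ m)
  set c : ℕ := n₀.toNat with hc
  obtain ⟨S, hS, hS', hle⟩ := fil_finite (𝓔 := 𝓔) U c
  have e0 : (k + c) - k = (c : ℤ) := by ring
  have hS'' : ∀ x : S, x.1 ∈ 𝓔.fil U ((k + c) - k) := fun x => by rw [e0]; exact hS' x.2
  have h1 : ∀ x : S, ∃ n₁ : ℤ, ∀ j : ℤ, n₁ ≤ j - (k + c) →
      ∀ (r : 𝓔.D U) (hr : r ∈ 𝓔.fil U (j - (k + c))),
      act M.obj j r hr (act M.obj (k + c) x.1 (hS'' x) m) = 0 := by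
    intro x
    obtain ⟨l, hl⟩ := (hip _ (act M.obj (k + c) x.1 (hS'' x) m)).1 (by
      rw [act_nat]; exact hn₀ _ (by omega) _ _)
    obtain ⟨n₁, hn₁⟩ := hL U _ l
    refine ⟨n₁, fun n hn r hr => ?_⟩
    rw [← hl, ← act_nat, hn₁ n hn r hr, map_zero]
  choose φ hφ using h1
  have := hS.to_subtype
  obtain ⟨N₁, hN₁⟩ := (Set.finite_range φ).bddAbove
  refine ⟨N₁.toNat + c, fun j hj r hr => ?_⟩
  obtain ⟨a, ha⟩ : ∃ a : ℕ, j - k = (a + c : ℕ) := ⟨(j - k - c).toNat, by omega⟩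
  have hr' : r ∈ 𝓔.fil U a * Submodule.span ℤ S := by
    rw [ha] at hr
    refine (((fil_le_mul U a c).trans (mul_le_mul' le_rfl hle)).trans ?_) hr
    rw [← mul_assoc]
    refine mul_le_mul' ?_ le_rfl
    calc _ ≤ 𝓔.fil U a * 𝓔.fil U 0 := mul_le_mul' le_rfl (by
            rintro _ ⟨f, rfl⟩; exact 𝓔.ιO_mem_fil f)
      _ ≤ _ := by simpa using 𝓔.fil_mul_le U a 0
  suffices r ∈ ann M.property.1 j m from this.2
  rw [← Submodule.span_eq (𝓔.fil U a), Submodule.span_mul_span] at hr'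
  refine Submodule.span_induction (p := fun r _ => r ∈ ann M.property.1 j m) ?_ (zero_mem _)
    (fun x y _ _ => add_mem) (fun z x _ hx => zsmul_mem hx z) hr'
  rintro _ ⟨b, hb, y, hy, rfl⟩
  have hb' : b ∈ 𝓔.fil U (j - (k + c)) := by
    have : j - (k + c) = a := by omega
    rwa [this]
  refine ⟨𝓔.mul_mem_fil (by ring) hb' (hS'' ⟨y, hy⟩), ?_⟩
  refine (act_act M.obj (hS'' ⟨y, hy⟩) hb' m).symm.trans (hφ ⟨y, hy⟩ j ?_ b hb')
  have := hN₁ ⟨⟨y, hy⟩, rfl⟩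
  omega

instance : PreservesFiniteLimits (isGr (𝓔 := 𝓔)).ι := by
  rw [((Functor.preservesFiniteLimits_tfae (isGr (𝓔 := 𝓔)).ι).out 3 2 :)]
  intro _ _ f
  exact ObjectProperty.preservesKernels_ι _ f

instance : PreservesFiniteColimits (isGr (𝓔 := 𝓔)).ι := by
  rw [((Functor.preservesFiniteColimits_tfae (isGr (𝓔 := 𝓔)).ι).out 3 2 :)]
  intro _ _ f
  exact ObjectProperty.preservesCokernels_ι _ f

instance (M N : Gr 𝓔) (f : M ⟶ N) [Mono f] : Mono f.hom :=
  inferInstanceAs (Mono ((isGr (𝓔 := 𝓔)).ι.map f))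

instance (M N : Gr 𝓔) (f : M ⟶ N) [Epi f] : Epi f.hom :=
  inferInstanceAs (Epi ((isGr (𝓔 := 𝓔)).ι.map f))

instance [IsSmoothCurve s] : (irrelevant 𝓔).IsSerreClass where
  exists_zero := by
    obtain ⟨Z, hZ⟩ := HasZeroObject.zero (C := Gr 𝓔)
    refine ⟨Z, hZ, fun U k m => ⟨0, fun j _ r hr => ?_⟩⟩
    have : IsZero Z.obj := (isGr (𝓔 := 𝓔)).ι.map_isZero hZ
    exact (AddCommGrpCat.subsingleton_of_isZero (this.obj ⟨U, j⟩)).elim _ _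
  prop_of_mono {M N} f _ hN U k m := by
    obtain ⟨n, hn⟩ := hN U k (f.hom.app _ m)
    refine ⟨n, fun j hj r hr => app_injective f.hom _ ?_⟩
    rw [act_nat, hn j hj, map_zero]
  prop_of_epi {M N} f _ hM U k m := by
    obtain ⟨m, rfl⟩ := app_surjective f.hom _ m
    obtain ⟨n, hn⟩ := hM U k m
    refine ⟨n, fun j hj r hr => ?_⟩
    rw [← act_nat, hn j hj, map_zero]
  prop_X₂_of_shortExact {S} hS h1 h3 := by
    refine irrelevant_ext S.f S.g (fun x => ?_) h1 h3
    exact app_exact (hS.exact.map (isGr (𝓔 := 𝓔)).ι) x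

variable (𝓔) in
/-- The category `Qgr R = Gr R / Tors R`, the quasi-coherent sheaves on `P_D`. -/
abbrev Qgr [IsSmoothCurve s] := (irrelevant 𝓔).isoModSerre.Localization

variable (𝓔) in
/-- The quotient functor `π : Gr R ⥤ Qgr R`. -/
noncomputable abbrev π [IsSmoothCurve s] : Gr 𝓔 ⥤ Qgr 𝓔 := (irrelevant 𝓔).isoModSerre.Q

variable [IsSmoothCurve s]

noncomputable instance : Abelian (Qgr 𝓔) :=
  ObjectProperty.SerreClassLocalization.abelian (π 𝓔) (irrelevant 𝓔)

instance : PreservesFiniteLimits (π 𝓔) :=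
  ObjectProperty.SerreClassLocalization.preservesFiniteLimits (π 𝓔) (irrelevant 𝓔)

instance : PreservesFiniteColimits (π 𝓔) :=
  ObjectProperty.SerreClassLocalization.preservesFiniteColimits (π 𝓔) (irrelevant 𝓔)

end Serre

section Tensor

/-- The sections of an `O`-module over an affine open. -/
def Sct (V : OMod s) (U : X.affineOpens) : Type := V.obj.obj ⟨U⟩

instance (V : OMod s) (U : X.affineOpens) : AddCommGroup (Sct V U) :=
  inferInstanceAs (AddCommGroup (V.obj.obj ⟨U⟩))

/-- Restrict to a smaller affine open and multiply by a section of `O`. -/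
def Sct.map (V : OMod s) {x y : OCat s} (g : x ⟶ y) : Sct V x.U →+ Sct V y.U := (V.obj.map g).hom

lemma Sct.map_comp (V : OMod s) {x y z : OCat s} (g : x ⟶ y) (g' : y ⟶ z) (m : Sct V x.U) :
    Sct.map V (g ≫ g') m = Sct.map V g' (Sct.map V g m) :=
  ConcreteCategory.congr_hom (V.obj.map_comp g g') m

lemma Sct.map_id (V : OMod s) (x : OCat s) (m : Sct V x.U) : Sct.map V (𝟙 x) m = m :=
  ConcreteCategory.congr_hom (V.obj.map_id x) m

lemma Sct.map_add' (V : OMod s) {U W : X.affineOpens} (h : W ≤ U) (a b : Sec s W) (m : Sct V U) :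
    Sct.map V (x := ⟨U⟩) (y := ⟨W⟩) ⟨h, a + b⟩ m = Sct.map V (x := ⟨U⟩) (y := ⟨W⟩) ⟨h, a⟩ m +
      Sct.map V (x := ⟨U⟩) (y := ⟨W⟩) ⟨h, b⟩ m :=
  ConcreteCategory.congr_hom (V.property (x := ⟨U⟩) (y := ⟨W⟩) h a b) m

instance (V : OMod s) (U : X.affineOpens) : Module (Sec s U) (Sct V U) where
  smul f m := Sct.map V (OCat.mul U f) m
  one_smul m := Sct.map_id V ⟨U⟩ m
  mul_smul f g m := (OCat.map_mul_mul V.obj f g m).symm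
  smul_zero f := map_zero (Sct.map V (OCat.mul U f))
  smul_add f := map_add (Sct.map V (OCat.mul U f))
  add_smul f g m := Sct.map_add' V le_rfl f g m
  zero_smul m := by
    have := Sct.map_add' V (le_refl U) 0 0 m
    rw [add_zero] at this
    exact (left_eq_add.1 this)

lemma Sct.smul_def {V : OMod s} {U : X.affineOpens} (f : Sec s U) (m : Sct V U) :
    f • m = Sct.map V (OCat.mul U f) m := rfl

/-- Restriction of sections. -/
def Sct.res (V : OMod s) {U W : X.affineOpens} (h : W ≤ U) : Sct V U →+ Sct V W :=
  Sct.map V (OCat.restr h)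

lemma Sct.res_smul (V : OMod s) {U W : X.affineOpens} (h : W ≤ U) (f : Sec s U) (m : Sct V U) :
    Sct.res V h (f • m) = resO s h f • Sct.res V h m := OCat.map_mul_restr V.obj h f m

lemma Sct.res_self (V : OMod s) {U : X.affineOpens} (h : U ≤ U) (m : Sct V U) :
    Sct.res V h m = m := Sct.map_id V ⟨U⟩ m

lemma Sct.res_res (V : OMod s) {U W W' : X.affineOpens} (h : W ≤ U) (h' : W' ≤ W) (m : Sct V U) :
    Sct.res V h' (Sct.res V h m) = Sct.res V (h'.trans h) m := by
  refine (Sct.map_comp V (OCat.restr h) (OCat.restr h') m).symm.trans ?_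
  congr 2
  apply OCat.Hom.ext
  exact (one_mul _).trans (map_one (resO s h'))

lemma Sct.map_eq (V : OMod s) {x y : OCat s} (g : x ⟶ y) (m : Sct V x.U) :
    Sct.map V g m = g.val • Sct.res V g.sub m := by
  refine Eq.trans ?_ (Sct.map_comp V (OCat.restr g.sub) (OCat.mul _ g.val) m)
  congr 2
  apply OCat.Hom.ext
  change g.val = g.val * resO s _ 1
  rw [map_one, mul_one]

/-- A morphism of `O`-modules on sections. -/
def Sct.hom {V W : OMod s} (φ : V ⟶ W) (U : X.affineOpens) : Sct V U →+ Sct W U :=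
  (φ.hom.app ⟨U⟩).hom

lemma Sct.hom_map {V W : OMod s} (φ : V ⟶ W) {x y : OCat s} (g : x ⟶ y) (m : Sct V x.U) :
    Sct.hom φ y.U (Sct.map V g m) = Sct.map W g (Sct.hom φ x.U m) :=
  ConcreteCategory.congr_hom (φ.hom.naturality g) m

lemma Sct.hom_res {V W : OMod s} (φ : V ⟶ W) {U U' : X.affineOpens} (h : U' ≤ U) (m : Sct V U) :
    Sct.hom φ U' (Sct.res V h m) = Sct.res W h (Sct.hom φ U m) := Sct.hom_map φ (OCat.restr h) m

lemma Sct.hom_smul {V W : OMod s} (φ : V ⟶ W) {U : X.affineOpens} (f : Sec s U) (m : Sct V U) :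
    Sct.hom φ U (f • m) = f • Sct.hom φ U m := Sct.hom_map φ (OCat.mul U f) m

/-- The map `N ⊗ M → N' ⊗ M'` of two semilinear maps. -/
def tensorMap {A A' N N' M M' : Type} [CommRing A] [CommRing A'] [AddCommGroup N]
    [AddCommGroup N'] [AddCommGroup M] [AddCommGroup M'] [Module A N] [Module A M] [Module A' N']
    [Module A' M'] (ρ : A →+* A') (φ : N →+ N') (ψ : M →+ M')
    (hφ : ∀ a n, φ (a • n) = ρ a • φ n) (hψ : ∀ a m, ψ (a • m) = ρ a • ψ m) :
    N ⊗[A] M →+ N' ⊗[A'] M' :=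
  TensorProduct.liftAddHom
    (AddMonoidHom.mk' (fun n => AddMonoidHom.mk' (fun m => φ n ⊗ₜ ψ m) (fun m m' => by
      rw [map_add, tmul_add])) (fun n n' => by ext m; simp [add_tmul]))
    (fun a n m => by simp [hφ, hψ, smul_tmul])

@[simp] lemma tensorMap_tmul {A A' N N' M M' : Type} [CommRing A] [CommRing A'] [AddCommGroup N]
    [AddCommGroup N'] [AddCommGroup M] [AddCommGroup M'] [Module A N] [Module A M] [Module A' N']
    [Module A' M'] (ρ : A →+* A') (φ : N →+ N') (ψ : M →+ M')
    (hφ : ∀ a n, φ (a • n) = ρ a • φ n) (hψ : ∀ a m, ψ (a • m) = ρ a • ψ m) (n : N) (m : M) :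
    tensorMap ρ φ ψ hφ hψ (n ⊗ₜ m) = φ n ⊗ₜ ψ m := rfl

lemma tensor_hom_ext {A N M P : Type} [CommRing A] [AddCommGroup N] [AddCommGroup M]
    [Module A N] [Module A M] [AddCommGroup P] {φ ψ : N ⊗[A] M →+ P}
    (h : ∀ n m, φ (n ⊗ₜ m) = ψ (n ⊗ₜ m)) : φ = ψ := by
  ext x
  induction x with
  | zero => simp
  | add x y hx hy => rw [map_add, map_add, hx, hy]
  | tmul n m => exact h n m

/-- A family of right `O(U_x)`-modules `N_x` (written as left modules, as `O` is commutative),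
indexed by the objects of a category `J` that maps to the affine opens of `X`, on which the
morphisms of `J` act from the left. -/
structure LeftAct {J : Type} [Category.{0} J] (s : X ⟶ Spec (CommRingCat.of ℂ))
    (U : J → X.affineOpens) (sub : ∀ {x y : J}, (x ⟶ y) → U y ≤ U x) where
  N : J → Type
  [grp : ∀ x, AddCommGroup (N x)]
  [mod : ∀ x, Module (Sec s (U x)) (N x)]
  map : ∀ {x y : J}, (x ⟶ y) → (N x →+ N y)
  map_smul : ∀ {x y : J} (g : x ⟶ y) (f : Sec s (U x)) (a : N x),
    map g (f • a) = resO s (sub g) f • map g a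
  map_id : ∀ (x : J) (a : N x), map (𝟙 x) a = a
  map_comp : ∀ {x y z : J} (g : x ⟶ y) (g' : y ⟶ z) (a : N x), map (g ≫ g') a = map g' (map g a)

attribute [instance] LeftAct.grp LeftAct.mod

namespace LeftAct

variable {J : Type} [Category.{0} J] {U : J → X.affineOpens}
  {sub : ∀ {x y : J}, (x ⟶ y) → U y ≤ U x} (B : LeftAct s U sub)

/-- The functor `x ↦ N_x ⊗ V(U_x)`. -/
def tensorObj (V : OMod s) : J ⥤ AddCommGrpCat.{0} where
  obj x := AddCommGrpCat.of (B.N x ⊗[Sec s (U x)] Sct V (U x))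
  map g := AddCommGrpCat.ofHom (tensorMap (resO s (sub g)) (B.map g) (Sct.res V (sub g))
    (B.map_smul g) (Sct.res_smul V (sub g)))
  map_id x := by
    refine AddCommGrpCat.hom_ext (tensor_hom_ext fun n m => ?_)
    change B.map _ n ⊗ₜ Sct.res V _ m = n ⊗ₜ m
    rw [B.map_id, Sct.res_self]
  map_comp g g' := by
    refine AddCommGrpCat.hom_ext (tensor_hom_ext fun n m => ?_)
    change B.map _ n ⊗ₜ Sct.res V _ m = B.map _ (B.map _ n) ⊗ₜ Sct.res V _ (Sct.res V _ m)
    rw [B.map_comp, Sct.res_res]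

/-- The functor `V ↦ N ⊗ V`. -/
def tensor : OMod s ⥤ (J ⥤ AddCommGrpCat.{0}) where
  obj V := B.tensorObj V
  map φ :=
    { app x := AddCommGrpCat.ofHom (tensorMap (RingHom.id _) (AddMonoidHom.id _)
        (Sct.hom φ (U x)) (fun _ _ => rfl) (fun f m => Sct.hom_smul φ f m))
      naturality x y g := by
        refine AddCommGrpCat.hom_ext (tensor_hom_ext fun n m => ?_)
        change B.map _ n ⊗ₜ Sct.hom φ _ (Sct.res _ _ m) = B.map _ n ⊗ₜ Sct.res _ _ (Sct.hom φ _ m)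
        rw [Sct.hom_res] }
  map_id V := by
    refine NatTrans.ext (funext fun x => AddCommGrpCat.hom_ext (tensor_hom_ext fun n m => rfl))
  map_comp φ ψ := by
    refine NatTrans.ext (funext fun x => AddCommGrpCat.hom_ext (tensor_hom_ext fun n m => rfl))

instance : B.tensor.Additive where
  map_add {V W φ ψ} := by
    refine NatTrans.ext (funext fun x => AddCommGrpCat.hom_ext (tensor_hom_ext fun n m => ?_))
    change n ⊗ₜ (Sct.hom φ _ m + Sct.hom ψ _ m) = n ⊗ₜ Sct.hom φ _ m + n ⊗ₜ Sct.hom ψ _ m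
    rw [tmul_add]

end LeftAct
end Tensor

section Bimodules

variable (𝓔 : FirstOrder s)

/-- The right `O`-module structure of `D¹`: `Z · f = f Z + anchor(Z)(f) · 1`. -/
noncomputable def rmul {U : X.affineOpens} (z : 𝓔.E U) (f : Sec s U) : 𝓔.E U :=
  f • z + 𝓔.anchor U z f • 𝓔.one U

/-- `D¹(U)` with its right `O`-module structure. -/
def ER (U : X.affineOpens) : Type := 𝓔.E U

instance (U : X.affineOpens) : AddCommGroup (ER 𝓔 U) := inferInstanceAs (AddCommGroup (𝓔.E U))

/-- A section of `D¹` as an element of the right module. -/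
def toER (U : X.affineOpens) : 𝓔.E U ≃+ ER 𝓔 U := AddEquiv.refl (𝓔.E U)

noncomputable instance (U : X.affineOpens) : Module (Sec s U) (ER 𝓔 U) where
  smul f z := toER 𝓔 U (rmul 𝓔 ((toER 𝓔 U).symm z) f)
  one_smul z := by
    change toER 𝓔 U (rmul 𝓔 ((toER 𝓔 U).symm z) 1) = z
    obtain ⟨z, rfl⟩ := (toER 𝓔 U).surjective z
    simp [rmul]
  mul_smul f g z := by
    change toER 𝓔 U (rmul 𝓔 ((toER 𝓔 U).symm z) _) =
      toER 𝓔 U (rmul 𝓔 ((toER 𝓔 U).symm (toER 𝓔 U (rmul 𝓔 ((toER 𝓔 U).symm z) g))) f)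
    obtain ⟨z, rfl⟩ := (toER 𝓔 U).surjective z
    rw [AddEquiv.symm_apply_apply, AddEquiv.symm_apply_apply]
    congr 1
    simp only [rmul, Derivation.leibniz, map_add, map_smul, 𝓔.anchor_one, smul_zero, add_zero,
      Derivation.smul_apply, smul_eq_mul]
    module
  smul_zero f := by
    change toER 𝓔 U (rmul 𝓔 ((toER 𝓔 U).symm 0) f) = 0
    simp [rmul]
  smul_add f z w := by
    change toER 𝓔 U (rmul 𝓔 ((toER 𝓔 U).symm (z + w)) f) =
      toER 𝓔 U (rmul 𝓔 ((toER 𝓔 U).symm z) f) + toER 𝓔 U (rmul 𝓔 ((toER 𝓔 U).symm w) f)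
    rw [← map_add]
    congr 1
    simp only [rmul, map_add, Derivation.add_apply]
    module
  add_smul f g z := by
    change toER 𝓔 U (rmul 𝓔 ((toER 𝓔 U).symm z) (f + g)) =
      toER 𝓔 U (rmul 𝓔 ((toER 𝓔 U).symm z) f) + toER 𝓔 U (rmul 𝓔 ((toER 𝓔 U).symm z) g)
    rw [← map_add]
    congr 1
    simp only [rmul, map_add]
    module
  zero_smul z := by
    change toER 𝓔 U (rmul 𝓔 ((toER 𝓔 U).symm z) 0) = 0
    simp [rmul]

lemma smul_toER {U : X.affineOpens} (f : Sec s U) (z : 𝓔.E U) :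
    f • toER 𝓔 U z = toER 𝓔 U (rmul 𝓔 z f) := rfl

lemma ιE_rmul {U : X.affineOpens} (f : Sec s U) (z : 𝓔.E U) :
    𝓔.ιE U (rmul 𝓔 z f) = 𝓔.ιE U z * 𝓔.ιO U f := (𝓔.ιE_mul_ιO U z f).symm

/-- The tangent sheaf `T = D¹/O`. Its left and right `O`-module structures agree. -/
abbrev TU (U : X.affineOpens) : Type :=
  𝓔.E U ⧸ Submodule.span (Sec s U) {𝓔.one U}

/-- Left multiplication by `f`, after restriction. -/
def lmulE {U V : X.affineOpens} (h : V ≤ U) (f : Sec s V) : 𝓔.E U →+ 𝓔.E V :=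
  (DistribSMul.toAddMonoidHom (𝓔.E V) f).comp (𝓔.res h)

lemma lmulE_apply {U V : X.affineOpens} (h : V ≤ U) (f : Sec s V) (z : 𝓔.E U) :
    lmulE 𝓔 h f z = f • 𝓔.res h z := rfl

/-- The bimodule `D¹`. -/
noncomputable def actE : LeftAct (J := OCat s) s OCat.U OCat.Hom.sub where
  N x := ER 𝓔 x.U
  map {x y} g := ((toER 𝓔 y.U).toAddMonoidHom.comp (lmulE 𝓔 g.sub g.val)).comp
    (toER 𝓔 x.U).symm.toAddMonoidHom
  map_smul {x y} g f z := by
    obtain ⟨z, rfl⟩ := (toER 𝓔 x.U).surjective z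
    change toER 𝓔 y.U (lmulE 𝓔 g.sub g.val (rmul 𝓔 z f)) =
      toER 𝓔 y.U (rmul 𝓔 (lmulE 𝓔 g.sub g.val z) (resO s g.sub f))
    rw [rmul, lmulE_apply, map_add, 𝓔.res_smul, 𝓔.res_smul, 𝓔.res_one, ← 𝓔.anchor_res, rmul,
      lmulE_apply, map_smul (𝓔.anchor y.U), Derivation.smul_apply, smul_eq_mul]
    congr 1
    module
  map_id x z := by
    obtain ⟨z, rfl⟩ := (toER 𝓔 x.U).surjective z
    change toER 𝓔 x.U ((1 : Sec s x.U) • 𝓔.res le_rfl z) = toER 𝓔 x.U z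
    rw [one_smul, 𝓔.res_self]
  map_comp {x y w} g g' z := by
    obtain ⟨z, rfl⟩ := (toER 𝓔 x.U).surjective z
    change toER 𝓔 w.U ((g'.val * resO s g'.sub g.val) • 𝓔.res (g'.sub.trans g.sub) z) =
      toER 𝓔 w.U (g'.val • 𝓔.res g'.sub (g.val • 𝓔.res g.sub z))
    rw [𝓔.res_smul, 𝓔.res_res, mul_smul]

/-- Restriction of sections of `T`. -/
def resT {U V : X.affineOpens} (h : V ≤ U) : TU 𝓔 U →+ TU 𝓔 V :=
  QuotientAddGroup.map _ _ (𝓔.res h) (by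
    rintro _ hz
    obtain ⟨f, rfl⟩ := Submodule.mem_span_singleton.1 hz
    change 𝓔.res h (f • 𝓔.one U) ∈ Submodule.span (Sec s V) {𝓔.one V}
    rw [𝓔.res_smul, 𝓔.res_one]
    exact Submodule.mem_span_singleton.2 ⟨_, rfl⟩)

lemma resT_mk {U V : X.affineOpens} (h : V ≤ U) (z : 𝓔.E U) :
    resT 𝓔 h (Submodule.Quotient.mk z) = Submodule.Quotient.mk (𝓔.res h z) := rfl

/-- The bimodule `T`. -/
noncomputable def actT : LeftAct (J := OCat s) s OCat.U OCat.Hom.sub where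
  N x := TU 𝓔 x.U
  map {x y} g := (AddMonoidHom.mk' (fun z => g.val • z) (smul_add g.val) :
    TU 𝓔 y.U →+ TU 𝓔 y.U).comp (resT 𝓔 g.sub)
  map_smul {x y} g f z := by
    obtain ⟨z, rfl⟩ := Submodule.Quotient.mk_surjective _ z
    change g.val • resT 𝓔 g.sub (Submodule.Quotient.mk (f • z)) =
      resO s g.sub f • g.val • resT 𝓔 g.sub (Submodule.Quotient.mk z)
    rw [resT_mk, resT_mk, 𝓔.res_smul, Submodule.Quotient.mk_smul, smul_comm]
  map_id x z := by
    obtain ⟨z, rfl⟩ := Submodule.Quotient.mk_surjective _ z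
    change (1 : Sec s x.U) • resT 𝓔 (le_refl x.U) (Submodule.Quotient.mk z) = _
    rw [one_smul, resT_mk, 𝓔.res_self]
  map_comp {x y w} g g' z := by
    obtain ⟨z, rfl⟩ := Submodule.Quotient.mk_surjective _ z
    change (g'.val * resO s g'.sub g.val) • resT 𝓔 (g'.sub.trans g.sub) (Submodule.Quotient.mk z) =
      g'.val • resT 𝓔 g'.sub (g.val • resT 𝓔 g.sub (Submodule.Quotient.mk z))
    rw [resT_mk, resT_mk, ← Submodule.Quotient.mk_smul, ← Submodule.Quotient.mk_smul, resT_mk,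
      𝓔.res_smul, 𝓔.res_res, mul_smul, ← Submodule.Quotient.mk_smul]

/-- `R_n(U) = Dⁿ(U)` with its right `O`-module structure. -/
def FR (U : X.affineOpens) (n : ℤ) : Type := 𝓔.fil U n

noncomputable instance (U : X.affineOpens) (n : ℤ) : AddCommGroup (FR 𝓔 U n) :=
  inferInstanceAs (AddCommGroup (𝓔.fil U n))

/-- An element of `R_n(U)`. -/
def FR.mk {U : X.affineOpens} {n : ℤ} (a : 𝓔.D U) (ha : a ∈ 𝓔.fil U n) : FR 𝓔 U n := ⟨a, ha⟩

variable {𝓔} in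
/-- The underlying element of `D(U)`. -/
def FR.val {U : X.affineOpens} {n : ℤ} (a : FR 𝓔 U n) : 𝓔.D U := (show 𝓔.fil U n from a).1

variable {𝓔} in
lemma FR.mem {U : X.affineOpens} {n : ℤ} (a : FR 𝓔 U n) : a.val ∈ 𝓔.fil U n :=
  (show 𝓔.fil U n from a).2

variable {𝓔} in
lemma FR.ext {U : X.affineOpens} {n : ℤ} {a b : FR 𝓔 U n} (h : a.val = b.val) : a = b :=
  Subtype.ext h

lemma FR.val_mk {U : X.affineOpens} {n : ℤ} (a : 𝓔.D U) (ha : a ∈ 𝓔.fil U n) :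
    (FR.mk 𝓔 a ha).val = a := rfl

lemma FR.val_add {U : X.affineOpens} {n : ℤ} (a b : FR 𝓔 U n) :
    (a + b).val = a.val + b.val := rfl

lemma FR.val_zero {U : X.affineOpens} {n : ℤ} : (0 : FR 𝓔 U n).val = 0 := rfl

noncomputable instance (U : X.affineOpens) (n : ℤ) : SMul (Sec s U) (FR 𝓔 U n) where
  smul f a := FR.mk 𝓔 (a.val * 𝓔.ιO U f) (𝓔.mul_mem_fil (add_zero n) a.mem (𝓔.ιO_mem_fil f))

lemma FR.val_smul {U : X.affineOpens} {n : ℤ} (f : Sec s U) (a : FR 𝓔 U n) :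
    (f • a).val = a.val * 𝓔.ιO U f := rfl

noncomputable instance (U : X.affineOpens) (n : ℤ) : Module (Sec s U) (FR 𝓔 U n) where
  one_smul a := FR.ext (by rw [FR.val_smul, map_one, mul_one])
  mul_smul f g a := FR.ext (by
    rw [FR.val_smul, FR.val_smul, FR.val_smul, mul_comm f g, map_mul, mul_assoc])
  smul_zero f := FR.ext (by rw [FR.val_smul, FR.val_zero, zero_mul])
  smul_add f a b := FR.ext (by simp only [FR.val_smul, FR.val_add, add_mul])
  add_smul f g a := FR.ext (by simp only [FR.val_smul, FR.val_add, map_add, mul_add])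
  zero_smul a := FR.ext (by rw [FR.val_smul, FR.val_zero, map_zero, mul_zero])

/-- The left action of `R` on `R(k)`, after restriction. -/
noncomputable def FR.map (k : ℤ) {x y : RCat 𝓔} (g : x ⟶ y) :
    FR 𝓔 x.U (x.deg + k) →+ FR 𝓔 y.U (y.deg + k) :=
  AddMonoidHom.mk' (fun a => FR.mk 𝓔 (g.val * 𝓔.resD g.sub a.val)
    (𝓔.mul_mem_fil (by ring) g.mem (𝓔.resD_mem_fil g.sub a.mem))) (fun a b => FR.ext (by
      simp only [FR.val_mk, FR.val_add, map_add, mul_add]))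

lemma FR.val_map (k : ℤ) {x y : RCat 𝓔} (g : x ⟶ y) (a : FR 𝓔 x.U (x.deg + k)) :
    (FR.map 𝓔 k g a).val = g.val * 𝓔.resD g.sub a.val := rfl

lemma FR.map_smul (k : ℤ) {x y : RCat 𝓔} (g : x ⟶ y) (f : Sec s x.U)
    (a : FR 𝓔 x.U (x.deg + k)) :
    FR.map 𝓔 k g (f • a) = resO s g.sub f • FR.map 𝓔 k g a := FR.ext (by
  rw [FR.val_map, FR.val_smul, FR.val_smul, FR.val_map, map_mul, 𝓔.resD_ιO, mul_assoc])

/-- The bimodule `R(k)`, with `R(k)_n = R_{n+k}`. -/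
noncomputable def actR (k : ℤ) : LeftAct (J := RCat 𝓔) s RCat.U RCat.Hom.sub where
  N x := FR 𝓔 x.U (x.deg + k)
  map g := FR.map 𝓔 k g
  map_smul g f a := FR.map_smul 𝓔 k g f a
  map_id x a := FR.ext ((congrArg (1 * ·) (𝓔.resD_self _ _)).trans (one_mul _))
  map_comp {x y w} g g' a := FR.ext (by
    rw [FR.val_map, FR.val_map, FR.val_map, map_mul, 𝓔.resD_resD, RCat.comp_val, mul_assoc])

/-- The functor `V ↦ D¹ ⊗ V`. -/
noncomputable def tensorE : OMod s ⥤ OMod s := isOMod.lift (actE 𝓔).tensor (fun V x y h a b => by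
  refine AddCommGrpCat.hom_ext (tensor_hom_ext fun z m => ?_)
  obtain ⟨z, rfl⟩ := (toER 𝓔 x.U).surjective z
  change toER 𝓔 y.U ((a + b) • 𝓔.res h z) ⊗ₜ[Sec s y.U] Sct.res V h m =
    toER 𝓔 y.U (a • 𝓔.res h z) ⊗ₜ[Sec s y.U] Sct.res V h m +
    toER 𝓔 y.U (b • 𝓔.res h z) ⊗ₜ[Sec s y.U] Sct.res V h m
  rw [add_smul, map_add, add_tmul])

/-- The functor `V ↦ T ⊗ V`. -/
noncomputable def tensorT : OMod s ⥤ OMod s := isOMod.lift (actT 𝓔).tensor (fun V x y h a b => by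
  refine AddCommGrpCat.hom_ext (tensor_hom_ext fun z m => ?_)
  change ((a + b) • resT 𝓔 h z) ⊗ₜ[Sec s y.U] Sct.res V h m =
    (a • resT 𝓔 h z) ⊗ₜ[Sec s y.U] Sct.res V h m +
    (b • resT 𝓔 h z) ⊗ₜ[Sec s y.U] Sct.res V h m
  rw [add_smul, add_tmul])

/-- The functor `V ↦ R(k) ⊗ V`. -/
noncomputable def ind (k : ℤ) : OMod s ⥤ GMod 𝓔 := isGMod.lift (actR 𝓔 k).tensor
  (fun V x y h a b ha hb => by
  refine AddCommGrpCat.hom_ext (tensor_hom_ext fun z m => ?_)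
  refine (congrArg (· ⊗ₜ[Sec s y.U] Sct.res V h m) ?_).trans (add_tmul _ _ _)
  exact FR.ext (add_mul a b (𝓔.resD h (FR.val z))))

instance : (tensorE 𝓔).Additive where
  map_add {V W φ ψ} := by
    apply (isOMod (s := s)).ι.map_injective
    exact (actE 𝓔).tensor.map_add

instance : (tensorT 𝓔).Additive where
  map_add {V W φ ψ} := by
    apply (isOMod (s := s)).ι.map_injective
    exact (actT 𝓔).tensor.map_add

instance (k : ℤ) : (ind 𝓔 k).Additive where
  map_add {V W φ ψ} := by
    apply (isGMod (𝓔 := 𝓔)).ι.map_injective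
    exact (actR 𝓔 k).tensor.map_add

/-- The component of degree `k` of a graded `R`-module, as an `O`-module. -/
noncomputable def degF (k : ℤ) : GMod 𝓔 ⥤ OMod s :=
  isOMod.lift ((isGMod (𝓔 := 𝓔)).ι ⋙ (Functor.whiskeringLeft _ _ _).obj (degFun 𝓔 k))
    (fun M x y h a b => by
      have h0 : ∀ c : Sec s y.U, 𝓔.ιO y.U c ∈ 𝓔.fil y.U (k - k) := fun c => by
        rw [sub_self]; exact 𝓔.ιO_mem_fil c
      refine Eq.trans ?_ (M.property (x := ⟨x.U, k⟩) (y := ⟨y.U, k⟩) h (𝓔.ιO y.U a) (𝓔.ιO y.U b)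
        (h0 a) (h0 b))
      refine congrArg M.obj.map (RCat.Hom.ext ?_)
      exact map_add (𝓔.ιO y.U) a b)

instance (k : ℤ) : (degF 𝓔 k).Additive where
  map_add {V W φ ψ} := by
    apply (isOMod (s := s)).ι.map_injective
    rfl

lemma unit_nat (V : OMod s) {x y : OCat s} (g : x ⟶ y) (m : Sct V x.U) :
    toER 𝓔 y.U (𝓔.one y.U) ⊗ₜ[Sec s y.U] Sct.map V g m =
      toER 𝓔 y.U (g.val • 𝓔.res g.sub (𝓔.one x.U)) ⊗ₜ[Sec s y.U] Sct.res V g.sub m := by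
  rw [Sct.map_eq, ← smul_tmul, smul_toER, rmul, 𝓔.anchor_one, 𝓔.res_one]
  simp

/-- The projection `D¹ → T`. -/
def mkT (U : X.affineOpens) : ER 𝓔 U →+ TU 𝓔 U :=
  (Submodule.mkQ (Submodule.span (Sec s U) {𝓔.one U})).toAddMonoidHom.comp
    (toER 𝓔 U).symm.toAddMonoidHom

lemma mkT_toER {U : X.affineOpens} (z : 𝓔.E U) :
    mkT 𝓔 U (toER 𝓔 U z) = Submodule.Quotient.mk z := rfl

lemma mkT_smul {U : X.affineOpens} (f : Sec s U) (z : ER 𝓔 U) :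
    mkT 𝓔 U (f • z) = f • mkT 𝓔 U z := by
  obtain ⟨z, rfl⟩ := (toER 𝓔 U).surjective z
  rw [smul_toER, mkT_toER, mkT_toER, ← Submodule.Quotient.mk_smul, Submodule.Quotient.eq, rmul,
    add_sub_cancel_left]
  exact Submodule.mem_span_singleton.2 ⟨_, rfl⟩

/-- The morphism `V → D¹ ⊗ V`, `m ↦ 1 ⊗ m`. -/
noncomputable def unitE : 𝟭 (OMod s) ⟶ tensorE 𝓔 where
  app V := ObjectProperty.homMk
    { app x := AddCommGrpCat.ofHom (AddMonoidHom.mk'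
        (fun m : Sct V x.U => (toER 𝓔 x.U (𝓔.one x.U) ⊗ₜ[Sec s x.U] m)) (fun m m' => tmul_add _ _ _))
      naturality x y g := by
        ext m
        exact unit_nat 𝓔 V g m }
  naturality V W φ := by
    apply (isOMod (s := s)).ι.map_injective
    ext x m
    rfl

/-- The projection `D¹ ⊗ V → T ⊗ V`. -/
noncomputable def quotET : tensorE 𝓔 ⟶ tensorT 𝓔 where
  app V := ObjectProperty.homMk
    { app x := AddCommGrpCat.ofHom (tensorMap (N := ER 𝓔 x.U) (N' := TU 𝓔 x.U) (M := Sct V x.U)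
        (M' := Sct V x.U) (RingHom.id (Sec s x.U))
        (mkT 𝓔 x.U) (AddMonoidHom.id _) (mkT_smul 𝓔) (fun _ _ => rfl))
      naturality x y g := by
        refine AddCommGrpCat.hom_ext (tensor_hom_ext fun z m => ?_)
        rfl }
  naturality V W φ := by
    apply (isOMod (s := s)).ι.map_injective
    refine NatTrans.ext (funext fun x => AddCommGrpCat.hom_ext (tensor_hom_ext fun z m => ?_))
    rfl

lemma unitE_quotET : unitE 𝓔 ≫ quotET 𝓔 = 0 := by
  refine NatTrans.ext (funext fun V => (isOMod (s := s)).ι.map_injective ?_)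
  refine NatTrans.ext (funext fun x => AddCommGrpCat.hom_ext
    (AddMonoidHom.ext fun (m : Sct V x.U) => ?_))
  change mkT 𝓔 x.U (toER 𝓔 x.U (𝓔.one x.U)) ⊗ₜ[Sec s x.U] m = 0
  rw [mkT_toER, (Submodule.Quotient.mk_eq_zero _).2 (Submodule.mem_span_singleton_self _),
    zero_tmul]

end Bimodules

section Alpha

variable (𝓔 : FirstOrder s)

lemma mem_sub_neg_one {U : X.affineOpens} {r : 𝓔.D U} (hr : r ∈ 𝓔.fil U 1) :
    r ∈ 𝓔.fil U (0 - (-1)) := by rwa [sub_neg_eq_add, zero_add]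

variable {𝓔} in
/-- Multiplication by `r ∈ R_1 = D¹` as a map `M_{-1} → M_0`. -/
def mulOne (M : GMod 𝓔) {U : X.affineOpens} (r : 𝓔.D U) (hr : r ∈ 𝓔.fil U 1) :
    Sct ((degF 𝓔 (-1)).obj M) U →+ Sct ((degF 𝓔 0).obj M) U :=
  (M.obj.map (X := ⟨U, -1⟩) (Y := ⟨U, 0⟩) ⟨le_rfl, r, mem_sub_neg_one 𝓔 hr⟩).hom

variable {𝓔} (M : GMod 𝓔) {U : X.affineOpens}

lemma mulOne_add (a b : 𝓔.D U) (ha : a ∈ 𝓔.fil U 1) (hb : b ∈ 𝓔.fil U 1)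
    (m : Sct ((degF 𝓔 (-1)).obj M) U) :
    mulOne M (a + b) (add_mem ha hb) m = mulOne M a ha m + mulOne M b hb m :=
  ConcreteCategory.congr_hom (M.property (x := ⟨U, -1⟩) (y := ⟨U, 0⟩) le_rfl a b
    (mem_sub_neg_one 𝓔 ha) (mem_sub_neg_one 𝓔 hb)) m

lemma map_map_eq (M : RCat 𝓔 ⥤ AddCommGrpCat.{0}) {x y z : RCat 𝓔} (g : x ⟶ y) (g' : y ⟶ z)
    (k : x ⟶ z) (h : g'.val * 𝓔.resD g'.sub g.val = k.val) (m : M.obj x) :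
    (M.map g').hom ((M.map g).hom m) = (M.map k).hom m := by
  have : k = g ≫ g' := RCat.Hom.ext h.symm
  rw [this, M.map_comp]
  rfl

/-- `r ∈ D¹` as a morphism of degree one. -/
def homOne (r : 𝓔.D U) (hr : r ∈ 𝓔.fil U 1) : (⟨U, -1⟩ : RCat 𝓔) ⟶ ⟨U, 0⟩ :=
  ⟨le_rfl, r, mem_sub_neg_one 𝓔 hr⟩

lemma mulOne_smul (f : Sec s U) (r : 𝓔.D U) (hr : r ∈ 𝓔.fil U 1)
    (m : Sct ((degF 𝓔 (-1)).obj M) U) :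
    f • mulOne M r hr m = mulOne M (𝓔.ιO U f * r)
      (𝓔.mul_mem_fil (zero_add 1) (𝓔.ιO_mem_fil f) hr) m :=
  map_map_eq M.obj (homOne r hr) ((degFun 𝓔 0).map (OCat.mul U f)) (homOne (𝓔.ιO U f * r)
    (𝓔.mul_mem_fil (zero_add 1) (𝓔.ιO_mem_fil f) hr))
    (congrArg (𝓔.ιO U f * ·) (𝓔.resD_self le_rfl r)) m

lemma mulOne_smul' (f : Sec s U) (r : 𝓔.D U) (hr : r ∈ 𝓔.fil U 1)
    (m : Sct ((degF 𝓔 (-1)).obj M) U) :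
    mulOne M r hr (f • m) = mulOne M (r * 𝓔.ιO U f)
      (𝓔.mul_mem_fil (add_zero 1) hr (𝓔.ιO_mem_fil f)) m :=
  map_map_eq M.obj ((degFun 𝓔 (-1)).map (OCat.mul U f)) (homOne r hr) (homOne (r * 𝓔.ιO U f)
    (𝓔.mul_mem_fil (add_zero 1) hr (𝓔.ιO_mem_fil f)))
    (congrArg (r * ·) (𝓔.resD_self le_rfl _)) m

lemma mulOne_res {V : X.affineOpens} (h : V ≤ U) (r : 𝓔.D U) (hr : r ∈ 𝓔.fil U 1)
    (m : Sct ((degF 𝓔 (-1)).obj M) U) :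
    Sct.res _ h (mulOne M r hr m) =
      mulOne M (𝓔.resD h r) (𝓔.resD_mem_fil h hr) (Sct.res _ h m) := by
  let k : (⟨U, -1⟩ : RCat 𝓔) ⟶ ⟨V, 0⟩ :=
    ⟨h, 𝓔.resD h r, 𝓔.resD_mem_fil h (mem_sub_neg_one 𝓔 hr)⟩
  refine (map_map_eq M.obj (homOne r hr) ((degFun 𝓔 0).map (OCat.restr h)) k ?_ m).trans
    (map_map_eq M.obj ((degFun 𝓔 (-1)).map (OCat.restr h))
      (homOne (𝓔.resD h r) (𝓔.resD_mem_fil h hr)) k ?_ m).symm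
  · change 𝓔.ιO V 1 * 𝓔.resD h r = 𝓔.resD h r
    rw [map_one, one_mul]
  · change 𝓔.resD h r * 𝓔.resD (le_refl V) (𝓔.ιO V 1) = 𝓔.resD h r
    rw [map_one, map_one, mul_one]

lemma mulOne_hom {M N : GMod 𝓔} (φ : M ⟶ N) (r : 𝓔.D U) (hr : r ∈ 𝓔.fil U 1)
    (m : Sct ((degF 𝓔 (-1)).obj M) U) :
    Sct.hom ((degF 𝓔 0).map φ) U (mulOne M r hr m) =
      mulOne N r hr (Sct.hom ((degF 𝓔 (-1)).map φ) U m) :=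
  ConcreteCategory.congr_hom (φ.hom.naturality _) m

/-- The product `a r ∈ R_n` of `a ∈ R(-1)_n = R_{n-1}` with `r ∈ R_1`. -/
noncomputable def mulD {n : ℤ} (a : FR 𝓔 U (n + -1)) (r : 𝓔.D U) (hr : r ∈ 𝓔.fil U 1) :
    FR 𝓔 U (n + 0) := FR.mk 𝓔 (a.val * r) (𝓔.mul_mem_fil (by ring) a.mem hr)

lemma val_mulD {n : ℤ} (a : FR 𝓔 U (n + -1)) (r : 𝓔.D U) (hr : r ∈ 𝓔.fil U 1) :
    (mulD a r hr).val = a.val * r := rfl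

/-- The element `a Z ⊗ t m - a t ⊗ Z m` of `R ⊗ M_0`, for `a ∈ R(-1)`, `Z ∈ D¹`, `m ∈ M_{-1}`. -/
noncomputable def alphaElt {n : ℤ} (a : FR 𝓔 U (n + -1)) (z : 𝓔.E U)
    (m : Sct ((degF 𝓔 (-1)).obj M) U) :
    FR 𝓔 U (n + 0) ⊗[Sec s U] Sct ((degF 𝓔 0).obj M) U :=
  mulD a (𝓔.ιE U z) (𝓔.ιE_mem_fil z) ⊗ₜ mulOne M 1 (𝓔.one_mem_fil_one U) m -
    mulD a 1 (𝓔.one_mem_fil_one U) ⊗ₜ mulOne M (𝓔.ιE U z) (𝓔.ιE_mem_fil z) m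

lemma alphaElt_add_m {n : ℤ} (a : FR 𝓔 U (n + -1)) (z : 𝓔.E U)
    (m m' : Sct ((degF 𝓔 (-1)).obj M) U) :
    alphaElt M a z (m + m') = alphaElt M a z m + alphaElt M a z m' := by
  simp only [alphaElt, map_add, tmul_add]; abel

lemma alphaElt_add_z {n : ℤ} (a : FR 𝓔 U (n + -1)) (z z' : 𝓔.E U)
    (m : Sct ((degF 𝓔 (-1)).obj M) U) :
    alphaElt M a (z + z') m = alphaElt M a z m + alphaElt M a z' m := by
  have h1 : mulD a (𝓔.ιE U (z + z')) (𝓔.ιE_mem_fil _) =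
      mulD a (𝓔.ιE U z) (𝓔.ιE_mem_fil z) +
        mulD a (𝓔.ιE U z') (𝓔.ιE_mem_fil _) :=
    FR.ext (by
      rw [FR.val_add, val_mulD, val_mulD, val_mulD, map_add, mul_add])
  have h2 : mulOne M (𝓔.ιE U (z + z')) (𝓔.ιE_mem_fil _) m =
      mulOne M (𝓔.ιE U z) (𝓔.ιE_mem_fil z) m + mulOne M (𝓔.ιE U z') (𝓔.ιE_mem_fil z') m := by
    rw [← mulOne_add]; congr 2; exact map_add _ _ _
  rw [alphaElt, h1, h2, add_tmul, tmul_add, alphaElt, alphaElt]; abel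

lemma alphaElt_add_a {n : ℤ} (a a' : FR 𝓔 U (n + -1)) (z : 𝓔.E U)
    (m : Sct ((degF 𝓔 (-1)).obj M) U) :
    alphaElt M (a + a') z m = alphaElt M a z m + alphaElt M a' z m := by
  have h1 : mulD (a + a') (𝓔.ιE U z) (𝓔.ιE_mem_fil _) =
      mulD a (𝓔.ιE U z) (𝓔.ιE_mem_fil z) +
        mulD a' (𝓔.ιE U z) (𝓔.ιE_mem_fil z) := FR.ext (by
      simp only [FR.val_add, val_mulD, add_mul])
  have h2 : mulD (a + a') 1 (𝓔.one_mem_fil_one U) =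
      mulD a 1 (𝓔.one_mem_fil_one U) + mulD a' 1 (𝓔.one_mem_fil_one U) := FR.ext (by
      simp only [FR.val_add, val_mulD, add_mul])
  rw [alphaElt, h1, h2, add_tmul, add_tmul, alphaElt, alphaElt]; abel

lemma ιO_apply (f : Sec s U) : 𝓔.ιO U f = 𝓔.ιE U (f • 𝓔.one U) := rfl

lemma alphaElt_one {n : ℤ} (a : FR 𝓔 U (n + -1)) (f : Sec s U)
    (m : Sct ((degF 𝓔 (-1)).obj M) U) : alphaElt M a (f • 𝓔.one U) m = 0 := by
  have h1 : mulD a (𝓔.ιE U (f • 𝓔.one U)) (𝓔.ιE_mem_fil _) =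
      f • mulD a 1 (𝓔.one_mem_fil_one U) := FR.ext (by
      rw [FR.val_smul, val_mulD, val_mulD, mul_one, ιO_apply])
  have h2 : mulOne M (𝓔.ιE U (f • 𝓔.one U)) (𝓔.ιE_mem_fil _) m =
      f • mulOne M 1 (𝓔.one_mem_fil_one U) m := by
    rw [mulOne_smul]; congr 2; rw [mul_one, ιO_apply]
  rw [alphaElt, h1, h2, smul_tmul, sub_self]

lemma alphaElt_smul_m {n : ℤ} (a : FR 𝓔 U (n + -1)) (z : 𝓔.E U) (f : Sec s U)
    (m : Sct ((degF 𝓔 (-1)).obj M) U) :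
    alphaElt M a z (f • m) = alphaElt M a (rmul 𝓔 z f) m := by
  have h1 : mulD a (𝓔.ιE U (rmul 𝓔 z f)) (𝓔.ιE_mem_fil _) =
      f • mulD a (𝓔.ιE U z) (𝓔.ιE_mem_fil z) := FR.ext (by
    rw [FR.val_smul, val_mulD, val_mulD, ιE_rmul, mul_assoc])
  have h2 : mulOne M 1 (𝓔.one_mem_fil_one U) (f • m) =
      f • mulOne M 1 (𝓔.one_mem_fil_one U) m := by
    rw [mulOne_smul, mulOne_smul']; congr 2; rw [one_mul, mul_one]
  have h3 : mulOne M (𝓔.ιE U z) (𝓔.ιE_mem_fil z) (f • m) =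
      mulOne M (𝓔.ιE U (rmul 𝓔 z f)) (𝓔.ιE_mem_fil _) m := by
    rw [mulOne_smul']; congr 2; exact (ιE_rmul 𝓔 f z).symm
  rw [alphaElt, alphaElt, h1, h2, h3, smul_tmul]

lemma alphaElt_smul_a {n : ℤ} (a : FR 𝓔 U (n + -1)) (z : 𝓔.E U) (f : Sec s U)
    (m : Sct ((degF 𝓔 (-1)).obj M) U) :
    alphaElt M (f • a) z m = alphaElt M a (f • z) m := by
  have h1 : mulD a (𝓔.ιE U (f • z)) (𝓔.ιE_mem_fil _) =
      mulD (f • a) (𝓔.ιE U z) (𝓔.ιE_mem_fil _) := FR.ext (by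
    simp only [val_mulD, FR.val_smul, 𝓔.ιE_smul, mul_assoc])
  have h2 : mulD (f • a) 1 (𝓔.one_mem_fil_one U) = f • mulD a 1 (𝓔.one_mem_fil_one U) :=
    FR.ext (by simp only [FR.val_smul, val_mulD, mul_one])
  have h3 : mulOne M (𝓔.ιE U (f • z)) (𝓔.ιE_mem_fil _) m =
      f • mulOne M (𝓔.ιE U z) (𝓔.ιE_mem_fil z) m := by
    rw [mulOne_smul]; congr 2; exact 𝓔.ιE_smul U f z
  rw [alphaElt, alphaElt, h1, h2, h3, smul_tmul]

/-- The map `T ⊗ M_{-1} → R ⊗ M_0`, `[Z] ⊗ m ↦ a Z ⊗ t m - a t ⊗ Z m`, for fixed `a`. -/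
noncomputable def alphaInner {n : ℤ} (a : FR 𝓔 U (n + -1)) :
    TU 𝓔 U ⊗[Sec s U] Sct ((degF 𝓔 (-1)).obj M) U →+
      FR 𝓔 U (n + 0) ⊗[Sec s U] Sct ((degF 𝓔 0).obj M) U :=
  TensorProduct.liftAddHom
    (QuotientAddGroup.lift (Submodule.span (Sec s U) {𝓔.one U}).toAddSubgroup
      (AddMonoidHom.mk' (fun z => AddMonoidHom.mk' (alphaElt M a z) (alphaElt_add_m M a z))
        (fun z z' => AddMonoidHom.ext (alphaElt_add_z M a z z')))
      (fun z hz => by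
        obtain ⟨f, rfl⟩ := Submodule.mem_span_singleton.1 hz
        exact AddMonoidHom.ext (alphaElt_one M a f)))
    (fun f z m => by
      obtain ⟨z, rfl⟩ := Submodule.Quotient.mk_surjective _ z
      change alphaElt M a (f • z) m = alphaElt M a z (f • m)
      rw [alphaElt_smul_m, rmul, alphaElt_add_z, alphaElt_one]
      exact (add_zero _).symm)

lemma alphaInner_tmul {n : ℤ} (a : FR 𝓔 U (n + -1)) (z : 𝓔.E U)
    (m : Sct ((degF 𝓔 (-1)).obj M) U) :
    alphaInner M a ((Submodule.Quotient.mk z : TU 𝓔 U) ⊗ₜ[Sec s U] m) = alphaElt M a z m := rfl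

/-- The section `z ⊗ m` of `T ⊗ V`. -/
def tmulT (V : OMod s) (z : TU 𝓔 U) (m : Sct V U) : Sct ((tensorT 𝓔).obj V) U :=
  (z ⊗ₜ[Sec s U] m : TU 𝓔 U ⊗[Sec s U] Sct V U)

lemma smul_tmulT (V : OMod s) (f : Sec s U) (z : 𝓔.E U) (m : Sct V U) :
    f • tmulT V (Submodule.Quotient.mk z : TU 𝓔 U) m =
      tmulT V (Submodule.Quotient.mk (f • z) : TU 𝓔 U) m := by
  change tmulT V (f • resT 𝓔 (le_refl U) (Submodule.Quotient.mk z)) (Sct.res V (le_refl U) m) = _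
  rw [resT_mk, 𝓔.res_self, Sct.res_self, Submodule.Quotient.mk_smul]

/-- The map `R(-1) ⊗ T ⊗ M_{-1} → R ⊗ M_0`, `a ⊗ [Z] ⊗ m ↦ a Z ⊗ t m - a t ⊗ Z m`. -/
noncomputable def alphaBarApp (n : ℤ) :
    FR 𝓔 U (n + -1) ⊗[Sec s U] Sct ((tensorT 𝓔).obj ((degF 𝓔 (-1)).obj M)) U →+
      FR 𝓔 U (n + 0) ⊗[Sec s U] Sct ((degF 𝓔 0).obj M) U :=
  TensorProduct.liftAddHom
    (AddMonoidHom.mk' (fun a => alphaInner M a) (fun a a' => tensor_hom_ext fun z m => by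
      obtain ⟨z, rfl⟩ := Submodule.Quotient.mk_surjective _ z
      exact alphaElt_add_a M a a' z m))
    (fun f a w => by
      change alphaInner M (f • a) w = alphaInner M a (f • w)
      have key : alphaInner M (f • a) = (alphaInner M a).comp
          (DistribSMul.toAddMonoidHom (Sct ((tensorT 𝓔).obj ((degF 𝓔 (-1)).obj M)) U) f) := by
        refine tensor_hom_ext fun z m => ?_
        obtain ⟨z, rfl⟩ := Submodule.Quotient.mk_surjective _ z
        refine Eq.trans ?_ (congrArg (alphaInner M a) (smul_tmulT _ f z m)).symm
        exact alphaElt_smul_a M a z f m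
      exact DFunLike.congr_fun key w)

lemma alphaElt_map {x y : RCat 𝓔} (g : x ⟶ y) (a : FR 𝓔 x.U (x.deg + -1)) (z : 𝓔.E x.U)
    (m : Sct ((degF 𝓔 (-1)).obj M) x.U) :
    alphaElt M (FR.map 𝓔 (-1) g a) (𝓔.res g.sub z) (Sct.res _ g.sub m) =
      tensorMap (resO s g.sub) (FR.map 𝓔 0 g) (Sct.res ((degF 𝓔 0).obj M) g.sub)
        (FR.map_smul 𝓔 0 g) (Sct.res_smul _ g.sub) (alphaElt M a z m) := by
  conv_rhs => rw [alphaElt, map_sub, tensorMap_tmul, tensorMap_tmul, mulOne_res, mulOne_res]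
  rw [alphaElt]
  have h1 : mulD (FR.map 𝓔 (-1) g a) (𝓔.ιE y.U (𝓔.res g.sub z)) (𝓔.ιE_mem_fil _) =
      FR.map 𝓔 0 g (mulD a (𝓔.ιE x.U z) (𝓔.ιE_mem_fil z)) := FR.ext (by
    simp only [FR.val_map, val_mulD, map_mul, 𝓔.resD_ιE, mul_assoc])
  have h2 : mulD (FR.map 𝓔 (-1) g a) 1 (𝓔.one_mem_fil_one _) =
      FR.map 𝓔 0 g (mulD a 1 (𝓔.one_mem_fil_one _)) := FR.ext (by
    simp only [FR.val_map, val_mulD, map_mul, map_one, mul_assoc])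
  rw [h1, h2]
  congr 3
  · congr 1
    exact (map_one (𝓔.resD g.sub)).symm
  · congr 1
    exact (𝓔.resD_ιE g.sub z).symm

lemma alphaElt_hom {M N : GMod 𝓔} (φ : M ⟶ N) {n : ℤ} (a : FR 𝓔 U (n + -1)) (z : 𝓔.E U)
    (m : Sct ((degF 𝓔 (-1)).obj M) U) :
    alphaElt N a z (Sct.hom ((degF 𝓔 (-1)).map φ) U m) =
      tensorMap (RingHom.id (Sec s U)) (AddMonoidHom.id (FR 𝓔 U (n + 0)))
        (Sct.hom ((degF 𝓔 0).map φ) U) (fun _ _ => rfl) (fun f m => Sct.hom_smul _ f m)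
        (alphaElt M a z m) := by
  rw [alphaElt, alphaElt, map_sub, tensorMap_tmul, tensorMap_tmul, mulOne_hom, mulOne_hom]
  rfl

lemma tensor_tensor_hom_ext {A N P : Type} [CommRing A] [AddCommGroup N] [Module A N]
    [AddCommGroup P] (V : OMod s) [Module A (Sct ((tensorT 𝓔).obj V) U)]
    {φ ψ : N ⊗[A] Sct ((tensorT 𝓔).obj V) U →+ P}
    (h : ∀ (n : N) (z : 𝓔.E U) (m : Sct V U),
      φ (n ⊗ₜ tmulT V (Submodule.Quotient.mk z) m) = ψ (n ⊗ₜ tmulT V (Submodule.Quotient.mk z) m)) :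
    φ = ψ := by
  refine tensor_hom_ext fun n w => ?_
  let φ' : TU 𝓔 U ⊗[Sec s U] Sct V U →+ P :=
    φ.comp (TensorProduct.mk A N (Sct ((tensorT 𝓔).obj V) U) n).toAddMonoidHom
  let ψ' : TU 𝓔 U ⊗[Sec s U] Sct V U →+ P :=
    ψ.comp (TensorProduct.mk A N (Sct ((tensorT 𝓔).obj V) U) n).toAddMonoidHom
  have : φ' = ψ' := tensor_hom_ext fun z m => by
    obtain ⟨z, rfl⟩ := Submodule.Quotient.mk_surjective _ z
    exact h n z m
  exact DFunLike.congr_fun this w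

variable (𝓔) in
/-- The natural transformation `R(-1) ⊗ T ⊗ M_{-1} → R ⊗ M_0`,
`a ⊗ [Z] ⊗ m ↦ a Z ⊗ t m - a t ⊗ Z m`. -/
noncomputable def alphaBar : degF 𝓔 (-1) ⋙ tensorT 𝓔 ⋙ ind 𝓔 (-1) ⟶ degF 𝓔 0 ⋙ ind 𝓔 0 where
  app M := ObjectProperty.homMk
    { app x := AddCommGrpCat.ofHom (alphaBarApp M x.deg)
      naturality x y g := by
        refine AddCommGrpCat.hom_ext (tensor_tensor_hom_ext _ fun a z m => ?_)
        refine Eq.trans ?_ (alphaElt_map M g a z m)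
        change alphaInner M _ (tmulT _ ((1 : Sec s y.U) • resT 𝓔 g.sub (Submodule.Quotient.mk z))
          (Sct.res _ g.sub m)) = _
        rw [one_smul]
        rfl }
  naturality M N φ := by
    apply (isGMod (𝓔 := 𝓔)).ι.map_injective
    refine NatTrans.ext (funext fun x => AddCommGrpCat.hom_ext
      (tensor_tensor_hom_ext _ fun a z m => ?_))
    exact alphaElt_hom φ a z m

end Alpha

section Resolution

variable (𝓔 : FirstOrder s)

/-- The functors `V ↦ D¹ ⊗ V`, `V ↦ T ⊗ V` and `V ↦ R(k) ⊗ V` preserve quasi-coherence. -/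
structure TensorQC : Prop where
  tensorE : ∀ V : OMod s, isQCoh V.obj → isQCoh ((tensorE 𝓔).obj V).obj
  tensorT : ∀ V : OMod s, isQCoh V.obj → isQCoh ((tensorT 𝓔).obj V).obj
  ind : ∀ (k : ℤ) (V : OMod s), isQCoh V.obj → isGr ((ind 𝓔 k).obj V).obj

variable {𝓔}

/-- A functor on presheaves of graded modules that preserves quasi-coherence, as a functor on
`Gr R`. -/
noncomputable def toGr (F : GMod 𝓔 ⥤ GMod 𝓔) (hF : ∀ M : GMod 𝓔, isGr M.obj → isGr (F.obj M).obj) :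
    Gr 𝓔 ⥤ Gr 𝓔 :=
  isGr.lift (ObjectProperty.ιOfLE isGr_le_isGMod ⋙ F ⋙ isGMod.ι) (fun M => hF _ M.property)

instance (F : GMod 𝓔 ⥤ GMod 𝓔) [F.Additive] (hF) : (toGr F hF).Additive where
  map_add {M N φ ψ} := by
    apply (isGr (𝓔 := 𝓔)).ι.map_injective
    exact congrArg (isGMod (𝓔 := 𝓔)).ι.map (F.map_add (f :=
      (ObjectProperty.ιOfLE isGr_le_isGMod).map φ)
      (g := (ObjectProperty.ιOfLE isGr_le_isGMod).map ψ))

/-- Natural transformations restrict to `Gr R`. -/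
noncomputable def toGrMap {F G : GMod 𝓔 ⥤ GMod 𝓔} (hF : ∀ M : GMod 𝓔, isGr M.obj → isGr (F.obj M).obj)
    (hG : ∀ M : GMod 𝓔, isGr M.obj → isGr (G.obj M).obj) (τ : F ⟶ G) : toGr F hF ⟶ toGr G hG where
  app M := ObjectProperty.homMk (τ.app ((ObjectProperty.ιOfLE isGr_le_isGMod).obj M)).hom
  naturality M N φ := by
    apply (isGr (𝓔 := 𝓔)).ι.map_injective
    exact congrArg (isGMod (𝓔 := 𝓔)).ι.map
      (τ.naturality ((ObjectProperty.ιOfLE isGr_le_isGMod).map φ))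

lemma toGrMap_comp {F G K : GMod 𝓔 ⥤ GMod 𝓔} (hF hG hK) (τ : F ⟶ G) (σ : G ⟶ K) :
    toGrMap hF hG τ ≫ toGrMap hG hK σ = toGrMap hF hK (τ ≫ σ) := rfl

lemma toGrMap_zero {F G : GMod 𝓔 ⥤ GMod 𝓔} (hF hG) : toGrMap hF hG (0 : F ⟶ G) = 0 := rfl

variable (h : TensorQC 𝓔)

/-- `M ↦ R ⊗ M_0` -/
noncomputable def termR : Gr 𝓔 ⥤ Gr 𝓔 :=
  toGr (degF 𝓔 0 ⋙ ind 𝓔 0) (fun _ hM => h.ind _ _ (hM.2 _))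

/-- `M ↦ R(-1) ⊗ T ⊗ M_{-1}` -/
noncomputable def termT : Gr 𝓔 ⥤ Gr 𝓔 :=
  toGr (degF 𝓔 (-1) ⋙ tensorT 𝓔 ⋙ ind 𝓔 (-1)) (fun _ hM => h.ind _ _ (h.tensorT _ (hM.2 _)))

/-- `M ↦ R(-1) ⊗ D¹ ⊗ M_{-1}` -/
noncomputable def termE : Gr 𝓔 ⥤ Gr 𝓔 :=
  toGr (degF 𝓔 (-1) ⋙ tensorE 𝓔 ⋙ ind 𝓔 (-1)) (fun _ hM => h.ind _ _ (h.tensorE _ (hM.2 _)))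

/-- `M ↦ R(-1) ⊗ M_{-1}` -/
noncomputable def termO : Gr 𝓔 ⥤ Gr 𝓔 :=
  toGr (degF 𝓔 (-1) ⋙ ind 𝓔 (-1)) (fun _ hM => h.ind _ _ (hM.2 _))

instance : (termR h).Additive := by unfold termR; infer_instance
instance : (termT h).Additive := by unfold termT; infer_instance
instance : (termE h).Additive := by unfold termE; infer_instance
instance : (termO h).Additive := by unfold termO; infer_instance

/-- The differential of `(δ ⊗_R M)_{•,0} = [R(-1) ⊗ T ⊗ M_{-1} → R ⊗ M_0]`,
`a ⊗ [Z] ⊗ m ↦ a Z ⊗ t m - a t ⊗ Z m`. -/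
noncomputable def diffT : termT h ⟶ termR h := toGrMap _ _ (alphaBar 𝓔)

/-- The second differential of
`(δ' ⊗_R M)_{•,0} = [R(-1) ⊗ M_{-1} → R(-1) ⊗ D¹ ⊗ M_{-1} → R ⊗ M_0]`,
`a ⊗ Z ⊗ m ↦ a Z ⊗ t m - a t ⊗ Z m`. -/
noncomputable def diffE : termE h ⟶ termR h := toGrMap _ _
  (Functor.whiskerLeft (degF 𝓔 (-1)) (Functor.whiskerRight (quotET 𝓔) (ind 𝓔 (-1))) ≫ alphaBar 𝓔)

/-- The first differential of `(δ' ⊗_R M)_{•,0}`, `a ⊗ m ↦ a ⊗ 1 ⊗ m`. -/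
noncomputable def diffO : termO h ⟶ termE h := toGrMap _ _
  (Functor.whiskerLeft (degF 𝓔 (-1)) (Functor.whiskerRight (unitE 𝓔) (ind 𝓔 (-1))))

lemma diffO_diffE : diffO h ≫ diffE h = 0 := by
  have key : Functor.whiskerLeft (degF 𝓔 (-1)) (Functor.whiskerRight (unitE 𝓔) (ind 𝓔 (-1))) ≫
      (Functor.whiskerLeft (degF 𝓔 (-1)) (Functor.whiskerRight (quotET 𝓔) (ind 𝓔 (-1))) ≫
        alphaBar 𝓔) = 0 := by
    ext1; ext1 M
    have := congr_app (unitE_quotET 𝓔) ((degF 𝓔 (-1)).obj M)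
    have h2 := congrArg (ind 𝓔 (-1)).map this
    rw [NatTrans.comp_app, Functor.map_comp] at h2
    simp only [NatTrans.comp_app, Functor.whiskerLeft_app, Functor.whiskerRight_app]
    rw [reassoc_of% h2]
    change (ind 𝓔 (-1)).map 0 ≫ _ = 0
    rw [Functor.map_zero, zero_comp]
  exact (toGrMap_comp _ _ _ _ _).trans ((congrArg _ key).trans (toGrMap_zero _ _))

/-- The functor `V ↦ R(k) ⊗ V` on quasi-coherent sheaves. -/
noncomputable def indQ (k : ℤ) : QCoh s ⥤ Gr 𝓔 :=
  isGr.lift (ObjectProperty.ιOfLE isQCoh_le_isOMod ⋙ ind 𝓔 k ⋙ isGMod.ι)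
    (fun V => h.ind k _ V.property)

end Resolution

section StructureSheaf

/-- The structure sheaf. -/
def strFun (s : X ⟶ Spec (CommRingCat.of ℂ)) : OCat s ⥤ AddCommGrpCat.{0} where
  obj x := AddCommGrpCat.of (Sec s x.U)
  map g := AddCommGrpCat.ofHom ((AddMonoidHom.mulLeft g.val).comp (resO s g.sub).toAddMonoidHom)
  map_id x := by
    ext f
    exact (one_mul _).trans (resO_self s _ f)
  map_comp {x y z} g g' := by
    ext f
    change g'.val * resO s g'.sub g.val * resO s _ f =
      g'.val * resO s g'.sub (g.val * resO s g.sub f)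
    rw [map_mul, resO_resO, mul_assoc]

lemma isQCoh_strFun : isQCoh (strFun s) := by
  refine ⟨fun x y h a b => ?_, fun U f => ?_⟩
  · ext m
    exact add_mul a b (resO s h m)
  · let _ := (resO s (bas_le s f)).toAlgebra
    have hl : IsLocalization.Away f (Sec s (bas s f)) := U.2.isLocalization_basicOpen f
    refine ⟨fun (y : Sec s (bas s f)) => ?_, fun (x : Sec s U) hx => ?_⟩
    · obtain ⟨k, x, hk⟩ := IsLocalization.Away.surj f y
      refine ⟨k, x, ?_⟩
      change resO s (bas_le s f) f ^ k * resO s le_rfl y = 1 * resO s (bas_le s f) x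
      rw [one_mul, resO_self, mul_comm]
      exact hk
    · change 1 * resO s (bas_le s f) x = 0 at hx
      rw [one_mul] at hx
      obtain ⟨k, hk⟩ := IsLocalization.Away.exists_of_eq (S := Sec s (bas s f)) f
        (hx.trans (map_zero (resO s (bas_le s f))).symm)
      refine ⟨k, ?_⟩
      change f ^ k * resO s le_rfl x = 0
      rw [resO_self, hk, mul_zero]

variable (s) in
/-- The structure sheaf as a quasi-coherent sheaf. -/
def strSheaf : QCoh s := ⟨strFun s, isQCoh_strFun⟩

end StructureSheaf

section DG

open CochainComplex HomComplex

universe v₁ v₂ v₃ u₁ u₂ u₃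

/-- A dg functor from the dg category of complexes in `A` to that of complexes in `B`. -/
structure DGFun (A : Type u₁) [Category.{v₁} A] [Preadditive A]
    (B : Type u₂) [Category.{v₂} B] [Preadditive B] where
  obj : CochainComplex A ℤ → CochainComplex B ℤ
  map : ∀ {K L : CochainComplex A ℤ} {n : ℤ}, Cochain K L n → Cochain (obj K) (obj L) n
  map_add : ∀ {K L : CochainComplex A ℤ} {n : ℤ} (z w : Cochain K L n),
    map (z + w) = map z + map w
  map_id : ∀ K : CochainComplex A ℤ, map (Cochain.ofHom (𝟙 K)) = Cochain.ofHom (𝟙 (obj K))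
  map_comp : ∀ {K L M : CochainComplex A ℤ} {n₁ n₂ n₁₂ : ℤ} (z : Cochain K L n₁)
    (w : Cochain L M n₂) (h : n₁ + n₂ = n₁₂), map (z.comp w h) = (map z).comp (map w) h
  map_δ : ∀ {K L : CochainComplex A ℤ} {n : ℤ} (m : ℤ) (_ : n + 1 = m) (z : Cochain K L n),
    map (δ n m z) = δ n m (map z)

namespace DGFun

variable {A : Type u₁} [Category.{v₁} A] [Preadditive A] {B : Type u₂} [Category.{v₂} B]
  [Preadditive B] {C : Type u₃} [Category.{v₃} C] [Preadditive C]

/-- A closed natural transformation of degree zero. -/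
structure NatTrans (F G : DGFun A B) where
  app : ∀ K : CochainComplex A ℤ, F.obj K ⟶ G.obj K
  naturality : ∀ {K L : CochainComplex A ℤ} {n : ℤ} (z : Cochain K L n),
    (F.map z).comp (Cochain.ofHom (app L)) (add_zero n) =
      (Cochain.ofHom (app K)).comp (G.map z) (zero_add n)

/-- The identity. -/
def id (A : Type u₁) [Category.{v₁} A] [Preadditive A] : DGFun A A where
  obj K := K
  map z := z
  map_add _ _ := rfl
  map_id _ := rfl
  map_comp _ _ _ := rfl
  map_δ _ _ _ := rfl

/-- The composition. -/
def comp (F : DGFun A B) (G : DGFun B C) : DGFun A C where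
  obj K := G.obj (F.obj K)
  map z := G.map (F.map z)
  map_add z w := by rw [F.map_add, G.map_add]
  map_id K := by rw [F.map_id, G.map_id]
  map_comp z w h := by rw [F.map_comp, G.map_comp]
  map_δ m h z := by rw [F.map_δ m h, G.map_δ m h]

/-- The dg functor of an additive functor. -/
noncomputable def ofAdditive (Φ : A ⥤ B) [Φ.Additive] : DGFun A B where
  obj K := (Φ.mapHomologicalComplex _).obj K
  map z := z.map Φ
  map_add z w := Cochain.map_add z w Φ
  map_id K := by ext p; simp [Functor.mapHomologicalComplex]
  map_comp z w h := by simp only [Cochain.map_comp]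
  map_δ m h z := by simp only [δ_map]

/-- The dg natural transformation of a natural transformation of additive functors. -/
noncomputable def NatTrans.ofNatTrans {Φ Ψ : A ⥤ B} [Φ.Additive] [Ψ.Additive] (τ : Φ ⟶ Ψ) :
    NatTrans (ofAdditive Φ) (ofAdditive Ψ) where
  app K := (NatTrans.mapHomologicalComplex τ _).app K
  naturality {K L n} z := by
    ext p q hpq
    simp [ofAdditive]
    exact τ.naturality _

lemma map_zero (F : DGFun A B) {K L : CochainComplex A ℤ} {n : ℤ} :
    F.map (0 : Cochain K L n) = 0 := by
  have := F.map_add (0 : Cochain K L n) 0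
  simpa using this

/-- The functor on complexes underlying a dg functor. -/
def toFunctor (F : DGFun A B) : CochainComplex A ℤ ⥤ CochainComplex B ℤ where
  obj K := F.obj K
  map f := Cocycle.homOf (Cocycle.mk (F.map (Cochain.ofHom f)) 1 (by norm_num) (by
    rw [← F.map_δ 1 (by norm_num), δ_ofHom, F.map_zero]))
  map_id K := by
    ext p
    simp [F.map_id, Cocycle.homOf]
  map_comp f g := by
    ext p
    simp [F.map_comp, Cocycle.homOf]

variable [HasBinaryBiproducts B]

open mappingCone

/-- The cone of a closed natural transformation, on cochains: `z` acts by `(-1)ⁿ F(z)` on the first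
and by `G(z)` on the second summand. -/
noncomputable def coneMap {F G : DGFun A B} (τ : NatTrans F G) {K L : CochainComplex A ℤ} {n : ℤ}
    (z : Cochain K L n) : Cochain (mappingCone (τ.app K)) (mappingCone (τ.app L)) n :=
  n.negOnePow • (fst (τ.app K)).1.comp ((F.map z).comp (inl (τ.app L))
      (show n + (-1) = n - 1 by ring)) (by ring) +
    (snd (τ.app K)).comp ((G.map z).comp (Cochain.ofHom (inr (τ.app L))) (add_zero n)) (zero_add n)

lemma inl_coneMap {F G : DGFun A B} (τ : NatTrans F G) {K L : CochainComplex A ℤ} {n : ℤ}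
    (z : Cochain K L n) (k : ℤ) (hk : -1 + n = k) :
    (inl (τ.app K)).comp (coneMap τ z) hk =
      n.negOnePow • (F.map z).comp (inl (τ.app L)) (by rw [← hk]; ring) := by
  obtain rfl : k = n - 1 := by omega
  rw [coneMap, Cochain.comp_add, Cochain.comp_units_smul, inl_fst_assoc, inl_snd_assoc, add_zero]

lemma inr_coneMap {F G : DGFun A B} (τ : NatTrans F G) {K L : CochainComplex A ℤ} {n : ℤ}
    (z : Cochain K L n) :
    (Cochain.ofHom (inr (τ.app K))).comp (coneMap τ z) (zero_add n) =
      (G.map z).comp (Cochain.ofHom (inr (τ.app L))) (add_zero n) := by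
  rw [coneMap, Cochain.comp_add, Cochain.comp_units_smul, inr_fst_assoc, inr_snd_assoc, smul_zero,
    zero_add]

lemma cone_ext {F G K : CochainComplex B ℤ} (φ : F ⟶ G) {n : ℤ} (k : ℤ) (hk : k + 1 = n)
    {z w : Cochain (mappingCone φ) K n}
    (h1 : (inl φ).comp z (show -1 + n = k by omega) = (inl φ).comp w (by omega))
    (h2 : (Cochain.ofHom (inr φ)).comp z (zero_add n) =
      (Cochain.ofHom (inr φ)).comp w (zero_add n)) : z = w :=
  (ext_cochain_from_iff φ k n hk).2 ⟨h1, h2⟩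

/-- The cone of a closed natural transformation of degree zero. -/
noncomputable def cone {F G : DGFun A B} (τ : NatTrans F G) : DGFun A B where
  obj K := mappingCone (τ.app K)
  map z := coneMap τ z
  map_add z w := by
    apply cone_ext _ (_ - 1) (sub_add_cancel _ _)
    · simp only [Cochain.comp_add, inl_coneMap, F.map_add, Cochain.add_comp, smul_add]
    · simp only [Cochain.comp_add, inr_coneMap, G.map_add, Cochain.add_comp]
  map_id K := by
    apply cone_ext _ (_ - 1) (sub_add_cancel _ _)
    · simp only [inl_coneMap, F.map_id, Int.negOnePow_zero, one_smul, Cochain.id_comp,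
        Cochain.comp_id]
    · simp only [inr_coneMap, G.map_id, Cochain.id_comp, Cochain.comp_id]
  map_comp {K L M n₁ n₂ n₁₂} z w h := by
    subst h
    apply cone_ext _ (_ - 1) (sub_add_cancel _ _)
    · rw [inl_coneMap, F.map_comp, ← Cochain.comp_assoc _ _ _ (show -1 + n₁ = n₁ - 1 by ring) rfl
        (by ring), inl_coneMap, Cochain.units_smul_comp,
        Cochain.comp_assoc _ _ _ (show n₁ + -1 = n₁ - 1 by ring) (show -1 + n₂ = n₂ - 1 by ring)
        (by ring), inl_coneMap, Cochain.comp_units_smul, smul_smul,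
        ← Cochain.comp_assoc _ _ _ rfl (show n₂ + -1 = n₂ - 1 by ring) (by ring),
        Int.negOnePow_add]
    · rw [inr_coneMap, G.map_comp, ← Cochain.comp_assoc_of_first_is_zero_cochain, inr_coneMap,
        Cochain.comp_assoc_of_second_is_zero_cochain, inr_coneMap,
        ← Cochain.comp_assoc_of_third_is_zero_cochain]
  map_δ {K L n} m h z := by
    subst h
    apply cone_ext _ n rfl
    · have h1 := δ_comp (inl (τ.app K)) (coneMap τ z) (show -1 + n = n - 1 by ring) 0 (n + 1) n
        (by ring) (by ring) rfl
      rw [inl_coneMap, δ_units_smul, δ_comp (F.map z) (inl (τ.app L)) (show n + -1 = n - 1 by ring)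
        (n + 1) 0 n (by ring) rfl (by ring), δ_inl, δ_inl, Cochain.ofHom_comp, Cochain.ofHom_comp,
        Cochain.comp_assoc_of_first_is_zero_cochain, inr_coneMap,
        ← Cochain.comp_assoc_of_third_is_zero_cochain, τ.naturality,
        Cochain.comp_assoc_of_third_is_zero_cochain, smul_add] at h1
      rw [inl_coneMap, F.map_δ _ rfl, Int.negOnePow_succ]
      rw [add_comm, smul_smul] at h1
      have h2 := add_right_cancel h1
      refine Eq.trans ?_ h2
      congr 1
      simp
    · have h1 := δ_ofHom_comp (inr (τ.app K)) (coneMap τ z) (n + 1)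
      rw [inr_coneMap, δ_comp_ofHom, ← G.map_δ _ rfl] at h1
      rw [inr_coneMap, h1]

lemma coneMap_desc {F G H : DGFun A B} (τ : NatTrans F G) (σ : NatTrans G H)
    (hτσ : ∀ K, δ (-1) 0 (0 : Cochain (F.obj K) (H.obj K) (-1)) =
      Cochain.ofHom (τ.app K ≫ σ.app K)) {K L : CochainComplex A ℤ} {n : ℤ} (z : Cochain K L n) :
    (coneMap τ z).comp (Cochain.ofHom (mappingCone.desc (τ.app L) 0 (σ.app L) (hτσ L)))
        (add_zero n) =
      (Cochain.ofHom (mappingCone.desc (τ.app K) 0 (σ.app K) (hτσ K))).comp (H.map z)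
        (zero_add n) := by
  apply cone_ext _ (n - 1) (sub_add_cancel _ _)
  · rw [← Cochain.comp_assoc_of_third_is_zero_cochain, inl_coneMap, Cochain.units_smul_comp,
      Cochain.comp_assoc_of_third_is_zero_cochain, inl_desc, Cochain.comp_zero, smul_zero,
      ← Cochain.comp_assoc_of_second_is_zero_cochain, inl_desc, Cochain.zero_comp]
  · rw [← Cochain.comp_assoc_of_third_is_zero_cochain, inr_coneMap,
      Cochain.comp_assoc_of_third_is_zero_cochain, ← Cochain.ofHom_comp, inr_desc,
      ← Cochain.comp_assoc_of_first_is_zero_cochain, ← Cochain.ofHom_comp, inr_desc, σ.naturality]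

/-- A closed natural transformation `σ : G ⟶ H` with `τ ≫ σ = 0` induces one on the cone of
`τ : F ⟶ G`. -/
noncomputable def coneDesc {F G H : DGFun A B} (τ : NatTrans F G) (σ : NatTrans G H)
    (hτσ : ∀ K, τ.app K ≫ σ.app K = 0) : NatTrans (cone τ) H where
  app K := mappingCone.desc (τ.app K) 0 (σ.app K) (by simp [hτσ K])
  naturality z := coneMap_desc τ σ (fun K => by simp [hτσ K]) z

end DGFun
end DG

section Beilinson

variable [IsSmoothCurve s] {𝓔 : FirstOrder s}

/-- `𝔹(M) = Tot (δ ⊗_R M)_{•,0}`, the total complex of `R(-1) ⊗ T ⊗ M_{-1} ⟶ R ⊗ M_0`, for a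
complex `M`. -/
noncomputable def BB (h : TensorQC 𝓔) : DGFun (Gr 𝓔) (Gr 𝓔) :=
  DGFun.cone (DGFun.NatTrans.ofNatTrans (diffT h))

/-- `𝔹'(M) = Tot (δ' ⊗_R M)_{•,0}`, the total complex of
`R(-1) ⊗ M_{-1} ⟶ R(-1) ⊗ D¹ ⊗ M_{-1} ⟶ R ⊗ M_0`, for a complex `M`. -/
noncomputable def BB' (h : TensorQC 𝓔) : DGFun (Gr 𝓔) (Gr 𝓔) :=
  DGFun.cone (DGFun.coneDesc (DGFun.NatTrans.ofNatTrans (diffO h))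
    (DGFun.NatTrans.ofNatTrans (diffE h)) (fun K => by
      apply HomologicalComplex.hom_ext; intro n
      exact congr_app (diffO_diffE h) (K.X n)))

variable (𝓔) in
/-- The right adjoint `ω` of `π`. -/
noncomputable def ω [(π 𝓔).IsLeftAdjoint] : Qgr 𝓔 ⥤ Gr 𝓔 := (π 𝓔).rightAdjoint

instance [(π 𝓔).IsLeftAdjoint] : (ω 𝓔).Additive :=
  (Adjunction.ofIsLeftAdjoint (π 𝓔)).right_adjoint_additive

/-- The objects of the dg category `D_dg(P_D)`: the bounded below complexes of injective objects of
`Qgr R` with bounded cohomology. The morphism complexes are the full ones. -/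
def IsDdg (I : CochainComplex (Qgr 𝓔) ℤ) : Prop :=
  (∃ a : ℤ, I.IsStrictlyGE a) ∧ (∀ n : ℤ, Injective (I.X n)) ∧ ∃ b : ℤ, I.IsLE b

/-- On `D_dg(P_D)`, the dg functor `M ↦ π B(ω M)` is quasi-isomorphic to the identity: there is a
closed natural transformation of degree zero to the identity which is a quasi-isomorphism at
every object of `D_dg(P_D)`. -/
def IsoIdDg [(π 𝓔).IsLeftAdjoint] (B : DGFun (Gr 𝓔) (Gr 𝓔)) : Prop :=
  ∃ η : DGFun.NatTrans (((DGFun.ofAdditive (ω 𝓔)).comp B).comp (DGFun.ofAdditive (π 𝓔)))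
    (DGFun.id (Qgr 𝓔)), ∀ I, IsDdg I → QuasiIso (η.app I)

variable [HasDerivedCategory (Gr 𝓔)] [HasDerivedCategory (Qgr 𝓔)]

open DerivedCategory in
/-- `B` descends to the derived category of `Gr R`, and the functor `M ↦ π B(Rω M)` is
isomorphic to the identity on the bounded derived category of `Qgr R`. -/
def IsoIdDb [(π 𝓔).IsLeftAdjoint] [EnoughInjectives (Qgr 𝓔)] (B : DGFun (Gr 𝓔) (Gr 𝓔)) : Prop :=
  ∃ 𝔅 : DerivedCategory (Gr 𝓔) ⥤ DerivedCategory (Gr 𝓔),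
    Nonempty (B.toFunctor ⋙ Q ≅ Q ⋙ 𝔅) ∧
    Nonempty (ObjectProperty.ιOfLE
      (inf_le_left : (TStructure.t (C := Qgr 𝓔)).bounded ≤ (TStructure.t (C := Qgr 𝓔)).plus) ⋙
      (ω 𝓔).rightDerivedFunctorPlus ⋙ Plus.ι ⋙ 𝔅 ⋙ (π 𝓔).mapDerivedCategory ≅
        (Bounded.ι : Bounded (Qgr 𝓔) ⥤ DerivedCategory (Qgr 𝓔)))

/-- The objects `π(R ⊗ V)` and `π(R(1) ⊗ V)`, for quasi-coherent sheaves `V` on `X`. -/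
def isInduced (h : TensorQC 𝓔) : ObjectProperty (DerivedCategory (Qgr 𝓔)) := fun M =>
  ∃ (k : ℤ) (V : QCoh s), (k = 0 ∨ k = 1) ∧
    M = (DerivedCategory.singleFunctor (Qgr 𝓔) 0).obj ((π 𝓔).obj ((indQ h k).obj V))

/-- `πR ⊕ πR(1)` -/
noncomputable def G (h : TensorQC 𝓔) : Qgr 𝓔 :=
  (π 𝓔).obj ((indQ h 0).obj (strSheaf s)) ⊞ (π 𝓔).obj ((indQ h 1).obj (strSheaf s))

/-- `πR ⊕ πR(1)` generates the bounded derived category of `Qgr R` over `X`: every object is in the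
thick triangulated subcategory spanned by the `πR(k) ⊗ V` with `k = 0, 1` and `V` a quasi-coherent
sheaf on `X`; and if `X` is affine, then an object which receives no nonzero morphism from a shift
of `πR ⊕ πR(1)` is zero. -/
structure Generates (h : TensorQC 𝓔) : Prop where
  thick : (DerivedCategory.TStructure.t (C := Qgr 𝓔)).bounded ≤ (isInduced h).triangEnvelope
  orthogonal : IsAffine X → ∀ M : DerivedCategory (Qgr 𝓔), DerivedCategory.TStructure.t.bounded M →
    (∀ (n : ℤ) (f : (DerivedCategory.singleFunctor (Qgr 𝓔) 0).obj (G h) ⟶ M⟦n⟧), f = 0) → IsZero M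

end Beilinson

end NCBeilinson

namespace NCBeilinson

variable {X : Scheme.{0}} {s : X ⟶ Spec (CommRingCat.of ℂ)}

section Nilpotent

/-! Two commuting operators whose difference is nilpotent have the same localizations. -/

variable {K K' G G' : Type} [CommRing K] [CommRing K'] [AddCommGroup G] [AddCommGroup G']
  [Module K' G'] [Module K G]

/-- The cofactor `Q` of `L ^ (k + N) = Q * R ^ k + P * (L - R) ^ N`. -/
def swapCof (L R : Module.End K G) (N k : ℕ) : Module.End K G :=
  ∑ i ∈ Finset.range N, (k + N).choose i • ((L - R) ^ i * R ^ (N - i))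

lemma swap_pow {L R : Module.End K G} (hc : Commute L R) (N k : ℕ) {x : G}
    (hx : ((L - R) ^ N) x = 0) : (L ^ (k + N)) x = swapCof L R N k ((R ^ k) x) := by
  have hc' : Commute (L - R) R := hc.sub_left (Commute.refl R)
  have h1 : L ^ (k + N) = ∑ i ∈ Finset.range (k + N + 1),
      ((L - R) ^ i * R ^ (k + N - i) * ((k + N).choose i : Module.End K G)) := by
    rw [← hc'.add_pow, sub_add_cancel]
  rw [h1, show k + N + 1 = N + (k + 1) by ring, Finset.sum_range_add, LinearMap.add_apply,
    LinearMap.sum_apply, LinearMap.sum_apply, swapCof,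
    LinearMap.sum_apply]
  have h2 : ∀ i ∈ Finset.range (k + 1), ((L - R) ^ (N + i) * R ^ (k + N - (N + i)) *
      ((k + N).choose (N + i) : Module.End K G)) x = 0 := by
    intro i _
    have e : (L - R) ^ (N + i) * R ^ (k + N - (N + i)) * ((k + N).choose (N + i) : Module.End K G)
        = (((L - R) ^ i * R ^ (k + N - (N + i)) * ((k + N).choose (N + i) : Module.End K G))
          * (L - R) ^ N) := by
      rw [add_comm N i, pow_add, mul_assoc, mul_assoc, mul_assoc, mul_assoc]
      congr 1
      rw [((hc'.pow_left N).pow_right _).left_comm, (Nat.cast_commute _ ((L - R) ^ N)).eq]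
    rw [e]
    rw [Module.End.mul_apply, hx, map_zero]
  rw [Finset.sum_eq_zero h2, add_zero]
  refine Finset.sum_congr rfl fun i hi => ?_
  rw [Finset.mem_range] at hi
  have e : ((L - R) ^ i * R ^ (k + N - i) * ((k + N).choose i : Module.End K G)) =
      ((k + N).choose i • ((L - R) ^ i * R ^ (N - i))) * R ^ k := by
    rw [show k + N - i = (N - i) + k by omega, pow_add, nsmul_eq_mul,
      ← (Nat.cast_commute ((k + N).choose i) _).eq]
    simp only [mul_assoc]
  rw [e]; rfl

lemma swapCof_map (φ : G →+ G') {L R : Module.End K G} {L' R' : Module.End K' G'}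
    (hL : ∀ x, φ (L x) = L' (φ x)) (hR : ∀ x, φ (R x) = R' (φ x)) (N k : ℕ) (x : G) :
    φ (swapCof L R N k x) = swapCof L' R' N k (φ x) := by
  have hp : ∀ {P : Module.End K G} {P' : Module.End K' G'} (_ : ∀ x, φ (P x) = P' (φ x)) (n : ℕ)
      (x : G), φ ((P ^ n) x) = (P' ^ n) (φ x) := by
    intro P P' hP n
    induction n with
    | zero => intro x; rfl
    | succ n ih =>
      intro x
      rw [pow_succ, pow_succ]
      exact (ih (P x)).trans (congrArg _ (hP x))
  have hLR : ∀ x, φ ((L - R) x) = (L' - R') (φ x) := fun x => by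
    rw [LinearMap.sub_apply, LinearMap.sub_apply, map_sub, hL, hR]
  rw [swapCof, swapCof, LinearMap.sum_apply, LinearMap.sum_apply, map_sum]
  refine Finset.sum_congr rfl fun i _ => ?_
  rw [LinearMap.smul_apply, LinearMap.smul_apply, map_nsmul]
  exact congrArg _ ((hp hLR _ _).trans (congrArg _ (hp hR _ _)))

lemma swap_surj (φ : G →+ G') {L R : Module.End K G} {L' R' : Module.End K' G'}
    (hL : ∀ x, φ (L x) = L' (φ x)) (hR : ∀ x, φ (R x) = R' (φ x)) (hc : Commute L' R') {N k : ℕ}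
    {x : G} {y : G'} (hy : ((L' - R') ^ N) y = 0) (h : (R' ^ k) y = φ x) :
    (L' ^ (k + N)) y = φ (swapCof L R N k x) := by
  rw [swap_pow hc N k hy, h, swapCof_map φ hL hR]

lemma swap_inj {L R : Module.End K G} (hc : Commute L R) {N k : ℕ} {x : G}
    (hx : ((L - R) ^ N) x = 0) (h : (R ^ k) x = 0) : (L ^ (k + N)) x = 0 := by
  rw [swap_pow hc N k hx, h, map_zero]

end Nilpotent

section Localization

/-- The semilinear map `φ : N → N'` exhibits `N'` as the localization of `N` away from `f`. -/
structure IsLoc {A A' N N' : Type} [CommRing A] [CommRing A'] [AddCommGroup N] [AddCommGroup N']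
    [Module A N] [Module A' N'] (ρ : A →+* A') (f : A) (φ : N →+ N') : Prop where
  surj : ∀ y : N', ∃ (k : ℕ) (x : N), ρ f ^ k • y = φ x
  inj : ∀ x : N, φ x = 0 → ∃ k : ℕ, f ^ k • x = 0

variable {U : X.affineOpens} (f : Sec s U)

lemma isLocalization_resO :
    letI := (resO s (bas_le s f)).toAlgebra
    IsLocalization.Away f (Sec s (bas s f)) := U.2.isLocalization_basicOpen f

lemma isUnit_resO : IsUnit (resO s (bas_le s f) f) := by
  let _ := (resO s (bas_le s f)).toAlgebra
  have := isLocalization_resO f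
  exact IsLocalization.Away.algebraMap_isUnit f

lemma isLoc_resO : IsLoc (resO s (bas_le s f)) f (resO s (bas_le s f)).toAddMonoidHom := by
  let _ := (resO s (bas_le s f)).toAlgebra
  have := isLocalization_resO f
  refine ⟨fun y => ?_, fun x hx => ?_⟩
  · obtain ⟨k, x, hk⟩ := IsLocalization.Away.surj f y
    exact ⟨k, x, (mul_comm _ _).trans hk⟩
  · obtain ⟨k, hk⟩ := IsLocalization.Away.exists_of_eq (S := Sec s (bas s f)) f
      (hx.trans (map_zero (resO s (bas_le s f))).symm)
    exact ⟨k, by simpa using hk⟩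

lemma span_pow_mem {A N : Type} [CommRing A] [AddCommGroup N] [Module A N] (P : Submodule A N)
    {S : Set A} (hS : Ideal.span S = ⊤) (x : N) (h : ∀ f ∈ S, ∃ k : ℕ, f ^ k • x ∈ P) : x ∈ P :=
  Submodule.mem_of_span_eq_top_of_smul_pow_mem P S hS x fun r => h r.1 r.2

end Localization

namespace FirstOrder

variable (𝓔 : FirstOrder s)

lemma isLoc_res {U : X.affineOpens} (f : Sec s U) :
    IsLoc (resO s (bas_le s f)) f (𝓔.res (bas_le s f)) :=
  ⟨𝓔.loc_surj f, 𝓔.loc_inj f⟩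

lemma fil_zero (U : X.affineOpens) : 𝓔.fil U 0 = 𝓔.imO U := by
  simpa using 𝓔.fil_natCast U 0

lemma fil_succ (U : X.affineOpens) (n : ℕ) : 𝓔.fil U (n + 1 : ℕ) = 𝓔.fil U n * 𝓔.imE U := by
  rw [fil_natCast, fil_natCast, pow_succ, mul_assoc]

lemma fil_le_succ (U : X.affineOpens) (n : ℤ) : 𝓔.fil U n ≤ 𝓔.fil U (n + 1) := fun a ha => by
  simpa using 𝓔.mul_mem_fil rfl ha (𝓔.one_mem_fil_one U)

lemma fil_mono (U : X.affineOpens) {m n : ℤ} (h : m ≤ n) : 𝓔.fil U m ≤ 𝓔.fil U n := by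
  obtain ⟨k, rfl⟩ := Int.le.dest h
  induction k with
  | zero => simp
  | succ k ih =>
    refine (ih (by omega)).trans ?_
    have := 𝓔.fil_le_succ U (m + k)
    rwa [add_assoc] at this

lemma exists_mem_fil {U : X.affineOpens} (d : 𝓔.D U) : ∃ n : ℕ, d ∈ 𝓔.fil U n := by
  obtain ⟨a, rfl⟩ := RingQuot.mkRingHom_surjective (𝓔.Rel U) d
  change ∃ n : ℕ, 𝓔.quo U a ∈ 𝓔.fil U n
  induction a using FreeAlgebra.induction with
  | grade0 r =>
    refine ⟨0, ?_⟩
    have : 𝓔.quo U (algebraMap ℤ _ r) = r • (1 : 𝓔.D U) := by simp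
    rw [this]
    exact Submodule.smul_mem _ r (𝓔.one_mem_fil_zero U)
  | grade1 z => exact ⟨1, 𝓔.ιE_mem_fil z⟩
  | mul a b ha hb =>
    obtain ⟨m, hm⟩ := ha
    obtain ⟨n, hn⟩ := hb
    refine ⟨m + n, ?_⟩
    rw [map_mul]
    exact 𝓔.mul_mem_fil (by push_cast; rfl) hm hn
  | add a b ha hb =>
    obtain ⟨m, hm⟩ := ha
    obtain ⟨n, hn⟩ := hb
    refine ⟨max m n, ?_⟩
    rw [map_add]
    exact add_mem (𝓔.fil_mono U (by simp) hm) (𝓔.fil_mono U (by simp) hn)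

lemma commutator_mem {U : X.affineOpens} (f : Sec s U) {n : ℤ} {a : 𝓔.D U} (ha : a ∈ 𝓔.fil U n) :
    𝓔.ιO U f * a - a * 𝓔.ιO U f ∈ 𝓔.fil U (n - 1) := by
  rcases lt_or_ge n 0 with hn | hn
  · rw [𝓔.fil_neg U hn, Submodule.mem_bot] at ha
    simp [ha]
  obtain ⟨n, rfl⟩ := Int.eq_ofNat_of_zero_le hn
  induction n generalizing a with
  | zero =>
    rw [Nat.cast_zero, fil_zero] at ha
    obtain ⟨g, rfl⟩ := ha
    change 𝓔.ιO U f * 𝓔.ιO U g - 𝓔.ιO U g * 𝓔.ιO U f ∈ _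
    rw [← map_mul, ← map_mul, mul_comm, sub_self]
    exact zero_mem _
  | succ n ih =>
    rw [fil_succ] at ha
    have e : ((n + 1 : ℕ) : ℤ) - 1 = n := by push_cast; ring
    rw [e]
    refine Submodule.mul_induction_on ha ?_ ?_
    · rintro d hd _ ⟨z, rfl⟩
      change 𝓔.ιO U f * (d * 𝓔.ιE U z) - d * 𝓔.ιE U z * 𝓔.ιO U f ∈ _
      have h1 : 𝓔.ιE U z * 𝓔.ιO U f = 𝓔.ιO U f * 𝓔.ιE U z + 𝓔.ιO U (𝓔.anchor U z f) := by
        rw [ιE_mul_ιO, map_add, ιE_smul]; rfl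
      have h2 : 𝓔.ιO U f * (d * 𝓔.ιE U z) - d * 𝓔.ιE U z * 𝓔.ιO U f =
          (𝓔.ιO U f * d - d * 𝓔.ιO U f) * 𝓔.ιE U z - d * 𝓔.ιO U (𝓔.anchor U z f) := by
        rw [mul_assoc d, h1]; noncomm_ring
      rw [h2]
      exact sub_mem (𝓔.mul_mem_fil (by ring) (ih hd (by omega)) (𝓔.ιE_mem_fil z))
        (𝓔.mul_mem_fil (add_zero _) hd (𝓔.ιO_mem_fil _))
    · intro x y hx hy
      rw [mul_add, add_mul, add_sub_add_comm]
      exact add_mem hx hy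

lemma ad_pow_mem {U : X.affineOpens} (f : Sec s U) {n : ℤ} {a : 𝓔.D U} (ha : a ∈ 𝓔.fil U n)
    (k : ℕ) : ((LinearMap.mulLeft ℤ (𝓔.ιO U f) -
      LinearMap.mulRight ℤ (𝓔.ιO U f)) ^ k) a ∈ 𝓔.fil U (n - k) := by
  induction k with
  | zero => simpa using ha
  | succ k ih =>
    rw [pow_succ']
    have := 𝓔.commutator_mem f ih
    rw [sub_sub] at this
    exact_mod_cast this

lemma ad_pow_eq_zero {U : X.affineOpens} (f : Sec s U) {n : ℤ} {a : 𝓔.D U} (ha : a ∈ 𝓔.fil U n)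
    (k : ℕ) (hk : n < k) : ((LinearMap.mulLeft ℤ (𝓔.ιO U f) -
      LinearMap.mulRight ℤ (𝓔.ιO U f)) ^ k) a = 0 := by
  have := 𝓔.ad_pow_mem f ha k
  rwa [𝓔.fil_neg U (by omega), Submodule.mem_bot] at this

end FirstOrder

namespace FirstOrder

variable (𝓔 : FirstOrder s) {U : X.affineOpens} (f : Sec s U)

lemma fil_loc_surj (n : ℕ) {y : 𝓔.D (bas s f)} (hy : y ∈ 𝓔.fil _ n) : ∃ (k : ℕ) (x : 𝓔.D U),
    x ∈ 𝓔.fil U n ∧ 𝓔.ιO _ (resO s (bas_le s f) f) ^ k * y = 𝓔.resD (bas_le s f) x := by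
  induction n generalizing y with
  | zero =>
    rw [Nat.cast_zero, fil_zero] at hy
    obtain ⟨g, rfl⟩ := hy
    obtain ⟨k, x, hx⟩ := (isLoc_resO f).surj g
    refine ⟨k, 𝓔.ιO U x, 𝓔.ιO_mem_fil x, ?_⟩
    rw [resD_ιO, ← map_pow]
    exact (map_mul (𝓔.ιO _) _ _).symm.trans (congrArg _ hx)
  | succ n ih =>
    rw [fil_succ] at hy
    refine Submodule.mul_induction_on hy ?_ ?_
    · rintro d hd _ ⟨e, rfl⟩
      change ∃ (k : ℕ) (x : 𝓔.D U), _ ∧ _ * (d * 𝓔.ιE _ e) = _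
      obtain ⟨k, e', he⟩ := (𝓔.isLoc_res f).surj e
      obtain ⟨u, hu⟩ := (isUnit_resO f).exists_left_inv
      have he' : e = u ^ k • 𝓔.res (bas_le s f) e' := by
        rw [← he, smul_smul, ← mul_pow, hu, one_pow, one_smul]
      obtain ⟨l, x, hx, hl⟩ := ih (𝓔.mul_mem_fil (add_zero _) hd (𝓔.ιO_mem_fil (u ^ k)))
      refine ⟨l, x * 𝓔.ιE U e', 𝓔.mul_mem_fil (by push_cast; rfl) hx (𝓔.ιE_mem_fil e'), ?_⟩
      rw [map_mul, resD_ιE, ← hl, he', ιE_smul]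
      simp only [mul_assoc]
    · rintro y y' ⟨k, x, hx, hk⟩ ⟨l, x', hx', hl⟩
      refine ⟨k + l, 𝓔.ιO U (f ^ l) * x + 𝓔.ιO U (f ^ k) * x', add_mem
        (𝓔.mul_mem_fil (zero_add _) (𝓔.ιO_mem_fil _) hx)
        (𝓔.mul_mem_fil (zero_add _) (𝓔.ιO_mem_fil _) hx'), ?_⟩
      rw [map_add, map_mul, map_mul, ← hk, ← hl, resD_ιO, resD_ιO, map_pow, map_pow, map_pow,
        map_pow, mul_add, ← mul_assoc, ← mul_assoc, ← pow_add, ← pow_add, add_comm l k]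

lemma bracket_skew (U : X.affineOpens) (z w : 𝓔.E U) : 𝓔.bracket U z w = -𝓔.bracket U w z := by
  have := 𝓔.bracket_self U (z + w)
  rw [map_add, map_add, AddMonoidHom.add_apply, AddMonoidHom.add_apply, 𝓔.bracket_self,
    𝓔.bracket_self, zero_add, add_zero, add_comm] at this
  exact eq_neg_of_add_eq_zero_left this

/-- A ring homomorphism on `D(U)` which inverts `f` extends to `D(U_f)`. -/
lemma exists_lift_resD {Q : Type} [Ring Q] (μ : 𝓔.D U →+* Q) (hμ : IsUnit (μ (𝓔.ιO U f))) :
    ∃ ν : 𝓔.D (bas s f) →+* Q, ∀ a, ν (𝓔.resD (bas_le s f) a) = μ a := by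
  set g := resO s (bas_le s f) f with hg
  set F := μ (𝓔.ιO U f) with hF
  have can : ∀ (k : ℕ) {a b : Q}, F ^ k * a = F ^ k * b → a = b := fun k a b h =>
    (hμ.pow k).mul_left_cancel h
  have hFk : ∀ k, μ (𝓔.ιO U (f ^ k)) = F ^ k := fun k => by rw [map_pow, map_pow]
  have hex : ∀ y : 𝓔.E (bas s f), ∃ q : Q, ∀ (k : ℕ) (x : 𝓔.E U),
      g ^ k • y = 𝓔.res (bas_le s f) x → F ^ k * q = μ (𝓔.ιE U x) := by
    intro y
    obtain ⟨l, x', hx'⟩ := (𝓔.isLoc_res f).surj y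
    obtain ⟨v, hv⟩ := (hμ.pow l).exists_right_inv
    refine ⟨v * μ (𝓔.ιE U x'), fun k x hx => ?_⟩
    have h0 : 𝓔.res (bas_le s f) (f ^ l • x - f ^ k • x') = 0 := by
      rw [map_sub, 𝓔.res_smul, 𝓔.res_smul, ← hx, ← hx', map_pow, map_pow, smul_smul, smul_smul,
        mul_comm, sub_self]
    obtain ⟨m, hm⟩ := (𝓔.isLoc_res f).inj _ h0
    rw [smul_sub, sub_eq_zero] at hm
    have h1 := congrArg (fun z => μ (𝓔.ιE U z)) hm
    simp only [ιE_smul, map_mul, hFk] at h1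
    have h2 := can m h1
    apply can l
    rw [h2, ← mul_assoc, ← pow_add, add_comm, pow_add, mul_assoc, ← mul_assoc (F ^ l), hv, one_mul]
  choose φ hφ using hex
  have hres : ∀ x, φ (𝓔.res (bas_le s f) x) = μ (𝓔.ιE U x) := fun x => by
    simpa using hφ (𝓔.res (bas_le s f) x) 0 x (by simp)
  have hadd : ∀ y w, φ (y + w) = φ y + φ w := by
    intro y w
    obtain ⟨k, x, hx⟩ := (𝓔.isLoc_res f).surj y
    obtain ⟨l, x', hx'⟩ := (𝓔.isLoc_res f).surj w
    apply can (k + l)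
    rw [hφ _ _ (f ^ l • x + f ^ k • x'), map_add, map_add, ιE_smul, ιE_smul, map_mul, map_mul, hFk,
      hFk, ← hφ y k x hx, ← hφ w l x' hx', mul_add, ← mul_assoc, ← mul_assoc, ← pow_add, ← pow_add,
      add_comm l k]
    rw [map_add, 𝓔.res_smul, 𝓔.res_smul, ← hx, ← hx', smul_add, map_pow, map_pow, smul_smul,
      smul_smul, ← pow_add, ← pow_add, add_comm l k]
  have hsm' : ∀ (b : Sec s U) y, φ (resO s (bas_le s f) b • y) = μ (𝓔.ιO U b) * φ y := by
    intro b y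
    obtain ⟨k, x, hx⟩ := (𝓔.isLoc_res f).surj y
    apply can k
    rw [hφ _ k (b • x), ιE_smul, map_mul, ← hφ y k x hx, ← mul_assoc, ← mul_assoc, ← hFk, ← map_mul,
      ← map_mul, ← map_mul, ← map_mul, mul_comm]
    rw [𝓔.res_smul, ← hx, smul_smul, smul_smul, mul_comm]
  have hsmg : ∀ y, φ (g • y) = F * φ y := hsm' f
  have hsm : ∀ (a : Sec s (bas s f)) (y : 𝓔.E (bas s f)), φ (a • y) = φ (a • 𝓔.one _) * φ y := by
    intro a y
    obtain ⟨l, b, hb⟩ := (isLoc_resO f).surj a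
    have hb : g ^ l * a = resO s (bas_le s f) b := hb
    apply can l
    rw [← mul_assoc, ← hFk, ← hsm', ← hsm', map_pow, smul_smul, smul_smul, hb, hsm', hsm',
      ← 𝓔.res_one (bas_le s f), hres, ιE_one, map_one, mul_one]
  have hcomm : ∀ (k : ℕ) y, (∃ x, g ^ k • y = 𝓔.res (bas_le s f) x) →
      φ y * F = F * φ y + φ (𝓔.anchor _ y g • 𝓔.one _) := by
    intro k
    induction k with
    | zero =>
      rintro y ⟨x, hx⟩
      rw [pow_zero, one_smul] at hx
      rw [hx, hres, ← map_mul, ιE_mul_ιO, map_add, map_add, ιE_smul, map_mul, hg, 𝓔.anchor_res, hsm',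
        ← 𝓔.res_one (bas_le s f), hres, ιE_one, map_one, mul_one, ← map_mul, ← ιE_smul]
      rfl
    | succ k ih =>
      rintro y ⟨x, hx⟩
      have := ih (g • y) ⟨x, by rw [smul_smul, ← pow_succ]; exact hx⟩
      rw [map_smul, Derivation.smul_apply, smul_assoc, hsmg, hsmg, mul_assoc, ← mul_add] at this
      exact hμ.mul_left_cancel this
  have hcomm : ∀ y, φ y * F = F * φ y + φ (𝓔.anchor _ y g • 𝓔.one _) := fun y => by
    obtain ⟨k, x, hx⟩ := (𝓔.isLoc_res f).surj y
    exact hcomm k y ⟨x, hx⟩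
  have hstep : ∀ y, (∀ x, φ y * φ (𝓔.res (bas_le s f) x) = φ (𝓔.res (bas_le s f) x) * φ y +
      φ (𝓔.bracket _ y (𝓔.res (bas_le s f) x))) →
      ∀ w, φ y * φ w = φ w * φ y + φ (𝓔.bracket _ y w) := by
    intro y hy
    have : ∀ (k : ℕ) w, (∃ x, g ^ k • w = 𝓔.res (bas_le s f) x) →
        φ y * φ w = φ w * φ y + φ (𝓔.bracket _ y w) := by
      intro k
      induction k with
      | zero =>
        rintro w ⟨x, hx⟩
        rw [pow_zero, one_smul] at hx
        rw [hx, hy]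
      | succ k ih =>
        rintro w ⟨x, hx⟩
        have := ih (g • w) ⟨x, by rw [smul_smul, ← pow_succ]; exact hx⟩
        rw [hsmg, 𝓔.bracket_smul, hadd, hsmg, hsm, ← mul_assoc, hcomm, add_mul, ← add_assoc] at this
        have := add_right_cancel this
        rw [mul_assoc, mul_assoc, ← mul_add] at this
        exact hμ.mul_left_cancel this
    intro w
    obtain ⟨k, x, hx⟩ := (𝓔.isLoc_res f).surj w
    exact this k w ⟨x, hx⟩
  have hneg : ∀ y, φ (-y) = - φ y := fun y => (AddMonoidHom.mk' φ hadd).map_neg y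
  have hbr : ∀ y w, φ y * φ w = φ w * φ y + φ (𝓔.bracket _ y w) := by
    intro y
    refine hstep y fun x => ?_
    have := hstep (𝓔.res (bas_le s f) x) (fun x' => by
      rw [← 𝓔.bracket_res, hres, hres, hres, ← map_mul, ιE_mul_ιE, map_add, map_mul]) y
    rw [this, bracket_skew, hneg]
    abel
  refine ⟨RingQuot.lift ⟨(FreeAlgebra.lift ℤ φ : FreeAlgebra ℤ _ →ₐ[ℤ] Q).toRingHom, ?_⟩, ?_⟩
  · intro a b hab
    induction hab with
    | add z w => simp [hadd]
    | one => simp [← 𝓔.res_one (bas_le s f), hres, ιE_one]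
    | smul f z => simp [hsm f z]
    | bracket z w => simp [hbr z w]
  · intro a
    refine DFunLike.congr_fun (f := RingHom.comp _ _) (𝓔.D_hom_ext fun z => ?_) a
    refine (congrArg _ (𝓔.resD_ιE _ z)).trans ((RingQuot.lift_mkRingHom_apply _ _ _).trans ?_)
    exact (FreeAlgebra.lift_ι_apply φ _).trans (hres z)

lemma ad_left_right (k N : ℕ) {a : 𝓔.D U} (ha : a ∈ 𝓔.fil U N) (h : a * 𝓔.ιO U f ^ k = 0) :
    𝓔.ιO U f ^ (k + (N + 1)) * a = 0 := by
  have := swap_inj (L := LinearMap.mulLeft ℤ (𝓔.ιO U f)) (R := LinearMap.mulRight ℤ (𝓔.ιO U f))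
    (LinearMap.commute_mulLeft_right ..) (N := N + 1) (k := k) (x := a)
    (𝓔.ad_pow_eq_zero f ha _ (by push_cast; omega)) (by simpa using h)
  simpa using this

lemma exists_ore (k : ℕ) (a : 𝓔.D U) : ∃ (l : ℕ) (b : 𝓔.D U),
    𝓔.ιO U f ^ l * a = b * 𝓔.ιO U f ^ k := by
  obtain ⟨N, hN⟩ := 𝓔.exists_mem_fil a
  have hc : Commute (LinearMap.mulLeft ℤ (𝓔.ιO U f)) (LinearMap.mulRight ℤ (𝓔.ιO U f)) :=
    LinearMap.commute_mulLeft_right ..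
  have := swap_pow hc (N + 1) k (x := a) (𝓔.ad_pow_eq_zero f hN _ (by push_cast; omega))
  have h2 := swapCof_map ((LinearMap.mulRight ℤ (𝓔.ιO U f) ^ k).toAddMonoidHom)
    (L := LinearMap.mulLeft ℤ (𝓔.ιO U f)) (L' := LinearMap.mulLeft ℤ (𝓔.ιO U f))
    (R := LinearMap.mulRight ℤ (𝓔.ιO U f)) (R' := LinearMap.mulRight ℤ (𝓔.ιO U f))
    (fun x => by simp [mul_assoc]) (fun x => by
      simp only [LinearMap.toAddMonoidHom_coe, LinearMap.pow_mulRight, LinearMap.mulRight_apply,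
        mul_assoc, ← pow_succ, ← pow_succ']) (N + 1) k a
  refine ⟨k + (N + 1), swapCof (LinearMap.mulLeft ℤ (𝓔.ιO U f)) (LinearMap.mulRight ℤ (𝓔.ιO U f))
    (N + 1) k a, ?_⟩
  refine Eq.trans ?_ (this.trans (h2.symm.trans ?_))
  · simp
  · simp

lemma resD_eq_zero {a : 𝓔.D U} (ha : 𝓔.resD (bas_le s f) a = 0) :
    ∃ k : ℕ, 𝓔.ιO U f ^ k * a = 0 := by
  have h1 : ∀ (r : 𝓔.D U) (q : Submonoid.powers (𝓔.ιO U f)),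
      ∃ (b : 𝓔.D U) (p : Submonoid.powers (𝓔.ιO U f)), (p : 𝓔.D U) * r = b * q := by
    rintro r ⟨_, k, rfl⟩
    obtain ⟨l, b, hb⟩ := 𝓔.exists_ore f k r
    exact ⟨b, ⟨_, l, rfl⟩, hb⟩
  choose num den hnd using h1
  let _ : OreLocalization.OreSet (Submonoid.powers (𝓔.ιO U f)) :=
    { ore_right_cancel := by
        rintro r₁ r₂ ⟨_, k, rfl⟩ h
        obtain ⟨N, hN⟩ := 𝓔.exists_mem_fil (r₁ - r₂)
        have := 𝓔.ad_left_right f k N hN (by rw [sub_mul, sub_eq_zero]; exact h)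
        rw [mul_sub, sub_eq_zero] at this
        exact ⟨⟨_, _, rfl⟩, this⟩
      oreNum := num
      oreDenom := den
      ore_eq := hnd }
  obtain ⟨ν, hν⟩ := 𝓔.exists_lift_resD f (OreLocalization.numeratorRingHom
    (S := Submonoid.powers (𝓔.ιO U f))) (OreLocalization.numerator_isUnit
      (⟨_, 1, pow_one _⟩ : Submonoid.powers (𝓔.ιO U f)))
  have h0 := hν a
  rw [ha, map_zero] at h0
  have h1 : (0 : OreLocalization (Submonoid.powers (𝓔.ιO U f)) (𝓔.D U)) = OreLocalization.oreDiv a 1 := h0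
  rw [← OreLocalization.zero_oreDiv (1 : Submonoid.powers (𝓔.ιO U f)),
    OreLocalization.oreDiv_eq_iff] at h1
  obtain ⟨⟨_, k, rfl⟩, v, hu, hv⟩ := h1
  refine ⟨k, ?_⟩
  simpa [Submonoid.smul_def] using hu

end FirstOrder

section Localization

variable {A A' N N' M M' : Type} [CommRing A] [CommRing A'] [AddCommGroup N]
    [AddCommGroup N'] [AddCommGroup M] [AddCommGroup M'] [Module A N] [Module A M] [Module A' N']
    [Module A' M']

lemma IsLoc.isLocalizedModule {ρ : A →+* A'} {f : A} (hρ : IsUnit (ρ f)) {φ : N →+ N'}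
    (h : IsLoc ρ f φ) [Module A N'] (hN' : ∀ (a : A) (n : N'), a • n = ρ a • n) (φl : N →ₗ[A] N')
    (hφl : ∀ n, φl n = φ n) : IsLocalizedModule (Submonoid.powers f) φl where
  map_units := by
    rintro ⟨_, k, rfl⟩
    rw [Module.End.isUnit_iff]
    have hu := hρ.pow k
    refine ⟨fun a b hab => ?_, fun b => ?_⟩
    · change f ^ k • a = f ^ k • b at hab
      rw [hN', hN', map_pow, hu.smul_left_cancel] at hab
      exact hab
    · obtain ⟨v, hv⟩ := hu.exists_right_inv
      refine ⟨v • b, ?_⟩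
      change f ^ k • v • b = b
      rw [hN', smul_smul, map_pow, hv, one_smul]
  surj := fun y => by
    obtain ⟨k, x, hx⟩ := h.surj y
    refine ⟨⟨x, ⟨_, k, rfl⟩⟩, ?_⟩
    change f ^ k • y = φl x
    rw [hN', map_pow, hx, hφl]
  exists_of_eq {x y} hxy := by
    rw [hφl, hφl, ← sub_eq_zero, ← map_sub] at hxy
    obtain ⟨k, hk⟩ := h.inj _ hxy
    rw [smul_sub, sub_eq_zero] at hk
    exact ⟨⟨_, k, rfl⟩, hk⟩

lemma isLoc_tensorMap {ρ : A →+* A'} {f : A} {φ : N →+ N'} {ψ : M →+ M'}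
    (hρ : letI := ρ.toAlgebra; IsLocalization.Away f A')
    (hφ : ∀ a n, φ (a • n) = ρ a • φ n) (hψ : ∀ a m, ψ (a • m) = ρ a • ψ m)
    (hN : IsLoc ρ f φ) (hM : IsLoc ρ f ψ) : IsLoc ρ f (tensorMap ρ φ ψ hφ hψ) := by
  let _ := ρ.toAlgebra
  have hu : IsUnit (ρ f) := IsLocalization.Away.algebraMap_isUnit (S := A') f
  let _ : Module A N' := Module.compHom N' ρ
  let _ : Module A M' := Module.compHom M' ρ
  have hN' : ∀ (a : A) (n : N'), a • n = ρ a • n := fun _ _ => rfl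
  have hM' : ∀ (a : A) (n : M'), a • n = ρ a • n := fun _ _ => rfl
  have : IsScalarTower A A' N' := ⟨fun a b c => by rw [Algebra.smul_def, mul_smul]; rfl⟩
  have : IsScalarTower A A' M' := ⟨fun a b c => by rw [Algebra.smul_def, mul_smul]; rfl⟩
  let φl : N →ₗ[A] N' := { φ with map_smul' := hφ }
  let ψl : M →ₗ[A] M' := { ψ with map_smul' := hψ }
  have := hN.isLocalizedModule hu hN' φl (fun _ => rfl)
  have := hM.isLocalizedModule hu hM' ψl (fun _ => rfl)
  have : IsLocalization (Submonoid.powers f) A' := hρ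
  let e := IsLocalization.moduleTensorEquiv (Submonoid.powers f) A' N' M'
  have he : ∀ x, e (tensorMap ρ φ ψ hφ hψ x) = TensorProduct.map φl ψl x := by
    intro x
    induction x with
    | zero => simp
    | add x y hx hy => rw [map_add, map_add, map_add, hx, hy]
    | tmul n m => rfl
  refine ⟨fun y => ?_, fun x hx => ?_⟩
  · induction y with
    | zero => exact ⟨0, 0, by simp⟩
    | tmul n m =>
      obtain ⟨k, a, ha⟩ := hN.surj n
      obtain ⟨l, b, hb⟩ := hM.surj m
      refine ⟨k + l, a ⊗ₜ b, ?_⟩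
      rw [tensorMap_tmul, ← ha, ← hb, smul_tmul_smul, ← pow_add]
    | add y y' hy hy' =>
      obtain ⟨k, a, ha⟩ := hy
      obtain ⟨l, b, hb⟩ := hy'
      refine ⟨k + l, f ^ l • a + f ^ k • b, ?_⟩
      have hs : ∀ (c : A) (x : N ⊗[A] M), tensorMap ρ φ ψ hφ hψ (c • x) =
          ρ c • tensorMap ρ φ ψ hφ hψ x := by
        intro c x
        induction x with
        | zero => simp
        | add x y hx hy => rw [smul_add, map_add, map_add, smul_add, hx, hy]
        | tmul n m => rw [smul_tmul', tensorMap_tmul, hφ, ← smul_tmul', tensorMap_tmul]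
      rw [map_add, hs, hs, ← ha, ← hb, map_pow, map_pow, smul_smul, smul_smul, smul_add, pow_add,
        mul_comm (ρ f ^ l)]
  · have h1 : TensorProduct.map φl ψl x = TensorProduct.map φl ψl 0 := by
      rw [← he, hx, map_zero, map_zero]
    obtain ⟨⟨_, k, rfl⟩, hk⟩ := IsLocalizedModule.exists_of_eq (S := Submonoid.powers f) h1
    exact ⟨k, hk.trans (smul_zero _)⟩

/-- An operator which differs from the multiplication by `f` by a locally nilpotent one. -/
def NilDiff (f : A) (l : Module.End A N) : Prop :=
  ∀ n : N, ∃ k : ℕ, ((l - algebraMap A (Module.End A N) f) ^ k) n = 0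

lemma pow_eq_zero_of_le {l : Module.End A N} {k m : ℕ} (h : k ≤ m) {n : N} (hn : (l ^ k) n = 0) :
    (l ^ m) n = 0 := by
  rw [← Nat.sub_add_cancel h, pow_add, Module.End.mul_apply, hn, map_zero]

lemma NilDiff.rTensor {f : A} {l : Module.End A N} (h : NilDiff f l) :
    NilDiff f (l.rTensor M) := by
  have e : l.rTensor M - algebraMap A (Module.End A (N ⊗[A] M)) f =
      (l - algebraMap A (Module.End A N) f).rTensor M := by
    rw [LinearMap.rTensor_sub]
    congr 1
  intro x
  rw [e]
  induction x with
  | zero => exact ⟨0, map_zero _⟩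
  | tmul n m =>
    obtain ⟨k, hk⟩ := h n
    exact ⟨k, by rw [LinearMap.rTensor_pow, LinearMap.rTensor_tmul, hk, zero_tmul]⟩
  | add x y hx hy =>
    obtain ⟨k, hk⟩ := hx
    obtain ⟨l, hl⟩ := hy
    refine ⟨max k l, ?_⟩
    rw [map_add, pow_eq_zero_of_le (le_max_left _ _) hk, pow_eq_zero_of_le (le_max_right _ _) hl,
      add_zero]

lemma algebraMap_pow_apply (f : A) (k : ℕ) (n : N) :
    ((algebraMap A (Module.End A N) f) ^ k) n = f ^ k • n := by
  rw [← map_pow, Module.algebraMap_end_apply]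

variable {ρ : A →+* A'} {f : A} {φ : N →+ N'} {l : Module.End A N} {l' : Module.End A' N'}

lemma IsLoc.left_surj (hφ : ∀ a n, φ (a • n) = ρ a • φ n) (h : IsLoc ρ f φ)
    (hl : ∀ n, φ (l n) = l' (φ n)) (h' : NilDiff (ρ f) l') (y : N') :
    ∃ (k : ℕ) (x : N), (l' ^ k) y = φ x := by
  obtain ⟨k, x, hx⟩ := h.surj y
  obtain ⟨m, hm⟩ := h' y
  exact ⟨_, _, swap_surj φ (R := algebraMap A (Module.End A N) f) hl (fun x => hφ f x)
    (Algebra.commutes _ _).symm (N := m) (k := k) (x := x) hm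
    (by rw [algebraMap_pow_apply, hx])⟩

lemma IsLoc.left_inj (h : IsLoc ρ f φ) (h' : NilDiff f l) {x : N} (hx : φ x = 0) :
    ∃ k : ℕ, (l ^ k) x = 0 := by
  obtain ⟨k, hk⟩ := h.inj x hx
  obtain ⟨m, hm⟩ := h' x
  exact ⟨_, swap_inj (R := algebraMap A (Module.End A N) f) (Algebra.commutes _ _).symm
    (N := m) (k := k) hm (by rw [algebraMap_pow_apply, hk])⟩

lemma neg_pow_apply_eq_zero {l : Module.End A N} {k : ℕ} {n : N} (h : (l ^ k) n = 0) :
    ((-l) ^ k) n = 0 := by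
  rw [neg_pow, Module.End.mul_apply, h, map_zero]

lemma isLoc_of_left (hφ : ∀ a n, φ (a • n) = ρ a • φ n)
    (hl : ∀ n, φ (l n) = l' (φ n)) (h : NilDiff f l) (h' : NilDiff (ρ f) l')
    (hs : ∀ y, ∃ (k : ℕ) (x : N), (l' ^ k) y = φ x)
    (hi : ∀ x, φ x = 0 → ∃ k : ℕ, (l ^ k) x = 0) : IsLoc ρ f φ := by
  refine ⟨fun y => ?_, fun x hx => ?_⟩
  · obtain ⟨k, x, hx⟩ := hs y
    obtain ⟨m, hm⟩ := h' y
    have := swap_surj φ (L := algebraMap A (Module.End A N) f)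
      (L' := algebraMap A' (Module.End A' N') (ρ f)) (R := l) (fun x => hφ f x) hl
      (Algebra.commutes _ _) (N := m) (k := k) (x := x)
      (by rw [← neg_sub]; exact neg_pow_apply_eq_zero hm) hx
    exact ⟨_, _, by rw [← algebraMap_pow_apply]; exact this⟩
  · obtain ⟨k, hk⟩ := hi x hx
    obtain ⟨m, hm⟩ := h x
    have := swap_inj (L := algebraMap A (Module.End A N) f) (R := l) (Algebra.commutes _ _)
      (N := m) (k := k) (by rw [← neg_sub]; exact neg_pow_apply_eq_zero hm) hk
    exact ⟨_, by rw [← algebraMap_pow_apply]; exact this⟩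

lemma rTensor_tensorMap {ψ : M →+ M'} (hφ : ∀ a n, φ (a • n) = ρ a • φ n)
    (hψ : ∀ a m, ψ (a • m) = ρ a • ψ m) (hl : ∀ n, φ (l n) = l' (φ n)) (x : N ⊗[A] M) :
    tensorMap ρ φ ψ hφ hψ (l.rTensor M x) = l'.rTensor M' (tensorMap ρ φ ψ hφ hψ x) := by
  induction x with
  | zero => simp
  | add x y hx hy => rw [map_add, map_add, map_add, map_add, hx, hy]
  | tmul n m => rw [LinearMap.rTensor_tmul, tensorMap_tmul, tensorMap_tmul, LinearMap.rTensor_tmul,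
      hl]

lemma tensorMap_smul {ψ : M →+ M'} (hφ : ∀ a n, φ (a • n) = ρ a • φ n)
    (hψ : ∀ a m, ψ (a • m) = ρ a • ψ m) (c : A) (x : N ⊗[A] M) :
    tensorMap ρ φ ψ hφ hψ (c • x) = ρ c • tensorMap ρ φ ψ hφ hψ x := by
  induction x with
  | zero => simp
  | add x y hx hy => rw [smul_add, map_add, map_add, smul_add, hx, hy]
  | tmul n m => rw [smul_tmul', tensorMap_tmul, hφ, ← smul_tmul', tensorMap_tmul]

end Localization

section Bimodules

variable {𝓔 : FirstOrder s}

lemma isLoc_Sct {V : OMod s} (hV : isQCoh V.obj) {U : X.affineOpens} (f : Sec s U) :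
    IsLoc (resO s (bas_le s f)) f (Sct.res V (bas_le s f)) :=
  ⟨(hV.2 U f).1, (hV.2 U f).2⟩

/-- Left multiplication by `f` on `D¹`, which is linear for the right module structure. -/
noncomputable def leftE {U : X.affineOpens} (f : Sec s U) : Module.End (Sec s U) (ER 𝓔 U) where
  toFun z := toER 𝓔 U (f • (toER 𝓔 U).symm z)
  map_add' z w := by simp
  map_smul' g z := by
    obtain ⟨z, rfl⟩ := (toER 𝓔 U).surjective z
    change toER 𝓔 U (f • rmul 𝓔 z g) = toER 𝓔 U (rmul 𝓔 (f • z) g)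
    rw [rmul, rmul, map_smul (𝓔.anchor U), Derivation.smul_apply, smul_eq_mul]
    congr 1
    module

lemma leftE_toER {U : X.affineOpens} (f : Sec s U) (z : 𝓔.E U) :
    leftE f (toER 𝓔 U z) = toER 𝓔 U (f • z) := rfl

lemma leftE_pow {U : X.affineOpens} (f : Sec s U) (k : ℕ) :
    (leftE f : Module.End (Sec s U) (ER 𝓔 U)) ^ k = leftE (f ^ k) := by
  induction k with
  | zero => ext z; simp [leftE]
  | succ k ih =>
    ext z
    obtain ⟨z, rfl⟩ := (toER 𝓔 U).surjective z
    rw [pow_succ', ih, Module.End.mul_apply, leftE_toER, leftE_toER, leftE_toER, smul_smul,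
      pow_succ']

lemma nilDiff_leftE {U : X.affineOpens} (f : Sec s U) :
    NilDiff f (leftE f : Module.End (Sec s U) (ER 𝓔 U)) := by
  have key : ∀ z : 𝓔.E U, ((leftE f : Module.End (Sec s U) (ER 𝓔 U)) -
      algebraMap (Sec s U) _ f) (toER 𝓔 U z) = toER 𝓔 U (- (𝓔.anchor U z f • 𝓔.one U)) := by
    intro z
    rw [LinearMap.sub_apply, leftE_toER, Module.algebraMap_end_apply, smul_toER, rmul, ← map_sub,
      sub_add_cancel_left]
  intro z
  obtain ⟨z, rfl⟩ := (toER 𝓔 U).surjective z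
  refine ⟨2, ?_⟩
  rw [pow_two, Module.End.mul_apply, key, key]
  simp [𝓔.anchor_one]

/-- Restriction, for the right module structure. -/
def resER {U V : X.affineOpens} (h : V ≤ U) : ER 𝓔 U →+ ER 𝓔 V := 𝓔.res h

lemma resER_smul {U V : X.affineOpens} (h : V ≤ U) (f : Sec s U) (z : ER 𝓔 U) :
    resER h (f • z) = resO s h f • resER (𝓔 := 𝓔) h z := by
  obtain ⟨z, rfl⟩ := (toER 𝓔 U).surjective z
  change toER 𝓔 V (𝓔.res h (rmul 𝓔 z f)) = toER 𝓔 V (rmul 𝓔 (𝓔.res h z) (resO s h f))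
  rw [rmul, rmul, map_add, 𝓔.res_smul, 𝓔.res_smul, 𝓔.res_one, 𝓔.anchor_res]

lemma isLoc_resER {U : X.affineOpens} (f : Sec s U) :
    IsLoc (resO s (bas_le s f)) f (resER (𝓔 := 𝓔) (bas_le s f)) := by
  refine isLoc_of_left (l := leftE f) (l' := leftE (resO s (bas_le s f) f))
    (resER_smul _) (fun z => 𝓔.res_smul _ _ _) (nilDiff_leftE f) (nilDiff_leftE _)
    (fun y => ?_) (fun x hx => ?_)
  · obtain ⟨k, x, hx⟩ := 𝓔.loc_surj f y
    exact ⟨k, x, by rw [leftE_pow]; exact hx⟩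
  · obtain ⟨k, hk⟩ := 𝓔.loc_inj f x hx
    exact ⟨k, by rw [leftE_pow]; exact hk⟩

lemma isQCoh_tensorE (V : OMod s) (hV : isQCoh V.obj) : isQCoh ((tensorE 𝓔).obj V).obj := by
  refine ⟨((tensorE 𝓔).obj V).property, fun U f => ?_⟩
  have hloc := isLoc_tensorMap (isLocalization_resO f) (resER_smul (𝓔 := 𝓔) (bas_le s f))
    (Sct.res_smul V (bas_le s f)) (isLoc_resER f) (isLoc_Sct hV f)
  have hres : ∀ x : ER 𝓔 U ⊗[Sec s U] Sct V U,
      ((tensorE 𝓔).obj V).obj.map (OCat.restr (bas_le s f)) x =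
        tensorMap (resO s (bas_le s f)) (resER (bas_le s f)) (Sct.res V (bas_le s f))
          (resER_smul _) (Sct.res_smul V _) x := by
    refine DFunLike.congr_fun (f := (((tensorE 𝓔).obj V).obj.map _).hom)
      (tensor_hom_ext fun z m => ?_)
    change toER 𝓔 _ ((1 : Sec s (bas s f)) • _) ⊗ₜ _ = _
    rw [one_smul]; rfl
  have hmul : ∀ {W : X.affineOpens} (g : Sec s W) (k : ℕ) (x : ER 𝓔 W ⊗[Sec s W] Sct V W),
      ((tensorE 𝓔).obj V).obj.map (OCat.mul W (g ^ k)) x = ((leftE g).rTensor (Sct V W) ^ k) x := by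
    intro W g k x
    rw [LinearMap.rTensor_pow, leftE_pow]
    refine DFunLike.congr_fun (f := (((tensorE 𝓔).obj V).obj.map _).hom)
      (g := ((leftE (g ^ k)).rTensor (Sct V W)).toAddMonoidHom) (tensor_hom_ext fun z m => ?_) x
    change toER 𝓔 W (g ^ k • 𝓔.res le_rfl _) ⊗ₜ Sct.res V _ m = _
    rw [𝓔.res_self, Sct.res_self]; rfl
  refine ⟨fun y => ?_, fun x hx => ?_⟩
  · obtain ⟨k, x, hx⟩ := hloc.left_surj (tensorMap_smul _ _)
      (rTensor_tensorMap (l := leftE f) (l' := leftE (resO s (bas_le s f) f)) _ _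
        (fun z => 𝓔.res_smul _ _ _)) (nilDiff_leftE _).rTensor y
    exact ⟨k, x, (hmul _ k y).trans (hx.trans (hres x).symm)⟩
  · obtain ⟨k, hk⟩ := hloc.left_inj (nilDiff_leftE f).rTensor (x := x) ((hres x).symm.trans hx)
    exact ⟨k, (hmul _ k x).trans hk⟩

lemma resT_smul {U V : X.affineOpens} (h : V ≤ U) (f : Sec s U) (z : TU 𝓔 U) :
    resT 𝓔 h (f • z) = resO s h f • resT 𝓔 h z := by
  obtain ⟨z, rfl⟩ := Submodule.Quotient.mk_surjective _ z
  rw [← Submodule.Quotient.mk_smul, resT_mk, resT_mk, 𝓔.res_smul, Submodule.Quotient.mk_smul]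

lemma isLoc_resT {U : X.affineOpens} (f : Sec s U) :
    IsLoc (resO s (bas_le s f)) f (resT 𝓔 (bas_le s f)) := by
  refine ⟨fun y => ?_, fun x hx => ?_⟩
  · obtain ⟨y, rfl⟩ := Submodule.Quotient.mk_surjective _ y
    obtain ⟨k, x, hx⟩ := 𝓔.loc_surj f y
    exact ⟨k, Submodule.Quotient.mk x, by rw [resT_mk, ← hx, Submodule.Quotient.mk_smul]⟩
  · obtain ⟨x, rfl⟩ := Submodule.Quotient.mk_surjective _ x
    rw [resT_mk, Submodule.Quotient.mk_eq_zero] at hx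
    obtain ⟨a, ha⟩ := Submodule.mem_span_singleton.1 hx
    obtain ⟨k, b, hb⟩ := (isLoc_resO f).surj a
    have hb : resO s (bas_le s f) f ^ k * a = resO s (bas_le s f) b := hb
    have h0 : 𝓔.res (bas_le s f) (f ^ k • x - b • 𝓔.one U) = 0 := by
      rw [map_sub, 𝓔.res_smul, 𝓔.res_smul, 𝓔.res_one, ← hb, ← ha, map_pow, smul_smul, sub_self]
    obtain ⟨l, hl⟩ := 𝓔.loc_inj f _ h0
    refine ⟨l + k, ?_⟩
    rw [← Submodule.Quotient.mk_smul, Submodule.Quotient.mk_eq_zero]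
    rw [smul_sub, smul_smul, smul_smul, ← pow_add, sub_eq_zero] at hl
    rw [hl]
    exact Submodule.mem_span_singleton.2 ⟨_, rfl⟩

lemma isQCoh_tensorT (V : OMod s) (hV : isQCoh V.obj) : isQCoh ((tensorT 𝓔).obj V).obj := by
  refine ⟨((tensorT 𝓔).obj V).property, fun U f => ?_⟩
  have hloc := isLoc_tensorMap (isLocalization_resO f) (resT_smul (𝓔 := 𝓔) (bas_le s f))
    (Sct.res_smul V (bas_le s f)) (isLoc_resT f) (isLoc_Sct hV f)
  have hres : ∀ x : TU 𝓔 U ⊗[Sec s U] Sct V U,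
      ((tensorT 𝓔).obj V).obj.map (OCat.restr (bas_le s f)) x =
        tensorMap (resO s (bas_le s f)) (resT 𝓔 (bas_le s f)) (Sct.res V (bas_le s f))
          (resT_smul _) (Sct.res_smul V _) x := by
    refine DFunLike.congr_fun (f := (((tensorT 𝓔).obj V).obj.map _).hom)
      (tensor_hom_ext fun z m => ?_)
    change ((1 : Sec s (bas s f)) • resT 𝓔 _ z) ⊗ₜ _ = _
    rw [one_smul]; rfl
  have hmul : ∀ {W : X.affineOpens} (g : Sec s W) (x : TU 𝓔 W ⊗[Sec s W] Sct V W),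
      ((tensorT 𝓔).obj V).obj.map (OCat.mul W g) x = g • x := by
    intro W g x
    refine DFunLike.congr_fun (f := (((tensorT 𝓔).obj V).obj.map _).hom)
      (g := DistribSMul.toAddMonoidHom (TU 𝓔 W ⊗[Sec s W] Sct V W) g)
      (tensor_hom_ext fun z m => ?_) x
    obtain ⟨z, rfl⟩ := Submodule.Quotient.mk_surjective _ z
    change (g • resT 𝓔 (le_refl W) (Submodule.Quotient.mk z)) ⊗ₜ[Sec s W] Sct.res V (le_refl W) m =
      g • ((Submodule.Quotient.mk z : TU 𝓔 W) ⊗ₜ[Sec s W] m)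
    rw [resT_mk, 𝓔.res_self, Sct.res_self, smul_tmul']
  refine ⟨fun y => ?_, fun x hx => ?_⟩
  · obtain ⟨k, x, hx⟩ := hloc.surj y
    exact ⟨k, x, (hmul _ y).trans (hx.trans (hres x).symm)⟩
  · obtain ⟨k, hk⟩ := hloc.inj x ((hres x).symm.trans hx)
    exact ⟨k, (hmul _ x).trans hk⟩

/-- Left multiplication by `f` on `Dⁿ`, which is linear for the right module structure. -/
noncomputable def leftR {U : X.affineOpens} (n : ℤ) (f : Sec s U) :
    Module.End (Sec s U) (FR 𝓔 U n) where
  toFun a := FR.mk 𝓔 (𝓔.ιO U f * a.val) (𝓔.mul_mem_fil (zero_add n) (𝓔.ιO_mem_fil f) a.mem)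
  map_add' _ _ := FR.ext (mul_add _ _ _)
  map_smul' _ _ := FR.ext (mul_assoc _ _ _).symm

lemma val_leftR {U : X.affineOpens} {n : ℤ} (f : Sec s U) (a : FR 𝓔 U n) :
    (leftR n f a).val = 𝓔.ιO U f * a.val := rfl

lemma leftR_pow {U : X.affineOpens} (n : ℤ) (f : Sec s U) (k : ℕ) :
    (leftR n f : Module.End (Sec s U) (FR 𝓔 U n)) ^ k = leftR n (f ^ k) := by
  induction k with
  | zero => ext a; exact FR.ext (by rw [val_leftR]; simp)
  | succ k ih =>
    ext z
    refine FR.ext ?_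
    rw [pow_succ', ih, Module.End.mul_apply, val_leftR, val_leftR, val_leftR, ← mul_assoc,
      ← map_mul, pow_succ']

lemma nilDiff_leftR {U : X.affineOpens} (n : ℤ) (f : Sec s U) :
    NilDiff f (leftR n f : Module.End (Sec s U) (FR 𝓔 U n)) := by
  have key : ∀ (k : ℕ) (a : FR 𝓔 U n), (((leftR n f : Module.End (Sec s U) (FR 𝓔 U n)) -
      algebraMap (Sec s U) _ f) ^ k) a = FR.mk 𝓔 (((LinearMap.mulLeft ℤ (𝓔.ιO U f) -
        LinearMap.mulRight ℤ (𝓔.ιO U f)) ^ k) a.val)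
        (𝓔.fil_mono U (by omega) (𝓔.ad_pow_mem f a.mem k)) := by
    intro k
    induction k with
    | zero => intro a; rfl
    | succ k ih =>
      intro a
      rw [pow_succ', Module.End.mul_apply, ih]
      refine FR.ext ?_
      rw [FR.val_mk, pow_succ', Module.End.mul_apply]
      rfl
  intro a
  refine ⟨(n + 1).toNat, ?_⟩
  rw [key]
  exact FR.ext (𝓔.ad_pow_eq_zero f a.mem _ (by omega))

/-- Restriction of sections of `Dⁿ`. -/
noncomputable def resR {U V : X.affineOpens} (n : ℤ) (h : V ≤ U) : FR 𝓔 U n →+ FR 𝓔 V n :=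
  AddMonoidHom.mk' (fun a => FR.mk 𝓔 (𝓔.resD h a.val) (𝓔.resD_mem_fil h a.mem))
    (fun _ _ => FR.ext (map_add _ _ _))

lemma val_resR {U V : X.affineOpens} {n : ℤ} (h : V ≤ U) (a : FR 𝓔 U n) :
    (resR n h a).val = 𝓔.resD h a.val := rfl

lemma resR_smul {U V : X.affineOpens} {n : ℤ} (h : V ≤ U) (f : Sec s U) (a : FR 𝓔 U n) :
    resR n h (f • a) = resO s h f • resR n h a := FR.ext (by
  rw [val_resR, FR.val_smul, FR.val_smul, map_mul, 𝓔.resD_ιO, val_resR])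

lemma resR_leftR {U V : X.affineOpens} {n : ℤ} (h : V ≤ U) (f : Sec s U) (a : FR 𝓔 U n) :
    resR n h (leftR n f a) = leftR n (resO s h f) (resR n h a) := FR.ext (by
  rw [val_resR, val_leftR, val_leftR, map_mul, 𝓔.resD_ιO, val_resR])

lemma isLoc_resR {U : X.affineOpens} (n : ℤ) (f : Sec s U) :
    IsLoc (resO s (bas_le s f)) f (resR (𝓔 := 𝓔) n (bas_le s f)) := by
  refine isLoc_of_left (l := leftR n f) (l' := leftR n (resO s (bas_le s f) f))
    (resR_smul _) (resR_leftR _ f) (nilDiff_leftR n f) (nilDiff_leftR n _)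
    (fun y => ?_) (fun x hx => ?_)
  · rcases lt_or_ge n 0 with hn | hn
    · refine ⟨0, 0, FR.ext ?_⟩
      have := y.mem
      rw [𝓔.fil_neg _ hn, Submodule.mem_bot] at this
      rw [pow_zero, Module.End.one_apply, this, map_zero, FR.val_zero]
    · obtain ⟨n, rfl⟩ := Int.eq_ofNat_of_zero_le hn
      obtain ⟨k, x, hx, hk⟩ := 𝓔.fil_loc_surj f n y.mem
      refine ⟨k, FR.mk 𝓔 x hx, FR.ext ?_⟩
      rw [leftR_pow, val_leftR, map_pow, hk, val_resR, FR.val_mk]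
  · obtain ⟨k, hk⟩ := 𝓔.resD_eq_zero f (a := x.val) (by rw [← val_resR, hx, FR.val_zero])
    exact ⟨k, FR.ext (by rw [leftR_pow, val_leftR, map_pow, hk, FR.val_zero])⟩

lemma isGr_ind (k : ℤ) (V : OMod s) (hV : isQCoh V.obj) : isGr ((ind 𝓔 k).obj V).obj := by
  refine ⟨((ind 𝓔 k).obj V).property, fun j =>
    ⟨((degF 𝓔 j).obj ((ind 𝓔 k).obj V)).property, fun U f => ?_⟩⟩
  have hloc := isLoc_tensorMap (isLocalization_resO f) (resR_smul (𝓔 := 𝓔) (n := j + k) (bas_le s f))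
    (Sct.res_smul V (bas_le s f)) (isLoc_resR (j + k) f) (isLoc_Sct hV f)
  have hres : ∀ x : FR 𝓔 U (j + k) ⊗[Sec s U] Sct V U,
      (degFun 𝓔 j ⋙ ((ind 𝓔 k).obj V).obj).map (OCat.restr (bas_le s f)) x =
        tensorMap (resO s (bas_le s f)) (resR (j + k) (bas_le s f)) (Sct.res V (bas_le s f))
          (resR_smul _) (Sct.res_smul V _) x := by
    refine DFunLike.congr_fun (f := ((degFun 𝓔 j ⋙ ((ind 𝓔 k).obj V).obj).map _).hom)
      (tensor_hom_ext fun (a : FR 𝓔 U (j + k)) (m : Sct V U) => ?_)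
    have e : FR.map 𝓔 k ((degFun 𝓔 j).map (OCat.restr (bas_le s f))) a =
        resR (j + k) (bas_le s f) a := FR.ext (by
      change 𝓔.ιO (bas s f) 1 * 𝓔.resD (bas_le s f) a.val = _
      rw [map_one, one_mul]
      rfl)
    exact congrArg (fun b : FR 𝓔 (bas s f) (j + k) =>
      b ⊗ₜ[Sec s (bas s f)] Sct.res V (bas_le s f) m) e
  have hmul : ∀ {W : X.affineOpens} (g : Sec s W) (l : ℕ) (x : FR 𝓔 W (j + k) ⊗[Sec s W] Sct V W),
      (degFun 𝓔 j ⋙ ((ind 𝓔 k).obj V).obj).map (OCat.mul W (g ^ l)) x =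
        ((leftR (j + k) g).rTensor (Sct V W) ^ l) x := by
    intro W g l x
    rw [LinearMap.rTensor_pow, leftR_pow]
    refine DFunLike.congr_fun (f := ((degFun 𝓔 j ⋙ ((ind 𝓔 k).obj V).obj).map _).hom)
      (g := ((leftR (j + k) (g ^ l)).rTensor (Sct V W)).toAddMonoidHom)
      (tensor_hom_ext fun (a : FR 𝓔 W (j + k)) (m : Sct V W) => ?_) x
    have e : FR.map 𝓔 k ((degFun 𝓔 j).map (OCat.mul W (g ^ l))) a = leftR (j + k) (g ^ l) a :=
      FR.ext (congrArg (𝓔.ιO W (g ^ l) * ·) (𝓔.resD_self _ _))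
    exact congrArg₂ (fun (b : FR 𝓔 W (j + k)) (m : Sct V W) => b ⊗ₜ[Sec s W] m) e
      (Sct.res_self V _ m)
  refine ⟨fun y => ?_, fun x hx => ?_⟩
  · obtain ⟨k, x, hx⟩ := hloc.left_surj (tensorMap_smul _ _)
      (rTensor_tensorMap (l := leftR _ f) (l' := leftR _ (resO s (bas_le s f) f)) _ _
        (resR_leftR _ f)) (nilDiff_leftR _ _).rTensor y
    exact ⟨k, x, (hmul _ k y).trans (hx.trans (hres x).symm)⟩
  · obtain ⟨k, hk⟩ := hloc.left_inj (nilDiff_leftR _ f).rTensor (x := x) ((hres x).symm.trans hx)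
    exact ⟨k, (hmul _ k x).trans hk⟩

variable (𝓔) in
lemma tensorQC : TensorQC 𝓔 := ⟨isQCoh_tensorE, isQCoh_tensorT, isGr_ind⟩

end Bimodules

section Small

lemma algebraMap_eq_resO {U V : X.affineOpens} (h : V ≤ U) :
    algebraMap ℂ (Sec s V) = (resO s h).comp (algebraMap ℂ (Sec s U)) := by
  change (((Scheme.ΓSpecIso (CommRingCat.of ℂ)).inv ≫ s.appLE ⊤ V.1 le_top).hom : ℂ →+* _) =
    (((Scheme.ΓSpecIso (CommRingCat.of ℂ)).inv ≫ s.appLE ⊤ U.1 le_top) ≫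
      X.presheaf.map (homOfLE (show V.1 ≤ U.1 from h)).op).hom
  have := Scheme.Hom.appLE_map s (U := ⊤) (V := U.1) le_top
    (homOfLE (show V.1 ≤ U.1 from h)).op
  rw [Category.assoc]
  exact congrArg (fun q => ((Scheme.ΓSpecIso (CommRingCat.of ℂ)).inv ≫ q).hom) this.symm

lemma exists_standardSmooth [hs : IsSmoothCurve s] (U : X.affineOpens) : ∃ S : Set (Sec s U),
    Ideal.span S = ⊤ ∧ ∀ f ∈ S,
      Algebra.IsStandardSmoothOfRelativeDimension 1 ℂ (Sec s (bas s f)) := by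
  have h1 := HasRingHomProperty.appLE (@SmoothOfRelativeDimension 1) s hs.smooth
    ⟨⊤, isAffineOpen_top _⟩ U le_top
  obtain ⟨S, hS, h2⟩ := h1
  refine ⟨S, hS, fun f hf => ?_⟩
  have h3 := h2 f hf
  let _ : Algebra Γ(X, U.1) (Sec s (bas s f)) := (resO s (bas_le s f)).toAlgebra
  let f' : Γ(X, U.1) := f
  have hl : IsLocalization.Away f' (Sec s (bas s f)) := isLocalization_resO f
  let e : Localization.Away f' ≃ₐ[Γ(X, U.1)] Sec s (bas s f) :=
    IsLocalization.algEquiv (Submonoid.powers f') _ _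
  have h4 : RingHom.IsStandardSmoothOfRelativeDimension 1
      ((e.toRingEquiv : _ →+* Sec s (bas s f)).comp
        (((algebraMap Γ(X, U.1) (Localization.Away f')).comp (s.appLE ⊤ U.1 le_top).hom).comp
        ((Scheme.ΓSpecIso (CommRingCat.of ℂ)).symm.commRingCatIsoToRingEquiv : ℂ →+* _))) := by
    have := (RingHom.IsStandardSmoothOfRelativeDimension.equiv e.toRingEquiv).comp
      (RingHom.IsStandardSmoothOfRelativeDimension.comp h3
        (RingHom.IsStandardSmoothOfRelativeDimension.equiv
          (Scheme.ΓSpecIso (CommRingCat.of ℂ)).symm.commRingCatIsoToRingEquiv))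
    exact this
  rw [← RingHom.isStandardSmoothOfRelativeDimension_algebraMap]
  convert h4
  rw [algebraMap_eq_resO (bas_le s f)]
  ext c
  exact (e.commutes (algebraMap ℂ (Sec s U) c)).symm

variable (𝓔 : FirstOrder s)

/-- A coordinate on an affine open `U`: a section `z` of `D¹` such that `D¹` is free on `1` and
`z`, and a differential form `ω` with `⟨z, ω⟩ = 1`. -/
structure Small (U : X.affineOpens) where
  z : 𝓔.E U
  ω : Ω[Sec s U⁄ℂ]
  span : ∀ e : 𝓔.E U, ∃ a b : Sec s U, e = a • 𝓔.one U + b • z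
  pair : (𝓔.symbol U z).liftKaehlerDifferential ω = 1

lemma small_of_standardSmooth (U : X.affineOpens)
    [Algebra.IsStandardSmoothOfRelativeDimension 1 ℂ (Sec s U)] : Nonempty (Small 𝓔 U) := by
  rcases subsingleton_or_nontrivial (Sec s U) with hA | hA
  · refine ⟨⟨0, 0, fun e => ⟨0, 0, ?_⟩, Subsingleton.elim _ _⟩⟩
    rw [← one_smul (Sec s U) e, Subsingleton.elim (1 : Sec s U) 0]
    simp
  · have : Algebra.IsStandardSmooth ℂ (Sec s U) :=
      Algebra.IsStandardSmoothOfRelativeDimension.isStandardSmooth 1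
    have hr := Algebra.IsStandardSmoothOfRelativeDimension.rank_kaehlerDifferential
      (R := ℂ) (S := Sec s U) 1
    have hr' : Module.finrank (Sec s U) Ω[Sec s U⁄ℂ] = 1 := by
      rw [Module.finrank, hr]; simp
    let b : Module.Basis Unit (Sec s U) Ω[Sec s U⁄ℂ] := Module.basisUnique Unit hr'
    obtain ⟨z, hz⟩ := 𝓔.symbol_surjective U
      (KaehlerDifferential.linearMapEquivDerivation ℂ (Sec s U) (b.coord ()))
    have hz' : (𝓔.symbol U z).liftKaehlerDifferential = b.coord () := by
      rw [hz]
      exact (KaehlerDifferential.linearMapEquivDerivation ℂ (Sec s U)).symm_apply_apply _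
    refine ⟨⟨z, b (), fun e => ?_, by rw [hz']; simp⟩⟩
    set c := (𝓔.symbol U e).liftKaehlerDifferential (b ())
    have : 𝓔.symbol U (e - c • z) = 0 := by
      apply (KaehlerDifferential.linearMapEquivDerivation ℂ (Sec s U)).symm.injective
      rw [map_zero, map_sub, map_sub, map_smul, map_smul]
      change (𝓔.symbol U e).liftKaehlerDifferential - c • (𝓔.symbol U z).liftKaehlerDifferential = 0
      apply b.ext
      intro i
      rw [hz']
      simp [c]
    obtain ⟨a, ha⟩ := (𝓔.symbol_eq_zero_iff U _).1 this
    exact ⟨a, c, by rw [← ha, sub_add_cancel]⟩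

lemma exists_small [IsSmoothCurve s] (U : X.affineOpens) : ∃ S : Set (Sec s U),
    Ideal.span S = ⊤ ∧ ∀ f ∈ S, Nonempty (Small 𝓔 (bas s f)) := by
  obtain ⟨S, hS, h⟩ := exists_standardSmooth (s := s) U
  exact ⟨S, hS, fun f hf => have := h f hf; small_of_standardSmooth 𝓔 _⟩

end Small

section Generation

/-- Sections over affine opens `W ≤ U` are generated by those over `U`. -/
lemma span_res_eq_top (N : X.affineOpens → Type) [∀ U, AddCommGroup (N U)]
    [∀ U, Module (Sec s U) (N U)] (res : ∀ {U V : X.affineOpens}, V ≤ U → (N U →+ N V))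
    (res_res : ∀ {U V W : X.affineOpens} (h : V ≤ U) (h' : W ≤ V) (z : N U),
      res h' (res h z) = res (h'.trans h) z)
    (res_smul : ∀ {U V : X.affineOpens} (h : V ≤ U) (f : Sec s U) (z : N U),
      res h (f • z) = resO s h f • res h z)
    (loc : ∀ {U : X.affineOpens} (f : Sec s U),
      IsLoc (resO s (bas_le s f)) f (res (bas_le s f)))
    {U W : X.affineOpens} (h : W ≤ U) :
    Submodule.span (Sec s W) (Set.range (res h)) = ⊤ := by
  rw [eq_top_iff]
  intro e _
  let S : Set (Sec s W) := {g | ∃ f : Sec s U, bas s g = bas s f}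
  have hS : Ideal.span S = ⊤ := by
    have := (IsAffineOpen.iSup_basicOpen_eq_self_iff W.2 (s := S)).1 ?_
    · exact this
    · apply le_antisymm
      · exact iSup_le fun g => X.basicOpen_le _
      · intro x hx
        obtain ⟨f, g, hfg, hxf⟩ := exists_basicOpen_le_affine_inter U.2 W.2 x ⟨h hx, hx⟩
        rw [TopologicalSpace.Opens.mem_iSup]
        refine ⟨⟨g, f, Subtype.ext hfg.symm⟩, ?_⟩
        change x ∈ X.basicOpen g
        rw [← hfg]; exact hxf
  refine span_pow_mem _ hS e ?_
  rintro g ⟨f, hfg⟩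
  have hle : bas s g ≤ U := (bas_le s g).trans h
  have key : ∀ (V : X.affineOpens) (hV : V = bas s f) (hV' : V ≤ U) (y : N V),
      ∃ (k : ℕ) (x : N U), resO s hV' f ^ k • y = res hV' x ∧ IsUnit (resO s hV' f) := by
    rintro _ rfl _ y
    obtain ⟨k, x, hx⟩ := (loc f).surj y
    exact ⟨k, x, hx, isUnit_resO f⟩
  obtain ⟨k, x, hx, hu⟩ := key _ hfg hle (res (bas_le s g) e)
  obtain ⟨v, hv⟩ := (hu.pow k).exists_left_inv
  obtain ⟨l, a, ha⟩ := (isLoc_resO g).surj v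
  have ha : resO s (bas_le s g) g ^ l * v = resO s (bas_le s g) a := ha
  have h0 : res (bas_le s g) (g ^ l • e - a • res h x) = 0 := by
    rw [map_sub, res_smul, res_smul, ← ha, res_res, ← hx, map_pow, smul_smul, mul_assoc, hv, mul_one,
      sub_self]
  obtain ⟨m, hm⟩ := (loc g).inj _ h0
  refine ⟨m + l, ?_⟩
  rw [smul_sub, smul_smul, ← pow_add, sub_eq_zero] at hm
  rw [hm]
  exact Submodule.smul_mem _ _ (Submodule.smul_mem _ _ (Submodule.subset_span ⟨x, rfl⟩))

lemma span_resE (𝓔 : FirstOrder s) {U W : X.affineOpens} (h : W ≤ U) :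
    Submodule.span (Sec s W) (Set.range (𝓔.res h)) = ⊤ :=
  span_res_eq_top 𝓔.E 𝓔.res 𝓔.res_res 𝓔.res_smul 𝓔.isLoc_res h

lemma span_resSct {V : OMod s} (hV : isQCoh V.obj) {U W : X.affineOpens} (h : W ≤ U) :
    Submodule.span (Sec s W) (Set.range (Sct.res V h)) = ⊤ :=
  span_res_eq_top (Sct V) (Sct.res V) (Sct.res_res V) (Sct.res_smul V) (isLoc_Sct hV) h

end Generation

namespace Small

variable {𝓔 : FirstOrder s} {U : X.affineOpens} (c : Small 𝓔 U)

/-- The coefficient of `z`. -/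
noncomputable def β : 𝓔.E U →ₗ[Sec s U] Sec s U :=
  ((LinearMap.applyₗ c.ω).comp
    (KaehlerDifferential.linearMapEquivDerivation ℂ (Sec s U)).symm.toLinearMap).comp (𝓔.symbol U)

lemma β_z : c.β c.z = 1 := c.pair

lemma β_one : c.β (𝓔.one U) = 0 := by
  have : 𝓔.symbol U (𝓔.one U) = 0 := (𝓔.symbol_eq_zero_iff U _).2 ⟨1, (one_smul _ _).symm⟩
  rw [β, LinearMap.comp_apply, this, map_zero]

lemma exists_α (e : 𝓔.E U) : ∃ a : Sec s U, e = a • 𝓔.one U + c.β e • c.z := by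
  obtain ⟨a, b, h⟩ := c.span e
  refine ⟨a, ?_⟩
  have := congrArg c.β h
  simp only [map_add, map_smul, β_z, β_one, smul_eq_mul, mul_zero, zero_add, mul_one] at this
  rw [this]; exact h

/-- The coefficient of `1`. -/
noncomputable def α' (e : 𝓔.E U) : Sec s U := (c.exists_α e).choose

lemma eq_α' (e : 𝓔.E U) : e = c.α' e • 𝓔.one U + c.β e • c.z := (c.exists_α e).choose_spec

lemma one_cancel {a b : Sec s U} (h : a • 𝓔.one U = b • 𝓔.one U) : a = b := by
  rw [← sub_eq_zero]
  exact 𝓔.smul_one_injective U _ (by rw [sub_smul, h, sub_self])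

lemma α'_unique {e : 𝓔.E U} {a b : Sec s U} (h : e = a • 𝓔.one U + b • c.z) : c.α' e = a := by
  have := congrArg c.β h
  simp only [map_add, map_smul, β_z, β_one, smul_eq_mul, mul_zero, zero_add, mul_one] at this
  have h2 := (c.eq_α' e).symm.trans h
  rw [this] at h2
  exact one_cancel (add_right_cancel h2)

/-- The coefficient of `1`, as a linear map. -/
noncomputable def α : 𝓔.E U →ₗ[Sec s U] Sec s U where
  toFun := c.α'
  map_add' e e' := c.α'_unique (b := c.β e + c.β e') (by
    conv_lhs => rw [c.eq_α' e, c.eq_α' e']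
    module)
  map_smul' f e := c.α'_unique (b := f * c.β e) (by
    conv_lhs => rw [c.eq_α' e]
    simp only [RingHom.id_apply, smul_eq_mul]
    module)

lemma eq_α (e : 𝓔.E U) : e = c.α e • 𝓔.one U + c.β e • c.z := c.eq_α' e

lemma α_one : c.α (𝓔.one U) = 1 := c.α'_unique (b := 0) (by simp)

/-- The derivation by which `z` acts on functions. -/
noncomputable def δ : Derivation ℂ (Sec s U) (Sec s U) := 𝓔.anchor U c.z

lemma bracket_eq (e e' : 𝓔.E U) : 𝓔.bracket U e e' =
    (c.β e * c.δ (c.α e') - c.β e' * c.δ (c.α e)) • 𝓔.one U +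
      (c.β e * c.δ (c.β e') - c.β e' * c.δ (c.β e)) • c.z := by
  have h1 : ∀ a b : Sec s U, 𝓔.bracket U c.z (a • 𝓔.one U + b • c.z) =
      c.δ a • 𝓔.one U + c.δ b • c.z := by
    intro a b
    rw [map_add, 𝓔.bracket_smul, 𝓔.bracket_smul, 𝓔.bracket_one, 𝓔.bracket_self, smul_zero, smul_zero,
      zero_add, zero_add]
    rfl
  have h2 : ∀ a : Sec s U, 𝓔.anchor U (𝓔.one U) a = 0 := fun a => by rw [𝓔.anchor_one]; rfl
  have h3 : ∀ e : 𝓔.E U, 𝓔.bracket U (𝓔.one U) e = 0 := fun e => by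
    rw [𝓔.bracket_skew, 𝓔.bracket_one, neg_zero]
  have h4 : 𝓔.bracket U e c.z = -(c.δ (c.α e) • 𝓔.one U + c.δ (c.β e) • c.z) := by
    rw [𝓔.bracket_skew]
    conv_lhs => rw [c.eq_α e, h1]
  have h5 : ∀ f, 𝓔.anchor U e f = c.β e * c.δ f := by
    intro f
    conv_lhs => rw [c.eq_α e]
    rw [map_add, map_smul, map_smul, 𝓔.anchor_one, smul_zero, zero_add]
    rfl
  conv_lhs => rw [c.eq_α e']
  rw [map_add, 𝓔.bracket_smul, 𝓔.bracket_smul, 𝓔.bracket_one, h4, h5, h5]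
  module

open Polynomial in
/-- The coefficientwise action of `z` on polynomials. -/
noncomputable def polδ : (Sec s U)[X] →+ (Sec s U)[X] where
  toFun p := p.sum fun i a => monomial i (c.δ a)
  map_zero' := by simp
  map_add' p q := by
    rw [sum_add_index] <;> simp

open Polynomial in
lemma coeff_polδ (p : (Sec s U)[X]) (n : ℕ) : (c.polδ p).coeff n = c.δ (p.coeff n) := by
  induction p using Polynomial.induction_on' with
  | add p q hp hq => rw [map_add, coeff_add, coeff_add, hp, hq, map_add]
  | monomial i a =>
    change Polynomial.coeff ((monomial i a).sum fun i a => monomial i (c.δ a)) n = _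
    rw [sum_monomial_index _ _ (by simp), coeff_monomial, coeff_monomial]
    split_ifs <;> simp

open Polynomial in
lemma polδ_C_mul (a : Sec s U) (p : (Sec s U)[X]) :
    c.polδ (C a * p) = C a * c.polδ p + C (c.δ a) * p := by
  ext n
  simp only [coeff_polδ, coeff_C_mul, coeff_add, Derivation.leibniz, smul_eq_mul]
  ring

open Polynomial in
lemma polδ_X_mul (p : (Sec s U)[X]) : c.polδ (Polynomial.X * p) = Polynomial.X * c.polδ p := by
  ext n
  cases n with
  | zero => simp [coeff_polδ]
  | succ n => simp [coeff_polδ, coeff_X_mul]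

open Polynomial in
/-- The right action of `D¹` on polynomials, written as a left action of the opposite. -/
noncomputable def polE (e : 𝓔.E U) : (Sec s U)[X] →+ (Sec s U)[X] where
  toFun p := C (c.α e) * p + (Polynomial.X * (C (c.β e) * p) - c.polδ (C (c.β e) * p))
  map_zero' := by simp
  map_add' p q := by simp only [mul_add, map_add]; ring

open Polynomial in
lemma polE_apply (e : 𝓔.E U) (p : (Sec s U)[X]) :
    c.polE e p = C (c.α e) * p + (Polynomial.X * (C (c.β e) * p) - c.polδ (C (c.β e) * p)) := rfl

open Polynomial in
lemma α_smul_one (f : Sec s U) : c.α (f • 𝓔.one U) = f := by rw [map_smul, α_one]; simp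

open Polynomial in
lemma polE_smul_one (f : Sec s U) (p : (Sec s U)[X]) : c.polE (f • 𝓔.one U) p = C f * p := by
  rw [polE_apply, α_smul_one, map_smul, β_one]; simp

open Polynomial in
lemma α_z : c.α c.z = 0 := c.α'_unique (b := 1) (by simp)

open Polynomial in
lemma polE_z (p : (Sec s U)[X]) : c.polE c.z p = Polynomial.X * p - c.polδ p := by
  rw [polE_apply, α_z, β_z]; simp

open Polynomial MulOpposite in
/-- The right action of `D` on polynomials. -/
noncomputable def polD : 𝓔.D U →+* (Module.End ℤ (Sec s U)[X])ᵐᵒᵖ :=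
  RingQuot.lift ⟨(FreeAlgebra.lift ℤ (fun e => op (c.polE e).toIntLinearMap) :
    FreeAlgebra ℤ (𝓔.E U) →ₐ[ℤ] (Module.End ℤ (Sec s U)[X])ᵐᵒᵖ).toRingHom, by
      intro a b hab
      induction hab with
      | add z w =>
        apply unop_injective
        ext1 p
        simp [polE_apply, mul_add, add_mul]
        ring
      | one =>
        apply unop_injective
        ext1 p
        simp [polE_apply, α_one, β_one]
      | smul f z =>
        apply unop_injective
        apply LinearMap.ext
        intro p
        simp [polE_smul_one]
        simp only [polE_apply, map_smul, smul_eq_mul, C_mul, polδ_C_mul, mul_assoc, ← C_mul]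
        simp only [Derivation.leibniz, smul_eq_mul, C_mul, C_add]
        ring
      | bracket z w =>
        apply unop_injective
        apply LinearMap.ext
        intro p
        simp
        rw [c.bracket_eq z w]
        simp only [polE_apply, map_add, map_sub, map_smul, smul_eq_mul, α_one, α_z, β_one, β_z,
          mul_one, mul_zero, add_zero, zero_add, C_mul, C_sub, C_add, sub_mul, mul_sub, mul_add,
          polδ_C_mul, polδ_X_mul, mul_assoc]
        ring⟩

lemma polD_ιE (e : 𝓔.E U) (p) : (c.polD (𝓔.ιE U e)).unop p = c.polE e p := by
  have : c.polD (𝓔.ιE U e) = MulOpposite.op (c.polE e).toIntLinearMap := by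
    refine (RingQuot.lift_mkRingHom_apply _ _ _).trans ?_
    exact FreeAlgebra.lift_ι_apply _ _
  rw [this]; rfl

end Small

namespace Small

variable {𝓔 : FirstOrder s} {U : X.affineOpens} (c : Small 𝓔 U)

/-- The element `z` of `D`. -/
noncomputable def Z : 𝓔.D U := 𝓔.ιE U c.z

open Polynomial in
lemma polD_pow (i : ℕ) : (c.polD (c.Z ^ i)).unop 1 = (Polynomial.X : (Sec s U)[X]) ^ i := by
  have h0 : ∀ i : ℕ, c.polδ ((Polynomial.X : (Sec s U)[X]) ^ i) = 0 := by
    intro i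
    ext n
    rw [coeff_polδ, coeff_X_pow]
    split_ifs <;> simp
  induction i with
  | zero => simp
  | succ i ih =>
    rw [pow_succ, map_mul, MulOpposite.unop_mul, Module.End.mul_apply, ih, Z, polD_ιE, polE_z, h0,
      sub_zero, pow_succ']

open Polynomial in
lemma polD_mul_ιO (d : 𝓔.D U) (f : Sec s U) (p) :
    (c.polD (d * 𝓔.ιO U f)).unop p = C f * (c.polD d).unop p := by
  rw [map_mul, MulOpposite.unop_mul, Module.End.mul_apply]
  exact (c.polD_ιE _ _).trans (c.polE_smul_one _ _)

open Polynomial in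
/-- The coefficients of a differential operator. -/
noncomputable def coef (n : ℤ) : FR 𝓔 U n →ₗ[Sec s U] (Sec s U)[X] where
  toFun a := (c.polD a.val).unop 1
  map_add' a b := by rw [FR.val_add, map_add]; rfl
  map_smul' f a := by rw [FR.val_smul, polD_mul_ιO, RingHom.id_apply, smul_eq_C_mul]

lemma Z_pow_mem {m : ℤ} {i : ℕ} (h : (i : ℤ) ≤ m) : c.Z ^ i ∈ 𝓔.fil U m := by
  refine 𝓔.fil_mono U h ?_
  clear h
  induction i with
  | zero => simpa using 𝓔.one_mem_fil_zero U
  | succ i ih =>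
    rw [pow_succ]
    exact 𝓔.mul_mem_fil (by push_cast; rfl) ih (𝓔.ιE_mem_fil c.z)

open scoped Classical in
/-- The element `z ^ i` of `Dᵐ`. -/
noncomputable def Zp (m : ℤ) (i : ℕ) : FR 𝓔 U m :=
  if h : (i : ℤ) ≤ m then FR.mk 𝓔 (c.Z ^ i) (c.Z_pow_mem h) else 0

lemma Zp_eq {m : ℤ} {i : ℕ} (h : (i : ℤ) ≤ m) : c.Zp m i = FR.mk 𝓔 (c.Z ^ i) (c.Z_pow_mem h) :=
  dif_pos h

lemma val_Zp {m : ℤ} {i : ℕ} (h : (i : ℤ) ≤ m) : (c.Zp m i).val = c.Z ^ i := by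
  rw [c.Zp_eq h]; rfl

lemma ιO_mul_Z (a : Sec s U) : 𝓔.ιO U a * c.Z = c.Z * 𝓔.ιO U a - 𝓔.ιO U (c.δ a) := by
  rw [Z, 𝓔.ιE_mul_ιO, map_add, 𝓔.ιE_smul]
  exact (add_sub_cancel_right _ _).symm

lemma fil_le_span (n : ℕ) : 𝓔.fil U n ≤
    Submodule.span ℤ {d | ∃ (i : ℕ) (a : Sec s U), i ≤ n ∧ d = c.Z ^ i * 𝓔.ιO U a} := by
  induction n with
  | zero =>
    rw [Nat.cast_zero, 𝓔.fil_zero]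
    rintro _ ⟨f, rfl⟩
    exact Submodule.subset_span ⟨0, f, le_rfl, by simp⟩
  | succ n ih =>
    rw [𝓔.fil_succ]
    refine (mul_le_mul' ih le_rfl).trans ?_
    rw [Submodule.mul_le]
    rintro d hd _ ⟨e, rfl⟩
    change d * 𝓔.ιE U e ∈ _
    induction hd using Submodule.span_induction with
    | mem d hd =>
      obtain ⟨i, a, hi, rfl⟩ := hd
      rw [c.eq_α e, map_add, 𝓔.ιE_smul, 𝓔.ιE_smul, 𝓔.ιE_one, mul_one, mul_assoc, mul_add, ← mul_assoc,
        ← map_mul, ← map_mul]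
      change c.Z ^ i * (_ + 𝓔.ιO U (a * c.β e) * c.Z) ∈ _
      rw [ιO_mul_Z, mul_add, mul_sub, ← mul_assoc, ← pow_succ]
      refine add_mem ?_ (sub_mem ?_ ?_)
      · exact Submodule.subset_span ⟨i, _, by omega, rfl⟩
      · exact Submodule.subset_span ⟨i + 1, _, by omega, rfl⟩
      · exact Submodule.subset_span ⟨i, _, by omega, rfl⟩
    | zero => rw [zero_mul]; exact zero_mem _
    | add x y _ _ hx hy => rw [add_mul]; exact add_mem hx hy
    | smul k x _ hx => rw [smul_mul_assoc]; exact Submodule.smul_mem _ _ hx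

/-- The basis `1, z, …, zⁿ` of the right module `Dⁿ`. -/
noncomputable def basisR (n : ℕ) : Module.Basis (Fin (n + 1)) (Sec s U) (FR 𝓔 U n) :=
  Module.Basis.mk (v := fun i => c.Zp n i) (by
    apply LinearIndependent.of_comp (c.coef n)
    have : (c.coef n ∘ fun i : Fin (n + 1) => c.Zp n i) =
        (Polynomial.basisMonomials (Sec s U)) ∘ Fin.val := by
      ext1 i
      change (c.polD (c.Zp n i).val).unop 1 = _
      rw [c.val_Zp (by have := i.2; omega), polD_pow]
      simp [Polynomial.X_pow_eq_monomial]
    rw [this]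
    exact (Polynomial.basisMonomials (Sec s U)).linearIndependent.comp _ Fin.val_injective) (by
    rintro x -
    obtain ⟨d, hd⟩ := x
    have key : ∀ d ∈ Submodule.span ℤ {d | ∃ (i : ℕ) (a : Sec s U), i ≤ n ∧ d = c.Z ^ i * 𝓔.ιO U a},
        ∃ hd : d ∈ 𝓔.fil U n, FR.mk 𝓔 d hd ∈
          Submodule.span (Sec s U) (Set.range fun i : Fin (n + 1) => c.Zp n i) := by
      intro d hd
      induction hd using Submodule.span_induction with
      | mem d hd =>
        obtain ⟨i, a, hi, rfl⟩ := hd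
        refine ⟨𝓔.mul_mem_fil (add_zero _) (c.Z_pow_mem (by omega)) (𝓔.ιO_mem_fil a), ?_⟩
        have : FR.mk 𝓔 (c.Z ^ i * 𝓔.ιO U a) (𝓔.mul_mem_fil (add_zero _)
            (c.Z_pow_mem (by omega)) (𝓔.ιO_mem_fil a)) = a • c.Zp n i := FR.ext (by
          rw [FR.val_smul, c.val_Zp (by omega)]; rfl)
        rw [this]
        exact Submodule.smul_mem _ _ (Submodule.subset_span ⟨⟨i, by omega⟩, rfl⟩)
      | zero => exact ⟨zero_mem _, zero_mem _⟩
      | add x y _ _ hx hy => exact ⟨add_mem hx.1 hy.1, add_mem hx.2 hy.2⟩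
      | smul k x _ hx =>
        refine ⟨Submodule.smul_mem _ _ hx.1, ?_⟩
        exact zsmul_mem hx.2 k
    exact (key d (c.fil_le_span n hd)).2)

lemma basisR_apply (n : ℕ) (i : Fin (n + 1)) : c.basisR n i = c.Zp n i := by
  rw [basisR, Module.Basis.mk_apply]

variable {W : Type} [AddCommGroup W] [Module (Sec s U) W] {m : ℤ} {n : ℕ}

lemma pbw_exists (hm : m = n) (x : FR 𝓔 U m ⊗[Sec s U] W) :
    ∃ w : ℕ → W, x = ∑ i ∈ Finset.range (n + 1), c.Zp m i ⊗ₜ[Sec s U] w i := by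
  subst hm
  let e := TensorProduct.equivFinsuppOfBasisLeft (N := W) (c.basisR n)
  obtain ⟨y, rfl⟩ := e.symm.surjective x
  refine ⟨fun i => if h : i < n + 1 then y ⟨i, h⟩ else 0, ?_⟩
  rw [TensorProduct.equivFinsuppOfBasisLeft_symm_apply, Finsupp.sum_fintype _ _ (by simp),
    Finset.sum_range]
  refine Finset.sum_congr rfl fun i _ => ?_
  simp only [basisR_apply, i.2, dite_true, Fin.eta]

lemma pbw_unique (hm : m = n) (w : ℕ → W)
    (h : ∑ i ∈ Finset.range (n + 1), c.Zp m i ⊗ₜ[Sec s U] w i = 0) {i : ℕ} (hi : i ≤ n) :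
    w i = 0 := by
  subst hm
  let e := TensorProduct.equivFinsuppOfBasisLeft (N := W) (c.basisR n)
  let y : Fin (n + 1) →₀ W := Finsupp.equivFunOnFinite.symm fun i => w i
  have hy : e.symm y = 0 := by
    rw [TensorProduct.equivFinsuppOfBasisLeft_symm_apply, Finsupp.sum_fintype _ _ (by simp), ← h,
      Finset.sum_range]
    refine Finset.sum_congr rfl fun i _ => ?_
    rw [basisR_apply]; rfl
  have := (map_eq_zero_iff _ e.symm.injective).1 hy
  exact DFunLike.congr_fun this ⟨i, by omega⟩

lemma flat_FR (c : Small 𝓔 U) (m : ℤ) : Module.Flat (Sec s U) (FR 𝓔 U m) := by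
  rcases lt_or_ge m 0 with hm | hm
  · have : Subsingleton (FR 𝓔 U m) := ⟨fun a b => FR.ext (by
      have ha := a.mem
      have hb := b.mem
      rw [𝓔.fil_neg U hm, Submodule.mem_bot] at ha hb
      rw [ha, hb])⟩
    infer_instance
  · obtain ⟨n, rfl⟩ := Int.eq_ofNat_of_zero_le hm
    have := Module.Free.of_basis (c.basisR n)
    infer_instance

/-- `D¹` is free on `1, z` as a right module. -/
noncomputable def equivER : (Sec s U × Sec s U) ≃ₗ[Sec s U] ER 𝓔 U :=
  LinearEquiv.ofBijective
    ((LinearMap.toSpanSingleton (Sec s U) (ER 𝓔 U) (toER 𝓔 U (𝓔.one U))).coprod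
      (LinearMap.toSpanSingleton (Sec s U) (ER 𝓔 U) (toER 𝓔 U c.z))) (by
    have key : ∀ a b : Sec s U, a • toER 𝓔 U (𝓔.one U) + b • toER 𝓔 U c.z =
        toER 𝓔 U ((a + c.δ b) • 𝓔.one U + b • c.z) := by
      intro a b
      rw [smul_toER, smul_toER, ← map_add]
      congr 1
      rw [rmul, rmul, 𝓔.anchor_one, add_smul]
      change a • 𝓔.one U + (0 : Sec s U) • 𝓔.one U + (b • c.z + c.δ b • 𝓔.one U) = _
      module
    refine ⟨(injective_iff_map_eq_zero _).2 ?_, fun e => ?_⟩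
    · rintro ⟨a, b⟩ h
      have h : a • toER 𝓔 U (𝓔.one U) + b • toER 𝓔 U c.z = 0 := h
      rw [key, map_eq_zero_iff _ (toER 𝓔 U).injective] at h
      have hb := congrArg c.β h
      rw [map_add, map_smul, map_smul, β_z, β_one, map_zero] at hb
      have hb : b = 0 := by simpa using hb
      subst hb
      have ha := 𝓔.smul_one_injective U (a + c.δ 0) (by simpa using h)
      rw [map_zero, add_zero] at ha
      rw [ha]; rfl
    · obtain ⟨e, rfl⟩ := (toER 𝓔 U).surjective e
      refine ⟨(c.α e - c.δ (c.β e), c.β e), ?_⟩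
      refine (key _ _).trans ?_
      change toER 𝓔 U ((c.α e - c.δ (c.β e) + c.δ (c.β e)) • 𝓔.one U + c.β e • c.z) = _
      rw [sub_add_cancel, ← c.eq_α e])

lemma equivER_apply (a b : Sec s U) :
    c.equivER (a, b) = a • toER 𝓔 U (𝓔.one U) + b • toER 𝓔 U c.z := rfl

/-- `T` is free on `z`. -/
noncomputable def equivT : Sec s U ≃ₗ[Sec s U] TU 𝓔 U :=
  LinearEquiv.ofBijective (LinearMap.toSpanSingleton (Sec s U) (TU 𝓔 U)
    (Submodule.Quotient.mk c.z)) (by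
    refine ⟨(injective_iff_map_eq_zero _).2 fun b h => ?_, fun e => ?_⟩
    · have h : b • (Submodule.Quotient.mk c.z : TU 𝓔 U) = 0 := h
      rw [← Submodule.Quotient.mk_smul, Submodule.Quotient.mk_eq_zero] at h
      obtain ⟨a, ha⟩ := Submodule.mem_span_singleton.1 h
      have := congrArg c.β ha
      rw [map_smul, map_smul, β_z, β_one] at this
      simpa using this.symm
    · obtain ⟨e, rfl⟩ := Submodule.Quotient.mk_surjective _ e
      refine ⟨c.β e, ?_⟩
      change c.β e • (Submodule.Quotient.mk c.z : TU 𝓔 U) = _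
      rw [← Submodule.Quotient.mk_smul, Submodule.Quotient.eq]
      refine Submodule.mem_span_singleton.2 ⟨-c.α e, ?_⟩
      rw [eq_sub_iff_add_eq]
      conv_lhs => rw [c.eq_α e]
      simp only [map_add, map_smul, β_one, β_z, α_one, α_z, smul_eq_mul, mul_zero, zero_add, mul_one,
        add_zero]
      module)

lemma flat_ER (c : Small 𝓔 U) : Module.Flat (Sec s U) (ER 𝓔 U) := Module.Flat.of_linearEquiv c.equivER.symm

lemma flat_TU (c : Small 𝓔 U) : Module.Flat (Sec s U) (TU 𝓔 U) := Module.Flat.of_linearEquiv c.equivT.symm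

lemma exists_tmul_TU (x : TU 𝓔 U ⊗[Sec s U] W) :
    ∃ w : W, x = (Submodule.Quotient.mk c.z : TU 𝓔 U) ⊗ₜ[Sec s U] w := by
  induction x with
  | zero => exact ⟨0, (tmul_zero _ _).symm⟩
  | add x y hx hy =>
    obtain ⟨w, rfl⟩ := hx
    obtain ⟨w', rfl⟩ := hy
    exact ⟨w + w', (tmul_add _ _ _).symm⟩
  | tmul e w =>
    obtain ⟨b, rfl⟩ := c.equivT.surjective e
    exact ⟨b • w, smul_tmul (R := Sec s U) b (Submodule.Quotient.mk c.z : TU 𝓔 U) w⟩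

lemma exists_tmul_ER (x : ER 𝓔 U ⊗[Sec s U] W) :
    ∃ w w' : W, x = toER 𝓔 U (𝓔.one U) ⊗ₜ[Sec s U] w + toER 𝓔 U c.z ⊗ₜ[Sec s U] w' := by
  induction x with
  | zero => exact ⟨0, 0, by simp⟩
  | add x y hx hy =>
    obtain ⟨v, v', rfl⟩ := hx
    obtain ⟨w, w', rfl⟩ := hy
    exact ⟨v + w, v' + w', by simp only [tmul_add]; abel⟩
  | tmul e w =>
    obtain ⟨⟨a, b⟩, rfl⟩ := c.equivER.surjective e
    exact ⟨a • w, b • w, by rw [equivER_apply, add_tmul, smul_tmul, smul_tmul]⟩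

end Small

section Exactness

variable {𝓔 : FirstOrder s}

lemma functor_exact_iff {J : Type} [SmallCategory J] {S : ShortComplex (J ⥤ AddCommGrpCat.{0})} :
    S.Exact ↔ ∀ x, Function.Exact (S.f.app x) (S.g.app x) := by
  refine ⟨app_exact, fun h => ?_⟩
  rw [ShortComplex.exact_iff_isZero_homology, Functor.isZero_iff]
  intro x
  refine IsZero.of_iso ?_ (S.mapHomologyIso ((evaluation J AddCommGrpCat.{0}).obj x)).symm
  rw [← ShortComplex.exact_iff_isZero_homology]
  exact (ShortComplex.ab_exact_iff_function_exact _).2 (h x)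

lemma gr_exact_iff {S : ShortComplex (Gr 𝓔)} :
    S.Exact ↔ ∀ x, Function.Exact (S.f.hom.app x) (S.g.hom.app x) := by
  rw [← ShortComplex.exact_map_iff_of_faithful S (isGr (𝓔 := 𝓔)).ι, functor_exact_iff]
  rfl

lemma gr_mono_of_injective {M N : Gr 𝓔} (φ : M ⟶ N)
    (h : ∀ x, Function.Injective (φ.hom.app x)) : Mono φ := by
  apply (isGr (𝓔 := 𝓔)).ι.mono_of_mono_map
  have : ∀ x, Mono (((isGr (𝓔 := 𝓔)).ι.map φ).app x) :=
    fun x => (AddCommGrpCat.mono_iff_injective _).2 (h x)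
  exact NatTrans.mono_of_mono_app _

lemma gr_epi_of_surjective {M N : Gr 𝓔} (φ : M ⟶ N)
    (h : ∀ x, Function.Surjective (φ.hom.app x)) : Epi φ := by
  apply (isGr (𝓔 := 𝓔)).ι.epi_of_epi_map
  have : ∀ x, Epi (((isGr (𝓔 := 𝓔)).ι.map φ).app x) :=
    fun x => (AddCommGrpCat.epi_iff_surjective _).2 (h x)
  exact NatTrans.epi_of_epi_app _

lemma gr_isZero_iff {M : Gr 𝓔} : IsZero M ↔ ∀ x, ∀ m : M.obj.obj x, m = 0 := by
  refine ⟨fun h x m => ?_, fun h => ?_⟩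
  · have : IsZero M.obj := (isGr (𝓔 := 𝓔)).ι.map_isZero h
    exact (AddCommGrpCat.subsingleton_of_isZero (this.obj x)).elim _ _
  · rw [IsZero.iff_id_eq_zero]
    apply (isGr (𝓔 := 𝓔)).ι.map_injective
    refine NatTrans.ext (funext fun x => AddCommGrpCat.hom_ext (AddMonoidHom.ext fun m => ?_))
    exact h x m

/-- A morphism of `O`-modules on sections, as a linear map. -/
def Sct.homL {V W : OMod s} (φ : V ⟶ W) (U : X.affineOpens) : Sct V U →ₗ[Sec s U] Sct W U where
  toFun := Sct.hom φ U
  map_add' := map_add _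
  map_smul' := Sct.hom_smul φ

lemma exists_of_cover {L M N : OMod s} (i : L ⟶ M) (p : M ⟶ N) (hL : isQCoh L.obj)
    (hM : isQCoh M.obj) {U : X.affineOpens} {S : Set (Sec s U)} (hS : Ideal.span S = ⊤)
    (h : ∀ f ∈ S, ∀ y : Sct M (bas s f), Sct.hom p _ y = 0 → ∃ x, Sct.hom i _ x = y)
    (y : Sct M U) (hy : Sct.hom p U y = 0) : ∃ x, Sct.hom i U x = y := by
  suffices y ∈ LinearMap.range (Sct.homL i U) from this
  refine span_pow_mem _ hS y fun f hf => ?_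
  obtain ⟨x, hx⟩ := h f hf (Sct.res M (bas_le s f) y) (by rw [Sct.hom_res, hy, map_zero])
  obtain ⟨k, x', hx'⟩ := (isLoc_Sct hL f).surj x
  have h0 : Sct.res M (bas_le s f) (f ^ k • y - Sct.hom i U x') = 0 := by
    rw [map_sub, Sct.res_smul, ← Sct.hom_res, ← hx', Sct.hom_smul, hx, map_pow, sub_self]
  obtain ⟨l, hl⟩ := (isLoc_Sct hM f).inj _ h0
  refine ⟨l + k, f ^ l • x', ?_⟩
  rw [smul_sub, smul_smul, ← pow_add, sub_eq_zero] at hl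
  rw [hl]
  exact Sct.hom_smul i _ _

lemma eq_zero_of_cover {M : OMod s} (hM : isQCoh M.obj) {U : X.affineOpens} {S : Set (Sec s U)}
    (hS : Ideal.span S = ⊤) (y : Sct M U) (h : ∀ f ∈ S, Sct.res M (bas_le s f) y = 0) : y = 0 := by
  suffices y ∈ (⊥ : Submodule (Sec s U) (Sct M U)) from this
  exact span_pow_mem _ hS y fun f hf => (isLoc_Sct hM f).inj _ (h f hf)

/-- An object of `Gr R` as a presheaf of graded modules. -/
noncomputable abbrev gm (M : Gr 𝓔) : GMod 𝓔 := (ObjectProperty.ιOfLE isGr_le_isGMod).obj M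

/-- The map on presheaves of graded modules. -/
noncomputable abbrev gmMap {M N : Gr 𝓔} (φ : M ⟶ N) : gm M ⟶ gm N := (ObjectProperty.ιOfLE isGr_le_isGMod).map φ

variable [IsSmoothCurve s]

lemma exists_of_small {L M N : Gr 𝓔} (i : L ⟶ M) (p : M ⟶ N) (k : ℤ)
    (h : ∀ (U : X.affineOpens) (_ : Small 𝓔 U) (y : M.obj.obj ⟨U, k⟩), p.hom.app _ y = 0 →
      ∃ x, i.hom.app ⟨U, k⟩ x = y) (U : X.affineOpens) (y : M.obj.obj ⟨U, k⟩)
    (hy : p.hom.app _ y = 0) : ∃ x, i.hom.app ⟨U, k⟩ x = y := by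
  obtain ⟨S, hS, hc⟩ := exists_small 𝓔 U
  exact exists_of_cover ((degF 𝓔 k).map (gmMap i)) ((degF 𝓔 k).map (gmMap p)) (L.property.2 k)
    (M.property.2 k) hS (fun f hf => h _ (hc f hf).some) y hy

lemma eq_zero_of_small {M : Gr 𝓔} (k : ℤ)
    (h : ∀ (U : X.affineOpens) (_ : Small 𝓔 U) (y : M.obj.obj ⟨U, k⟩), y = 0)
    (U : X.affineOpens) (y : M.obj.obj ⟨U, k⟩) : y = 0 := by
  obtain ⟨S, hS, hc⟩ := exists_small 𝓔 U
  exact eq_zero_of_cover (M := (degF 𝓔 k).obj (gm M)) (M.property.2 k) hS y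
    fun f hf => h _ (hc f hf).some _

lemma surjective_of_small {M N : Gr 𝓔} (p : M ⟶ N) (k : ℤ)
    (h : ∀ (U : X.affineOpens) (_ : Small 𝓔 U), Function.Surjective (p.hom.app ⟨U, k⟩))
    (U : X.affineOpens) : Function.Surjective (p.hom.app ⟨U, k⟩) :=
  fun y => exists_of_small p (0 : N ⟶ N) k (fun U c y _ => h U c y) U y rfl

lemma injective_of_small {M N : Gr 𝓔} (p : M ⟶ N) (k : ℤ)
    (h : ∀ (U : X.affineOpens) (_ : Small 𝓔 U), Function.Injective (p.hom.app ⟨U, k⟩))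
    (U : X.affineOpens) : Function.Injective (p.hom.app ⟨U, k⟩) :=
  (injective_iff_map_eq_zero _).2 fun y hy => by
    obtain ⟨x, hx⟩ := exists_of_small (0 : M ⟶ M) p k (fun U c y hy => ⟨0, by
      have := h U c (hy.trans (map_zero (p.hom.app ⟨U, k⟩).hom).symm)
      rw [this, map_zero]⟩) U y hy
    exact hx.symm

lemma app_zero_of_comp {L M N : Gr 𝓔} {i : L ⟶ M} {p : M ⟶ N} (h : i ≫ p = 0) (x : RCat 𝓔)
    (m : L.obj.obj x) : p.hom.app x (i.hom.app x m) = 0 :=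
  ConcreteCategory.congr_hom (congr_app (congrArg (isGr (𝓔 := 𝓔)).ι.map h) x) m

lemma gr_exact_of_small {S : ShortComplex (Gr 𝓔)}
    (h : ∀ (U : X.affineOpens) (_ : Small 𝓔 U) (k : ℤ) (y : S.X₂.obj.obj ⟨U, k⟩),
      S.g.hom.app _ y = 0 → ∃ x, S.f.hom.app ⟨U, k⟩ x = y) : S.Exact := by
  rw [gr_exact_iff]
  rintro ⟨U, k⟩ y
  refine ⟨exists_of_small S.f S.g k (fun U c => h U c k) U y, ?_⟩
  rintro ⟨x, rfl⟩
  exact app_zero_of_comp S.zero _ _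

end Exactness

section TensorExact

lemma LeftAct.tensor_exact {J : Type} [Category.{0} J] {U : J → X.affineOpens}
    {sub : ∀ {x y : J}, (x ⟶ y) → U y ≤ U x} (B : LeftAct s U sub) {V₁ V₂ V₃ : OMod s}
    (φ : V₁ ⟶ V₂) (ψ : V₂ ⟶ V₃) (x : J) (hf : Module.Flat (Sec s (U x)) (B.N x))
    (h : Function.Exact (Sct.hom φ (U x)) (Sct.hom ψ (U x))) :
    Function.Exact ((B.tensor.map φ).app x) ((B.tensor.map ψ).app x) := by
  have key : ∀ {V W : OMod s} (φ : V ⟶ W) (y : B.N x ⊗[Sec s (U x)] Sct V (U x)),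
      (B.tensor.map φ).app x y = (Sct.homL φ (U x)).lTensor (B.N x) y := by
    intro V W φ y
    exact DFunLike.congr_fun (f := ((B.tensor.map φ).app x).hom)
      (g := ((Sct.homL φ (U x)).lTensor (B.N x)).toAddMonoidHom) (tensor_hom_ext fun _ _ => rfl) y
  have := Module.Flat.lTensor_exact (B.N x) (f := Sct.homL φ (U x)) (g := Sct.homL ψ (U x)) h
  intro y
  exact (Eq.congr_left (key ψ y)).trans ((this y).trans (exists_congr fun z =>
    (Eq.congr_left (key φ z)).symm))

variable {𝓔 : FirstOrder s} {V₁ V₂ V₃ : OMod s} (φ : V₁ ⟶ V₂) (ψ : V₂ ⟶ V₃)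
  {U : X.affineOpens} (c : Small 𝓔 U)

lemma tensorE_exact (c : Small 𝓔 U) (h : Function.Exact (Sct.hom φ U) (Sct.hom ψ U)) :
    Function.Exact (Sct.hom ((tensorE 𝓔).map φ) U) (Sct.hom ((tensorE 𝓔).map ψ) U) :=
  (actE 𝓔).tensor_exact φ ψ ⟨U⟩ c.flat_ER h

lemma tensorT_exact (c : Small 𝓔 U) (h : Function.Exact (Sct.hom φ U) (Sct.hom ψ U)) :
    Function.Exact (Sct.hom ((tensorT 𝓔).map φ) U) (Sct.hom ((tensorT 𝓔).map ψ) U) :=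
  (actT 𝓔).tensor_exact φ ψ ⟨U⟩ c.flat_TU h

lemma ind_exact (c : Small 𝓔 U) (k n : ℤ) (h : Function.Exact (Sct.hom φ U) (Sct.hom ψ U)) :
    Function.Exact (((ind 𝓔 k).map φ).hom.app ⟨U, n⟩) (((ind 𝓔 k).map ψ).hom.app ⟨U, n⟩) :=
  (actR 𝓔 k).tensor_exact φ ψ ⟨U, n⟩ (c.flat_FR _) h

lemma ind_injective (c : Small 𝓔 U) (k n : ℤ) (h : Function.Injective (Sct.hom φ U)) :
    Function.Injective (((ind 𝓔 k).map φ).hom.app ⟨U, n⟩) := by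
  refine (injective_iff_map_eq_zero _).2 fun y hy => ?_
  obtain ⟨x, hx⟩ := (ind_exact (0 : V₁ ⟶ V₁) φ c k n (fun y =>
    ⟨fun hy => ⟨0, (h (hy.trans (map_zero _).symm)).symm⟩, by rintro ⟨x, rfl⟩; exact map_zero _⟩) y).1 hy
  rw [← hx, Functor.map_zero]; rfl

lemma ind_surjective (c : Small 𝓔 U) (k n : ℤ) (h : Function.Surjective (Sct.hom φ U)) :
    Function.Surjective (((ind 𝓔 k).map φ).hom.app ⟨U, n⟩) := fun y =>
  (ind_exact φ (0 : V₂ ⟶ V₂) c k n (fun y => ⟨fun _ => h y, fun _ => rfl⟩) y).1 (by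
    rw [Functor.map_zero]; rfl)

lemma exact_degF {S : ShortComplex (Gr 𝓔)} (hS : S.Exact) (k : ℤ) (U : X.affineOpens) :
    Function.Exact (Sct.hom ((degF 𝓔 k).map (gmMap S.f)) U)
      (Sct.hom ((degF 𝓔 k).map (gmMap S.g)) U) := gr_exact_iff.1 hS ⟨U, k⟩

section

variable [IsSmoothCurve s] (h : TensorQC 𝓔)

lemma termR_exact {S : ShortComplex (Gr 𝓔)} (hS : S.Exact) : (S.map (termR h)).Exact :=
  gr_exact_of_small fun U c n y hy => (ind_exact _ _ c 0 n (exact_degF hS 0 U) y).1 hy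

lemma termO_exact {S : ShortComplex (Gr 𝓔)} (hS : S.Exact) : (S.map (termO h)).Exact :=
  gr_exact_of_small fun U c n y hy => (ind_exact _ _ c (-1) n (exact_degF hS (-1) U) y).1 hy

lemma termT_exact {S : ShortComplex (Gr 𝓔)} (hS : S.Exact) : (S.map (termT h)).Exact :=
  gr_exact_of_small fun U c n y hy =>
    (ind_exact _ _ c (-1) n (tensorT_exact _ _ c (exact_degF hS (-1) U)) y).1 hy

lemma termE_exact {S : ShortComplex (Gr 𝓔)} (hS : S.Exact) : (S.map (termE h)).Exact :=
  gr_exact_of_small fun U c n y hy =>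
    (ind_exact _ _ c (-1) n (tensorE_exact _ _ c (exact_degF hS (-1) U)) y).1 hy

lemma preserves_of_exact {F : Gr 𝓔 ⥤ Gr 𝓔} [F.Additive]
    (hF : ∀ S : ShortComplex (Gr 𝓔), S.Exact → (S.map F).Exact) :
    PreservesFiniteLimits F ∧ PreservesFiniteColimits F :=
  ((Functor.exact_tfae F).out 1 3).1 hF

instance : PreservesFiniteLimits (termR h) := (preserves_of_exact fun _ => termR_exact h).1
instance : PreservesFiniteColimits (termR h) := (preserves_of_exact fun _ => termR_exact h).2
instance : PreservesFiniteLimits (termO h) := (preserves_of_exact fun _ => termO_exact h).1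
instance : PreservesFiniteColimits (termO h) := (preserves_of_exact fun _ => termO_exact h).2
instance : PreservesFiniteLimits (termT h) := (preserves_of_exact fun _ => termT_exact h).1
instance : PreservesFiniteColimits (termT h) := (preserves_of_exact fun _ => termT_exact h).2
instance : PreservesFiniteLimits (termE h) := (preserves_of_exact fun _ => termE_exact h).1
instance : PreservesFiniteColimits (termE h) := (preserves_of_exact fun _ => termE_exact h).2

end

namespace Small

variable {W : Type} [AddCommGroup W] [Module (Sec s U) W]

lemma tmul_TU_eq_zero {w : W}
    (h : (Submodule.Quotient.mk c.z : TU 𝓔 U) ⊗ₜ[Sec s U] w = 0) : w = 0 := by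
  have := congrArg (TensorProduct.lid (Sec s U) W ∘ c.equivT.symm.toLinearMap.rTensor W) h
  have e : c.equivT.symm (Submodule.Quotient.mk c.z) = 1 := by
    rw [LinearEquiv.symm_apply_eq]
    exact (one_smul (Sec s U) (Submodule.Quotient.mk c.z : TU 𝓔 U)).symm
  simpa [e] using this

lemma tmul_ER_eq_zero {w w' : W}
    (h : toER 𝓔 U (𝓔.one U) ⊗ₜ[Sec s U] w + toER 𝓔 U c.z ⊗ₜ[Sec s U] w' = 0) :
    w = 0 ∧ w' = 0 := by
  have e1 : c.equivER.symm (toER 𝓔 U (𝓔.one U)) = (1, 0) := by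
    rw [LinearEquiv.symm_apply_eq, equivER_apply]; simp
  have e2 : c.equivER.symm (toER 𝓔 U c.z) = (0, 1) := by
    rw [LinearEquiv.symm_apply_eq, equivER_apply]; simp
  constructor
  · have := congrArg (TensorProduct.lid (Sec s U) W ∘
      ((LinearMap.fst _ _ _).comp c.equivER.symm.toLinearMap).rTensor W) h
    simpa [e1, e2] using this
  · have := congrArg (TensorProduct.lid (Sec s U) W ∘
      ((LinearMap.snd _ _ _).comp c.equivER.symm.toLinearMap).rTensor W) h
    simpa [e1, e2] using this

lemma unitE_injective (c : Small 𝓔 U) (V : OMod s) :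
    Function.Injective (Sct.hom ((unitE 𝓔).app V) U) :=
  (injective_iff_map_eq_zero _).2 fun w hw =>
    (c.tmul_ER_eq_zero (w := w) (w' := 0) (by rw [tmul_zero, add_zero]; exact hw)).1

lemma quotET_surjective (c : Small 𝓔 U) (V : OMod s) :
    Function.Surjective (Sct.hom ((quotET 𝓔).app V) U) := fun y => by
  obtain ⟨w, hw⟩ := c.exists_tmul_TU (W := Sct V U) y
  exact ⟨(toER 𝓔 U c.z ⊗ₜ[Sec s U] w : ER 𝓔 U ⊗[Sec s U] Sct V U), hw.symm⟩

lemma unitE_quotET_exact (c : Small 𝓔 U) (V : OMod s) :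
    Function.Exact (Sct.hom ((unitE 𝓔).app V) U) (Sct.hom ((quotET 𝓔).app V) U) := by
  intro y
  constructor
  · intro hy
    obtain ⟨w, w', hw⟩ := c.exists_tmul_ER (W := Sct V U) y
    rw [hw] at hy
    have h2 : (Submodule.Quotient.mk (𝓔.one U) : TU 𝓔 U) ⊗ₜ[Sec s U] w +
      (Submodule.Quotient.mk c.z : TU 𝓔 U) ⊗ₜ[Sec s U] w' = 0 := hy
    rw [(Submodule.Quotient.mk_eq_zero _).2 (Submodule.mem_span_singleton_self _), zero_tmul,
      zero_add] at h2
    rw [c.tmul_TU_eq_zero h2, tmul_zero, add_zero] at hw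
    exact ⟨w, hw.symm⟩
  · rintro ⟨w, rfl⟩
    have := congrArg (fun q => Sct.hom (NatTrans.app q V) U w) (unitE_quotET 𝓔)
    exact this

end Small

section

variable [IsSmoothCurve s] (h : TensorQC 𝓔)

/-- The projection `R(-1) ⊗ D¹ ⊗ M_{-1} → R(-1) ⊗ T ⊗ M_{-1}`. -/
noncomputable def quotTerm : termE h ⟶ termT h := toGrMap _ _
  (Functor.whiskerLeft (degF 𝓔 (-1)) (Functor.whiskerRight (quotET 𝓔) (ind 𝓔 (-1))))

lemma quotTerm_diffT : quotTerm h ≫ diffT h = diffE h := rfl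

lemma diffO_quotTerm : diffO h ≫ quotTerm h = 0 := by
  have key : Functor.whiskerLeft (degF 𝓔 (-1)) (Functor.whiskerRight (unitE 𝓔) (ind 𝓔 (-1))) ≫
      Functor.whiskerLeft (degF 𝓔 (-1)) (Functor.whiskerRight (quotET 𝓔) (ind 𝓔 (-1))) = 0 := by
    ext1; ext1 M
    have := congr_app (unitE_quotET 𝓔) ((degF 𝓔 (-1)).obj M)
    have h2 := congrArg (ind 𝓔 (-1)).map this
    rw [NatTrans.comp_app, Functor.map_comp] at h2
    simp only [NatTrans.comp_app, Functor.whiskerLeft_app, Functor.whiskerRight_app]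
    rw [h2]
    change (ind 𝓔 (-1)).map 0 = 0
    rw [Functor.map_zero]
  exact (toGrMap_comp _ _ _ _ _).trans ((congrArg _ key).trans (toGrMap_zero _ _))

lemma shortExact_diffO_quotTerm (M : Gr 𝓔) : (ShortComplex.mk ((diffO h).app M)
    ((quotTerm h).app M) (congr_app (diffO_quotTerm h) M)).ShortExact where
  exact := gr_exact_of_small fun U c n y hy =>
    (ind_exact _ _ c (-1) n (c.unitE_quotET_exact ((degF 𝓔 (-1)).obj (gm M))) y).1 hy
  mono_f := gr_mono_of_injective _ fun ⟨U, n⟩ => injective_of_small _ n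
    (fun U c => ind_injective _ c (-1) n (c.unitE_injective ((degF 𝓔 (-1)).obj (gm M)))) U
  epi_g := gr_epi_of_surjective _ fun ⟨U, n⟩ => surjective_of_small _ n
    (fun U c => ind_surjective _ c (-1) n (c.quotET_surjective ((degF 𝓔 (-1)).obj (gm M)))) U

end

end TensorExact

section Action

variable {𝓔 : FirstOrder s} {U : X.affineOpens} {k j i : ℤ}

lemma act_congr (M : RCat 𝓔 ⥤ AddCommGrpCat.{0}) {a b : 𝓔.D U} (h : a = b)
    (ha : a ∈ 𝓔.fil U (j - k)) (hb : b ∈ 𝓔.fil U (j - k)) (m : M.obj ⟨U, k⟩) :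
    act M j a ha m = act M j b hb m := by subst h; rfl

lemma act_one (M : RCat 𝓔 ⥤ AddCommGrpCat.{0}) (h : (1 : 𝓔.D U) ∈ 𝓔.fil U (k - k))
    (m : M.obj ⟨U, k⟩) : act M k 1 h m = m :=
  ConcreteCategory.congr_hom (M.map_id ⟨U, k⟩) m

/-- The action as an additive map. -/
noncomputable def actHom (M : RCat 𝓔 ⥤ AddCommGrpCat.{0}) (j : ℤ) (r : 𝓔.D U)
    (hr : r ∈ 𝓔.fil U (j - k)) : M.obj ⟨U, k⟩ →+ M.obj ⟨U, j⟩ :=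
  (M.map (X := ⟨U, k⟩) (Y := ⟨U, j⟩) ⟨le_rfl, r, hr⟩).hom

lemma act_zero (M : RCat 𝓔 ⥤ AddCommGrpCat.{0}) {a : 𝓔.D U} (ha : a ∈ 𝓔.fil U (j - k)) :
    act M j a ha (0 : M.obj ⟨U, k⟩) = 0 := map_zero (actHom M j a ha)

lemma map_map_res (M : RCat 𝓔 ⥤ AddCommGrpCat.{0}) {x y z : RCat 𝓔} (g : x ⟶ y) (g' : y ⟶ z)
    (m : M.obj x) : M.map g' (M.map g m) = M.map (g ≫ g') m :=
  (ConcreteCategory.congr_hom (M.map_comp g g') m).symm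

lemma map_congr (M : RCat 𝓔 ⥤ AddCommGrpCat.{0}) {x y : RCat 𝓔} {g g' : x ⟶ y}
    (h : g.val = g'.val) (m : M.obj x) : M.map g m = M.map g' m := by
  rw [show g = g' from RCat.Hom.ext h]

/-- The evaluation `a ⊗ m ↦ a m` on sections. -/
noncomputable def evApp (M : GMod 𝓔) (k l : ℤ) (h : k + l = 0) (x : RCat 𝓔) :
    FR 𝓔 x.U (x.deg + k) ⊗[Sec s x.U] Sct ((degF 𝓔 l).obj M) x.U →+ M.obj.obj x :=
  TensorProduct.liftAddHom
    (AddMonoidHom.mk' (fun a => actHom (k := l) M.obj x.deg a.val (by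
        rw [show x.deg - l = x.deg + k by omega]; exact a.mem)) (fun a b => by
      ext m
      exact act_add M.property _ _ m))
    (fun f a m => by
      change act M.obj x.deg (a.val * 𝓔.ιO x.U f) _ m = act M.obj x.deg a.val _
        (act M.obj l (𝓔.ιO x.U f) (by rw [sub_self]; exact 𝓔.ιO_mem_fil f) m)
      exact (act_act M.obj _ _ m).symm)

variable (𝓔) in
/-- The evaluation `R(k) ⊗ M_l → M`, `a ⊗ m ↦ a m`, for `k + l = 0`. -/
noncomputable def ev (k l : ℤ) (h : k + l = 0) : degF 𝓔 l ⋙ ind 𝓔 k ⟶ 𝟭 (GMod 𝓔) where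
  app M := ObjectProperty.homMk
    { app x := AddCommGrpCat.ofHom (evApp M k l h x)
      naturality x y g := by
        refine AddCommGrpCat.hom_ext (tensor_hom_ext fun a m => ?_)
        change act (k := l) M.obj y.deg (g.val * 𝓔.resD g.sub (FR.val a)) _
          (M.obj.map ((degFun 𝓔 l).map (OCat.restr g.sub)) m) =
            M.obj.map g (act (k := l) M.obj x.deg (FR.val a) _ m)
        refine (map_map_res _ _ _ _).trans (Eq.trans (map_congr _ ?_ _) (map_map_res _ _ _ _).symm)
        change _ * 𝓔.resD le_rfl (𝓔.ιO y.U 1) = _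
        rw [map_one, map_one, mul_one]
        rfl }
  naturality M N φ := by
    apply (isGMod (𝓔 := 𝓔)).ι.map_injective
    refine NatTrans.ext (funext fun x => AddCommGrpCat.hom_ext
      (tensor_hom_ext fun a m => ?_))
    exact (act_nat φ.hom (FR.val a) _ m).symm

end Action

namespace Small

variable {𝓔 : FirstOrder s} {U : X.affineOpens} (c : Small 𝓔 U)

lemma mem_of_le {i : ℕ} {j k : ℤ} (h : i + k ≤ j) : c.Z ^ i ∈ 𝓔.fil U (j - k) :=
  c.Z_pow_mem (by omega)

/-- The operator `zⁱ t^{j-k-i} : M_k → M_j`. -/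
noncomputable def op (M : RCat 𝓔 ⥤ AddCommGrpCat.{0}) (i : ℕ) {k j : ℤ} (h : i + k ≤ j) :
    M.obj ⟨U, k⟩ →+ M.obj ⟨U, j⟩ := actHom M j (c.Z ^ i) (c.mem_of_le h)

variable (M : RCat 𝓔 ⥤ AddCommGrpCat.{0})

lemma op_op {i i' : ℕ} {k j l : ℤ} (h : i + k ≤ j) (h' : i' + j ≤ l) (m : M.obj ⟨U, k⟩) :
    c.op M i' h' (c.op M i h m) = c.op M (i' + i) (by push_cast; omega) m := by
  refine (act_act M _ _ m).trans (act_congr M ?_ _ _ m)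
  rw [pow_add]

lemma op_zero (k : ℤ) (m : M.obj ⟨U, k⟩) : c.op M 0 (k := k) (j := k) (by simp) m = m := by
  refine (act_congr M (pow_zero _) _ ?_ m).trans (act_one M _ m)
  rw [sub_self]; exact 𝓔.one_mem_fil_zero U

lemma op_congr {i i' : ℕ} (hi : i = i') {k j : ℤ} (h : i + k ≤ j) (m : M.obj ⟨U, k⟩) :
    c.op M i h m = c.op M i' (hi ▸ h) m := by subst hi; rfl

lemma op_nat {M N : RCat 𝓔 ⥤ AddCommGrpCat.{0}} (p : M ⟶ N) {i : ℕ} {k j : ℤ} (h : i + k ≤ j)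
    (m : M.obj ⟨U, k⟩) : p.app _ (c.op M i h m) = c.op N i h (p.app _ m) := act_nat p _ _ m

/-- The multiplication by `t`. -/
noncomputable def tm {k j : ℤ} (h : k + 1 = j) : M.obj ⟨U, k⟩ →+ M.obj ⟨U, j⟩ :=
  c.op M 0 (by push_cast; omega)

/-- The multiplication by `z`. -/
noncomputable def zm {k j : ℤ} (h : k + 1 = j) : M.obj ⟨U, k⟩ →+ M.obj ⟨U, j⟩ :=
  c.op M 1 (by push_cast; omega)

lemma tm_zm {k j l : ℤ} (h : k + 1 = j) (h' : j + 1 = l) (m : M.obj ⟨U, k⟩) :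
    c.tm M h' (c.zm M h m) = c.zm M h' (c.tm M h m) := by
  rw [tm, zm, op_op, zm, tm, op_op]

/-- Koszul exactness of `t, z` in degrees `≥ -1`. -/
structure Kos : Prop where
  inj : ∀ {k j : ℤ} (_ : -1 ≤ k) (h : k + 1 = j) (u : M.obj ⟨U, k⟩), c.tm M h u = 0 →
    c.zm M h u = 0 → u = 0
  mid : ∀ {k j l : ℤ} (_ : 0 ≤ j) (h : k + 1 = j) (h' : j + 1 = l) (m m' : M.obj ⟨U, j⟩),
    c.zm M h' m = c.tm M h' m' → ∃ u : M.obj ⟨U, k⟩, c.tm M h u = m ∧ c.zm M h u = m'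
  surj : ∀ {k j : ℤ} (_ : 0 ≤ k) (h : k + 1 = j) (m : M.obj ⟨U, j⟩),
    ∃ a b : M.obj ⟨U, k⟩, m = c.zm M h a + c.tm M h b

variable {c M}

end Small

namespace Small

variable {𝓔 : FirstOrder s} {U : X.affineOpens}

/-- The section `a ⊗ v` of `R(k) ⊗ V`. -/
noncomputable def pur {k n : ℤ} {V : OMod s} (a : FR 𝓔 U (n + k)) :
    Sct V U →+ ((ind 𝓔 k).obj V).obj.obj ⟨U, n⟩ :=
  (TensorProduct.mk (Sec s U) (FR 𝓔 U (n + k)) (Sct V U) a).toAddMonoidHom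

variable (𝓔 U) in
/-- The section `1 ⊗ v` of `R(k) ⊗ V`. -/
noncomputable def gen (k : ℤ) (V : OMod s) {n : ℤ} (h : n + k = 0) :
    Sct V U →+ ((ind 𝓔 k).obj V).obj.obj ⟨U, n⟩ :=
  pur (FR.mk 𝓔 1 (by rw [h]; exact 𝓔.one_mem_fil_zero U))

lemma subsingleton_ind (k : ℤ) (V : OMod s) {n : ℤ} (h : n + k < 0)
    (x : ((ind 𝓔 k).obj V).obj.obj ⟨U, n⟩) : x = 0 := by
  have h0 : ∀ a : FR 𝓔 U (n + k), a = 0 := fun a => FR.ext (by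
    have := a.mem
    rw [𝓔.fil_neg U h] at this
    exact this)
  have : AddMonoidHom.id (FR 𝓔 U (n + k) ⊗[Sec s U] Sct V U) = 0 := tensor_hom_ext fun a v => by
    rw [h0 a, zero_tmul]; rfl
  exact DFunLike.congr_fun this x

variable (c : Small 𝓔 U) {k : ℤ} {V : OMod s}

lemma exists_pur {n : ℤ} {N : ℕ} (hN : n + k = N) (x : ((ind 𝓔 k).obj V).obj.obj ⟨U, n⟩) :
    ∃ w : ℕ → Sct V U, x = ∑ i ∈ Finset.range (N + 1), pur (c.Zp (n + k) i) (w i) :=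
  c.pbw_exists hN x

lemma eq_zero_of_sum_pur {n : ℤ} {N : ℕ} (hN : n + k = N) (w : ℕ → Sct V U)
    (h : ∑ i ∈ Finset.range (N + 1),
      (pur (c.Zp (n + k) i) (w i) : ((ind 𝓔 k).obj V).obj.obj ⟨U, n⟩) = 0) {i : ℕ}
    (hi : i ≤ N) : w i = 0 := c.pbw_unique hN w h hi

lemma op_pur {i : ℕ} {n m : ℤ} (h : i + n ≤ m) (a : FR 𝓔 U (n + k)) (v : Sct V U) :
    c.op ((ind 𝓔 k).obj V).obj i h (pur a v) =
      pur (FR.mk 𝓔 (c.Z ^ i * a.val) (𝓔.mul_mem_fil (by ring) (c.mem_of_le h) a.mem)) v := by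
  change pur (FR.map 𝓔 k (x := ⟨U, n⟩) (y := ⟨U, m⟩) ⟨le_rfl, c.Z ^ i, c.mem_of_le h⟩ a)
    (Sct.res V le_rfl v) = _
  rw [Sct.res_self]
  congr 2
  exact FR.ext (congrArg (_ * ·) (𝓔.resD_self _ _))

lemma op_Zp {i i' : ℕ} {n m : ℤ} (h : i + n ≤ m) (h' : i' ≤ n + k) (v : Sct V U) :
    c.op ((ind 𝓔 k).obj V).obj i h (pur (c.Zp (n + k) i') v) =
      pur (c.Zp (m + k) (i + i')) v := by
  rw [op_pur]
  congr 2
  refine FR.ext ?_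
  rw [FR.val_mk, val_Zp _ h', val_Zp _ (by push_cast; omega), pow_add]

lemma gen_eq {n : ℤ} (h : n + k = 0) (v : Sct V U) :
    gen 𝓔 U k V h v = pur (c.Zp (n + k) 0) v := by
  rw [gen]
  congr 2
  exact FR.ext (by rw [val_Zp _ (by simp [h]), pow_zero]; rfl)

lemma op_gen {i : ℕ} {n m : ℤ} (hn : n + k = 0) (h : i + n ≤ m) (v : Sct V U) :
    c.op ((ind 𝓔 k).obj V).obj i h (gen 𝓔 U k V hn v) = pur (c.Zp (m + k) i) v := by
  rw [c.gen_eq]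
  exact c.op_Zp h (by simp [hn]) v

lemma gen_surjective (c : Small 𝓔 U) {n : ℤ} (h : n + k = 0) :
    Function.Surjective (gen 𝓔 U k V h) := by
  intro x
  obtain ⟨w, hw⟩ := c.exists_pur (N := 0) (h.trans Nat.cast_zero.symm) x
  exact ⟨w 0, by rw [c.gen_eq, hw, Finset.sum_range_one]⟩

lemma gen_injective (c : Small 𝓔 U) {n : ℤ} (h : n + k = 0) :
    Function.Injective (gen 𝓔 U k V h) := by
  refine (injective_iff_map_eq_zero _).2 fun v hv => ?_
  rw [c.gen_eq] at hv
  exact c.eq_zero_of_sum_pur (N := 0) (h.trans Nat.cast_zero.symm) (fun _ => v)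
    (by rw [Finset.sum_range_one]; exact hv) (i := 0) le_rfl

lemma zm_sum {m m' : ℤ} (hm : m + 1 = m') (N : ℕ) (hN : m + k = N) (w : ℕ → Sct V U) :
    c.zm ((ind 𝓔 k).obj V).obj hm (∑ i ∈ Finset.range (N + 1), pur (c.Zp (m + k) i) (w i)) =
      ∑ i ∈ Finset.range (N + 1), pur (c.Zp (m' + k) (i + 1)) (w i) := by
  refine (map_sum _ _ _).trans (Finset.sum_congr rfl fun i hi => ?_)
  rw [add_comm i 1]
  exact c.op_Zp _ (by rw [Finset.mem_range] at hi; omega) _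

lemma ind_cases {n m m' : ℤ} (hn : n + k = 0) (hm : m + 1 = m') (h : n ≤ m)
    (x : ((ind 𝓔 k).obj V).obj.obj ⟨U, m'⟩) :
    ∃ (v : Sct V U) (y : ((ind 𝓔 k).obj V).obj.obj ⟨U, m⟩),
      x = c.op ((ind 𝓔 k).obj V).obj 0 (by push_cast; omega) (gen 𝓔 U k V hn v) +
        c.zm ((ind 𝓔 k).obj V).obj hm y := by
  obtain ⟨N, hN⟩ : ∃ N : ℕ, m + k = N := ⟨(m + k).toNat, by omega⟩
  obtain ⟨w, hw⟩ := c.exists_pur (N := N + 1) (show m' + k = (N + 1 : ℕ) by push_cast; omega) x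
  refine ⟨w 0, ∑ i ∈ Finset.range (N + 1), pur (c.Zp (m + k) i) (w (i + 1)), ?_⟩
  rw [c.op_gen hn, c.zm_sum hm N hN (fun i => w (i + 1)), hw, Finset.sum_range_succ', add_comm]

lemma ind_unique {n m m' : ℤ} (hn : n + k = 0) (hm : m + 1 = m') (h : n ≤ m)
    {v : Sct V U} {y : ((ind 𝓔 k).obj V).obj.obj ⟨U, m⟩}
    (hx : c.op ((ind 𝓔 k).obj V).obj 0 (by push_cast; omega) (gen 𝓔 U k V hn v) +
        c.zm ((ind 𝓔 k).obj V).obj hm y = 0) : v = 0 ∧ y = 0 := by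
  obtain ⟨N, hN⟩ : ∃ N : ℕ, m + k = N := ⟨(m + k).toNat, by omega⟩
  obtain ⟨w, hw⟩ := c.exists_pur (N := N) hN y
  rw [hw, c.op_gen hn, c.zm_sum hm N hN w] at hx
  let w' : ℕ → Sct V U := fun i => Nat.casesOn i v w
  have key : ∀ {i : ℕ}, i ≤ N + 1 → w' i = 0 := fun hi =>
    c.eq_zero_of_sum_pur (N := N + 1) (show m' + k = (N + 1 : ℕ) by push_cast; omega) w' (by
      rw [Finset.sum_range_succ', add_comm]
      exact hx) hi
  refine ⟨key (i := 0) (by simp), ?_⟩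
  rw [hw]
  refine Finset.sum_eq_zero fun i hi => ?_
  have : w i = 0 := key (i := i + 1) (by rw [Finset.mem_range] at hi; omega)
  rw [this, map_zero]

end Small

section Koszul

variable {𝓔 : FirstOrder s}

lemma evApp_alphaElt (M : GMod 𝓔) (x : RCat 𝓔) (a : FR 𝓔 x.U (x.deg + -1)) (z : 𝓔.E x.U)
    (m : Sct ((degF 𝓔 (-1)).obj M) x.U) : evApp M 0 0 rfl x (alphaElt M a z m) = 0 := by
  have hx : ∀ (r : 𝓔.D x.U) (hr : r ∈ 𝓔.fil x.U 1), a.val * r ∈ 𝓔.fil x.U (x.deg - 0) :=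
    fun r hr => 𝓔.mul_mem_fil (by ring) a.mem hr
  have h1 : ∀ (r r' : 𝓔.D x.U) (hr : r ∈ 𝓔.fil x.U 1) (hr' : r' ∈ 𝓔.fil x.U 1),
      evApp M 0 0 rfl x (mulD a r hr ⊗ₜ[Sec s x.U] mulOne M r' hr' m) =
        act (k := -1) M.obj x.deg (a.val * r * r') (𝓔.mul_mem_fil (by ring) (hx r hr)
          (mem_sub_neg_one 𝓔 hr')) m := fun r r' hr hr' =>
    act_act (k := -1) (j := 0) M.obj (mem_sub_neg_one 𝓔 hr') (hx r hr) m
  rw [alphaElt, map_sub, h1, h1, sub_eq_zero]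
  exact act_congr M.obj (by rw [mul_one, mul_one]) _ _ _

lemma alphaBar_ev (M : GMod 𝓔) : (alphaBar 𝓔).app M ≫ (ev 𝓔 0 0 rfl).app M = 0 := by
  apply (isGMod (𝓔 := 𝓔)).ι.map_injective
  exact NatTrans.ext (funext fun x => AddCommGrpCat.hom_ext
    (tensor_tensor_hom_ext _ fun a z m => evApp_alphaElt M x a z m))

namespace Small

variable {U : X.affineOpens} (c : Small 𝓔 U)

lemma op_tm (M : RCat 𝓔 ⥤ AddCommGrpCat.{0}) {i : ℕ} {k j l : ℤ} (h : k + 1 = j) (h' : i + j ≤ l)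
    (m : M.obj ⟨U, k⟩) : c.op M i h' (c.tm M h m) = c.op M i (by omega) m := c.op_op M _ _ m

lemma op_zm (M : RCat 𝓔 ⥤ AddCommGrpCat.{0}) {i : ℕ} {k j l : ℤ} (h : k + 1 = j) (h' : i + j ≤ l)
    (m : M.obj ⟨U, k⟩) : c.op M i h' (c.zm M h m) = c.op M (i + 1) (by push_cast; omega) m :=
  c.op_op M _ _ m

lemma tm_op (M : RCat 𝓔 ⥤ AddCommGrpCat.{0}) {i : ℕ} {k j l : ℤ} (h : i + k ≤ j) (h' : j + 1 = l)
    (m : M.obj ⟨U, k⟩) : c.tm M h' (c.op M i h m) = c.op M i (by omega) m := by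
  rw [tm, op_op]; exact c.op_congr M (zero_add i) _ m

lemma zm_op (M : RCat 𝓔 ⥤ AddCommGrpCat.{0}) {i : ℕ} {k j l : ℤ} (h : i + k ≤ j) (h' : j + 1 = l)
    (m : M.obj ⟨U, k⟩) : c.zm M h' (c.op M i h m) = c.op M (i + 1) (by push_cast; omega) m := by
  rw [zm, op_op]; exact c.op_congr M (add_comm 1 i) _ m

/-- The source of `alphaBar`. -/
noncomputable abbrev srcT (M : GMod 𝓔) : GMod 𝓔 :=
  (ind 𝓔 (-1)).obj ((tensorT 𝓔).obj ((degF 𝓔 (-1)).obj M))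

/-- The target of `alphaBar`. -/
noncomputable abbrev tgtR (M : GMod 𝓔) : GMod 𝓔 := (ind 𝓔 0).obj ((degF 𝓔 0).obj M)

variable (U) in
/-- The evaluation on sections. -/
noncomputable def evm (M : GMod 𝓔) (j : ℤ) : (tgtR M).obj.obj ⟨U, j⟩ →+ M.obj.obj ⟨U, j⟩ :=
  (((ev 𝓔 0 0 rfl).app M).hom.app ⟨U, j⟩).hom

variable (U) in
/-- The map `alphaBar` on sections. -/
noncomputable def alm (M : GMod 𝓔) (j : ℤ) :
    (srcT M).obj.obj ⟨U, j⟩ →+ (tgtR M).obj.obj ⟨U, j⟩ :=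
  (((alphaBar 𝓔).app M).hom.app ⟨U, j⟩).hom

variable (U) in
/-- The section `1 ⊗ m` of `R ⊗ M_0`. -/
noncomputable def genR (M : GMod 𝓔) : M.obj.obj ⟨U, 0⟩ →+ (tgtR M).obj.obj ⟨U, 0⟩ :=
  gen 𝓔 U 0 ((degF 𝓔 0).obj M) rfl

/-- The section `1 ⊗ z ⊗ u` of `R(-1) ⊗ T ⊗ M_{-1}`. -/
noncomputable def genT (M : GMod 𝓔) : M.obj.obj ⟨U, -1⟩ →+ (srcT M).obj.obj ⟨U, 1⟩ :=
  (gen 𝓔 U (-1) ((tensorT 𝓔).obj ((degF 𝓔 (-1)).obj M)) rfl).comp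
    (TensorProduct.mk (Sec s U) (TU 𝓔 U) (Sct ((degF 𝓔 (-1)).obj M) U)
      (Submodule.Quotient.mk c.z)).toAddMonoidHom

variable {M : GMod 𝓔}

lemma evm_op {i : ℕ} {k j : ℤ} (h : i + k ≤ j) (x : (tgtR M).obj.obj ⟨U, k⟩) :
    evm U M j (c.op _ i h x) = c.op _ i h (evm U M k x) :=
  c.op_nat ((ev 𝓔 0 0 rfl).app M).hom h x

lemma alm_op {i : ℕ} {k j : ℤ} (h : i + k ≤ j) (x : (srcT M).obj.obj ⟨U, k⟩) :
    alm U M j (c.op _ i h x) = c.op _ i h (alm U M k x) :=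
  c.op_nat ((alphaBar 𝓔).app M).hom h x

lemma evm_zm {k j : ℤ} (h : k + 1 = j) (x : (tgtR M).obj.obj ⟨U, k⟩) :
    evm U M j (c.zm _ h x) = c.zm _ h (evm U M k x) := c.evm_op _ x

lemma evm_tm {k j : ℤ} (h : k + 1 = j) (x : (tgtR M).obj.obj ⟨U, k⟩) :
    evm U M j (c.tm _ h x) = c.tm _ h (evm U M k x) := c.evm_op _ x

lemma alm_zm {k j : ℤ} (h : k + 1 = j) (x : (srcT M).obj.obj ⟨U, k⟩) :
    alm U M j (c.zm _ h x) = c.zm _ h (alm U M k x) := c.alm_op _ x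

lemma alm_tm {k j : ℤ} (h : k + 1 = j) (x : (srcT M).obj.obj ⟨U, k⟩) :
    alm U M j (c.tm _ h x) = c.tm _ h (alm U M k x) := c.alm_op _ x

lemma evm_genR (m : M.obj.obj ⟨U, 0⟩) : evm U M 0 (genR U M m) = m := act_one M.obj _ m

lemma evm_alm (j : ℤ) (q : (srcT M).obj.obj ⟨U, j⟩) : evm U M j (alm U M j q) = 0 :=
  ConcreteCategory.congr_hom (congr_app (congrArg (isGMod (𝓔 := 𝓔)).ι.map (alphaBar_ev M)) _) q

lemma genR_surjective (c : Small 𝓔 U) (p : (tgtR M).obj.obj ⟨U, 0⟩) : ∃ m, p = genR U M m := by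
  obtain ⟨m, hm⟩ := c.gen_surjective (k := 0) (V := (degF 𝓔 0).obj M) rfl p
  exact ⟨m, hm.symm⟩

lemma genR_injective (c : Small 𝓔 U) {m : M.obj.obj ⟨U, 0⟩} (h : genR U M m = 0) : m = 0 :=
  c.gen_injective (k := 0) (V := (degF 𝓔 0).obj M) rfl (h.trans (map_zero _).symm)

lemma tgtR_cases {m m' : ℤ} (hm : m + 1 = m') (h : 0 ≤ m) (x : (tgtR M).obj.obj ⟨U, m'⟩) :
    ∃ v y, x = c.op (tgtR M).obj 0 (by push_cast; omega) (genR U M v) +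
      c.zm (tgtR M).obj hm y := c.ind_cases (k := 0) (n := 0) rfl hm h x

lemma tgtR_unique {m m' : ℤ} (hm : m + 1 = m') (h : 0 ≤ m) {v : M.obj.obj ⟨U, 0⟩}
    {y : (tgtR M).obj.obj ⟨U, m⟩} (hx : c.op (tgtR M).obj 0 (by push_cast; omega) (genR U M v) +
      c.zm (tgtR M).obj hm y = 0) : v = 0 ∧ y = 0 := c.ind_unique (k := 0) (n := 0) rfl hm h hx

lemma exists_genT (w : Sct ((tensorT 𝓔).obj ((degF 𝓔 (-1)).obj M)) U) :
    ∃ u, gen 𝓔 U (-1) ((tensorT 𝓔).obj ((degF 𝓔 (-1)).obj M)) rfl w = c.genT M u := by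
  obtain ⟨u, hu⟩ := c.exists_tmul_TU (W := Sct ((degF 𝓔 (-1)).obj M) U) w
  exact ⟨u, congrArg _ hu⟩

lemma genT_surjective (q : (srcT M).obj.obj ⟨U, 1⟩) : ∃ u, q = c.genT M u := by
  obtain ⟨w, rfl⟩ := c.gen_surjective (k := -1)
    (V := (tensorT 𝓔).obj ((degF 𝓔 (-1)).obj M)) rfl q
  exact c.exists_genT w

lemma srcT_cases {m m' : ℤ} (hm : m + 1 = m') (h : 1 ≤ m) (x : (srcT M).obj.obj ⟨U, m'⟩) :
    ∃ u y, x = c.op (srcT M).obj 0 (by push_cast; omega) (c.genT M u) +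
      c.zm (srcT M).obj hm y := by
  obtain ⟨w, y, h⟩ := c.ind_cases (k := -1) (n := 1)
    (V := (tensorT 𝓔).obj ((degF 𝓔 (-1)).obj M)) rfl hm h x
  obtain ⟨u, hu⟩ := c.exists_genT w
  exact ⟨u, y, by rw [h, hu]⟩

lemma mulD_tmul_mulOne {r r' : 𝓔.D U} (hr : r ∈ 𝓔.fil U 1) (hr' : r' ∈ 𝓔.fil U 1) {i i' : ℕ}
    (hi : i + 0 ≤ (1 : ℤ)) (h : c.Z ^ i = r) (hi' : i' + -1 ≤ (0 : ℤ)) (h' : c.Z ^ i' = r')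
    (u : M.obj.obj ⟨U, -1⟩) :
    (mulD (n := 1) (FR.mk 𝓔 1 (𝓔.one_mem_fil_zero U)) r hr ⊗ₜ[Sec s U] mulOne M r' hr' u :
      FR 𝓔 U (1 + 0) ⊗[Sec s U] Sct ((degF 𝓔 0).obj M) U) =
      c.op (tgtR M).obj i (j := 1) hi (genR U M (c.op M.obj i' (k := -1) (j := 0) hi' u)) := by
  subst h h'
  refine Eq.trans ?_ (c.op_gen (V := (degF 𝓔 0).obj M) (k := 0) (n := 0) rfl hi _).symm
  refine congrArg (fun a => pur (k := 0) (n := 1) (V := (degF 𝓔 0).obj M) a _) ?_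
  exact FR.ext (by rw [val_mulD, val_Zp _ (by omega), FR.val_mk, one_mul])

lemma alm_genT (u : M.obj.obj ⟨U, -1⟩) : alm U M 1 (c.genT M u) =
    c.zm (tgtR M).obj rfl (genR U M (c.tm M.obj (k := -1) rfl u)) -
      c.tm (tgtR M).obj rfl (genR U M (c.zm M.obj (k := -1) rfl u)) := by
  exact congrArg₂ (fun a b : (tgtR M).obj.obj ⟨U, 1⟩ => a - b)
    (c.mulD_tmul_mulOne (𝓔.ιE_mem_fil c.z) (𝓔.one_mem_fil_one U) (i := 1) (i' := 0) (by simp)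
      (pow_one _) (by simp) (pow_zero _) u)
    (c.mulD_tmul_mulOne (𝓔.one_mem_fil_one U) (𝓔.ιE_mem_fil c.z) (i := 0) (i' := 1) (by simp)
      (pow_zero _) (by simp) (pow_one _) u)

lemma alm_t_genT {j i : ℤ} (h : (0 : ℕ) + 1 ≤ j) (hi : i + 1 = j) (u : M.obj.obj ⟨U, -1⟩) :
    alm U M j (c.op (srcT M).obj 0 h (c.genT M u)) =
    c.op (tgtR M).obj 0 (by push_cast; omega) (genR U M (-c.zm M.obj (k := -1) rfl u)) +
    c.zm (tgtR M).obj hi (c.op (tgtR M).obj 0 (j := i) (k := 0) (by push_cast; omega)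
      (genR U M (c.tm M.obj (k := -1) rfl u))) := by
  rw [alm_op, alm_genT, map_sub, op_zm, op_tm, zm_op, map_neg, map_neg]
  exact (neg_add_eq_sub _ _).symm

lemma Kos.ev_surjective {c : Small 𝓔 U} (hK : c.Kos M.obj) (n : ℕ) {j : ℤ} (hj : j = n) :
    Function.Surjective (evm U M j) := by
  induction n generalizing j with
  | zero =>
    obtain rfl : j = 0 := by simpa using hj
    exact fun m => ⟨_, evm_genR m⟩
  | succ n ih =>
    intro m
    obtain ⟨a, b, rfl⟩ := hK.surj (k := n) (by simp) (by rw [hj]; push_cast; rfl) m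
    obtain ⟨a, rfl⟩ := ih rfl a
    obtain ⟨b, rfl⟩ := ih rfl b
    refine ⟨c.zm _ (by rw [hj]; push_cast; rfl) a + c.tm _ (by rw [hj]; push_cast; rfl) b, ?_⟩
    rw [map_add, evm_zm, evm_tm]

lemma Kos.eq_zero_of_pow {c : Small 𝓔 U} (hK : c.Kos M.obj) (N : ℕ) {k j : ℤ} (hk : -1 ≤ k)
    (hj : k + N = j) (u : M.obj.obj ⟨U, k⟩) (hz : c.zm M.obj rfl u = 0)
    (ht : c.op M.obj 0 (j := j) (by push_cast; omega) u = 0) : u = 0 := by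
  induction N generalizing k with
  | zero =>
    obtain rfl : k = j := by simpa using hj
    rw [← c.op_zero M.obj k u]
    exact ht
  | succ N ih =>
    refine hK.inj hk rfl u (ih (by omega) (by push_cast at hj; omega) _ ?_ ?_) hz
    · rw [← tm_zm, hz, map_zero]
    · rw [tm, op_op]; exact ht

lemma Kos.alphaBar_injective {c : Small 𝓔 U} (hK : c.Kos M.obj) (j : ℤ) :
    Function.Injective (alm U M j) := by
  refine (injective_iff_map_eq_zero _).2 fun q hq => ?_
  rcases lt_or_ge j 1 with hj | hj
  · exact subsingleton_ind (-1) _ (by omega) q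
  obtain ⟨n, hn⟩ : ∃ n : ℕ, j = n + 1 := ⟨(j - 1).toNat, by omega⟩
  clear hj
  induction n generalizing j with
  | zero =>
    obtain rfl : j = 1 := by simpa using hn
    obtain ⟨u, rfl⟩ := c.genT_surjective q
    have := c.alm_t_genT (j := 1) (i := 0) (by simp) rfl u
    rw [c.op_zero, c.op_zero, hq] at this
    obtain ⟨h1, h2⟩ := c.tgtR_unique (m := 0) rfl le_rfl this.symm
    rw [hK.inj le_rfl rfl u (c.genR_injective h2) (neg_eq_zero.1 h1), map_zero]
  | succ n ih =>
    have hi : (n + 1 : ℤ) + 1 = j := by push_cast at hn; omega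
    obtain ⟨u, q', rfl⟩ := c.srcT_cases hi (by omega) q
    rw [map_add, c.alm_t_genT (by push_cast; omega) hi, alm_zm, add_assoc, ← map_add] at hq
    obtain ⟨e1, e2⟩ := c.tgtR_unique hi (by omega) hq
    have e3 := congrArg (evm U M _) e2
    rw [map_add, evm_alm, map_zero, add_zero, evm_op, evm_genR, op_tm] at e3
    have hu : u = 0 := hK.eq_zero_of_pow (n + 2) le_rfl (by push_cast; ring) u
      (neg_eq_zero.1 e1) e3
    subst hu
    rw [map_zero, map_zero, map_zero, zero_add] at e2
    rw [ih (n + 1) q' e2 rfl, map_zero, map_zero, map_zero, add_zero]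

lemma Kos.exists_alphaBar {c : Small 𝓔 U} (hK : c.Kos M.obj) (j : ℤ)
    (p : (tgtR M).obj.obj ⟨U, j⟩) (hp : evm U M j p = 0) : ∃ q, alm U M j q = p := by
  rcases lt_or_ge j 0 with hj | hj
  · exact ⟨0, by rw [map_zero]; exact (subsingleton_ind 0 _ (by omega) p).symm⟩
  obtain ⟨n, hn⟩ : ∃ n : ℕ, j = n := ⟨j.toNat, by omega⟩
  clear hj
  induction n generalizing j with
  | zero =>
    obtain rfl : j = 0 := by simpa using hn
    obtain ⟨m, rfl⟩ := c.genR_surjective p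
    rw [evm_genR] at hp
    exact ⟨0, by rw [map_zero, hp, map_zero]⟩
  | succ n ih =>
    have hi : (n : ℤ) + 1 = j := by push_cast at hn; omega
    obtain ⟨m, y, rfl⟩ := c.tgtR_cases hi (by omega) p
    have h1 : c.zm M.obj hi (evm U M n y) =
        c.tm M.obj hi (-c.op M.obj 0 (k := 0) (by push_cast; omega) m) := by
      rw [map_add, evm_op, evm_genR, evm_zm] at hp
      rw [map_neg, tm_op, ← add_eq_zero_iff_eq_neg, add_comm]
      exact hp
    obtain ⟨u, hu, hu'⟩ := hK.mid (k := n - 1) (by omega) (by ring) hi _ _ h1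
    cases n with
    | zero =>
      obtain rfl : j = 1 := by simpa using hn
      obtain ⟨y, rfl⟩ := c.genR_surjective y
      refine ⟨c.genT M u, ?_⟩
      have e1 : c.tm M.obj (k := -1) rfl u = y := hu.trans (evm_genR y)
      have e2 : c.zm M.obj (k := -1) rfl u = -m := hu'.trans (congrArg _ (c.op_zero M.obj 0 m))
      rw [alm_genT, e1, e2, map_neg, map_neg, sub_neg_eq_add, add_comm]
      rfl
    | succ n =>
      obtain ⟨x, hx⟩ := hK.ev_surjective n (j := ((n + 1 : ℕ) : ℤ) - 1) (by push_cast; ring) u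
      obtain ⟨q, hq⟩ := ih ((n + 1 : ℕ) : ℤ) (y - c.tm (tgtR M).obj (by ring) x) (by
        rw [map_sub, evm_tm, hx, sub_eq_zero, ← hu]) rfl
      obtain ⟨q', hq'⟩ := ih ((n + 1 : ℕ) : ℤ) (c.op (tgtR M).obj 0 (k := 0) (by push_cast; omega)
        (genR U M m) + c.zm (tgtR M).obj (k := ((n + 1 : ℕ) : ℤ) - 1) (by ring) x) (by
        rw [map_add, evm_op, evm_genR, evm_zm, hx, hu', add_neg_cancel]) rfl
      refine ⟨c.zm (srcT M).obj hi q + c.tm (srcT M).obj hi q', ?_⟩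
      rw [map_add, alm_zm, alm_tm, hq, hq', map_sub, map_add, tm_zm, tm_op]
      abel

end Small

end Koszul

section Subfunctor

variable {J : Type} [Category.{0} J] (M : J ⥤ AddCommGrpCat.{0}) (S : ∀ x, AddSubgroup (M.obj x))
  (hS : ∀ {x y : J} (g : x ⟶ y) (m : M.obj x), m ∈ S x → M.map g m ∈ S y)

/-- The subfunctor of a functor to abelian groups given by a family of subgroups. -/
def subFun : J ⥤ AddCommGrpCat.{0} where
  obj x := AddCommGrpCat.of (S x)
  map {x y} g := AddCommGrpCat.ofHom (((M.map g).hom.comp (S x).subtype).codRestrict (S y)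
    fun m => hS g m.1 m.2)
  map_id x := by
    ext m
    exact ConcreteCategory.congr_hom (M.map_id x) m.1
  map_comp g j := by
    ext m
    exact ConcreteCategory.congr_hom (M.map_comp g j) m.1

/-- The inclusion of a subfunctor. -/
def subFunι : subFun M S hS ⟶ M where
  app x := AddCommGrpCat.ofHom (S x).subtype

lemma subFunι_injective (x : J) : Function.Injective ((subFunι M S hS).app x) :=
  Subtype.val_injective

end Subfunctor

section SubGr

variable {𝓔 : FirstOrder s} {M : RCat 𝓔 ⥤ AddCommGrpCat.{0}} {S : ∀ x, AddSubgroup (M.obj x)}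
  {hS : ∀ {x y : RCat 𝓔} (g : x ⟶ y) (m : M.obj x), m ∈ S x → M.map g m ∈ S y}

lemma isGr_subFun (hM : isGr M) (h : ∀ (U : X.affineOpens) (f : Sec s U) (k : ℤ)
    (y : M.obj ⟨bas s f, k⟩), y ∈ S _ → ∃ (n : ℕ) (x : M.obj ⟨U, k⟩), x ∈ S _ ∧
      (degFun 𝓔 k ⋙ M).map (OCat.mul _ (resO s (bas_le s f) f ^ n)) y =
        (degFun 𝓔 k ⋙ M).map (OCat.restr (bas_le s f)) x) : isGr (subFun M S hS) := by
  refine ⟨fun x y h a b ha hb => ?_, fun k => ⟨fun x y h a b => ?_, fun U f =>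
    ⟨fun y => ?_, fun x hx => ?_⟩⟩⟩
  · ext m
    exact Subtype.ext (ConcreteCategory.congr_hom (hM.1 h a b ha hb) m.1)
  · ext m
    exact Subtype.ext (ConcreteCategory.congr_hom ((hM.2 k).1 h a b) m.1)
  · obtain ⟨n, x, hx, e⟩ := h U f k y.1 y.2
    exact ⟨n, ⟨x, hx⟩, Subtype.ext e⟩
  · obtain ⟨n, hn⟩ := ((hM.2 k).2 U f).2 x.1 (congrArg Subtype.val hx)
    exact ⟨n, Subtype.ext hn⟩

end SubGr

section Induced

variable {𝓔 : FirstOrder s}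

/-- The object `R(k) ⊗ V` of `Gr R`. -/
noncomputable def grInd (𝓔 : FirstOrder s) (k : ℤ) (V : OMod s) (hV : isQCoh V.obj) : Gr 𝓔 :=
  ⟨((ind 𝓔 k).obj V).obj, isGr_ind k V hV⟩

/-- A morphism of presheaves of graded modules as a morphism of `Gr R`. -/
noncomputable def grHom {M N : GMod 𝓔} (hM : isGr M.obj) (hN : isGr N.obj) (f : M ⟶ N) :
    (⟨M.obj, hM⟩ : Gr 𝓔) ⟶ ⟨N.obj, hN⟩ := ObjectProperty.homMk f.hom

/-- The inclusion of `Dᵐ` in `Dⁿ`. -/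
noncomputable def FR.incl {U : X.affineOpens} {m n : ℤ} (h : m ≤ n) : FR 𝓔 U m →+ FR 𝓔 U n :=
  AddMonoidHom.mk' (fun a => FR.mk 𝓔 a.val (𝓔.fil_mono U h a.mem)) (fun _ _ => rfl)

lemma FR.val_incl {U : X.affineOpens} {m n : ℤ} (h : m ≤ n) (a : FR 𝓔 U m) :
    (FR.incl h a).val = a.val := rfl

lemma FR.incl_smul {U : X.affineOpens} {m n : ℤ} (h : m ≤ n) (f : Sec s U) (a : FR 𝓔 U m) :
    FR.incl h (f • a) = f • FR.incl h a :=
  FR.ext (by rw [FR.val_incl, FR.val_smul, FR.val_smul, FR.val_incl])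

lemma FR.incl_map {k k' : ℤ} (h : k ≤ k') {x y : RCat 𝓔} (g : x ⟶ y)
    (a : FR 𝓔 x.U (x.deg + k)) : FR.incl (add_le_add_right h y.deg) (FR.map 𝓔 k g a) =
      FR.map 𝓔 k' g (FR.incl (add_le_add_right h x.deg) a) :=
  FR.ext (by rw [FR.val_incl, FR.val_map, FR.val_map, FR.val_incl])

/-- The inclusion on sections. -/
noncomputable def inclApp {U : X.affineOpens} {m n : ℤ} (h : m ≤ n) (V : OMod s) :
    FR 𝓔 U m ⊗[Sec s U] Sct V U →+ FR 𝓔 U n ⊗[Sec s U] Sct V U :=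
  tensorMap (RingHom.id (Sec s U)) (FR.incl h) (AddMonoidHom.id _) (FR.incl_smul h)
    (fun _ _ => rfl)

lemma inclApp_tmul {U : X.affineOpens} {m n : ℤ} (h : m ≤ n) (V : OMod s) (a : FR 𝓔 U m)
    (v : Sct V U) : inclApp h V (a ⊗ₜ[Sec s U] v) = FR.incl h a ⊗ₜ[Sec s U] v := rfl

lemma inclApp_map {k k' : ℤ} (h : k ≤ k') (V : OMod s) {x y : RCat 𝓔} (g : x ⟶ y) :
    (inclApp (add_le_add_right h y.deg) V).comp (tensorMap (resO s g.sub) (FR.map 𝓔 k g)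
      (Sct.res V g.sub) (FR.map_smul 𝓔 k g) (Sct.res_smul V g.sub)) =
    (tensorMap (resO s g.sub) (FR.map 𝓔 k' g) (Sct.res V g.sub) (FR.map_smul 𝓔 k' g)
      (Sct.res_smul V g.sub)).comp (inclApp (add_le_add_right h x.deg) V) :=
  tensor_hom_ext fun a v => by
    rw [AddMonoidHom.comp_apply, AddMonoidHom.comp_apply, tensorMap_tmul, inclApp_tmul,
      inclApp_tmul, tensorMap_tmul, FR.incl_map h g]

/-- The inclusion `R(k) ⊗ V → R(k') ⊗ V` for `k ≤ k'`. -/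
noncomputable def indIncl {k k' : ℤ} (h : k ≤ k') (V : OMod s) :
    (ind 𝓔 k).obj V ⟶ (ind 𝓔 k').obj V := ObjectProperty.homMk
  { app x := AddCommGrpCat.ofHom (inclApp (add_le_add_right h x.deg) V)
    naturality x y g := AddCommGrpCat.hom_ext (inclApp_map h V g) }

namespace Small

variable {U : X.affineOpens} (c : Small 𝓔 U)

lemma indIncl_gen {k k' n : ℤ} (h : k + 1 = k') {n' : ℤ} (hn : n + k = 0) (hn' : n' + k' = 0)
    (hnn : n' + 1 = n) (V : OMod s) (v : Sct V U) :
    (indIncl (𝓔 := 𝓔) (show k ≤ k' by omega) V).hom.app ⟨U, n⟩ (gen 𝓔 U k V hn v) =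
      c.tm ((ind 𝓔 k').obj V).obj hnn (gen 𝓔 U k' V hn' v) := by
  rw [tm, op_gen]
  change pur (FR.incl _ _) v = _
  congr 2
  refine FR.ext ?_
  rw [val_Zp _ (by push_cast; omega), pow_zero]
  rfl

lemma indIncl_injective (c : Small 𝓔 U) {k k' : ℤ} (h : k + 1 = k') (V : OMod s) (j : ℤ) :
    Function.Injective ((indIncl (𝓔 := 𝓔) (show k ≤ k' by omega) V).hom.app ⟨U, j⟩) := by
  refine (injective_iff_map_eq_zero _).2 fun q hq => ?_
  rcases lt_or_ge (j + k) 0 with hj | hj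
  · exact subsingleton_ind k V hj q
  obtain ⟨n, hn⟩ : ∃ n : ℕ, j = n + -k := ⟨(j + k).toNat, by omega⟩
  clear hj
  have hk : -k + k = 0 := by omega
  have hk' : -k - 1 + k' = 0 := by omega
  induction n generalizing j with
  | zero =>
    obtain rfl : j = -k := by simpa using hn
    obtain ⟨v, rfl⟩ := c.gen_surjective hk q
    rw [c.indIncl_gen h hk hk' (sub_add_cancel _ _)] at hq
    have := c.ind_unique (n := -k - 1) (m := -k - 1) hk' (sub_add_cancel _ _) le_rfl (v := v)
      (y := 0) (by rw [map_zero, add_zero]; exact hq)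
    rw [this.1, map_zero]
  | succ n ih =>
    have hi : ((n : ℤ) + -k) + 1 = j := by push_cast at hn; omega
    obtain ⟨v, q', rfl⟩ := c.ind_cases hk hi (by omega) q
    rw [map_add, op_nat, zm, op_nat, c.indIncl_gen h hk hk' (sub_add_cancel _ _), op_tm] at hq
    have := c.ind_unique (n := -k - 1) (m := n + -k) hk' hi (by omega) hq
    rw [this.1, ih _ q' this.2 rfl, map_zero, map_zero, map_zero, add_zero]

end Small

end Induced

section Epsilon

variable {𝓔 : FirstOrder s} (h : TensorQC 𝓔)

/-- The evaluation `R ⊗ M_0 → M`. -/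
noncomputable def eps : termR h ⟶ 𝟭 (Gr 𝓔) where
  app M := ObjectProperty.homMk ((ev 𝓔 0 0 rfl).app (gm M)).hom
  naturality M N φ := by
    apply (isGr (𝓔 := 𝓔)).ι.map_injective
    exact congrArg (isGMod (𝓔 := 𝓔)).ι.map ((ev 𝓔 0 0 rfl).naturality (gmMap φ))

lemma diffT_eps : diffT h ≫ eps h = 0 := by
  ext1; ext1 M
  apply (isGr (𝓔 := 𝓔)).ι.map_injective
  exact congrArg (isGMod (𝓔 := 𝓔)).ι.map (alphaBar_ev (gm M))

variable [IsSmoothCurve s]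

/-- Koszul exactness over all coordinate neighbourhoods. -/
def IsKos (M : Gr 𝓔) : Prop := ∀ (U : X.affineOpens) (c : Small 𝓔 U), c.Kos M.obj

lemma irrelevant_of_nonneg {M : Gr 𝓔}
    (hM : ∀ (U : X.affineOpens) (_ : Small 𝓔 U) (k : ℤ) (_ : 0 ≤ k) (m : M.obj.obj ⟨U, k⟩), m = 0) :
    irrelevant 𝓔 M := fun U k m => ⟨-k, fun j hj r hr =>
  eq_zero_of_small j (fun U c y => hM U c j (by omega) y) U _⟩

lemma IsKos.mono_diffT {M : Gr 𝓔} (hM : IsKos M) : Mono ((diffT h).app M) :=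
  gr_mono_of_injective _ fun ⟨U, n⟩ => injective_of_small _ n
    (fun U c => (hM U c).alphaBar_injective (M := gm M) n) U

lemma IsKos.exact {M : Gr 𝓔} (hM : IsKos M) : (ShortComplex.mk ((diffT h).app M) ((eps h).app M)
    (congr_app (diffT_eps h) M)).Exact :=
  gr_exact_of_small fun U c k y hy => (hM U c).exists_alphaBar (M := gm M) k y hy

lemma IsKos.irrelevant_cokernel {M : Gr 𝓔} (hM : IsKos M) :
    irrelevant 𝓔 (cokernel ((eps h).app M)) := by
  refine irrelevant_of_nonneg fun U c k hk m => ?_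
  obtain ⟨m, rfl⟩ := app_surjective (cokernel.π ((eps h).app M)).hom _ m
  obtain ⟨p, rfl⟩ := (hM U c).ev_surjective (M := gm M) k.toNat (j := k) (by omega) m
  exact app_zero_of_comp (cokernel.condition ((eps h).app M)) _ p

lemma IsKos.shortExact {M : Gr 𝓔} (hM : IsKos M) :
    (ShortComplex.mk ((π 𝓔).map ((diffT h).app M)) ((π 𝓔).map ((eps h).app M))
      (by rw [← Functor.map_comp, ← NatTrans.comp_app, diffT_eps]; exact (π 𝓔).map_zero _ _)).ShortExact where
  exact := (hM.exact h).map (π 𝓔)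
  mono_f := by
    have := hM.mono_diffT h
    infer_instance
  epi_g := (ObjectProperty.SerreClassLocalization.epi_map_iff (π 𝓔) (irrelevant 𝓔) _).2
    (hM.irrelevant_cokernel h)

end Epsilon

section DegreeOne

variable {𝓔 : FirstOrder s} (M : GMod 𝓔) {U : X.affineOpens} {k j : ℤ}

lemma ιE_mem_of (h : k + 1 = j) (e : 𝓔.E U) : 𝓔.ιE U e ∈ 𝓔.fil U (j - k) := by
  rw [← h, add_sub_cancel_left]; exact 𝓔.ιE_mem_fil e

/-- The action of `D¹` as a map `M_k → M_{k+1}`. -/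
noncomputable def eact (h : k + 1 = j) (e : 𝓔.E U) :
    Sct ((degF 𝓔 k).obj M) U →+ Sct ((degF 𝓔 j).obj M) U :=
  actHom M.obj j (𝓔.ιE U e) (ιE_mem_of h e)

lemma eact_add (h : k + 1 = j) (e e' : 𝓔.E U) (m : Sct ((degF 𝓔 k).obj M) U) :
    eact M h (e + e') m = eact M h e m + eact M h e' m :=
  (act_congr M.obj (map_add (𝓔.ιE U) e e') _
    (add_mem (ιE_mem_of h e) (ιE_mem_of h e')) m).trans
    (act_add M.property (ιE_mem_of h e) (ιE_mem_of h e') m)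

lemma eact_smul_left (h : k + 1 = j) (f : Sec s U) (e : 𝓔.E U) (m : Sct ((degF 𝓔 k).obj M) U) :
    eact M h (f • e) m = f • eact M h e m :=
  (act_congr M.obj (𝓔.ιE_smul U f e) _ (𝓔.mul_mem_fil (by ring)
    (show _ ∈ 𝓔.fil U (j - j) by rw [sub_self]; exact 𝓔.ιO_mem_fil f) (ιE_mem_of h e)) m).trans
    (act_act M.obj (ιE_mem_of h e) (by rw [sub_self]; exact 𝓔.ιO_mem_fil f) m).symm

lemma eact_smul (h : k + 1 = j) (f : Sec s U) (e : 𝓔.E U) (m : Sct ((degF 𝓔 k).obj M) U) :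
    eact M h e (f • m) = f • eact M h e m + 𝓔.anchor U e f • eact M h (𝓔.one U) m := by
  rw [← eact_smul_left, ← eact_smul_left, ← eact_add]
  exact (act_act M.obj (by rw [sub_self]; exact 𝓔.ιO_mem_fil f) (ιE_mem_of h e) m).trans
    (act_congr M.obj (𝓔.ιE_mul_ιO U e f) _ _ m)

lemma eact_one_smul (h : k + 1 = j) (f : Sec s U) (m : Sct ((degF 𝓔 k).obj M) U) :
    eact M h (𝓔.one U) (f • m) = f • eact M h (𝓔.one U) m := by
  rw [eact_smul, 𝓔.anchor_one, Derivation.zero_apply, zero_smul, add_zero]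

lemma sct_res_eq {W : X.affineOpens} (hW : W ≤ U) (m : Sct ((degF 𝓔 k).obj M) U) :
    Sct.res _ hW m = M.obj.map (X := ⟨U, k⟩) (Y := ⟨W, k⟩)
      ⟨hW, 1, by dsimp; rw [sub_self]; exact 𝓔.one_mem_fil_zero W⟩ m :=
  map_congr M.obj (map_one (𝓔.ιO W)) m

lemma eact_res (h : k + 1 = j) {W : X.affineOpens} (hW : W ≤ U) (e : 𝓔.E U)
    (m : Sct ((degF 𝓔 k).obj M) U) :
    Sct.res _ hW (eact M h e m) = eact M h (𝓔.res hW e) (Sct.res _ hW m) := by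
  rw [sct_res_eq, sct_res_eq]
  refine (map_map_res _ _ _ _).trans (Eq.trans (map_congr _ ?_ _) (map_map_res _ _ _ _).symm)
  change 1 * 𝓔.resD hW (𝓔.ιE U e) = 𝓔.ιE W (𝓔.res hW e) * 𝓔.resD le_rfl 1
  rw [one_mul, map_one, mul_one, 𝓔.resD_ιE]

lemma map_eq_act_res {x y : RCat 𝓔} (g : x ⟶ y) (m : M.obj.obj x) :
    M.obj.map g m = act (k := x.deg) M.obj y.deg g.val g.mem
      (Sct.res ((degF 𝓔 x.deg).obj M) g.sub m) := by
  refine Eq.trans ?_ (congrArg (act (k := x.deg) M.obj y.deg g.val g.mem)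
    (sct_res_eq M (k := x.deg) g.sub m).symm)
  refine (map_congr M.obj ?_ m).trans (map_map_res _ _ _ _).symm
  change g.val = g.val * 𝓔.resD le_rfl 1
  rw [map_one, mul_one]

/-- Sections killed by `D¹` are killed by all operators of positive order. -/
lemma act_eq_zero_of_eact (m : Sct ((degF 𝓔 k).obj M) U) (hm : ∀ e, eact M rfl e m = 0)
    (h : k ≠ j) (r : 𝓔.D U) (hr : r ∈ 𝓔.fil U (j - k)) : act (k := k) M.obj j r hr m = 0 := by
  suffices r ∈ ann (k := k) M.property j m from this.2
  rcases lt_or_gt_of_ne h with h | h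
  · obtain ⟨n, hn⟩ : ∃ n : ℕ, j - k = (n + 1 : ℕ) := ⟨(j - k - 1).toNat, by push_cast; omega⟩
    have hr' := hr
    rw [hn, 𝓔.fil_succ] at hr'
    rw [← Submodule.span_eq (𝓔.fil U n), ← Submodule.span_eq (𝓔.imE U),
      Submodule.span_mul_span] at hr'
    refine Submodule.span_induction (p := fun r _ => r ∈ ann (k := k) M.property j m) ?_
      (zero_mem _) (fun x y _ _ => add_mem) (fun z x _ hx => zsmul_mem hx z) hr'
    rintro _ ⟨b, hb, _, ⟨e, rfl⟩, rfl⟩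
    have hb' : b ∈ 𝓔.fil U (j - (k + 1)) := by
      rwa [show j - (k + 1) = n by push_cast at hn; omega]
    refine ⟨𝓔.mul_mem_fil (by ring) hb' (ιE_mem_of rfl e), ?_⟩
    refine (act_act M.obj (ιE_mem_of rfl e) hb' m).symm.trans ?_
    exact (congrArg _ (hm e)).trans (act_zero M.obj hb')
  · rw [𝓔.fil_neg U (by omega), Submodule.mem_bot] at hr
    rw [hr]
    exact zero_mem _

lemma eact_res_eq_zero {W : X.affineOpens} (hW : W ≤ U) (m : Sct ((degF 𝓔 k).obj M) U)
    (h : k + 1 = j) (hm : ∀ e, eact M h e m = 0) (e : 𝓔.E W) :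
    eact M h e (Sct.res _ hW m) = 0 := by
  have he : e ∈ Submodule.span (Sec s W) (Set.range (𝓔.res hW)) := by
    rw [span_resE]; exact Submodule.mem_top
  induction he using Submodule.span_induction with
  | mem x hx =>
    obtain ⟨e, rfl⟩ := hx
    rw [← eact_res, hm, map_zero]
  | zero =>
    rw [← zero_smul (Sec s W) (0 : 𝓔.E W), eact_smul_left, zero_smul]
  | add x y _ _ hx hy => rw [eact_add, hx, hy, add_zero]
  | smul f x _ hx => rw [eact_smul_left, hx, smul_zero]

lemma Small.eact_eq_zero (c : Small 𝓔 U) (h : k + 1 = j) (m : Sct ((degF 𝓔 k).obj M) U)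
    (ht : eact M h (𝓔.one U) m = 0) (hz : eact M h c.z m = 0) (e : 𝓔.E U) : eact M h e m = 0 := by
  obtain ⟨a, b, rfl⟩ := c.span e
  rw [eact_add, eact_smul_left, eact_smul_left, ht, hz, smul_zero, smul_zero, add_zero]

end DegreeOne

section TorsionFree

variable {𝓔 : FirstOrder s} (M : Gr 𝓔) (k : ℤ)

/-- The sections of degree `k` that are killed by `D¹`. -/
noncomputable def killed (x : RCat 𝓔) : AddSubgroup (M.obj.obj x) where
  carrier := {m | (x.deg ≠ k → m = 0) ∧ ∀ e, eact (k := x.deg) (gm M) rfl e m = 0}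
  zero_mem' := ⟨fun _ => rfl, fun _ => map_zero _⟩
  add_mem' := by
    rintro a b ⟨h1, h2⟩ ⟨h3, h4⟩
    exact ⟨fun h => by rw [h1 h, h3 h, add_zero], fun e => (map_add _ _ _).trans (by
      rw [h2, h4, add_zero])⟩
  neg_mem' := by
    rintro a ⟨h1, h2⟩
    exact ⟨fun h => by rw [h1 h, neg_zero], fun e => (map_neg _ _).trans (by rw [h2, neg_zero])⟩

variable {k}

lemma map_mem_killed {x y : RCat 𝓔} (g : x ⟶ y) (m : M.obj.obj x) (hm : m ∈ killed M k x) :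
    M.obj.map g m ∈ killed M k y := by
  by_cases hx : x.deg = k
  swap
  · rw [hm.1 hx, map_zero]; exact zero_mem _
  have hres := eact_res_eq_zero (gm M) g.sub m rfl hm.2
  rw [show M.obj.map g m = _ from map_eq_act_res (gm M) g m]
  by_cases hy : x.deg = y.deg
  · obtain ⟨x, d⟩ := x
    obtain ⟨y, d'⟩ := y
    obtain rfl : d = d' := hy
    refine ⟨fun h => (h hx).elim, fun e => ?_⟩
    obtain ⟨sub, r, hr⟩ := g
    have hr' : r ∈ 𝓔.fil y 0 := by rw [← sub_self d]; exact hr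
    rw [𝓔.fil_zero] at hr'
    obtain ⟨f, rfl⟩ := hr'
    change eact (gm M) rfl e (f • Sct.res ((degF 𝓔 d).obj (gm M)) sub m) = 0
    rw [eact_smul, hres, hres, smul_zero, smul_zero, add_zero]
  · have := act_eq_zero_of_eact (gm M) _ hres hy g.val g.mem
    exact this.symm ▸ zero_mem (killed M k y)

variable [IsSmoothCurve s]

lemma exists_pow_smul_killed {U : X.affineOpens} (f : Sec s U)
    (x : Sct ((degF 𝓔 k).obj (gm M)) U)
    (hx : ∀ e : 𝓔.E (bas s f), eact (gm M) rfl e (Sct.res _ (bas_le s f) x) = 0) :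
    ∃ L : ℕ, ∀ e, eact (gm M) rfl e (f ^ L • x) = 0 := by
  have h1 : ∀ e : 𝓔.E U, ∃ n : ℕ, f ^ n • eact (gm M) rfl e x = 0 := fun e =>
    (isLoc_Sct (V := (degF 𝓔 (k + 1)).obj (gm M)) (M.property.2 (k + 1)) f).inj _
      ((eact_res (gm M) rfl (bas_le s f) e x).trans (hx _))
  obtain ⟨S, hS⟩ := (finite_E (𝓔 := 𝓔) U).fg_top
  choose n hn using h1
  let N := S.sup n + n (𝓔.one U)
  have hpow : ∀ {y : Sct ((degF 𝓔 (k + 1)).obj (gm M)) U} {a b : ℕ}, a ≤ b → f ^ a • y = 0 →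
      f ^ b • y = 0 := fun h h' => by
    rw [← Nat.sub_add_cancel h, pow_add, mul_smul, h', smul_zero]
  refine ⟨N + 1, fun e => ?_⟩
  have he : e ∈ Submodule.span (Sec s U) (S : Set (𝓔.E U)) := hS ▸ Submodule.mem_top
  induction he using Submodule.span_induction with
  | mem e he =>
    have hle : n e ≤ S.sup n := Finset.le_sup (f := n) he
    rw [eact_smul, hpow (show n e ≤ N + 1 by omega) (hn e), Derivation.leibniz_pow,
      Nat.add_sub_cancel, zero_add, show (N + 1) • f ^ N • 𝓔.anchor U e f =
        ((N + 1) • 𝓔.anchor U e f) * f ^ N by simp only [nsmul_eq_mul, smul_eq_mul]; ring,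
      mul_smul, hpow (show n (𝓔.one U) ≤ N by omega) (hn _), smul_zero]
  | zero => rw [← zero_smul (Sec s U) (0 : 𝓔.E U), eact_smul_left, zero_smul]
  | add x y _ _ hx hy => rw [eact_add, hx, hy, add_zero]
  | smul f x _ hx => rw [eact_smul_left, hx, smul_zero]

lemma exists_killed {U : X.affineOpens} (f : Sec s U)
    (y : Sct ((degF 𝓔 k).obj (gm M)) (bas s f)) (hy : ∀ e, eact (gm M) rfl e y = 0) :
    ∃ (L : ℕ) (x : Sct ((degF 𝓔 k).obj (gm M)) U), (∀ e, eact (gm M) rfl e x = 0) ∧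
      resO s (bas_le s f) f ^ L • y = Sct.res _ (bas_le s f) x := by
  obtain ⟨n, x, hx⟩ := (isLoc_Sct (V := (degF 𝓔 k).obj (gm M)) (M.property.2 k) f).surj y
  obtain ⟨L, hL⟩ := exists_pow_smul_killed M f x fun e => by
    rw [← hx, eact_smul, hy, hy, smul_zero, smul_zero, add_zero]
  refine ⟨L + n, f ^ L • x, hL, ?_⟩
  rw [Sct.res_smul, ← hx, pow_add, mul_smul, map_pow]

variable (k) in
/-- The submodule of the sections of degree `k` that are killed by `D¹`. -/
noncomputable def killedGr : Gr 𝓔 :=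
  ⟨subFun M.obj (killed M k) (map_mem_killed M), isGr_subFun M.property fun U f j y hy => by
    by_cases hj : j = k
    · subst hj
      obtain ⟨L, x, hx, e⟩ := exists_killed M f y hy.2
      exact ⟨L, x, ⟨fun h => (h rfl).elim, hx⟩, e⟩
    · obtain rfl : y = 0 := hy.1 hj
      exact ⟨0, 0, zero_mem _, (map_zero ((degFun 𝓔 j ⋙ M.obj).map _).hom).trans
        (map_zero ((degFun 𝓔 j ⋙ M.obj).map _).hom).symm⟩⟩

/-- Injective objects of `Gr R` without nonzero maps from irrelevant modules. -/
structure IsSat : Prop where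
  inj : Injective M
  tors : ∀ (N : Gr 𝓔) (_ : irrelevant 𝓔 N) (f : N ⟶ M), f = 0

variable {M}

lemma irrelevant_killedGr (k : ℤ) : irrelevant 𝓔 (killedGr M k) := fun U j m =>
  ⟨1, fun i hi r hr => by
    by_cases h : j = k
    · refine Subtype.ext ?_
      have := act_eq_zero_of_eact (gm M) (k := j) m.1 m.2.2 (j := i) (by omega) r hr
      exact this
    · have : m = 0 := Subtype.ext (m.2.1 h)
      rw [this]
      exact act_zero _ _⟩

lemma IsSat.eq_zero (hM : IsSat M) {U : X.affineOpens} {k j : ℤ} (h : k + 1 = j)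
    (m : M.obj.obj ⟨U, k⟩) (hm : ∀ e, eact (k := k) (gm M) h e m = 0) : m = 0 := by
  subst h
  have := hM.tors _ (irrelevant_killedGr k) (ObjectProperty.homMk (subFunι M.obj (killed M k) (map_mem_killed M)))
  have h2 := congr_app (congrArg (isGr (𝓔 := 𝓔)).ι.map this) ⟨U, k⟩
  exact ConcreteCategory.congr_hom h2 ⟨m, ⟨fun h => (h rfl).elim, hm⟩⟩

lemma Small.eact_z {U : X.affineOpens} (c : Small 𝓔 U) {k j : ℤ} (h : k + 1 = j)
    (m : M.obj.obj ⟨U, k⟩) : eact (k := k) (gm M) h c.z m = c.zm M.obj h m :=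
  act_congr M.obj (pow_one _).symm _ _ _

lemma Small.eact_one {U : X.affineOpens} (c : Small 𝓔 U) {k j : ℤ} (h : k + 1 = j)
    (m : M.obj.obj ⟨U, k⟩) : eact (k := k) (gm M) h (𝓔.one U) m = c.tm M.obj h m :=
  act_congr M.obj ((𝓔.ιE_one U).trans (pow_zero _).symm) _ _ _

lemma IsSat.kos_inj (hM : IsSat M) {U : X.affineOpens} (c : Small 𝓔 U) {k j : ℤ} (h : k + 1 = j)
    (u : M.obj.obj ⟨U, k⟩) (ht : c.tm M.obj h u = 0) (hz : c.zm M.obj h u = 0) : u = 0 := by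
  refine hM.eq_zero h u fun e => ?_
  exact c.eact_eq_zero (gm M) h u ((c.eact_one h u).trans ht) ((c.eact_z h u).trans hz) e

lemma IsSat.tm_surjective (hM : IsSat M) {U : X.affineOpens} (c : Small 𝓔 U) {k j : ℤ}
    (h : k + 1 = j) : Function.Surjective (c.tm M.obj h) := by
  intro m
  have hV : isQCoh ((degF 𝓔 j).obj (gm M)).obj := M.property.2 j
  let V := (degF 𝓔 j).obj (gm M)
  let ι : grInd 𝓔 (-j) V hV ⟶ grInd 𝓔 (-k) V hV :=
    grHom _ _ (indIncl (show -j ≤ -k by omega) V)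
  have : Mono ι := gr_mono_of_injective _ fun ⟨U, n⟩ => injective_of_small _ n
    (fun U c => c.indIncl_injective (show -j + 1 = -k by omega) V n) U
  let e : grInd 𝓔 (-j) V hV ⟶ M := grHom _ M.property ((ev 𝓔 (-j) j (by omega)).app (gm M))
  have := hM.inj
  let g := Injective.factorThru e ι
  have hg : ι ≫ g = e := Injective.comp_factorThru e ι
  let x := Small.gen 𝓔 U (-k) V (n := k) (by omega) m
  refine ⟨g.hom.app ⟨U, k⟩ x, ?_⟩
  have h1 := c.op_nat g.hom (i := 0) (k := k) (j := j) (by push_cast; omega) x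
  have h2 := c.indIncl_gen (show -j + 1 = -k by omega) (n := j) (n' := k) (by omega) (by omega) h
    V m
  have h4 := ConcreteCategory.congr_hom (congr_app (congrArg (isGr (𝓔 := 𝓔)).ι.map hg) ⟨U, j⟩)
    (Small.gen 𝓔 U (-j) V (n := j) (by omega) m)
  exact h1.symm.trans ((congrArg (g.hom.app ⟨U, j⟩) h2.symm).trans
    (h4.trans (act_one M.obj _ m)))

end TorsionFree

section Differentials

open KaehlerDifferential

/-- Restriction of differential forms. -/
noncomputable def resΩ {U W : X.affineOpens} (h : W ≤ U) : Ω[Sec s U⁄ℂ] →+ Ω[Sec s W⁄ℂ] :=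
  letI := (resO s h).toAlgebra
  haveI : IsScalarTower ℂ (Sec s U) (Sec s W) := IsScalarTower.of_algebraMap_eq' (algebraMap_eq_resO h)
  (KaehlerDifferential.map ℂ ℂ (Sec s U) (Sec s W)).toAddMonoidHom

lemma resΩ_smul {U W : X.affineOpens} (h : W ≤ U) (f : Sec s U) (w : Ω[Sec s U⁄ℂ]) :
    resΩ h (f • w) = resO s h f • resΩ h w := by
  letI := (resO s h).toAlgebra
  haveI : IsScalarTower ℂ (Sec s U) (Sec s W) := IsScalarTower.of_algebraMap_eq' (algebraMap_eq_resO h)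
  change KaehlerDifferential.map ℂ ℂ (Sec s U) (Sec s W) _ =
    algebraMap (Sec s U) (Sec s W) f • KaehlerDifferential.map ℂ ℂ (Sec s U) (Sec s W) w
  rw [map_smul, algebraMap_smul]

lemma resΩ_D {U W : X.affineOpens} (h : W ≤ U) (f : Sec s U) :
    resΩ h (D ℂ (Sec s U) f) = D ℂ (Sec s W) (resO s h f) := by
  letI := (resO s h).toAlgebra
  haveI : IsScalarTower ℂ (Sec s U) (Sec s W) := IsScalarTower.of_algebraMap_eq' (algebraMap_eq_resO h)
  exact KaehlerDifferential.map_D ℂ ℂ (Sec s U) (Sec s W) f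

lemma Ω_induction {U : X.affineOpens} {p : Ω[Sec s U⁄ℂ] → Prop}
    (hD : ∀ f, p (D ℂ (Sec s U) f)) (h0 : p 0) (hadd : ∀ v w, p v → p w → p (v + w))
    (hsmul : ∀ (f : Sec s U) w, p w → p (f • w)) (w : Ω[Sec s U⁄ℂ]) : p w := by
  have hw : w ∈ Submodule.span (Sec s U) (Set.range (D ℂ (Sec s U))) := by
    rw [span_range_derivation]; exact Submodule.mem_top
  induction hw using Submodule.span_induction with
  | mem x hx => obtain ⟨f, rfl⟩ := hx; exact hD f
  | zero => exact h0
  | add x y _ _ hx hy => exact hadd x y hx hy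
  | smul a x _ hx => exact hsmul a x hx

lemma resΩ_self {U : X.affineOpens} (h : U ≤ U) (w : Ω[Sec s U⁄ℂ]) : resΩ h w = w := by
  refine Ω_induction (p := fun w => resΩ h w = w) (fun f => ?_) (map_zero _) (fun v w hv hw => ?_) (fun f w hw => ?_) w
  · rw [resΩ_D, resO_self]
  · rw [map_add, hv, hw]
  · rw [resΩ_smul, hw, resO_self]

lemma resΩ_resΩ {U V W : X.affineOpens} (h : V ≤ U) (h' : W ≤ V) (w : Ω[Sec s U⁄ℂ]) :
    resΩ h' (resΩ h w) = resΩ (h'.trans h) w := by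
  refine Ω_induction (p := fun w => resΩ h' (resΩ h w) = resΩ (h'.trans h) w)
    (fun f => ?_) (by simp only [map_zero]) (fun v w hv hw => ?_)
    (fun f w hw => ?_) w
  · rw [resΩ_D, resΩ_D, resΩ_D, resO_resO]
  · rw [map_add, map_add, hv, hw, map_add]
  · rw [resΩ_smul, resΩ_smul, resΩ_smul, hw, resO_resO]

lemma isLoc_resΩ {U : X.affineOpens} (f : Sec s U) :
    IsLoc (resO s (bas_le s f)) f (resΩ (s := s) (bas_le s f)) := by
  letI := (resO s (bas_le s f)).toAlgebra
  haveI : IsScalarTower ℂ (Sec s U) (Sec s (bas s f)) :=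
    IsScalarTower.of_algebraMap_eq' (algebraMap_eq_resO (bas_le s f))
  haveI := isLocalization_resO f
  have hl : IsLocalizedModule (Submonoid.powers f)
    (KaehlerDifferential.map ℂ ℂ (Sec s U) (Sec s (bas s f))) := inferInstance
  refine ⟨fun y => ?_, fun x hx => ?_⟩
  · obtain ⟨⟨x, ⟨_, k, rfl⟩⟩, hk⟩ := hl.surj y
    refine ⟨k, x, Eq.trans ?_ hk⟩
    rw [← map_pow]
    exact algebraMap_smul (Sec s (bas s f)) (f ^ k) y
  · obtain ⟨⟨_, k, rfl⟩, hk⟩ := hl.exists_of_eq (x₁ := x) (x₂ := 0) (hx.trans (map_zero _).symm)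
    exact ⟨k, hk.trans (smul_zero _)⟩

variable (s) in
/-- The cotangent sheaf. -/
noncomputable def actΩ : LeftAct (J := OCat s) s OCat.U OCat.Hom.sub where
  N x := Ω[Sec s x.U⁄ℂ]
  map {x y} g := (DistribSMul.toAddMonoidHom (Ω[Sec s y.U⁄ℂ]) g.val).comp (resΩ g.sub)
  map_smul {x y} g f w := by
    change g.val • resΩ g.sub (f • w) = resO s g.sub f • g.val • resΩ g.sub w
    rw [resΩ_smul, smul_comm]
  map_id x w := by
    change (1 : Sec s x.U) • resΩ (le_refl x.U) w = w
    rw [one_smul, resΩ_self]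
  map_comp {x y w} g g' v := by
    change (g'.val * resO s g'.sub g.val) • resΩ (g'.sub.trans g.sub) v =
      g'.val • resΩ g'.sub (g.val • resΩ g.sub v)
    rw [resΩ_smul, resΩ_resΩ, mul_smul]

/-- The sheaf `Ω ⊗ V`. -/
noncomputable def tensorΩ (V : OMod s) : OMod s := ⟨(actΩ s).tensor.obj V, fun x y h a b => by
  refine AddCommGrpCat.hom_ext (tensor_hom_ext fun (w : Ω[Sec s x.U⁄ℂ]) (m : Sct V x.U) => ?_)
  change ((a + b) • resΩ h w) ⊗ₜ[Sec s y.U] Sct.res V h m =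
    (a • resΩ h w) ⊗ₜ[Sec s y.U] Sct.res V h m + (b • resΩ h w) ⊗ₜ[Sec s y.U] Sct.res V h m
  rw [add_smul, add_tmul]⟩

lemma tensorΩ_map {V : OMod s} {U : X.affineOpens} (g : Sec s U)
    (x : Ω[Sec s U⁄ℂ] ⊗[Sec s U] Sct V U) : (tensorΩ V).obj.map (OCat.mul U g) x = g • x := by
  refine DFunLike.congr_fun (f := ((tensorΩ V).obj.map _).hom)
    (g := DistribSMul.toAddMonoidHom (Ω[Sec s U⁄ℂ] ⊗[Sec s U] Sct V U) g)
    (tensor_hom_ext fun (w : Ω[Sec s U⁄ℂ]) (m : Sct V U) => ?_) x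
  change (g • resΩ (le_refl U) w) ⊗ₜ[Sec s U] Sct.res V (le_refl U) m = g • (w ⊗ₜ[Sec s U] m)
  rw [resΩ_self, Sct.res_self, smul_tmul']

lemma isQCoh_tensorΩ (V : OMod s) (hV : isQCoh V.obj) : isQCoh (tensorΩ V).obj := by
  refine ⟨(tensorΩ V).property, fun U f => ?_⟩
  have hloc := isLoc_tensorMap (isLocalization_resO f) (resΩ_smul (bas_le s f))
    (Sct.res_smul V (bas_le s f)) (isLoc_resΩ f) (isLoc_Sct hV f)
  have hres : ∀ x : Ω[Sec s U⁄ℂ] ⊗[Sec s U] Sct V U,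
      (tensorΩ V).obj.map (OCat.restr (bas_le s f)) x =
        tensorMap (resO s (bas_le s f)) (resΩ (bas_le s f)) (Sct.res V (bas_le s f))
          (resΩ_smul _) (Sct.res_smul V _) x := by
    refine DFunLike.congr_fun (f := ((tensorΩ V).obj.map _).hom)
      (tensor_hom_ext fun (w : Ω[Sec s U⁄ℂ]) (m : Sct V U) => ?_)
    change ((1 : Sec s (bas s f)) • resΩ _ w) ⊗ₜ _ = _
    rw [one_smul]; rfl
  refine ⟨fun y => ?_, fun x hx => ?_⟩
  · obtain ⟨k, x, hx⟩ := hloc.surj y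
    exact ⟨k, x, (tensorΩ_map _ y).trans (hx.trans (hres x).symm)⟩
  · obtain ⟨k, hk⟩ := hloc.inj x ((hres x).symm.trans hx)
    exact ⟨k, (tensorΩ_map _ x).trans hk⟩

variable {𝓔 : FirstOrder s}

/-- The pairing of `D¹` with differential forms. -/
noncomputable def pairing {U : X.affineOpens} (e : 𝓔.E U) : Ω[Sec s U⁄ℂ] →ₗ[Sec s U] Sec s U :=
  (𝓔.symbol U e).liftKaehlerDifferential

lemma pairing_D {U : X.affineOpens} (e : 𝓔.E U) (f : Sec s U) :
    pairing e (D ℂ (Sec s U) f) = 𝓔.symbol U e f := Derivation.liftKaehlerDifferential_comp_D _ _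

lemma pairing_add {U : X.affineOpens} (e e' : 𝓔.E U) (w : Ω[Sec s U⁄ℂ]) :
    pairing (e + e') w = pairing e w + pairing e' w := by
  refine Ω_induction (p := fun w => pairing (e + e') w = pairing e w + pairing e' w) (fun f => ?_)
    (by simp) (fun v w hv hw => ?_) (fun f w hw => ?_) w
  · simp only [pairing_D, map_add, Derivation.add_apply]
  · simp only [map_add, hv, hw]; abel
  · simp only [map_smul, hw, smul_add]

lemma pairing_smul {U : X.affineOpens} (a : Sec s U) (e : 𝓔.E U) (w : Ω[Sec s U⁄ℂ]) :
    pairing (a • e) w = a • pairing e w := by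
  refine Ω_induction (p := fun w => pairing (a • e) w = a • pairing e w) (fun f => ?_)
    (by simp) (fun v w hv hw => ?_) (fun f w hw => ?_) w
  · simp only [pairing_D, map_smul, Derivation.smul_apply]
  · simp only [map_add, hv, hw, smul_add]
  · rw [map_smul, hw, map_smul, smul_comm]

lemma pairing_one {U : X.affineOpens} (w : Ω[Sec s U⁄ℂ]) : pairing (𝓔.one U) w = 0 := by
  have : 𝓔.symbol U (𝓔.one U) = 0 := (𝓔.symbol_eq_zero_iff U _).2 ⟨1, (one_smul _ _).symm⟩
  refine Ω_induction (p := fun w => pairing (𝓔.one U) w = 0) (fun f => ?_)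
    (by simp) (fun v w hv hw => ?_) (fun f w hw => ?_) w
  · rw [pairing_D, this]; rfl
  · rw [map_add, hv, hw, add_zero]
  · rw [map_smul, hw, smul_zero]

lemma pairing_rmul {U : X.affineOpens} (f : Sec s U) (e : 𝓔.E U) (w : Ω[Sec s U⁄ℂ]) :
    pairing (rmul 𝓔 e f) w = f • pairing e w := by
  rw [rmul, pairing_add, pairing_smul, pairing_smul, pairing_one, smul_zero, add_zero]

lemma pairing_res {U W : X.affineOpens} (h : W ≤ U) (e : 𝓔.E U) (w : Ω[Sec s U⁄ℂ]) :
    pairing (𝓔.res h e) (resΩ h w) = resO s h (pairing e w) := by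
  refine Ω_induction (p := fun w => pairing (𝓔.res h e) (resΩ h w) = resO s h (pairing e w)) (fun f => ?_)
    (by simp) (fun v w hv hw => ?_) (fun f w hw => ?_) w
  · rw [resΩ_D, pairing_D, pairing_D, 𝓔.symbol_res]
  · rw [map_add, map_add, hv, hw, map_add, map_add]
  · rw [resΩ_smul, map_smul, hw, map_smul, smul_eq_mul, smul_eq_mul, map_mul]

end Differentials

section MulMap

variable {𝓔 : FirstOrder s}

/-- The product of `a ∈ Dᵐ` with `e ∈ D¹`. -/
noncomputable def mulE {U : X.affineOpens} {m n : ℤ} (h : m + 1 = n) (a : FR 𝓔 U m) (e : 𝓔.E U) :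
    FR 𝓔 U n := FR.mk 𝓔 (a.val * 𝓔.ιE U e) (𝓔.mul_mem_fil h a.mem (𝓔.ιE_mem_fil e))

lemma val_mulE {U : X.affineOpens} {m n : ℤ} (h : m + 1 = n) (a : FR 𝓔 U m) (e : 𝓔.E U) :
    (mulE h a e).val = a.val * 𝓔.ιE U e := rfl

/-- The section `e ⊗ v` of `D¹ ⊗ V`. -/
noncomputable def tmulE {U : X.affineOpens} (V : OMod s) (e : 𝓔.E U) (v : Sct V U) :
    Sct ((tensorE 𝓔).obj V) U := (toER 𝓔 U e ⊗ₜ[Sec s U] v : ER 𝓔 U ⊗[Sec s U] Sct V U)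

lemma smul_tmulE {U : X.affineOpens} (V : OMod s) (f : Sec s U) (e : 𝓔.E U) (v : Sct V U) :
    f • tmulE V e v = tmulE V (f • e) v := by
  change tmulE V (f • 𝓔.res (le_refl U) e) (Sct.res V (le_refl U) v) = _
  rw [𝓔.res_self, Sct.res_self]

/-- The map `e ⊗ v ↦ a e ⊗ v`. -/
noncomputable def mulInner {U : X.affineOpens} {m n : ℤ} (h : m + 1 = n) (V : OMod s)
    (a : FR 𝓔 U m) : ER 𝓔 U ⊗[Sec s U] Sct V U →+ FR 𝓔 U n ⊗[Sec s U] Sct V U :=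
  tensorMap (RingHom.id (Sec s U))
    ((AddMonoidHom.mk' (fun e : 𝓔.E U => mulE h a e) (fun e e' => FR.ext (by
      rw [FR.val_add, val_mulE, val_mulE, val_mulE, map_add, mul_add]))).comp
        (toER 𝓔 U).symm.toAddMonoidHom)
    (AddMonoidHom.id _) (fun f e => by
      obtain ⟨e, rfl⟩ := (toER 𝓔 U).surjective e
      change mulE h a (rmul 𝓔 e f) = f • mulE h a e
      exact FR.ext (by rw [FR.val_smul, val_mulE, val_mulE, ιE_rmul, mul_assoc])) (fun _ _ => rfl)

lemma mulInner_tmul {U : X.affineOpens} {m n : ℤ} (h : m + 1 = n) (V : OMod s) (a : FR 𝓔 U m)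
    (e : 𝓔.E U) (v : Sct V U) :
    mulInner h V a (toER 𝓔 U e ⊗ₜ[Sec s U] v) = mulE h a e ⊗ₜ[Sec s U] v := rfl

lemma mulInner_add {U : X.affineOpens} {m n : ℤ} (h : m + 1 = n) (V : OMod s) (a a' : FR 𝓔 U m) :
    mulInner h V (a + a') = mulInner h V a + mulInner h V a' := tensor_hom_ext fun e v => by
  obtain ⟨e, rfl⟩ := (toER 𝓔 U).surjective e
  rw [AddMonoidHom.add_apply, mulInner_tmul, mulInner_tmul, mulInner_tmul, ← add_tmul]
  congr 1
  exact FR.ext (by rw [FR.val_add, val_mulE, val_mulE, val_mulE, FR.val_add, add_mul])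

/-- The map `a ⊗ e ⊗ v ↦ a e ⊗ v` on sections. -/
noncomputable def mulApp {U : X.affineOpens} {m n : ℤ} (h : m + 1 = n) (V : OMod s) :
    FR 𝓔 U m ⊗[Sec s U] Sct ((tensorE 𝓔).obj V) U →+ FR 𝓔 U n ⊗[Sec s U] Sct V U :=
  TensorProduct.liftAddHom
    (AddMonoidHom.mk' (fun a => mulInner h V a) (mulInner_add h V))
    (fun f a w => by
      change mulInner h V (f • a) w = mulInner h V a (f • w)
      have key : mulInner h V (f • a) = (mulInner h V a).comp
          (DistribSMul.toAddMonoidHom (Sct ((tensorE 𝓔).obj V) U) f) := by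
        refine tensor_hom_ext fun e v => ?_
        obtain ⟨e, rfl⟩ := (toER 𝓔 U).surjective e
        refine Eq.trans ?_ (congrArg (mulInner h V a) (smul_tmulE V f e v)).symm
        refine Eq.trans ?_ (mulInner_tmul h V a (f • e) v).symm
        rw [mulInner_tmul]
        congr 1
        exact FR.ext (by rw [val_mulE, val_mulE, FR.val_smul, 𝓔.ιE_smul, mul_assoc])
      exact DFunLike.congr_fun key w)

lemma mulApp_tmul {U : X.affineOpens} {m n : ℤ} (h : m + 1 = n) (V : OMod s) (a : FR 𝓔 U m)
    (e : 𝓔.E U) (v : Sct V U) :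
    mulApp h V (a ⊗ₜ[Sec s U] tmulE V e v) = mulE h a e ⊗ₜ[Sec s U] v := rfl

lemma tensor_tensorE_hom_ext {U : X.affineOpens} {A N P : Type} [CommRing A] [AddCommGroup N]
    [Module A N] [AddCommGroup P] (V : OMod s) [Module A (Sct ((tensorE 𝓔).obj V) U)]
    {φ ψ : N ⊗[A] Sct ((tensorE 𝓔).obj V) U →+ P}
    (h : ∀ (n : N) (e : 𝓔.E U) (v : Sct V U),
      φ (n ⊗ₜ tmulE V e v) = ψ (n ⊗ₜ tmulE V e v)) : φ = ψ := by
  refine tensor_hom_ext fun n w => ?_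
  let φ' : ER 𝓔 U ⊗[Sec s U] Sct V U →+ P :=
    φ.comp (TensorProduct.mk A N (Sct ((tensorE 𝓔).obj V) U) n).toAddMonoidHom
  let ψ' : ER 𝓔 U ⊗[Sec s U] Sct V U →+ P :=
    ψ.comp (TensorProduct.mk A N (Sct ((tensorE 𝓔).obj V) U) n).toAddMonoidHom
  have : φ' = ψ' := tensor_hom_ext fun e v => h n ((toER 𝓔 U).symm e) v
  exact DFunLike.congr_fun this w

lemma res_tmulE {U W : X.affineOpens} (h : W ≤ U) (V : OMod s) (e : 𝓔.E U) (v : Sct V U) :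
    Sct.res ((tensorE 𝓔).obj V) h (tmulE V e v) = tmulE V (𝓔.res h e) (Sct.res V h v) := by
  change tmulE V ((1 : Sec s W) • 𝓔.res h e) (Sct.res V h v) = _
  rw [one_smul]

lemma mulApp_map {k k' : ℤ} (h : k + 1 = k') (V : OMod s) {x y : RCat 𝓔} (g : x ⟶ y) :
    (mulApp (show y.deg + k + 1 = y.deg + k' by omega) V).comp
      (tensorMap (resO s g.sub) (FR.map 𝓔 k g) (Sct.res ((tensorE 𝓔).obj V) g.sub)
        (FR.map_smul 𝓔 k g) (Sct.res_smul _ g.sub)) =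
    (tensorMap (resO s g.sub) (FR.map 𝓔 k' g) (Sct.res V g.sub) (FR.map_smul 𝓔 k' g)
      (Sct.res_smul V g.sub)).comp (mulApp (show x.deg + k + 1 = x.deg + k' by omega) V) :=
  tensor_tensorE_hom_ext V fun a e v => by
    rw [AddMonoidHom.comp_apply, AddMonoidHom.comp_apply, tensorMap_tmul, res_tmulE, mulApp_tmul,
      mulApp_tmul, tensorMap_tmul]
    congr 1
    exact FR.ext (by rw [val_mulE, FR.val_map, FR.val_map, val_mulE, map_mul, 𝓔.resD_ιE, mul_assoc])

/-- The map `R(k) ⊗ D¹ ⊗ V → R(k + 1) ⊗ V`, `a ⊗ e ⊗ v ↦ a e ⊗ v`. -/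
noncomputable def mulMap {k k' : ℤ} (h : k + 1 = k') (V : OMod s) :
    (ind 𝓔 k).obj ((tensorE 𝓔).obj V) ⟶ (ind 𝓔 k').obj V := ObjectProperty.homMk
  { app x := AddCommGrpCat.ofHom (mulApp (show x.deg + k + 1 = x.deg + k' by omega) V)
    naturality x y g := AddCommGrpCat.hom_ext (mulApp_map h V g) }

end MulMap

section Contraction

variable {𝓔 : FirstOrder s}

/-- The section `w ⊗ v` of `Ω ⊗ V`. -/
noncomputable def tmulΩ {U : X.affineOpens} (V : OMod s) (w : Ω[Sec s U⁄ℂ]) (v : Sct V U) :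
    Sct (tensorΩ V) U := (w ⊗ₜ[Sec s U] v : Ω[Sec s U⁄ℂ] ⊗[Sec s U] Sct V U)

lemma smul_tmulΩ {U : X.affineOpens} (V : OMod s) (f : Sec s U) (w : Ω[Sec s U⁄ℂ]) (v : Sct V U) :
    f • tmulΩ V w v = tmulΩ V (f • w) v :=
  (tensorΩ_map f _).trans (smul_tmul' f w v)

lemma res_tmulΩ {U W : X.affineOpens} (h : W ≤ U) (V : OMod s) (w : Ω[Sec s U⁄ℂ]) (v : Sct V U) :
    Sct.res (tensorΩ V) h (tmulΩ V w v) = tmulΩ V (resΩ h w) (Sct.res V h v) := by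
  change tmulΩ V ((1 : Sec s W) • resΩ h w) (Sct.res V h v) = _
  rw [one_smul]

lemma Ω_hom_ext {U : X.affineOpens} {V : OMod s} {P : Type} [AddCommGroup P]
    {φ ψ : Sct (tensorΩ V) U →+ P} (h : ∀ w v, φ (tmulΩ V w v) = ψ (tmulΩ V w v)) : φ = ψ :=
  tensor_hom_ext (N := Ω[Sec s U⁄ℂ]) (M := Sct V U) h

/-- The map `w ⊗ v ↦ ⟨e, w⟩ v`. -/
noncomputable def contrInner {U : X.affineOpens} (V : OMod s) (e : 𝓔.E U) :
    Sct (tensorΩ V) U →+ Sct V U :=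
  TensorProduct.liftAddHom (R := Sec s U) (M := Ω[Sec s U⁄ℂ]) (N := Sct V U)
    (AddMonoidHom.mk' (fun w => DistribSMul.toAddMonoidHom (Sct V U) (pairing e w))
      (fun w w' => by
        ext v
        change pairing e (w + w') • v = pairing e w • v + pairing e w' • v
        rw [map_add, add_smul]))
    (fun f w v => by
      change pairing e (f • w) • v = pairing e w • f • v
      rw [map_smul, smul_eq_mul, mul_comm, mul_smul])

lemma contrInner_tmul {U : X.affineOpens} (V : OMod s) (e : 𝓔.E U) (w : Ω[Sec s U⁄ℂ])
    (v : Sct V U) : contrInner V e (tmulΩ V w v) = pairing e w • v := rfl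

lemma contrInner_add {U : X.affineOpens} (V : OMod s) (e e' : 𝓔.E U) :
    contrInner V (e + e') = contrInner V e + contrInner V e' := Ω_hom_ext fun w v => by
  rw [AddMonoidHom.add_apply, contrInner_tmul, contrInner_tmul, contrInner_tmul, pairing_add,
    add_smul]

lemma contrInner_rmul {U : X.affineOpens} (V : OMod s) (f : Sec s U) (e : 𝓔.E U)
    (x : Sct (tensorΩ V) U) : contrInner V (rmul 𝓔 e f) x = contrInner V e (f • x) := by
  have : contrInner V (rmul 𝓔 e f) = (contrInner V e).comp
      (DistribSMul.toAddMonoidHom (Sct (tensorΩ V) U) f) := Ω_hom_ext fun w v => by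
    rw [AddMonoidHom.comp_apply, DistribSMul.toAddMonoidHom_apply, smul_tmulΩ, contrInner_tmul,
      contrInner_tmul, pairing_rmul, map_smul]
  exact DFunLike.congr_fun this x

/-- The contraction on sections. -/
noncomputable def contrApp (𝓔 : FirstOrder s) (V : OMod s) (U : X.affineOpens) :
    ER 𝓔 U ⊗[Sec s U] Sct (tensorΩ V) U →+ Sct V U :=
  TensorProduct.liftAddHom
    ((AddMonoidHom.mk' (fun e : 𝓔.E U => contrInner V e) (contrInner_add V)).comp
      (toER 𝓔 U).symm.toAddMonoidHom)
    (fun f e x => contrInner_rmul V f _ x)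

variable (𝓔) in
/-- The contraction `D¹ ⊗ Ω ⊗ V → V`, `e ⊗ w ⊗ v ↦ ⟨e, w⟩ v`. -/
noncomputable def contr (V : OMod s) : (tensorE 𝓔).obj (tensorΩ V) ⟶ V := ObjectProperty.homMk
  { app x := AddCommGrpCat.ofHom (contrApp 𝓔 V x.U)
    naturality x y g := by
      refine AddCommGrpCat.hom_ext (tensor_hom_ext fun (e : ER 𝓔 x.U) (x' : Sct (tensorΩ V) x.U) => ?_)
      obtain ⟨e, rfl⟩ := (toER 𝓔 x.U).surjective e
      change contrInner V (g.val • 𝓔.res g.sub e) (Sct.res _ g.sub x') =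
        Sct.map V g (contrInner V e x')
      have : (contrInner V (g.val • 𝓔.res g.sub e)).comp (Sct.res (tensorΩ V) g.sub) =
          (Sct.map V g).comp (contrInner V e) := Ω_hom_ext fun w v => by
        rw [AddMonoidHom.comp_apply, AddMonoidHom.comp_apply, res_tmulΩ, contrInner_tmul,
          contrInner_tmul, pairing_smul, pairing_res, Sct.map_eq, Sct.res_smul, smul_assoc]
      exact DFunLike.congr_fun this x' }

lemma contr_tmul {U : X.affineOpens} (V : OMod s) (e : 𝓔.E U) (w : Ω[Sec s U⁄ℂ]) (v : Sct V U) :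
    Sct.hom (contr 𝓔 V) U (tmulE _ e (tmulΩ V w v)) = pairing e w • v := rfl

lemma contr_one {U : X.affineOpens} (V : OMod s) (x : Sct (tensorΩ V) U) :
    Sct.hom (contr 𝓔 V) U (tmulE _ (𝓔.one U) x) = 0 := by
  have : contrInner V (𝓔.one U) = 0 := Ω_hom_ext fun w v => by
    rw [contrInner_tmul, pairing_one, zero_smul]; rfl
  exact DFunLike.congr_fun this x

end Contraction

section KernelT

variable {𝓔 : FirstOrder s} (M : Gr 𝓔) (j : ℤ)

/-- Multiplication by `t` as a morphism `M_j → M_{j+1}`. -/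
noncomputable def tHom : (degF 𝓔 j).obj (gm M) ⟶ (degF 𝓔 (j + 1)).obj (gm M) :=
  ObjectProperty.homMk
  { app x := AddCommGrpCat.ofHom (eact (gm M) rfl (𝓔.one x.U))
    naturality x y g := by
      refine AddCommGrpCat.hom_ext (AddMonoidHom.ext fun (m : Sct ((degF 𝓔 j).obj (gm M)) x.U) => ?_)
      change eact (gm M) rfl (𝓔.one y.U) (Sct.map _ g m) =
        Sct.map _ g (eact (gm M) rfl (𝓔.one x.U) m)
      rw [Sct.map_eq, Sct.map_eq, eact_one_smul, eact_res, 𝓔.res_one] }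

lemma map_mem_ker_tHom {x y : OCat s} (g : x ⟶ y) (m : ((degF 𝓔 j).obj (gm M)).obj.obj x)
    (hm : m ∈ ((tHom M j).hom.app x).hom.ker) :
    ((degF 𝓔 j).obj (gm M)).obj.map g m ∈ ((tHom M j).hom.app y).hom.ker :=
  (Sct.hom_map (tHom M j) g m).trans ((congrArg (Sct.map _ g) hm).trans (map_zero _))

/-- The kernel of `t` on `M_j`. -/
noncomputable def kerT : OMod s := ⟨subFun ((degF 𝓔 j).obj (gm M)).obj
    (fun x => ((tHom M j).hom.app x).hom.ker) (map_mem_ker_tHom M j), fun x y h a b => by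
  ext m
  exact Subtype.ext (ConcreteCategory.congr_hom (((degF 𝓔 j).obj (gm M)).property h a b) m.1)⟩

/-- The inclusion of the kernel of `t`. -/
noncomputable def kerTι : kerT M j ⟶ (degF 𝓔 j).obj (gm M) :=
  ObjectProperty.homMk (subFunι ((degF 𝓔 j).obj (gm M)).obj _ (map_mem_ker_tHom M j))

lemma isQCoh_kerT : isQCoh (kerT M j).obj := by
  refine isQCoh_of_kernel (kerTι M j).hom (tHom M j).hom (fun x => Subtype.val_injective)
    (fun x m => ⟨fun hm => ⟨⟨m, hm⟩, rfl⟩, ?_⟩) (M.property.2 j) (M.property.2 (j + 1))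
  rintro ⟨m, rfl⟩
  exact m.2

lemma eact_kerTι {U : X.affineOpens} {k : ℤ} (h : j + 1 = k) (m : Sct (kerT M j) U) :
    eact (gm M) h (𝓔.one U) (Sct.hom (kerTι M j) U m) = 0 := by
  subst h; exact m.2

end KernelT

namespace Small

variable {𝓔 : FirstOrder s} {U : X.affineOpens} (c : Small 𝓔 U)

lemma op_eq_zero_of_tm {M : RCat 𝓔 ⥤ AddCommGrpCat.{0}} {j n : ℤ} (w : M.obj ⟨U, j⟩)
    (hw : c.tm M (rfl : j + 1 = j + 1) w = 0) (hn : j < n) :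
    c.op M 0 (j := n) (by push_cast; omega) w = 0 := by
  rw [← map_zero (c.op M 0 (k := j + 1) (j := n) (by push_cast; omega)), ← hw, tm, op_op]

/-- `mulMap` on sections. -/
noncomputable def mum {k k' : ℤ} (h : k + 1 = k') (V : OMod s) (n : ℤ) :
    ((ind 𝓔 k).obj ((tensorE 𝓔).obj V)).obj.obj ⟨U, n⟩ →+ ((ind 𝓔 k').obj V).obj.obj ⟨U, n⟩ :=
  ((mulMap h V).hom.app ⟨U, n⟩).hom

lemma mum_op {k k' : ℤ} (h : k + 1 = k') (V : OMod s) {i : ℕ} {n m : ℤ} (hi : i + n ≤ m)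
    (x : ((ind 𝓔 k).obj ((tensorE 𝓔).obj V)).obj.obj ⟨U, n⟩) :
    mum h V m (c.op _ i hi x) = c.op _ i hi (mum h V n x) := c.op_nat (mulMap h V).hom hi x

lemma mum_one {k k' : ℤ} (h : k + 1 = k') (V : OMod s) {n n' : ℤ} (hn : n + k = 0)
    (hn' : n' + k' = 0) (hnn : n' + 1 = n) (v : Sct V U) :
    mum h V n (gen 𝓔 U k _ hn (tmulE V (𝓔.one U) v)) =
      c.tm ((ind 𝓔 k').obj V).obj hnn (gen 𝓔 U k' V hn' v) := by
  rw [tm, op_gen]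
  change pur (mulE (show n + k + 1 = n + k' by omega) _ (𝓔.one U)) v = _
  congr 2
  refine FR.ext ?_
  rw [val_Zp _ (by push_cast; omega), pow_zero, val_mulE, FR.val_mk, 𝓔.ιE_one, one_mul]

lemma mum_z {k k' : ℤ} (h : k + 1 = k') (V : OMod s) {n n' : ℤ} (hn : n + k = 0)
    (hn' : n' + k' = 0) (hnn : n' + 1 = n) (v : Sct V U) :
    mum h V n (gen 𝓔 U k _ hn (tmulE V c.z v)) =
      c.zm ((ind 𝓔 k').obj V).obj hnn (gen 𝓔 U k' V hn' v) := by
  rw [zm, op_gen]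
  change pur (mulE (show n + k + 1 = n + k' by omega) _ c.z) v = _
  congr 2
  refine FR.ext ?_
  rw [val_Zp _ (by push_cast; omega), pow_one, val_mulE, FR.val_mk, one_mul, Z]

lemma exists_tmulE (V : OMod s) (w : Sct ((tensorE 𝓔).obj V) U) :
    ∃ v v', w = tmulE V (𝓔.one U) v + tmulE V c.z v' := c.exists_tmul_ER (W := Sct V U) w

variable {V : OMod s} {M : GMod 𝓔} {j : ℤ}

variable (U) in
/-- The extension of `χ : D¹ ⊗ V → M_j` to `R(-j) ⊗ D¹ ⊗ V`, on sections. -/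
noncomputable def exm (χ : (tensorE 𝓔).obj V ⟶ (degF 𝓔 j).obj M) (n : ℤ) :
    ((ind 𝓔 (-j)).obj ((tensorE 𝓔).obj V)).obj.obj ⟨U, n⟩ →+ M.obj.obj ⟨U, n⟩ :=
  (((ind 𝓔 (-j)).map χ ≫ (ev 𝓔 (-j) j (by omega)).app M).hom.app ⟨U, n⟩).hom

variable (χ : (tensorE 𝓔).obj V ⟶ (degF 𝓔 j).obj M)

lemma exm_op {i : ℕ} {n m : ℤ} (hi : i + n ≤ m)
    (x : ((ind 𝓔 (-j)).obj ((tensorE 𝓔).obj V)).obj.obj ⟨U, n⟩) :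
    exm U χ m (c.op _ i hi x) = c.op _ i hi (exm U χ n x) :=
  c.op_nat ((ind 𝓔 (-j)).map χ ≫ (ev 𝓔 (-j) j (by omega)).app M).hom hi x

lemma exm_gen (w : Sct ((tensorE 𝓔).obj V) U) (hj : j + -j = 0) :
    exm U χ j (gen 𝓔 U (-j) _ hj w) = Sct.hom χ U w := act_one M.obj _ _

lemma exm_eq_zero (h1 : ∀ v, Sct.hom χ U (tmulE V (𝓔.one U) v) = 0)
    (h2 : ∀ (w : M.obj.obj ⟨U, j⟩), (∃ w', Sct.hom χ U w' = w) →
      c.tm M.obj (rfl : j + 1 = j + 1) w = 0) {k' : ℤ} (hk : -j + 1 = k') (N : ℕ) {n n' : ℤ} (hn : n = j + N)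
    (hnn : n' + 1 = n) (y : ((ind 𝓔 (-j)).obj ((tensorE 𝓔).obj V)).obj.obj ⟨U, n⟩)
    (x : ((ind 𝓔 k').obj V).obj.obj ⟨U, n'⟩)
    (hxy : mum hk V n y = c.tm ((ind 𝓔 k').obj V).obj hnn x) : exm U χ n y = 0 := by
  have hj : j + -j = 0 := by omega
  have hj' : j - 1 + k' = 0 := by omega
  induction N generalizing n n' with
  | zero =>
    obtain rfl : n = j := by simpa using hn
    obtain rfl : n' = n - 1 := by omega
    obtain ⟨w, rfl⟩ := c.gen_surjective hj y
    obtain ⟨a, rfl⟩ := c.gen_surjective hj' x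
    obtain ⟨v, v', rfl⟩ := c.exists_tmulE V w
    rw [map_add, map_add, c.mum_one hk V hj hj' hnn, c.mum_z hk V hj hj' hnn] at hxy
    have := (c.ind_unique (n := n - 1) (m := n - 1) hj' hnn le_rfl (v := v - a)
      (y := gen 𝓔 U k' V hj' v') (by
        rw [map_sub, map_sub, sub_add_eq_add_sub, sub_eq_zero]; exact hxy)).2
    have hv : v' = 0 := c.gen_injective hj' (this.trans (map_zero _).symm)
    rw [exm_gen, map_add, h1, hv, zero_add]
    exact (congrArg (Sct.hom χ U) (tmul_zero (Sct V U) (toER 𝓔 U c.z))).trans (map_zero _)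
  | succ N ih =>
    obtain ⟨w, y, rfl⟩ := c.ind_cases (m := n') hj hnn (by push_cast at hn; omega) y
    obtain ⟨a, x, rfl⟩ := c.ind_cases (m := n' - 1) hj' (sub_add_cancel n' 1)
      (by push_cast at hn; omega) x
    obtain ⟨v, v', rfl⟩ := c.exists_tmulE V w
    have hy : exm U χ n' y = 0 := by
      refine ih (by push_cast at hn; omega) (sub_add_cancel n' 1) y
        (x - c.op _ 0 (by push_cast at hn ⊢; omega) (gen 𝓔 U k' V hj' v')) ?_
      rw [map_add, zm, mum_op, mum_op, map_add, map_add, c.mum_one hk V hj hj' (sub_add_cancel j 1),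
        c.mum_z hk V hj hj' (sub_add_cancel j 1), map_add, map_add, tm_op, tm, tm, op_op, zm, op_op,
        zm, op_op] at hxy
      have := (c.ind_unique (n := j - 1) (m := n') hj' hnn (by push_cast at hn; omega) (v := v - a)
        (y := c.op _ 0 (by push_cast at hn ⊢; omega) (gen 𝓔 U k' V hj' v') + mum hk V n' y -
          c.tm _ (sub_add_cancel n' 1) x) (by
          rw [map_sub, map_sub, map_sub, map_add, zm, op_op, tm, op_op]
          rw [← sub_eq_zero] at hxy
          rw [← hxy]
          abel)).2
      rw [map_sub, tm, op_op]
      rw [sub_eq_zero] at this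
      rw [tm] at this
      rw [← this]
      abel
    rw [map_add, zm, exm_op, exm_op, hy, map_zero, add_zero, exm_gen]
    exact c.op_eq_zero_of_tm _ (h2 _ ⟨_, rfl⟩) (by push_cast at hn; omega)

end Small

section Saturated

variable {𝓔 : FirstOrder s} [IsSmoothCurve s] {M : Gr 𝓔}

lemma gr_eq_zero_of_small {M N : Gr 𝓔} {f : M ⟶ N}
    (h : ∀ (U : X.affineOpens) (_ : Small 𝓔 U) (n : ℤ) (m : M.obj.obj ⟨U, n⟩),
      f.hom.app _ m = 0) : f = 0 := by
  apply (isGr (𝓔 := 𝓔)).ι.map_injective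
  refine NatTrans.ext (funext fun ⟨U, n⟩ => AddCommGrpCat.hom_ext (AddMonoidHom.ext
    fun (m : Sct ((degF 𝓔 n).obj (gm M)) U) => ?_))
  obtain ⟨S, hS, hc⟩ := exists_small 𝓔 U
  refine eq_zero_of_cover (M := (degF 𝓔 n).obj (gm N)) (N.property.2 n) hS
    (Sct.hom ((degF 𝓔 n).map (gmMap f)) U m) fun g hg => ?_
  rw [← Sct.hom_res]
  exact h _ (hc g hg).some _ _

lemma IsSat.exists_zm (hM : IsSat M) {U : X.affineOpens} (c : Small 𝓔 U) {k j l : ℤ}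
    (h : k + 1 = j) (h' : j + 1 = l) (w : M.obj.obj ⟨U, j⟩) (hw : c.tm M.obj h' w = 0) :
    ∃ w' : M.obj.obj ⟨U, k⟩, c.zm M.obj h w' = w ∧ c.tm M.obj h w' = 0 := by
  subst h'
  let V := tensorΩ (kerT M j)
  have hV : isQCoh V.obj := isQCoh_tensorΩ _ (isQCoh_kerT M j)
  have hk : -j + 1 = -k := by omega
  let χ : (tensorE 𝓔).obj V ⟶ (degF 𝓔 j).obj (gm M) := contr 𝓔 _ ≫ kerTι M j
  let p : grInd 𝓔 (-j) ((tensorE 𝓔).obj V) (isQCoh_tensorE V hV) ⟶ grInd 𝓔 (-k) V hV :=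
    grHom _ _ (mulMap hk V)
  let q : grInd 𝓔 (-j) ((tensorE 𝓔).obj V) (isQCoh_tensorE V hV) ⟶ M :=
    grHom _ M.property ((ind 𝓔 (-j)).map χ ≫ (ev 𝓔 (-j) j (by omega)).app (gm M))
  have hχ : ∀ (U : X.affineOpens) v, Sct.hom χ U (tmulE V (𝓔.one U) v) = 0 := fun U v =>
    (congrArg (Sct.hom (kerTι M j) U) (contr_one _ v)).trans (map_zero _)
  have hpq : kernel.ι p ≫ q = 0 := by
    refine gr_eq_zero_of_small fun U c n m => ?_
    rcases lt_or_ge (n + -j) 0 with hn | hn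
    · have h0 : (kernel.ι p).hom.app ⟨U, n⟩ m = 0 :=
        Small.subsingleton_ind (-j) ((tensorE 𝓔).obj V) hn _
      exact (congrArg (q.hom.app ⟨U, n⟩) h0).trans (map_zero (q.hom.app ⟨U, n⟩).hom)
    · refine c.exm_eq_zero χ (hχ U) ?_ hk (n + -j).toNat (n := n) (n' := n - 1) (by omega)
        (by omega) ((kernel.ι p).hom.app ⟨U, n⟩ m) 0 ?_
      · rintro w ⟨w', rfl⟩
        refine (c.eact_one _ _).symm.trans ?_
        exact eact_kerTι M j rfl (Sct.hom (contr 𝓔 _) U w')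
      · rw [map_zero]
        exact app_zero_of_comp (kernel.condition p) _ m
  have := hM.inj
  have hex : (ShortComplex.mk (kernel.ι p) p (kernel.condition p)).Exact :=
    ShortComplex.exact_kernel p
  let g := hex.descToInjective q hpq
  have hg : p ≫ g = q := hex.comp_descToInjective q hpq
  have hg' : ∀ e v, g.hom.app ⟨U, j⟩ (Small.mum hk V j (Small.gen 𝓔 U (-j) _ (by omega) (tmulE V e v))) =
      Sct.hom χ U (tmulE V e v) := fun e v =>
    (ConcreteCategory.congr_hom (congr_app (congrArg (isGr (𝓔 := 𝓔)).ι.map hg) ⟨U, j⟩)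
      (Small.gen 𝓔 U (-j) _ (by omega) (tmulE V e v))).trans (Small.exm_gen χ _ _)
  let w₀ : Sct (kerT M j) U := ⟨w, (c.eact_one rfl w).trans hw⟩
  let v : Sct V U := tmulΩ (kerT M j) c.ω w₀
  let x := Small.gen 𝓔 U (-k) V (n := k) (by omega) v
  refine ⟨g.hom.app ⟨U, k⟩ x, ?_, ?_⟩
  · refine (c.op_nat g.hom (i := 1) (by push_cast; omega) x).symm.trans ?_
    refine (congrArg (g.hom.app ⟨U, j⟩) (c.mum_z hk V (by omega) (by omega) h v)).symm.trans ?_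
    refine (hg' c.z v).trans ((congrArg (Sct.hom (kerTι M j) U) (contr_tmul _ _ _ _)).trans ?_)
    rw [show pairing c.z c.ω = 1 from c.pair, one_smul]
    rfl
  · refine (c.op_nat g.hom (i := 0) (by push_cast; omega) x).symm.trans ?_
    refine (congrArg (g.hom.app ⟨U, j⟩) (c.mum_one hk V (by omega) (by omega) h v)).symm.trans ?_
    exact (hg' (𝓔.one U) v).trans (hχ U v)

lemma IsSat.exists_tm_zm (hM : IsSat M) {U : X.affineOpens} (c : Small 𝓔 U) {k j l : ℤ}
    (h : k + 1 = j) (h' : j + 1 = l) (m m' : M.obj.obj ⟨U, j⟩)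
    (hm : c.zm M.obj h' m = c.tm M.obj h' m') :
    ∃ u : M.obj.obj ⟨U, k⟩, c.tm M.obj h u = m ∧ c.zm M.obj h u = m' := by
  obtain ⟨u, rfl⟩ := hM.tm_surjective c h m
  obtain ⟨w, hw, hw'⟩ := hM.exists_zm c h h' (m' - c.zm M.obj h u) (by
    rw [map_sub, c.tm_zm, ← hm, sub_self])
  exact ⟨u + w, by rw [map_add, hw', add_zero], by rw [map_add, hw, add_sub_cancel]⟩

lemma IsSat.isKos (hM : IsSat M) : IsKos M := fun U c =>
  ⟨fun _ h u => hM.kos_inj c h u, fun _ h h' m m' => hM.exists_tm_zm c h h' m m', fun _ h m => by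
    obtain ⟨b, rfl⟩ := hM.tm_surjective c h m
    exact ⟨0, b, by rw [map_zero, zero_add]⟩⟩

lemma isSat_rightAdjoint [(π 𝓔).IsLeftAdjoint] (I : Qgr 𝓔) [Injective I] : IsSat ((ω 𝓔).obj I) where
  inj := (Adjunction.ofIsLeftAdjoint (π 𝓔)).map_injective I inferInstance
  tors N hN f := by
    have hz : IsZero ((π 𝓔).obj N) :=
      (ObjectProperty.SerreClassLocalization.isZero_obj_iff (π 𝓔) (irrelevant 𝓔) N).2 hN
    apply ((Adjunction.ofIsLeftAdjoint (π 𝓔)).homEquiv N I).symm.injective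
    exact hz.eq_of_src _ _

lemma Small.kos_ind {U : X.affineOpens} (c : Small 𝓔 U) (V : OMod s) :
    c.Kos ((ind 𝓔 1).obj V).obj := by
  have h1 : (-1 : ℤ) + 1 = 0 := rfl
  refine ⟨fun {k j} hk h u ht hz => ?_, fun {k j l} hj h h' m m' hm => ?_, fun {k j} hk h m => ?_⟩
  · exact (c.ind_unique (k := 1) (V := V) (n := -1) (v := 0) (y := u) h1 h hk
      (by rw [map_zero, map_zero, zero_add]; exact hz)).2
  · obtain ⟨v, y, rfl⟩ := c.ind_cases (k := 1) (V := V) (n := -1) h1 h (by omega) m'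
    have := c.ind_unique (k := 1) (V := V) (n := -1) (v := v) (y := c.tm _ h y - m) h1 h'
      (by omega) (by
        rw [map_sub, hm, map_add, c.tm_zm, tm_op]
        abel)
    refine ⟨y, sub_eq_zero.1 this.2, ?_⟩
    rw [this.1, map_zero, map_zero, zero_add]
  · obtain ⟨v, y, rfl⟩ := c.ind_cases (k := 1) (V := V) (n := -1) h1 h (by omega) m
    refine ⟨y, c.op _ 0 (by push_cast; omega) (Small.gen 𝓔 U 1 V h1 v), ?_⟩
    rw [Small.tm, Small.op_op, add_comm]

/-- The modules `R(1) ⊗ V` are Koszul. -/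
lemma isKos_grInd_one (V : OMod s) (hV : isQCoh V.obj) : IsKos (grInd 𝓔 1 V hV) :=
  fun _ c => c.kos_ind V

end Saturated

section QSub

variable {𝓔 : FirstOrder s}

/-- The quasi-coherent graded submodules of an object of `Gr R`. -/
@[ext]
structure QSub (M : Gr 𝓔) where
  /-- the sections -/
  S : ∀ x, AddSubgroup (M.obj.obj x)
  map_mem : ∀ {x y : RCat 𝓔} (g : x ⟶ y) (m : M.obj.obj x), m ∈ S x → M.obj.map g m ∈ S y
  wit : ∀ (U : X.affineOpens) (f : Sec s U) (k : ℤ) (y : Sct ((degF 𝓔 k).obj (gm M)) (bas s f)),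
    y ∈ S ⟨bas s f, k⟩ → ∃ (n : ℕ) (x : Sct ((degF 𝓔 k).obj (gm M)) U), x ∈ S ⟨U, k⟩ ∧
      resO s (bas_le s f) f ^ n • y = Sct.res _ (bas_le s f) x

namespace QSub

variable {M N : Gr 𝓔}

instance : PartialOrder (QSub M) := PartialOrder.lift QSub.S (fun _ _ => QSub.ext)

lemma smul_mem (P : QSub M) {U : X.affineOpens} {k : ℤ} (f : Sec s U)
    (x : Sct ((degF 𝓔 k).obj (gm M)) U) (hx : x ∈ P.S ⟨U, k⟩) : f • x ∈ P.S ⟨U, k⟩ :=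
  P.map_mem _ _ hx

/-- The object of `Gr R` of a submodule. -/
noncomputable def gr (P : QSub M) : Gr 𝓔 :=
  ⟨subFun M.obj P.S P.map_mem, isGr_subFun M.property fun U f k y hy => P.wit U f k y hy⟩

/-- The inclusion of a submodule. -/
noncomputable def ι (P : QSub M) : P.gr ⟶ M := ObjectProperty.homMk (subFunι M.obj P.S P.map_mem)

instance (P : QSub M) : Mono P.ι :=
  gr_mono_of_injective _ fun x => subFunι_injective M.obj P.S P.map_mem x

/-- The lift of a morphism to a submodule that contains its image. -/
noncomputable def lift (P : QSub M) (f : N ⟶ M) (h : ∀ x n, f.hom.app x n ∈ P.S x) : N ⟶ P.gr :=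
  ObjectProperty.homMk
  { app x := AddCommGrpCat.ofHom ((f.hom.app x).hom.codRestrict (P.S x) (h x))
    naturality x y g := by
      ext n
      exact Subtype.ext (ConcreteCategory.congr_hom (f.hom.naturality g) n) }

lemma lift_ι (P : QSub M) (f : N ⟶ M) (h : ∀ x n, f.hom.app x n ∈ P.S x) : P.lift f h ≫ P.ι = f := rfl

lemma app_map (f : N ⟶ M) {x y : RCat 𝓔} (g : x ⟶ y) (n : N.obj.obj x) :
    f.hom.app y (N.obj.map g n) = M.obj.map g (f.hom.app x n) :=
  ConcreteCategory.congr_hom (f.hom.naturality g) n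

/-- A morphism of `Gr R` on sections. -/
noncomputable abbrev sh (f : N ⟶ M) (U : X.affineOpens) (k : ℤ) :
    Sct ((degF 𝓔 k).obj (gm N)) U →+ Sct ((degF 𝓔 k).obj (gm M)) U :=
  Sct.hom ((degF 𝓔 k).map (gmMap f)) U

/-- The image of a morphism. -/
noncomputable def range (f : N ⟶ M) : QSub M where
  S x := (f.hom.app x).hom.range
  map_mem := by
    rintro x y g _ ⟨n, rfl⟩
    exact ⟨N.obj.map g n, app_map f g n⟩
  wit := by
    rintro U a k y ⟨n, hn⟩
    obtain ⟨i, x, hx⟩ := (isLoc_Sct (V := (degF 𝓔 k).obj (gm N)) (N.property.2 k) a).surj n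
    refine ⟨i, sh f U k x, ⟨x, rfl⟩, ?_⟩
    obtain rfl : sh f (bas s a) k n = y := hn
    rw [← Sct.hom_res]
    exact (Sct.hom_smul ((degF 𝓔 k).map (gmMap f)) _ n).symm.trans (congrArg (sh f (bas s a) k) hx)

/-- The preimage of a submodule. -/
noncomputable def comap (f : N ⟶ M) (P : QSub M) : QSub N where
  S x := (P.S x).comap (f.hom.app x).hom
  map_mem g n hn := by
    refine AddSubgroup.mem_comap.2 ?_
    rw [show (f.hom.app _).hom _ = _ from app_map f g n]
    exact P.map_mem g _ hn
  wit U a k y hy := by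
    obtain ⟨i, x, hx⟩ := (isLoc_Sct (V := (degF 𝓔 k).obj (gm N)) (N.property.2 k) a).surj y
    obtain ⟨j, w, hw, e⟩ := P.wit U a k (sh f _ k y) hy
    obtain ⟨l, hl⟩ := (isLoc_Sct (V := (degF 𝓔 k).obj (gm M)) (M.property.2 k) a).inj
      (a ^ j • sh f U k x - a ^ i • w) (by
        rw [map_sub, Sct.res_smul, Sct.res_smul, ← Sct.hom_res, ← hx, ← e, Sct.hom_smul, map_pow,
          map_pow, smul_comm, sub_self])
    refine ⟨l + j + i, a ^ (l + j) • x, ?_, ?_⟩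
    · have : sh f U k (a ^ (l + j) • x) = a ^ l • a ^ i • w := by
        rw [Sct.hom_smul, pow_add, mul_smul, ← sub_eq_zero, ← smul_sub, hl]
      change sh f U k (a ^ (l + j) • x) ∈ P.S ⟨U, k⟩
      rw [this]
      exact P.smul_mem _ _ (P.smul_mem _ _ hw)
    · rw [Sct.res_smul, ← hx, smul_smul, map_pow, ← pow_add]

lemma directed_S {I : Type*} {P : I → QSub M} (hP : Directed (· ≤ ·) P) (x : RCat 𝓔) :
    Directed (· ≤ ·) (fun i => (P i).S x) := fun i j =>
  let ⟨k, hi, hj⟩ := hP i j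
  ⟨k, hi x, hj x⟩

/-- The union of a directed family of submodules. -/
noncomputable def directedSup {I : Type*} [Nonempty I] (P : I → QSub M) (hP : Directed (· ≤ ·) P) :
    QSub M where
  S x := ⨆ i, (P i).S x
  map_mem {x y} g m hm := by
    obtain ⟨i, hi⟩ := (AddSubgroup.mem_iSup_of_directed (K := fun i => (P i).S x) (directed_S hP x)).1 hm
    exact AddSubgroup.mem_iSup_of_mem i ((P i).map_mem g m hi)
  wit U f k y hy := by
    obtain ⟨i, hi⟩ := (AddSubgroup.mem_iSup_of_directed (K := fun i => (P i).S ⟨bas s f, k⟩) (directed_S hP _)).1 hy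
    obtain ⟨n, x, hx, e⟩ := (P i).wit U f k y hi
    exact ⟨n, x, AddSubgroup.mem_iSup_of_mem i hx, e⟩

lemma mem_directedSup {I : Type*} [Nonempty I] {P : I → QSub M} (hP : Directed (· ≤ ·) P)
    {x : RCat 𝓔} {m : M.obj.obj x} : m ∈ (directedSup P hP).S x ↔ ∃ i, m ∈ (P i).S x :=
  AddSubgroup.mem_iSup_of_directed (directed_S hP x)

/-- Zorn's lemma for submodules. -/
lemma exists_maximal (p : QSub M → Prop)
    (hp : ∀ {I : Type 0} [Nonempty I] (P : I → QSub M) (hP : Directed (· ≤ ·) P), (∀ i, p (P i)) →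
      p (directedSup P hP)) (A : QSub M) (hA : p A) : ∃ P, A ≤ P ∧ p P ∧ ∀ Q, P ≤ Q → p Q → Q ≤ P := by
  obtain ⟨P, hP, hm⟩ := zorn_le_nonempty₀ {P | p P} (fun c hc hchain y hy => by
    have : Nonempty c := ⟨⟨y, hy⟩⟩
    have hd : Directed (· ≤ ·) (fun i : c => i.1) := hchain.directed
    exact ⟨directedSup _ hd, hp _ hd fun i => hc i.2, fun z hz x m hm =>
      (mem_directedSup hd).2 ⟨⟨z, hz⟩, hm⟩⟩) A hA
  exact ⟨P, hP, hm.1, fun Q h hQ => hm.2 hQ h⟩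

end QSub

end QSub

section Torsion

variable {𝓔 : FirstOrder s} [IsSmoothCurve s]

/-- Modules without irrelevant submodules. -/
def TorsionFree (M : Gr 𝓔) : Prop := ∀ (N : Gr 𝓔) (_ : irrelevant 𝓔 N) (f : N ⟶ M), f = 0

lemma gr_hom_eq_zero {M N : Gr 𝓔} {f : M ⟶ N} (h : ∀ x m, f.hom.app x m = 0) : f = 0 :=
  gr_eq_zero_of_small fun U _ n m => h ⟨U, n⟩ m

lemma gr_app_surjective {M N : Gr 𝓔} (f : M ⟶ N) [Epi f] (x : RCat 𝓔) :
    Function.Surjective (f.hom.app x) := app_surjective f.hom x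

lemma QSub.mem_cokernel {M : Gr 𝓔} (P : QSub M) {x : RCat 𝓔} {m : M.obj.obj x} :
    (cokernel.π P.ι).hom.app x m = 0 ↔ m ∈ P.S x := by
  have hex : (ShortComplex.mk P.ι (cokernel.π P.ι) (cokernel.condition _)).Exact :=
    ShortComplex.exact_cokernel P.ι
  have := gr_exact_iff.1 hex x m
  refine this.trans ⟨?_, fun h => ⟨⟨m, h⟩, rfl⟩⟩
  rintro ⟨m, rfl⟩
  exact m.2

lemma irrelevant_directedSup {M : Gr 𝓔} {I : Type} [Nonempty I] (P : I → QSub M)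
    (hP : Directed (· ≤ ·) P) (h : ∀ i, irrelevant 𝓔 (P i).gr) :
    irrelevant 𝓔 (QSub.directedSup P hP).gr := fun U k m => by
  obtain ⟨i, hi⟩ := (QSub.mem_directedSup hP).1 m.2
  obtain ⟨n, hn⟩ := h i U k ⟨m.1, hi⟩
  refine ⟨n, fun j hj r hr => Subtype.ext ?_⟩
  have := congrArg Subtype.val (hn j hj r hr)
  exact this

/-- Every module has a torsion-free quotient by an irrelevant submodule. -/
lemma exists_torsionFree_quotient (M : Gr 𝓔) : ∃ (M' : Gr 𝓔) (q : M ⟶ M'),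
    TorsionFree M' ∧ irrelevant 𝓔 (kernel q) := by
  obtain ⟨T, -, hT, hmax⟩ := QSub.exists_maximal (fun P : QSub M => irrelevant 𝓔 P.gr)
    irrelevant_directedSup (QSub.range (0 : M ⟶ M)) (fun U k ⟨m, n, hm⟩ => ⟨0, fun j _ r hr => by
      have : (⟨m, n, hm⟩ : (QSub.range (0 : M ⟶ M)).gr.obj.obj ⟨U, k⟩) = 0 := Subtype.ext hm.symm
      rw [this]
      exact act_zero _ _⟩)
  refine ⟨cokernel T.ι, cokernel.π T.ι, fun N hN f => ?_, ?_⟩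
  · let K := QSub.comap (cokernel.π T.ι) (QSub.range f)
    have hrange : irrelevant 𝓔 (QSub.range f).gr := fun U k ⟨m, n, hm⟩ => by
      obtain ⟨a, ha⟩ := hN U k n
      refine ⟨a, fun j hj r hr => Subtype.ext ?_⟩
      change act (cokernel T.ι).obj j r hr m = 0
      rw [← hm]
      exact (act_nat f.hom r hr n).symm.trans ((congrArg _ (ha j hj r hr)).trans
        (map_zero (f.hom.app ⟨U, j⟩).hom))
    have hTK : T ≤ K := fun x m hm => by
      refine AddSubgroup.mem_comap.2 ⟨0, ?_⟩
      rw [map_zero]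
      exact ((T.mem_cokernel).2 hm).symm
    have hK : irrelevant 𝓔 K.gr := by
      refine irrelevant_ext (L := T.gr) (N := (QSub.range f).gr) (K.lift T.ι fun x m => hTK x m.2)
        ((QSub.range f).lift (K.ι ≫ cokernel.π T.ι) fun x m => m.2) (fun x m => ?_) hT hrange
      constructor
      · intro h
        have : m.1 ∈ T.S x := T.mem_cokernel.1 (congrArg Subtype.val h)
        exact ⟨⟨m.1, this⟩, rfl⟩
      · rintro ⟨m, rfl⟩
        exact Subtype.ext (T.mem_cokernel.2 m.2)
    refine gr_hom_eq_zero fun x n => ?_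
    obtain ⟨m, hm⟩ := gr_app_surjective (cokernel.π T.ι) x (f.hom.app x n)
    rw [← hm]
    exact T.mem_cokernel.2 (hmax K hTK hK x ⟨n, hm.symm⟩)
  · let l := T.lift (kernel.ι (cokernel.π T.ι)) fun x m =>
      T.mem_cokernel.1 (app_zero_of_comp (kernel.condition _) x m)
    have : Mono l := mono_of_mono_fac (T.lift_ι _ _)
    exact (irrelevant 𝓔).prop_of_mono l hT

lemma QSub.eq_zero_of_torsionFree {M : Gr 𝓔} (hM : TorsionFree M) (K : QSub M)
    (hK : irrelevant 𝓔 K.gr) {x : RCat 𝓔} {m : M.obj.obj x} (hm : m ∈ K.S x) : m = 0 := by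
  have := hM _ hK K.ι
  have h2 := congr_app (congrArg (isGr (𝓔 := 𝓔)).ι.map this) x
  exact ConcreteCategory.congr_hom h2 ⟨m, hm⟩

lemma irrelevant_range {M N : Gr 𝓔} (hN : irrelevant 𝓔 N) (f : N ⟶ M) :
    irrelevant 𝓔 (QSub.range f).gr := fun U k ⟨m, n, hm⟩ => by
  obtain ⟨a, ha⟩ := hN U k n
  refine ⟨a, fun j hj r hr => Subtype.ext ?_⟩
  change act M.obj j r hr m = 0
  rw [← hm]
  exact (act_nat f.hom r hr n).symm.trans ((congrArg _ (ha j hj r hr)).trans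
    (map_zero (f.hom.app ⟨U, j⟩).hom))

lemma irrelevant_comap {M N : Gr 𝓔} (f : N ⟶ M) [Mono f] (K : QSub M) (hK : irrelevant 𝓔 K.gr) :
    irrelevant 𝓔 (K.comap f).gr := by
  let l : (K.comap f).gr ⟶ K.gr := K.lift ((K.comap f).ι ≫ f) fun x m => m.2
  have : Mono l := mono_of_mono_fac (K.lift_ι _ _)
  exact (irrelevant 𝓔).prop_of_mono l hK

lemma torsionFree_directedSup {M : Gr 𝓔} {I : Type} [Nonempty I] (P : I → QSub M)
    (hP : Directed (· ≤ ·) P) (h : ∀ i, TorsionFree (P i).gr) :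
    TorsionFree (QSub.directedSup P hP).gr := fun N hN f => by
  refine gr_hom_eq_zero fun x n => Subtype.ext ?_
  let K := QSub.range (f ≫ (QSub.directedSup P hP).ι)
  have hK : irrelevant 𝓔 K.gr := irrelevant_range hN _
  obtain ⟨i, hi⟩ := (QSub.mem_directedSup hP).1 (f.hom.app x n).2
  have := QSub.eq_zero_of_torsionFree (h i) (K.comap (P i).ι) (irrelevant_comap _ _ hK)
    (x := x) (m := ⟨_, hi⟩) ⟨n, rfl⟩
  have h0 := congrArg Subtype.val this
  exact h0

/-- A torsion-free submodule of an injective module is contained in a torsion-free direct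
summand. -/
lemma exists_injective_torsionFree {E : Gr 𝓔} [Injective E] (A : QSub E) (hA : TorsionFree A.gr) :
    ∃ P : QSub E, A ≤ P ∧ TorsionFree P.gr ∧ Injective P.gr := by
  obtain ⟨P, hAP, hP, hmax⟩ := QSub.exists_maximal (fun P : QSub E => TorsionFree P.gr)
    torsionFree_directedSup A hA
  obtain ⟨C, -, hC, hCmax⟩ := QSub.exists_maximal
    (fun C : QSub E => ∀ x m, m ∈ C.S x → m ∈ P.S x → m = 0)
    (fun Q hQ h x m hm hm' => by
      obtain ⟨i, hi⟩ := (QSub.mem_directedSup hQ).1 hm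
      exact h i x m hi hm') (QSub.range (0 : E ⟶ E)) (fun x m ⟨n, hm⟩ _ => hm.symm)
  let q := cokernel.π C.ι
  have hq : ∀ {x} {m : E.obj.obj x}, q.hom.app x m = 0 ↔ m ∈ C.S x := C.mem_cokernel
  have hess : ∀ K : QSub (cokernel C.ι), (∀ x m, m ∈ P.S x → q.hom.app x m ∈ K.S x → m = 0) →
      ∀ x m, m ∈ K.S x → m = 0 := fun K hK x m hm => by
    obtain ⟨m, rfl⟩ := gr_app_surjective q x m
    refine hq.2 (hCmax (K.comap q) (fun x m hm => AddSubgroup.mem_comap.2 ?_)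
      (fun x m hm hm' => hK x m hm' hm) x hm)
    rw [show (q.hom.app x).hom m = 0 from hq.2 hm]
    exact zero_mem _
  have : Mono (P.ι ≫ q) := gr_mono_of_injective _ fun x => (injective_iff_map_eq_zero
    ((P.ι ≫ q).hom.app x).hom).2 fun m hm => Subtype.ext (hC x m.1 (hq.1 hm) m.2)
  let φ := Injective.factorThru P.ι (P.ι ≫ q)
  have hφ : P.ι ≫ q ≫ φ = P.ι := by
    rw [← Category.assoc]; exact Injective.comp_factorThru P.ι (P.ι ≫ q)
  have hφ' : ∀ x m, m ∈ P.S x → φ.hom.app x (q.hom.app x m) = m := fun x m hm =>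
    ConcreteCategory.congr_hom (congr_app (congrArg (isGr (𝓔 := 𝓔)).ι.map hφ) x) ⟨m, hm⟩
  have hinj : Mono φ := gr_mono_of_injective _ fun x => (injective_iff_map_eq_zero
      (φ.hom.app x).hom).2 fun m hm => by
    refine hess (QSub.comap φ (QSub.range (0 : E ⟶ E))) (fun x m hm hm' => ?_) x m ⟨0, hm.symm⟩
    obtain ⟨_, h0⟩ := hm'
    rw [← hφ' x m hm]
    exact h0.symm
  have hPr : P ≤ QSub.range φ := fun x m hm => ⟨q.hom.app x m, hφ' x m hm⟩
  have hle : QSub.range φ ≤ P := by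
    refine hmax _ hPr fun N hN f => gr_hom_eq_zero fun x n => ?_
    let K := QSub.range (f ≫ (QSub.range φ).ι)
    have hK : irrelevant 𝓔 K.gr := irrelevant_range hN _
    obtain ⟨w, hw⟩ := (f.hom.app x n).2
    have := hess (K.comap φ) (fun x m hm hm' => by
      have hm'' : m ∈ K.S x := by
        have : φ.hom.app x (q.hom.app x m) ∈ K.S x := hm'
        rwa [hφ' x m hm] at this
      exact congrArg Subtype.val (QSub.eq_zero_of_torsionFree hP (K.comap P.ι)
        (irrelevant_comap _ _ hK) (x := x) (m := ⟨m, hm⟩) hm'')) x w ⟨n, hw.symm⟩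
    refine Subtype.ext (hw.symm.trans ?_)
    rw [this, map_zero]
    rfl
  let ψ : cokernel C.ι ⟶ P.gr := P.lift φ fun x m => hle x ⟨m, rfl⟩
  refine ⟨P, hAP, hP, Retract.injective (Y := E) ⟨P.ι, q ≫ ψ, ?_⟩⟩
  rw [← cancel_mono P.ι, Category.id_comp, Category.assoc, Category.assoc, P.lift_ι, hφ]

/-- Every module maps to an injective torsion-free module with irrelevant kernel. -/
lemma exists_isSat [EnoughInjectives (Gr 𝓔)] (M : Gr 𝓔) : ∃ (E : Gr 𝓔) (g : M ⟶ E),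
    IsSat E ∧ irrelevant 𝓔 (kernel g) := by
  obtain ⟨M', q, hM', hq⟩ := exists_torsionFree_quotient M
  let i := Injective.ι M'
  have hA : TorsionFree (QSub.range i).gr := by
    have : Mono ((QSub.range i).ι) := inferInstance
    intro N hN f
    refine gr_hom_eq_zero fun x n => ?_
    let K := QSub.comap i (QSub.range (f ≫ (QSub.range i).ι))
    obtain ⟨m, hm⟩ := (f.hom.app x n).2
    have := QSub.eq_zero_of_torsionFree hM' K (irrelevant_comap _ _ (irrelevant_range hN _))
      (m := m) ⟨n, hm.symm⟩
    refine Subtype.ext (hm.symm.trans ?_)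
    rw [this, map_zero]
    rfl
  obtain ⟨P, hP, hPt, hPi⟩ := exists_injective_torsionFree _ hA
  let l : M' ⟶ P.gr := P.lift i fun x m => hP x ⟨m, rfl⟩
  have : Mono l := mono_of_mono_fac (P.lift_ι _ _)
  exact ⟨P.gr, q ≫ l, ⟨hPi, hPt⟩, (irrelevant 𝓔).prop_of_iso (kernelCompMono q l).symm hq⟩

end Torsion

section Adjoint

variable {𝓔 : FirstOrder s} [IsSmoothCurve s]

/-- The modules `E` with `Hom(N, E) = Hom(πN, πE)` for all `N`. -/
def IsClosedObj (E : Gr 𝓔) : Prop :=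
  ∀ N : Gr 𝓔, Function.Bijective (fun f : N ⟶ E => (π 𝓔).map f)

lemma IsSat.exists_lift {E : Gr 𝓔} (hE : IsSat E) {A B : Gr 𝓔} (g : A ⟶ B)
    (hg : irrelevant 𝓔 (kernel g)) (f : A ⟶ E) : ∃ h : B ⟶ E, g ≫ h = f := by
  have := hE.inj
  have hex : (ShortComplex.mk (kernel.ι g) g (kernel.condition g)).Exact :=
    ShortComplex.exact_kernel g
  exact ⟨hex.descToInjective f (hE.tors _ hg _), hex.comp_descToInjective f _⟩

lemma IsSat.isClosedObj {E : Gr 𝓔} (hE : IsSat E) : IsClosedObj E := fun N => by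
  constructor
  · refine (injective_iff_map_eq_zero (π 𝓔).mapAddHom).2 fun f hf => ?_
    have := (ObjectProperty.SerreClassLocalization.map_eq_zero_iff (π 𝓔) (irrelevant 𝓔) f).1 hf
    rw [← Abelian.image.fac f, hE.tors _ this (Abelian.image.ι f), comp_zero]
  · intro φ
    obtain ⟨F, rfl⟩ := Localization.exists_rightFraction (π 𝓔) (irrelevant 𝓔).isoModSerre φ
    obtain ⟨h, hh⟩ := hE.exists_lift F.s F.hs.1 F.f
    have := Localization.inverts (π 𝓔) (irrelevant 𝓔).isoModSerre F.s F.hs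
    refine ⟨h, ?_⟩
    rw [← cancel_epi ((π 𝓔).map F.s), MorphismProperty.RightFraction.map_s_comp_map, ← hh,
      Functor.map_comp]

lemma π_obj_surjective (Y : Qgr 𝓔) : ∃ A, (π 𝓔).obj A = Y :=
  (Localization.Construction.objEquiv (irrelevant 𝓔).isoModSerre).surjective Y

lemma IsSat.injective_obj {E : Gr 𝓔} (hE : IsSat E) : Injective ((π 𝓔).obj E) where
  factors {Y Y'} f j _ := by
    obtain ⟨A, rfl⟩ : ∃ A, (π 𝓔).obj A = Y := π_obj_surjective Y
    obtain ⟨B, rfl⟩ := π_obj_surjective Y'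
    obtain ⟨F, hF⟩ := Localization.exists_rightFraction (π 𝓔) (irrelevant 𝓔).isoModSerre j
    have := Localization.inverts (π 𝓔) (irrelevant 𝓔).isoModSerre F.s F.hs
    obtain ⟨h, hh⟩ := (hE.isClosedObj _).2 ((π 𝓔).map F.s ≫ f)
    have hs : (π 𝓔).map F.s ≫ j = (π 𝓔).map F.f := by
      rw [hF, MorphismProperty.RightFraction.map_s_comp_map]
    have hm : Mono ((π 𝓔).map F.f) := hs ▸ mono_comp _ _
    obtain ⟨g, hg⟩ := hE.exists_lift F.f ((ObjectProperty.SerreClassLocalization.mono_map_iff (π 𝓔)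
      (irrelevant 𝓔) _).1 hm) h
    refine ⟨(π 𝓔).map g, ?_⟩
    rw [← cancel_epi ((π 𝓔).map F.s), reassoc_of% hs, ← Functor.map_comp, hg]
    exact hh

variable [EnoughInjectives (Gr 𝓔)]

lemma exists_mono_isSat (Y : Qgr 𝓔) : ∃ (E : Gr 𝓔) (i : Y ⟶ (π 𝓔).obj E), IsSat E ∧ Mono i := by
  obtain ⟨M, rfl⟩ := π_obj_surjective Y
  obtain ⟨E, g, hE, hg⟩ := exists_isSat M
  exact ⟨E, (π 𝓔).map g, hE, (ObjectProperty.SerreClassLocalization.mono_map_iff (π 𝓔)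
      (irrelevant 𝓔) _).2 hg⟩

lemma enoughInjectives_qgr : EnoughInjectives (Qgr 𝓔) where
  presentation Y := by
    obtain ⟨E, i, hE, hi⟩ := exists_mono_isSat Y
    exact ⟨⟨_, hE.injective_obj, i, hi⟩⟩

lemma IsClosedObj.kernel {E E' : Gr 𝓔} (hE : IsClosedObj E) (hE' : IsClosedObj E') (d : E ⟶ E') :
    IsClosedObj (kernel d) := fun N => by
  constructor
  · intro f g h
    rw [← cancel_mono (kernel.ι d)]
    refine (hE N).1 ?_
    dsimp only at h ⊢
    rw [Functor.map_comp, Functor.map_comp, h]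
  · intro φ
    obtain ⟨f, hf⟩ := (hE N).2 (φ ≫ (π 𝓔).map (kernel.ι d))
    dsimp only at hf
    refine ⟨kernel.lift d f ((hE' N).1 ?_), ?_⟩
    · dsimp only
      rw [Functor.map_comp, hf, Category.assoc, ← Functor.map_comp, kernel.condition,
        Functor.map_zero, Functor.map_zero, comp_zero]
    · dsimp only
      rw [← cancel_mono ((π 𝓔).map (kernel.ι d)), ← Functor.map_comp, kernel.lift_ι, hf]

lemma exists_isClosedObj (Y : Qgr 𝓔) : ∃ (W : Gr 𝓔) (_ : (π 𝓔).obj W ≅ Y), IsClosedObj W := by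
  obtain ⟨E, i, hE, hi⟩ := exists_mono_isSat Y
  obtain ⟨E', i', hE', hi'⟩ := exists_mono_isSat (cokernel i)
  obtain ⟨d, hd⟩ := (hE'.isClosedObj E).2 (cokernel.π i ≫ i')
  dsimp only at hd
  refine ⟨kernel d, ?_, hE.isClosedObj.kernel hE'.isClosedObj d⟩
  refine PreservesKernel.iso (π 𝓔) d ≪≫ kernelIsoOfEq hd ≪≫ kernelCompMono _ _ ≪≫ ?_
  exact (IsLimit.conePointUniqueUpToIso (Abelian.monoIsKernelOfCokernel _ (cokernelIsCokernel i))
    (kernelIsKernel (cokernel.π i))).symm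

lemma isLeftAdjoint_π : (π 𝓔).IsLeftAdjoint := by
  have : ∀ Y, HasTerminal (CostructuredArrow (π 𝓔) Y) := fun Y => by
    obtain ⟨W, e, hW⟩ := exists_isClosedObj Y
    refine IsTerminal.hasTerminal (X := CostructuredArrow.mk e.hom) ?_
    refine IsTerminal.ofUniqueHom (fun A => CostructuredArrow.homMk
      ((hW A.left).2 (A.hom ≫ e.inv)).choose ?_) (fun A m => ?_)
    · have := ((hW A.left).2 (A.hom ≫ e.inv)).choose_spec
      dsimp only at this
      rw [this]
      simp
    · refine CostructuredArrow.hom_ext _ _ ?_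
      refine (hW A.left).1 ?_
      dsimp only
      have := ((hW A.left).2 (A.hom ≫ e.inv)).choose_spec
      dsimp only at this
      refine Eq.trans ?_ this.symm
      rw [← CostructuredArrow.w m]
      simp
  exact isLeftAdjoint_of_costructuredArrowTerminals _

end Adjoint

section FilteredColimits

variable {𝓔 : FirstOrder s} {J : Type} [SmallCategory J] [IsFiltered J]

instance : (isGr (𝓔 := 𝓔)).IsClosedUnderColimitsOfShape J where
  colimitsOfShape_le := by
    rintro M ⟨⟨⟨D, ι, hι⟩, hD⟩⟩
    have hcol : ∀ x : RCat 𝓔, IsColimit (((evaluation _ _).obj x).mapCocone (Cocone.mk M ι)) :=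
      fun x => isColimitOfPreserves ((evaluation _ AddCommGrpCat.{0}).obj x) hι
    have rep : ∀ x (m : M.obj x), ∃ j, ∃ y : (D.obj j).obj x, (ι.app j).app x y = m := fun x m =>
      Concrete.isColimit_exists_rep _ (hcol x) m
    have nat : ∀ (j : J) {x y : RCat 𝓔} (g : x ⟶ y) (m : (D.obj j).obj x),
        (ι.app j).app y ((D.obj j).map g m) = M.map g ((ι.app j).app x m) := fun j x y g m =>
      ConcreteCategory.congr_hom ((ι.app j).naturality g) m
    refine ⟨fun x y h a b ha hb => ?_, fun k => ⟨fun x y h a b => ?_, fun U f =>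
      ⟨fun y => ?_, fun x hx => ?_⟩⟩⟩
    · ext m
      obtain ⟨j, m, rfl⟩ := rep _ m
      have := congrArg ((ι.app j).app y) (ConcreteCategory.congr_hom ((hD j).1 h a b ha hb) m)
      refine (nat _ _ _).symm.trans (this.trans ((map_add ((ι.app j).app y).hom _ _).trans ?_))
      exact congrArg₂ (· + ·) (nat _ _ _) (nat _ _ _)
    · ext m
      obtain ⟨j, m, rfl⟩ := rep _ m
      have := congrArg ((ι.app j).app _) (ConcreteCategory.congr_hom (((hD j).2 k).1 h a b) m)
      refine (nat _ _ _).symm.trans (this.trans ((map_add ((ι.app j).app _).hom _ _).trans ?_))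
      exact congrArg₂ (· + ·) (nat _ _ _) (nat _ _ _)
    · obtain ⟨j, y, rfl⟩ := rep _ y
      obtain ⟨n, x, hx⟩ := (((hD j).2 k).2 U f).1 y
      refine ⟨n, (ι.app j).app _ x, (nat _ _ _).symm.trans (Eq.trans ?_ (nat _ _ _))⟩
      exact congrArg ((ι.app j).app _) hx
    · obtain ⟨j, x, rfl⟩ := rep _ x
      obtain ⟨i, g, g', h⟩ := Concrete.isColimit_exists_of_rep_eq _ (hcol _)
        ((D.obj j).map ((degFun 𝓔 k).map (OCat.restr (bas_le s f))) x)
        (0 : (D.obj j).obj ((degFun 𝓔 k).obj ⟨bas s f⟩))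
        ((nat _ _ _).trans (hx.trans (map_zero ((ι.app j).app _).hom).symm))
      have h' : (D.obj i).map ((degFun 𝓔 k).map (OCat.restr (bas_le s f))) ((D.map g).app _ x) = 0 :=
        (ConcreteCategory.congr_hom ((D.map g).naturality _) x).symm.trans
          (h.trans (map_zero ((D.map g').app _).hom))
      obtain ⟨n, hn⟩ := (((hD i).2 k).2 U f).2 ((D.map g).app _ x) h'
      refine ⟨n, ?_⟩
      have e : (ι.app i).app _ ((D.map g).app _ x) = (ι.app j).app _ x :=
        (ConcreteCategory.congr_hom (congr_app (ι.naturality g) _) x)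
      rw [← e]
      exact (nat _ _ _).symm.trans ((congrArg ((ι.app i).app _) hn).trans
        (map_zero ((ι.app i).app _).hom))

instance : HasColimitsOfShape J (Gr 𝓔) := hasColimitsOfShape_of_closedUnderColimits _ _

instance : PreservesColimitsOfShape J (isGr (𝓔 := 𝓔)).ι := inferInstance

instance : HasExactColimitsOfShape J (Gr 𝓔) :=
  HasExactColimitsOfShape.domain_of_functor J (isGr (𝓔 := 𝓔)).ι

instance : HasFilteredColimits (Gr 𝓔) := ⟨fun _ _ _ => inferInstance⟩

instance : AB5 (Gr 𝓔) := ⟨fun _ _ _ => inferInstance⟩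

instance : HasColimits (Gr 𝓔) := has_colimits_of_finite_and_filtered

end FilteredColimits

section Separator

variable (𝓔 : FirstOrder s)

/-- The terms for the sections of a submodule generated by sections. -/
inductive Tm : RCat 𝓔 → Type
  | gen (x : RCat 𝓔) : Tm x
  | zero (x : RCat 𝓔) : Tm x
  | add {x : RCat 𝓔} : Tm x → Tm x → Tm x
  | neg {x : RCat 𝓔} : Tm x → Tm x
  | map {x y : RCat 𝓔} (g : x ⟶ y) : Tm x → Tm y
  | wit {U : X.affineOpens} (f : Sec s U) (k : ℤ) : Tm ⟨bas s f, k⟩ → Tm ⟨U, k⟩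

variable {𝓔}

/-- An interpretation of the terms in a module. -/
structure Interp (A : Gr 𝓔) where
  t : ∀ x, Tm 𝓔 x → A.obj.obj x
  t_add : ∀ x (a b : Tm 𝓔 x), t x (a.add b) = t x a + t x b
  t_map : ∀ {x y} (g : x ⟶ y) (a : Tm 𝓔 x), t y (a.map g) = A.obj.map g (t x a)

/-- Two interpretations with the same equalities are related by a morphism. -/
lemma Interp.exists_hom {N A : Gr 𝓔} (I : Interp N) (K : Interp A)
    (hI : ∀ x, Function.Surjective (I.t x))
    (h : ∀ x a b, I.t x a = I.t x b ↔ K.t x a = K.t x b) :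
    ∃ φ : N ⟶ A, ∀ x a, φ.hom.app x (I.t x a) = K.t x a := by
  let F : ∀ x, N.obj.obj x → A.obj.obj x := fun x n => K.t x (hI x n).choose
  have hF : ∀ x a, F x (I.t x a) = K.t x a := fun x a => (h x _ _).1 (hI x _).choose_spec
  refine ⟨ObjectProperty.homMk
    { app x := AddCommGrpCat.ofHom (AddMonoidHom.mk' (F x) fun n n' => ?_)
      naturality x y g := ?_ }, fun x a => hF x a⟩
  · obtain ⟨a, rfl⟩ := hI x n
    obtain ⟨b, rfl⟩ := hI x n'
    rw [← I.t_add, hF, hF, hF, K.t_add]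
  · refine AddCommGrpCat.hom_ext (AddMonoidHom.ext fun n => ?_)
    obtain ⟨a, rfl⟩ := hI x n
    change F y (N.obj.map g (I.t x a)) = A.obj.map g (F x (I.t x a))
    rw [← I.t_map, hF, hF, K.t_map]

variable (A : Gr 𝓔) (a : ∀ x, A.obj.obj x)

/-- The evaluation of terms at a family of sections. -/
noncomputable def evalTm : ∀ {x : RCat 𝓔}, Tm 𝓔 x → A.obj.obj x
  | _, .gen x => a x
  | _, .zero _ => 0
  | _, .add τ σ => evalTm τ + evalTm σ
  | _, .neg τ => - evalTm τ
  | _, .map g τ => A.obj.map g (evalTm τ)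
  | _, .wit f k τ => ((isLoc_Sct (V := (degF 𝓔 k).obj (gm A)) (A.property.2 k) f).surj
      (evalTm τ)).choose_spec.choose

/-- The submodule generated by a family of sections and by chosen denominators. -/
noncomputable def genSub : QSub A where
  S x :=
    { carrier := Set.range (evalTm A a (x := x))
      zero_mem' := ⟨.zero x, rfl⟩
      add_mem' := by
        rintro _ _ ⟨τ, rfl⟩ ⟨σ, rfl⟩
        exact ⟨.add τ σ, rfl⟩
      neg_mem' := by
        rintro _ ⟨τ, rfl⟩
        exact ⟨.neg τ, rfl⟩ }
  map_mem := by
    rintro x y g _ ⟨τ, rfl⟩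
    exact ⟨.map g τ, rfl⟩
  wit := by
    rintro U f k y ⟨τ, rfl⟩
    have h := (isLoc_Sct (V := (degF 𝓔 k).obj (gm A)) (A.property.2 k) f).surj (evalTm A a τ)
    exact ⟨h.choose, h.choose_spec.choose, ⟨.wit f k τ, rfl⟩, h.choose_spec.choose_spec⟩

/-- Evaluation as an interpretation. -/
noncomputable def evalInterp : Interp A := ⟨fun _ => evalTm A a, fun _ _ _ => rfl, fun _ _ => rfl⟩

/-- Evaluation as an interpretation in the generated submodule. -/
noncomputable def genInterp : Interp (genSub A a).gr :=
  ⟨fun _ τ => ⟨evalTm A a τ, τ, rfl⟩, fun _ _ _ => rfl, fun _ _ => rfl⟩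

open Classical ZeroObject in
/-- A module with an interpretation that satisfies the given equalities. -/
noncomputable def relObj (r : ∀ x, Tm 𝓔 x → Tm 𝓔 x → Prop) : Gr 𝓔 :=
  if h : ∃ (N : Gr 𝓔) (I : Interp N), (∀ x, Function.Surjective (I.t x)) ∧
    ∀ x τ σ, I.t x τ = I.t x σ ↔ r x τ σ then h.choose else 0

lemma exists_relObj_hom : ∃ (r : ∀ x, Tm 𝓔 x → Tm 𝓔 x → Prop) (φ : relObj r ⟶ A),
    ∀ x, ∃ n, φ.hom.app x n = a x := by
  let r : ∀ x, Tm 𝓔 x → Tm 𝓔 x → Prop := fun x τ σ => evalTm A a τ = evalTm A a σ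
  have h : ∃ (N : Gr 𝓔) (I : Interp N), (∀ x, Function.Surjective (I.t x)) ∧
    ∀ x τ σ, I.t x τ = I.t x σ ↔ r x τ σ :=
    ⟨(genSub A a).gr, genInterp A a, fun x ⟨_, τ, h⟩ => ⟨τ, Subtype.ext h⟩,
      fun x τ σ => Subtype.ext_iff⟩
  have e : relObj r = h.choose := dif_pos h
  obtain ⟨I, hI, hr⟩ := h.choose_spec
  obtain ⟨φ, hφ⟩ := I.exists_hom (evalInterp A a) hI hr
  refine ⟨r, ?_⟩
  rw [e]
  exact ⟨φ, fun x => ⟨I.t x (.gen x), hφ x _⟩⟩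

instance [IsSmoothCurve s] : HasSeparator (Gr 𝓔) := by
  refine ⟨∐ (relObj (𝓔 := 𝓔)), (isSeparator_sigma _).2 fun A B f g h => ?_⟩
  rw [← sub_eq_zero]
  apply (isGr (𝓔 := 𝓔)).ι.map_injective
  refine NatTrans.ext (funext fun x => AddCommGrpCat.hom_ext (AddMonoidHom.ext fun m => ?_))
  classical
  obtain ⟨r, φ, hφ⟩ := exists_relObj_hom A (Pi.single x m)
  obtain ⟨n, hn⟩ := hφ x
  have h1 := h (relObj r) ⟨r⟩ φ
  rw [← sub_eq_zero, ← Preadditive.comp_sub] at h1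
  have h2 := app_zero_of_comp h1 x n
  rw [hn, Pi.single_eq_same] at h2
  exact h2

instance [IsSmoothCurve s] : IsGrothendieckAbelian.{0} (Gr 𝓔) where

instance [IsSmoothCurve s] : EnoughInjectives (Gr 𝓔) := IsGrothendieckAbelian.enoughInjectives.{0}

end Separator

section ConeLemmas

open CochainComplex HomComplex

universe v₁ v₂ v₃ u₁ u₂ u₃

variable {A : Type u₁} [Category.{v₁} A] [Preadditive A] {B : Type u₂} [Category.{v₂} B]
  [Abelian B] {C : Type u₃} [Category.{v₃} C] [Abelian C]

lemma quasiIso_mappingCone_map {K₁ L₁ K₂ L₂ : CochainComplex B ℤ} (φ₁ : K₁ ⟶ L₁) (φ₂ : K₂ ⟶ L₂)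
    (a : K₁ ⟶ K₂) (b : L₁ ⟶ L₂) (comm : φ₁ ≫ b = a ≫ φ₂) (ha : QuasiIso a) (hb : QuasiIso b) :
    QuasiIso (mappingCone.map φ₁ φ₂ a b comm) := by
  letI := HasDerivedCategory.standard B
  have := Pretriangulated.isIso₃_of_isIso₁₂
    (DerivedCategory.Q.mapTriangle.map (mappingCone.triangleMap φ₁ φ₂ a b comm))
    (DerivedCategory.mappingCone_triangle_distinguished φ₁)
    (DerivedCategory.mappingCone_triangle_distinguished φ₂)
    (inferInstanceAs (IsIso (DerivedCategory.Q.map a)))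
    (inferInstanceAs (IsIso (DerivedCategory.Q.map b)))
  exact (DerivedCategory.isIso_Q_map_iff_quasiIso B _).1 this

lemma desc_zero_comp {K L M N : CochainComplex B ℤ} (φ : K ⟶ L) (ψ : L ⟶ M) (w : φ ≫ ψ = 0)
    (g : M ⟶ N) : mappingCone.desc φ (0 : Cochain K M (-1)) ψ (by simp [w]) ≫ g =
      mappingCone.desc φ 0 (ψ ≫ g) (by simp [reassoc_of% w]) := by
  ext n
  simp [mappingCone.ext_from_iff _ _ _ rfl]

lemma desc_zero_eq_zero {K L M : CochainComplex B ℤ} (φ : K ⟶ L) (ψ : L ⟶ M) (hψ : ψ = 0) :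
    mappingCone.desc φ (0 : Cochain K M (-1)) ψ (by simp [hψ]) = 0 := by
  ext n
  simp [mappingCone.ext_from_iff _ _ _ rfl, hψ]

lemma map_id_desc_zero {K K' L M : CochainComplex B ℤ} (φ : K ⟶ L) (φ' : K' ⟶ L) (a : K ⟶ K')
    (comm : φ ≫ 𝟙 L = a ≫ φ') (ψ : L ⟶ M) (w : φ ≫ ψ = 0) (w' : φ' ≫ ψ = 0) :
    mappingCone.map φ φ' a (𝟙 L) comm ≫
      mappingCone.desc φ' (0 : Cochain K' M (-1)) ψ (by simp [w']) =
      mappingCone.desc φ 0 ψ (by simp [w]) := by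
  ext n
  simp [mappingCone.ext_from_iff _ _ _ rfl, mappingCone.map]

lemma quasiIso_desc {K L M : CochainComplex B ℤ} (φ : K ⟶ L) (ψ : L ⟶ M) (w : φ ≫ ψ = 0)
    (hS : ∀ n, ((ShortComplex.mk φ ψ w).map (HomologicalComplex.eval B _ n)).ShortExact) :
    QuasiIso (mappingCone.desc φ (0 : Cochain K M (-1)) ψ (by simp [w])) := by
  have h1 := HomologicalComplex.shortExact_of_degreewise_shortExact _ hS
  have h2 := mappingCone.quasiIso_descShortComplex h1
  rwa [mappingCone.descShortComplex] at h2

lemma quasiIso_map_desc (H : B ⥤ C) [H.Additive] {K L M : CochainComplex B ℤ} (φ : K ⟶ L)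
    (ψ : L ⟶ M) (w : φ ≫ ψ = 0)
    (hS : ∀ n, (ShortComplex.mk (H.map (φ.f n)) (H.map (ψ.f n)) (by
      rw [← H.map_comp, ← HomologicalComplex.comp_f, w, HomologicalComplex.zero_f,
        H.map_zero])).ShortExact) :
    QuasiIso ((H.mapHomologicalComplex _).map (mappingCone.desc φ (0 : Cochain K M (-1)) ψ (by simp [w]))) := by
  have w'' : (H.mapHomologicalComplex (.up ℤ)).map φ ≫ (H.mapHomologicalComplex (.up ℤ)).map ψ = 0 := by
    rw [← Functor.map_comp, w, Functor.map_zero]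
  let S := ShortComplex.mk _ _ w''
  have h1 : S.ShortExact := HomologicalComplex.shortExact_of_degreewise_shortExact S hS
  have h2 := mappingCone.quasiIso_descShortComplex h1
  have : (H.mapHomologicalComplex _).map (mappingCone.desc φ (0 : Cochain K M (-1)) ψ (by simp [w])) =
      (mappingCone.mapHomologicalComplexIso φ H).hom ≫ mappingCone.descShortComplex S := by
    rw [← Iso.inv_comp_eq]
    ext n
    have e : (mappingCone.mapHomologicalComplexIso φ H).inv.f n =
        (mappingCone.mapHomologicalComplexXIso' φ H n (n + 1) rfl).inv := rfl
    rw [HomologicalComplex.comp_f, e, mappingCone.mapHomologicalComplexXIso'_inv,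
      mappingCone.descShortComplex, mappingCone.desc_f _ _ _ _ n (n + 1) rfl]
    refine (Preadditive.add_comp _ _ _ _ _ _).trans (congrArg₂ (· + ·) ?_ ?_)
    · rw [Cochain.zero_v, comp_zero]
      refine (Category.assoc _ _ _).trans ((congrArg _ ((H.map_comp _ _).symm.trans ?_)).trans
        comp_zero)
      rw [mappingCone.inl_v_desc_f, Cochain.zero_v, H.map_zero]
      rfl
    · refine (Category.assoc _ _ _).trans (congrArg _ ((H.map_comp _ _).symm.trans ?_))
      rw [mappingCone.inr_f_desc_f]
      rfl
  rw [this]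
  infer_instance

/-- The counit of an adjunction on complexes. -/
noncomputable def counitMap {P : A ⥤ C} {W : C ⥤ A} [P.Additive] [W.Additive] (adj : P ⊣ W)
    (I : CochainComplex C ℤ) :
    (P.mapHomologicalComplex _).obj ((W.mapHomologicalComplex _).obj I) ⟶ I where
  f n := adj.counit.app (I.X n)
  comm' i j _ := (adj.counit.naturality (I.d i j)).symm

namespace DGFun

lemma coneDesc_app_comp {F G H : DGFun A B} (τ : NatTrans F G) (σ : NatTrans G H)
    (hτσ : ∀ K, τ.app K ≫ σ.app K = 0) {K : CochainComplex A ℤ} {N : CochainComplex B ℤ}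
    (g : H.obj K ⟶ N) : (coneDesc τ σ hτσ).app K ≫ g = mappingCone.desc (τ.app K) 0 (σ.app K ≫ g)
      (by simp [reassoc_of% hτσ K]) :=
  desc_zero_comp _ _ (hτσ K) _

section

variable {Φ Ψ Θ : A ⥤ B} [Φ.Additive] [Ψ.Additive] [Θ.Additive] (τ : Φ ⟶ Ψ) (σ : Ψ ⟶ Θ)
  (w : τ ≫ σ = 0)

lemma ofNatTrans_app_comp (w : τ ≫ σ = 0) (K : CochainComplex A ℤ) :
    (NatTrans.ofNatTrans τ).app K ≫ (NatTrans.ofNatTrans σ).app K = 0 :=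
  HomologicalComplex.hom_ext _ _ fun n => congr_app w (K.X n)

/-- The transformation from the cone of `τ` induced by `σ`. -/
noncomputable def coneDescOf : NatTrans (cone (NatTrans.ofNatTrans τ)) (ofAdditive Θ) :=
  coneDesc _ (NatTrans.ofNatTrans σ) (ofNatTrans_app_comp τ σ w)

lemma quasiIso_coneDescOf (K : CochainComplex A ℤ) (hS : ∀ n, (ShortComplex.mk (τ.app (K.X n))
    (σ.app (K.X n)) (congr_app w (K.X n))).ShortExact) : QuasiIso ((coneDescOf τ σ w).app K) :=
  quasiIso_desc _ _ (ofNatTrans_app_comp τ σ w K) hS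

lemma quasiIso_map_coneDescOf (H : B ⥤ C) [H.Additive] (K : CochainComplex A ℤ)
    (w' : ∀ n, H.map (τ.app (K.X n)) ≫ H.map (σ.app (K.X n)) = 0)
    (hS : ∀ n, (ShortComplex.mk _ _ (w' n)).ShortExact) :
    QuasiIso ((H.mapHomologicalComplex _).map ((coneDescOf τ σ w).app K)) :=
  quasiIso_map_desc _ _ _ (ofNatTrans_app_comp τ σ w K) hS

end

/-- The transformation `P F W → 1` given by `F → 1` and the counit of `P ⊣ W`. -/
noncomputable def counitTrans {P : A ⥤ C} {W : C ⥤ A} [P.Additive] [W.Additive] (adj : P ⊣ W)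
    {F : DGFun A A} (ε : NatTrans F (DGFun.ofAdditive (𝟭 A))) :
    NatTrans (((DGFun.ofAdditive W).comp F).comp (DGFun.ofAdditive P)) (DGFun.id C) where
  app I := (P.mapHomologicalComplex _).map (ε.app ((W.mapHomologicalComplex _).obj I)) ≫
    counitMap adj I
  naturality {K L n} z := by
    ext p q hpq
    have h1 := Cochain.congr_v (ε.naturality (z.map W)) p q hpq
    simp only [Cochain.comp_zero_cochain_v, Cochain.zero_cochain_comp_v, Cochain.ofHom_v] at h1 ⊢
    refine (Category.assoc _ _ _).symm.trans ((congrArg (· ≫ _)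
      ((P.map_comp _ _).symm.trans ((congrArg P.map h1).trans (P.map_comp _ _)))).trans
      ((Category.assoc _ _ _).trans ((congrArg _ ?_).trans (Category.assoc _ _ _).symm)))
    exact adj.counit.naturality (z.v p q hpq)

end DGFun

end ConeLemmas

section BeilinsonDg

open CochainComplex HomComplex

variable [IsSmoothCurve s] {𝓔 : FirstOrder s} (h : TensorQC 𝓔)

variable (𝓔) in
/-- The adjunction of `π` and `ω`. -/
noncomputable def adjπ [(π 𝓔).IsLeftAdjoint] : π 𝓔 ⊣ ω 𝓔 := Adjunction.ofIsLeftAdjoint (π 𝓔)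

lemma isIso_counit_π [(π 𝓔).IsLeftAdjoint] (Y : Qgr 𝓔) : IsIso ((adjπ 𝓔).counit.app Y) := by
  obtain ⟨W, e, hW⟩ := exists_isClosedObj Y
  let adj := adjπ 𝓔
  have hu : IsIso (adj.unit.app W) := by
    apply isIso_of_yoneda_map_bijective
    intro N
    have := (adj.homEquiv N ((π 𝓔).obj W)).bijective.comp (hW N)
    refine (congrArg Function.Bijective (funext fun f => ?_)).mp this
    exact (adj.homEquiv_unit _ _ _).trans (adj.unit.naturality f).symm
  have h1 : IsIso (adj.counit.app ((π 𝓔).obj W)) := by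
    have := adj.left_triangle_components W
    exact (IsIso.of_isIso_fac_left this)
  exact (NatTrans.isIso_app_iff_of_iso adj.counit e).1 h1

/-- The augmentation `𝔹(M) → M`. -/
noncomputable def augB : DGFun.NatTrans (BB h) (DGFun.ofAdditive (𝟭 (Gr 𝓔))) :=
  DGFun.coneDescOf (diffT h) (eps h) (diffT_eps h)

lemma diffE_eps : diffE h ≫ eps h = 0 := by
  rw [← quotTerm_diffT, Category.assoc, diffT_eps, comp_zero]

lemma coneDesc_eps (K : CochainComplex (Gr 𝓔) ℤ) :
    mappingCone.desc ((DGFun.NatTrans.ofNatTrans (diffO h)).app K) 0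
      ((DGFun.NatTrans.ofNatTrans (diffE h)).app K)
      (by rw [DGFun.ofNatTrans_app_comp _ _ (diffO_diffE h), δ_zero, Cochain.ofHom_zero]) ≫
      (DGFun.NatTrans.ofNatTrans (eps h)).app K = 0 :=
  (desc_zero_comp _ _ (DGFun.ofNatTrans_app_comp _ _ (diffO_diffE h) K) _).trans
    (desc_zero_eq_zero _ _ (DGFun.ofNatTrans_app_comp _ _ (diffE_eps h) K))

/-- The augmentation `𝔹'(M) → M`. -/
noncomputable def augB' : DGFun.NatTrans (BB' h) (DGFun.ofAdditive (𝟭 (Gr 𝓔))) :=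
  DGFun.coneDesc _ (DGFun.NatTrans.ofNatTrans (eps h)) (coneDesc_eps h)

/-- The projection `[R(-1) ⊗ M_{-1} → R(-1) ⊗ D¹ ⊗ M_{-1}] → R(-1) ⊗ T ⊗ M_{-1}`. -/
noncomputable def projO : DGFun.NatTrans (DGFun.cone (DGFun.NatTrans.ofNatTrans (diffO h)))
    (DGFun.ofAdditive (termT h)) :=
  DGFun.coneDescOf (diffO h) (quotTerm h) (diffO_quotTerm h)

lemma quasiIso_projO (K : CochainComplex (Gr 𝓔) ℤ) : QuasiIso ((projO h).app K) :=
  DGFun.quasiIso_coneDescOf _ _ _ _ fun n => shortExact_diffO_quotTerm h (K.X n)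

lemma projO_diffT (K : CochainComplex (Gr 𝓔) ℤ) :
    (projO h).app K ≫ (DGFun.NatTrans.ofNatTrans (diffT h)).app K = mappingCone.desc
      ((DGFun.NatTrans.ofNatTrans (diffO h)).app K) 0 ((DGFun.NatTrans.ofNatTrans (diffE h)).app K)
      (by rw [DGFun.ofNatTrans_app_comp _ _ (diffO_diffE h), δ_zero, Cochain.ofHom_zero]) :=
  DGFun.coneDesc_app_comp _ _ (DGFun.ofNatTrans_app_comp _ _ (diffO_quotTerm h)) _

/-- The projection `𝔹'(M) → 𝔹(M)`. -/
noncomputable def projB (K : CochainComplex (Gr 𝓔) ℤ) : (BB' h).obj K ⟶ (BB h).obj K :=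
  mappingCone.map _ _ ((projO h).app K) (𝟙 _) ((Category.comp_id _).trans (projO_diffT h K).symm)

lemma quasiIso_projB (K : CochainComplex (Gr 𝓔) ℤ) : QuasiIso (projB h K) :=
  quasiIso_mappingCone_map _ _ _ _ _ (quasiIso_projO h K) inferInstance

lemma projB_augB (K : CochainComplex (Gr 𝓔) ℤ) : projB h K ≫ (augB h).app K = (augB' h).app K :=
  map_id_desc_zero _ _ _ _ _ (coneDesc_eps h K)
    (DGFun.ofNatTrans_app_comp _ _ (diffT_eps h) K)

variable [(π 𝓔).IsLeftAdjoint]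

lemma quasiIso_π_augB (I : CochainComplex (Qgr 𝓔) ℤ) (hI : ∀ n, Injective (I.X n)) :
    QuasiIso (((π 𝓔).mapHomologicalComplex _).map
      ((augB h).app (((ω 𝓔).mapHomologicalComplex _).obj I))) :=
  DGFun.quasiIso_map_coneDescOf _ _ _ _ _ _ fun n => by
    have := hI n
    exact (isSat_rightAdjoint (I.X n)).isKos.shortExact h

lemma quasiIso_π_augB' (I : CochainComplex (Qgr 𝓔) ℤ) (hI : ∀ n, Injective (I.X n)) :
    QuasiIso (((π 𝓔).mapHomologicalComplex _).map
      ((augB' h).app (((ω 𝓔).mapHomologicalComplex _).obj I))) := by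
  have h1 := quasiIso_π_augB h I hI
  have h2 := quasiIso_projB h (((ω 𝓔).mapHomologicalComplex _).obj I)
  rw [← projB_augB, Functor.map_comp]
  infer_instance

/-- The transformation `π B(ω I) → I` given by an augmentation `B(M) → M`. -/
noncomputable def etaOf {B : DGFun (Gr 𝓔) (Gr 𝓔)}
    (ε : DGFun.NatTrans B (DGFun.ofAdditive (𝟭 (Gr 𝓔)))) :
    DGFun.NatTrans (((DGFun.ofAdditive (ω 𝓔)).comp B).comp (DGFun.ofAdditive (π 𝓔)))
      (DGFun.id (Qgr 𝓔)) := DGFun.counitTrans (adjπ 𝓔) ε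

lemma quasiIso_etaOf {B : DGFun (Gr 𝓔) (Gr 𝓔)}
    (ε : DGFun.NatTrans B (DGFun.ofAdditive (𝟭 (Gr 𝓔)))) (I : CochainComplex (Qgr 𝓔) ℤ)
    (h1 : QuasiIso (((π 𝓔).mapHomologicalComplex _).map
      (ε.app (((ω 𝓔).mapHomologicalComplex _).obj I)))) : QuasiIso ((etaOf ε).app I) := by
  refine @quasiIso_comp _ _ _ _ _ _ _ _ _ _ _ _ _ h1 ?_
  have h2 : IsIso (counitMap (adjπ 𝓔) I) :=
    @HomologicalComplex.Hom.isIso_of_components _ _ _ _ _ _ _ _ fun n => isIso_counit_π (I.X n)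
  exact @quasiIso_of_isIso _ _ _ _ _ _ _ _ h2 _ _

lemma quasiIso_etaB (I : CochainComplex (Qgr 𝓔) ℤ) (hI : ∀ n, Injective (I.X n)) :
    QuasiIso ((etaOf (augB h)).app I) :=
  quasiIso_etaOf _ I (quasiIso_π_augB h I hI)

lemma quasiIso_etaB' (I : CochainComplex (Qgr 𝓔) ℤ) (hI : ∀ n, Injective (I.X n)) :
    QuasiIso ((etaOf (augB' h)).app I) :=
  quasiIso_etaOf _ I (quasiIso_π_augB' h I hI)

lemma isoIdDg_BB : IsoIdDg (BB h) := ⟨etaOf (augB h), fun I hI => quasiIso_etaB h I hI.2.1⟩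

lemma isoIdDg_BB' : IsoIdDg (BB' h) := ⟨etaOf (augB' h), fun I hI => quasiIso_etaB' h I hI.2.1⟩

end BeilinsonDg

namespace DGFun

open CochainComplex HomComplex

universe v₁ v₂ u₁ u₂

variable {A : Type u₁} [Category.{v₁} A] [Abelian A] {B : Type u₂} [Category.{v₂} B] [Abelian B]

/-- The functor on complexes preserves quasi-isomorphisms. -/
def PreservesQuasiIso (F : DGFun A B) : Prop :=
  ∀ ⦃K L : CochainComplex A ℤ⦄ (f : K ⟶ L), QuasiIso f → QuasiIso (F.toFunctor.map f)

lemma NatTrans.toFunctor_naturality {F G : DGFun A B} (τ : NatTrans F G) {K L : CochainComplex A ℤ}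
    (f : K ⟶ L) : τ.app K ≫ G.toFunctor.map f = F.toFunctor.map f ≫ τ.app L := by
  ext n
  have h1 := Cochain.congr_v (τ.naturality (Cochain.ofHom f)) n n (add_zero n)
  rw [Cochain.comp_zero_cochain_v, Cochain.zero_cochain_comp_v, Cochain.ofHom_v,
    Cochain.ofHom_v] at h1
  exact h1.symm

lemma ofHom_toFunctor_map (F : DGFun A B) {K L : CochainComplex A ℤ} (f : K ⟶ L) :
    Cochain.ofHom (F.toFunctor.map f) = F.map (Cochain.ofHom f) :=
  Cochain.ext₀ _ _ fun _ => Cochain.ofHom_v _ _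

lemma cone_toFunctor_map {F G : DGFun A B} (τ : NatTrans F G) {K L : CochainComplex A ℤ}
    (f : K ⟶ L) : (cone τ).toFunctor.map f = mappingCone.map (τ.app K) (τ.app L)
      (F.toFunctor.map f) (G.toFunctor.map f) (τ.toFunctor_naturality f) := by
  have h1 : coneMap τ (Cochain.ofHom f) = Cochain.ofHom (mappingCone.map (τ.app K) (τ.app L)
      (F.toFunctor.map f) (G.toFunctor.map f) (τ.toFunctor_naturality f)) := by
    apply cone_ext _ (-1) (by norm_num)
    · rw [inl_coneMap, Int.negOnePow_zero, one_smul, ← ofHom_toFunctor_map]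
      exact (mappingCone.inl_desc _ _ _ _).symm
    · rw [inr_coneMap, ← ofHom_toFunctor_map]
      exact (Cochain.ofHom_comp _ _).symm.trans ((congrArg Cochain.ofHom
        (mappingCone.inr_desc _ _ _ _).symm).trans (Cochain.ofHom_comp _ _))
  ext n
  exact (Cochain.congr_v h1 n n (add_zero n)).trans (Cochain.ofHom_v _ _)

lemma PreservesQuasiIso.cone {F G : DGFun A B} (τ : NatTrans F G) (hF : F.PreservesQuasiIso)
    (hG : G.PreservesQuasiIso) : (DGFun.cone τ).PreservesQuasiIso := fun K L f hf => by
  rw [cone_toFunctor_map]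
  exact quasiIso_mappingCone_map _ _ _ _ _ (hF f hf) (hG f hf)

lemma ofAdditive_toFunctor_map (Φ : A ⥤ B) [Φ.Additive] {K L : CochainComplex A ℤ} (f : K ⟶ L) :
    (ofAdditive Φ).toFunctor.map f = (Φ.mapHomologicalComplex _).map f := by
  ext n
  exact (Cochain.congr_v (Cochain.map_ofHom (Φ := Φ) _ _ f) n n (add_zero n)).trans
    (Cochain.ofHom_v _ _)

lemma preservesQuasiIso_ofAdditive (Φ : A ⥤ B) [Φ.Additive] [PreservesFiniteLimits Φ]
    [PreservesFiniteColimits Φ] : (ofAdditive Φ).PreservesQuasiIso := fun K L f hf => by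
  rw [ofAdditive_toFunctor_map]
  exact inferInstanceAs (QuasiIso ((Φ.mapHomologicalComplex _).map f))

end DGFun

section

variable [IsSmoothCurve s] {𝓔 : FirstOrder s} (h : TensorQC 𝓔)

lemma preservesQuasiIso_BB : (BB h).PreservesQuasiIso :=
  .cone _ (DGFun.preservesQuasiIso_ofAdditive _) (DGFun.preservesQuasiIso_ofAdditive _)

lemma preservesQuasiIso_BB' : (BB' h).PreservesQuasiIso :=
  .cone _ (.cone _ (DGFun.preservesQuasiIso_ofAdditive _) (DGFun.preservesQuasiIso_ofAdditive _))
    (DGFun.preservesQuasiIso_ofAdditive _)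

end

section InjectiveResolution

open CochainComplex HomComplex DerivedCategory

universe v₁ u₁

variable {C : Type u₁} [Category.{v₁} C] [Abelian C] [HasDerivedCategory C] [EnoughInjectives C]

lemma injQ_map_bijective (K L : HomotopyCategory.Plus (InjectiveObject C)) :
    Function.Bijective (((InjectiveObject.ι C).mapHomotopyCategoryPlus ⋙ Plus.Qh).map :
      (K ⟶ L) → _) := by
  have hL : CochainComplex.IsKInjective
      ((InjectiveObject.ι C).mapHomotopyCategoryPlus.obj L).obj.as := by
    obtain ⟨L, hL⟩ := L
    obtain ⟨L, rfl⟩ := HomotopyCategory.quotient_obj_surjective L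
    have : ∀ K : CochainComplex.Plus (InjectiveObject C), CochainComplex.IsKInjective
        (((InjectiveObject.ι C).mapHomologicalComplex (.up ℤ)).obj K.obj) := inferInstance
    exact this ⟨L, (HomotopyCategory.plus_quotient_obj_iff _).1 hL⟩
  exact (Plus.Qh_map_bijective_of_isKInjective _ _ hL).comp
    ⟨Functor.map_injective _, Functor.map_surjective _⟩

variable (C) in
/-- The localization functor from bounded below complexes of injective objects. -/
noncomputable abbrev injQ : CochainComplex.Plus (InjectiveObject C) ⥤ DerivedCategory.Plus C :=
  HomotopyCategory.Plus.quotient (InjectiveObject C) ⋙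
    ((InjectiveObject.ι C).mapHomotopyCategoryPlus ⋙ Plus.Qh)

instance : (injQ C).IsLocalization
    ((CochainComplex.Plus.quasiIso C).inverseImage (InjectiveObject.ι C).mapCochainComplexPlus) := by
  have : ((InjectiveObject.ι C).mapHomotopyCategoryPlus ⋙ Plus.Qh).IsEquivalence :=
    { faithful := ⟨fun h => (injQ_map_bijective _ _).1 h⟩
      full := ⟨fun f => (injQ_map_bijective _ _).2 f⟩
      essSurj := inferInstance }
  exact Functor.IsLocalization.of_equivalence_target
    (HomotopyCategory.Plus.quotient (InjectiveObject C)) _ _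
    (((InjectiveObject.ι C).mapHomotopyCategoryPlus ⋙ Plus.Qh).asEquivalence) (Iso.refl _)

end InjectiveResolution

section BeilinsonDb

open CochainComplex HomComplex DerivedCategory

variable [IsSmoothCurve s] {𝓔 : FirstOrder s} [HasDerivedCategory (Gr 𝓔)]
  [HasDerivedCategory (Qgr 𝓔)] [(π 𝓔).IsLeftAdjoint] [EnoughInjectives (Qgr 𝓔)]

variable (𝓔) in
/-- The underlying complex of a bounded below complex of injective objects. -/
noncomputable abbrev injCpx :
    CochainComplex.Plus (InjectiveObject (Qgr 𝓔)) ⥤ CochainComplex (Qgr 𝓔) ℤ :=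
  CochainComplex.Plus.ι _ ⋙ (InjectiveObject.ι (Qgr 𝓔)).mapHomologicalComplex _

lemma isIso_derivedUnit (K : CochainComplex.Plus (InjectiveObject (Qgr 𝓔))) :
    IsIso ((ω 𝓔).rightDerivedFunctorPlusUnit.app
      ((InjectiveObject.ι (Qgr 𝓔)).mapHomotopyCategoryPlus.obj
        ((HomotopyCategory.Plus.quotient (InjectiveObject (Qgr 𝓔))).obj K))) := inferInstance

variable (𝓔) in
/-- The derived functor of `ω` on complexes of injective objects. -/
noncomputable def derivedIso : injQ (Qgr 𝓔) ⋙ (ω 𝓔).rightDerivedFunctorPlus ⋙ Plus.ι ≅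
    injCpx 𝓔 ⋙ (ω 𝓔).mapHomologicalComplex (.up ℤ) ⋙ Q :=
  (NatIso.ofComponents (F := (HomotopyCategory.Plus.quotient (InjectiveObject (Qgr 𝓔)) ⋙
      (InjectiveObject.ι (Qgr 𝓔)).mapHomotopyCategoryPlus ⋙ (ω 𝓔).mapHomotopyCategoryPlus ⋙
        Plus.Qh) ⋙ DerivedCategory.Plus.ι)
      (G := injQ (Qgr 𝓔) ⋙ (ω 𝓔).rightDerivedFunctorPlus ⋙ Plus.ι)
      (fun K => DerivedCategory.Plus.ι.mapIso (@asIso _ _ _ _ _ (isIso_derivedUnit K)))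
    fun f => (Functor.whiskerRight (ω 𝓔).rightDerivedFunctorPlusUnit
      DerivedCategory.Plus.ι).naturality ((InjectiveObject.ι (Qgr 𝓔)).mapHomotopyCategoryPlus.map
        ((HomotopyCategory.Plus.quotient (InjectiveObject (Qgr 𝓔))).map f))).symm ≪≫
  Functor.isoWhiskerLeft (injCpx 𝓔 ⋙ (ω 𝓔).mapHomologicalComplex (.up ℤ)) (quotientCompQhIso _)

variable (𝓔) in
/-- The localization functor on complexes of injective objects. -/
noncomputable def injQIso : injQ (Qgr 𝓔) ⋙ Plus.ι ≅ injCpx 𝓔 ⋙ Q :=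
  Functor.isoWhiskerLeft (injCpx 𝓔) (quotientCompQhIso _)

/-- The isomorphism `π B(ω I) = I` in the derived category. -/
noncomputable def transformIso {B : DGFun (Gr 𝓔) (Gr 𝓔)}
    (η : DGFun.NatTrans (((DGFun.ofAdditive (ω 𝓔)).comp B).comp (DGFun.ofAdditive (π 𝓔)))
      (DGFun.id (Qgr 𝓔)))
    (hη : ∀ I : CochainComplex (Qgr 𝓔) ℤ, (∀ n, Injective (I.X n)) → QuasiIso (η.app I)) :
    injCpx 𝓔 ⋙ (ω 𝓔).mapHomologicalComplex (.up ℤ) ⋙ B.toFunctor ⋙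
      (π 𝓔).mapHomologicalComplex (.up ℤ) ⋙ Q ≅ injCpx 𝓔 ⋙ Q :=
  NatIso.ofComponents
    (fun K => @asIso _ _ _ _ (Q.map (η.app ((injCpx 𝓔).obj K)))
      ((isIso_Q_map_iff_quasiIso _ _).2 (hη _ fun n => (K.obj.X n).property)))
    (fun {K L} f => by
      refine (Q.map_comp _ _).symm.trans ((congrArg Q.map ?_).trans (Q.map_comp _ _))
      ext n
      have h1 := Cochain.congr_v (η.naturality (Cochain.ofHom ((injCpx 𝓔).map f))) n n (add_zero n)
      rw [Cochain.comp_zero_cochain_v, Cochain.zero_cochain_comp_v, Cochain.ofHom_v,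
        Cochain.ofHom_v] at h1
      refine Eq.trans (congrArg (· ≫ _) (congrArg (π 𝓔).map ?_)) (h1.trans ?_)
      · exact Cochain.congr_v (congrArg B.map (Cochain.map_ofHom (Φ := ω 𝓔) _ _ _).symm) n n (add_zero n)
      · exact congrArg _ (Cochain.ofHom_v _ _))

lemma isoIdDb_of {B : DGFun (Gr 𝓔) (Gr 𝓔)} 
    (η : DGFun.NatTrans (((DGFun.ofAdditive (ω 𝓔)).comp B).comp (DGFun.ofAdditive (π 𝓔)))
      (DGFun.id (Qgr 𝓔)))
    (hη : ∀ I : CochainComplex (Qgr 𝓔) ℤ, (∀ n, Injective (I.X n)) → QuasiIso (η.app I))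
    (hB : B.PreservesQuasiIso) :
    IsoIdDb B := by
  have hQ : (HomologicalComplex.quasiIso (Gr 𝓔) (.up ℤ)).IsInvertedBy (B.toFunctor ⋙ Q) :=
    fun K L f hf => (isIso_Q_map_iff_quasiIso _ _).2 (hB f hf)
  let 𝔅 := Localization.lift (B.toFunctor ⋙ Q) hQ Q
  let e : Q ⋙ 𝔅 ≅ B.toFunctor ⋙ Q := Localization.fac _ hQ Q
  refine ⟨𝔅, ⟨e.symm⟩, ⟨Functor.isoWhiskerLeft (ObjectProperty.ιOfLE
      (inf_le_left : (TStructure.t (C := Qgr 𝓔)).bounded ≤ (TStructure.t (C := Qgr 𝓔)).plus))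
      (H := Plus.ι) ?_⟩⟩
  let W := (CochainComplex.Plus.quasiIso (Qgr 𝓔)).inverseImage
    (InjectiveObject.ι (Qgr 𝓔)).mapCochainComplexPlus
  refine Localization.liftNatIso (injQ (Qgr 𝓔)) W (injQ (Qgr 𝓔) ⋙ (ω 𝓔).rightDerivedFunctorPlus ⋙
    Plus.ι ⋙ 𝔅 ⋙ (π 𝓔).mapDerivedCategory) (injQ (Qgr 𝓔) ⋙ Plus.ι) _ _ ?_
  refine Functor.isoWhiskerRight (derivedIso 𝓔) (𝔅 ⋙ (π 𝓔).mapDerivedCategory) ≪≫ 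
   Functor.isoWhiskerLeft (injCpx 𝓔 ⋙ (ω 𝓔).mapHomologicalComplex (.up ℤ)) 
     (Functor.isoWhiskerRight e (π 𝓔).mapDerivedCategory ≪≫ 
       Functor.isoWhiskerLeft B.toFunctor (π 𝓔).mapDerivedCategoryFactors) ≪≫
   transformIso η hη ≪≫ (injQIso 𝓔).symm

lemma isoIdDb_BB (h : TensorQC 𝓔) : IsoIdDb (BB h) :=
  isoIdDb_of _ (quasiIso_etaB h) (preservesQuasiIso_BB h)

lemma isoIdDb_BB' (h : TensorQC 𝓔) : IsoIdDb (BB' h) :=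
  isoIdDb_of _ (quasiIso_etaB' h) (preservesQuasiIso_BB' h)

end BeilinsonDb

section Truncation

open CochainComplex HomComplex DerivedCategory Pretriangulated

universe v₁ u₁

variable {C : Type u₁} [Category.{v₁} C] [Abelian C]

lemma isIso_ιTruncLE_f (K : CochainComplex C ℤ) {n i : ℤ} (hi : i < n) :
    IsIso ((K.ιTruncLE n).f i) := by
  obtain ⟨k, hk⟩ := Int.eq_ofNat_of_zero_le (show 0 ≤ n - i by omega)
  have hf : (ComplexShape.embeddingUpIntLE n).op.f k = i := by
    change n - (k : ℤ) = i
    omega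
  have hb : ¬ (ComplexShape.embeddingUpIntLE n).op.BoundaryGE k :=
    ComplexShape.Embedding.not_boundaryGE_next _ (j := k - 1) (show k - 1 + 1 = k by omega)
  have : IsIso ((K.op.πTruncGE (ComplexShape.embeddingUpIntLE n).op).f i) := by
    exact (ComplexShape.Embedding.isIso_liftExtend_f_iff _ _ _ hf).2
      (K.op.isIso_restrictionToTruncGE' _ _ hb)
  change IsIso ((K.op.πTruncGE (ComplexShape.embeddingUpIntLE n).op).f i).unop
  infer_instance

lemma quasiIsoAt_of_isIso_f {K L : CochainComplex C ℤ} (f : K ⟶ L) {n i : ℤ} (hi : i < n)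
    (h : ∀ j ≤ n, IsIso (f.f j)) : QuasiIsoAt f i := by
  rw [quasiIsoAt_iff' f (i - 1) i (i + 1) (by simp) (by simp)]
  have h1 : IsIso ((HomologicalComplex.shortComplexFunctor' C (.up ℤ) (i - 1) i (i + 1)).map f).τ₁ :=
    h _ (by omega)
  have h2 : IsIso ((HomologicalComplex.shortComplexFunctor' C (.up ℤ) (i - 1) i (i + 1)).map f).τ₂ :=
    h _ (by omega)
  have h3 : IsIso ((HomologicalComplex.shortComplexFunctor' C (.up ℤ) (i - 1) i (i + 1)).map f).τ₃ :=
    h _ (by omega)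
  have := ShortComplex.isIso_of_isIso
    ((HomologicalComplex.shortComplexFunctor' C (.up ℤ) (i - 1) i (i + 1)).map f)
  infer_instance

lemma isIso_mappingCone_map_f {K₁ L₁ K₂ L₂ : CochainComplex C ℤ} (φ₁ : K₁ ⟶ L₁) (φ₂ : K₂ ⟶ L₂)
    (a : K₁ ⟶ K₂) (b : L₁ ⟶ L₂) (comm : φ₁ ≫ b = a ≫ φ₂) (i : ℤ) (ha : IsIso (a.f (i + 1)))
    (hb : IsIso (b.f i)) : IsIso ((mappingCone.map φ₁ φ₂ a b comm).f i) := by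
  refine ⟨(mappingCone.fst φ₂).1.v i (i + 1) rfl ≫ inv (a.f (i + 1)) ≫
    (mappingCone.inl φ₁).v (i + 1) i (by omega) + (mappingCone.snd φ₂).v i i (add_zero i) ≫
      inv (b.f i) ≫ (mappingCone.inr φ₁).f i, ?_, ?_⟩
  all_goals simp [mappingCone.ext_from_iff _ (i + 1) i rfl, mappingCone.map]

variable [HasDerivedCategory C]

lemma retract_of_quasiIsoAt {K L : CochainComplex C ℤ} (f : K ⟶ L) (b : ℤ) [L.IsLE b]
    (h : ∀ i ≤ b, QuasiIsoAt f i) : Nonempty (Retract (Q.obj L) (Q.obj K)) := by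
  have hq : QuasiIso (K.ιTruncLE b ≫ f) := ⟨fun i => by
    by_cases hi : i ≤ b
    · have := h i hi
      have := K.quasiIsoAt_ιTruncLE b i hi
      infer_instance
    · rw [quasiIsoAt_iff_exactAt']
      · exact exactAt_of_isLE _ b i (by omega)
      · exact exactAt_of_isLE _ b i (by omega)⟩
  have : IsIso (Q.map (K.ιTruncLE b) ≫ Q.map f) := by
    rw [← Q.map_comp]
    infer_instance
  exact ⟨⟨inv (Q.map (K.ιTruncLE b) ≫ Q.map f) ≫ Q.map (K.ιTruncLE b), Q.map f, by simp⟩⟩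

lemma prop_of_bounded (P : ObjectProperty (DerivedCategory C)) [P.IsTriangulated]
    [P.IsClosedUnderIsomorphisms]
    (hP : ∀ V : C, P ((DerivedCategory.singleFunctor C 0).obj V)) : TStructure.t.bounded ≤ P := by
  have hP' : ∀ (n : ℤ) (V : C), P ((DerivedCategory.singleFunctor C n).obj V) := fun n V => by
    exact P.prop_of_iso (((DerivedCategory.singleFunctors C).shiftIso (-n) n 0 (by simp)).app V)
      (P.le_shift (-n) _ (hP V))
  have key : ∀ (k : ℕ) (a : ℤ) (M : DerivedCategory C), M.IsGE a → M.IsLE (a + k) → P M := by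
    intro k
    induction k with
    | zero =>
      intro a M h1 h2
      have : M.IsLE a := by simpa using h2
      obtain ⟨V, ⟨e⟩⟩ := exists_iso_singleFunctor_obj_of_isGE_of_isLE M a
      exact P.prop_of_iso e.symm (hP' a V)
    | succ k ih =>
      intro a M h1 h2
      obtain ⟨A, B, hA, hB, f, g, δ, hT⟩ := TStructure.t.exists_triangle M a (a + 1) rfl
      have hA' : A.IsLE a := ⟨hA⟩
      have hB' : B.IsGE (a + 1) := ⟨hB⟩
      refine P.ext_of_isTriangulatedClosed₂ _ hT (ih a A ?_ (TStructure.t.isLE_of_le A a (a + k)))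
        (ih (a + 1) B hB' ?_)
      · exact TStructure.t.isGE₂ _ (inv_rot_of_distTriang _ hT) a
          (@Triangulated.TStructure.isGE_of_ge _ _ _ _ _ _ _ _ _ a (a + 2) (by omega)
            (TStructure.t.isGE_shift B (a + 1) (-1) (a + 2))) h1
      · exact TStructure.t.isLE₂ _ (rot_of_distTriang _ hT) (a + 1 + k)
          (TStructure.t.isLE_of_le M (a + (k + 1 : ℕ)) _)
          (@Triangulated.TStructure.isLE_of_le _ _ _ _ _ _ _ _ _ (a - 1) (a + 1 + k) (by omega)
            (TStructure.t.isLE_shift A a 1 (a - 1)))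
  rintro M ⟨⟨a, ha⟩, ⟨b, hb⟩⟩
  exact key (b - a).toNat a M ha (TStructure.t.isLE_of_le M b _)

end Truncation

section Thick

open CochainComplex HomComplex DerivedCategory Pretriangulated

variable [IsSmoothCurve s] {𝓔 : FirstOrder s} (h : TensorQC 𝓔)

/-- The evaluation `R(1) ⊗ M_{-1} → M`. -/
noncomputable def evOne (M : Gr 𝓔) : grInd 𝓔 1 ((degF 𝓔 (-1)).obj (gm M)) (M.property.2 _) ⟶ M :=
  grHom _ _ ((ev 𝓔 1 (-1) (by norm_num)).app (gm M))

lemma bijective_evOne (M : Gr 𝓔) (U : X.affineOpens) :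
    Function.Bijective ((evOne M).hom.app ⟨U, -1⟩) := by
  have key : ∀ (U : X.affineOpens) (_ : Small 𝓔 U), Function.Bijective ((evOne M).hom.app ⟨U, -1⟩) := by
    intro U c
    let g := Small.gen 𝓔 U 1 ((degF 𝓔 (-1)).obj (gm M)) (n := -1) (by norm_num)
    have hg : ∀ m, (evOne M).hom.app ⟨U, -1⟩ (g m) = m := fun m => act_one M.obj _ m
    refine ⟨(injective_iff_map_eq_zero _).2 fun x hx => ?_, fun m => ⟨g m, hg m⟩⟩
    obtain ⟨m, rfl⟩ := Small.gen_surjective c (show (-1 : ℤ) + 1 = 0 by norm_num) x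
    exact (congrArg g ((hg m).symm.trans hx)).trans (map_zero g)
  exact ⟨injective_of_small _ _ (fun U c => (key U c).1) U,
    surjective_of_small _ _ (fun U c => (key U c).2) U⟩

lemma isIso_termT_map {M N : Gr 𝓔} (f : M ⟶ N)
    (hf : ∀ U, Function.Bijective (f.hom.app ⟨U, -1⟩)) : IsIso ((termT h).map f) := by
  have h1 : ∀ x, IsIso (((degF 𝓔 (-1)).map (gmMap f)).hom.app x) := fun x =>
    (ConcreteCategory.isIso_iff_bijective _).2 (hf x.U)
  have h2 : IsIso ((degF 𝓔 (-1)).map (gmMap f)).hom := NatIso.isIso_of_isIso_app _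
  have h3 : IsIso ((degF 𝓔 (-1)).map (gmMap f)) :=
    @isIso_of_reflects_iso _ _ _ _ _ _ ((degF 𝓔 (-1)).map (gmMap f)) (isOMod (s := s)).ι h2 _
  have h4 : IsIso ((ind 𝓔 (-1)).map ((tensorT 𝓔).map ((degF 𝓔 (-1)).map (gmMap f)))) := inferInstance
  have h5 : IsIso ((isGMod (𝓔 := 𝓔)).ι.map
    ((ind 𝓔 (-1)).map ((tensorT 𝓔).map ((degF 𝓔 (-1)).map (gmMap f))))) := inferInstance
  exact @isIso_of_reflects_iso _ _ _ _ _ _ ((termT h).map f) (isGr (𝓔 := 𝓔)).ι h5 _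

variable [HasDerivedCategory (Gr 𝓔)] [HasDerivedCategory (Qgr 𝓔)]

instance : (isInduced h).Nonempty := ⟨_, 0, strSheaf s, Or.inl rfl, rfl⟩

lemma prop_termR (M : Gr 𝓔) : (isInduced h).triangEnvelope
    ((DerivedCategory.singleFunctor (Qgr 𝓔) 0).obj ((π 𝓔).obj ((termR h).obj M))) :=
  ObjectProperty.le_triangEnvelope _ _ ⟨0, ⟨((degF 𝓔 0).obj (gm M)).obj, M.property.2 0⟩, Or.inl rfl, rfl⟩

lemma prop_termT (M : Gr 𝓔) : (isInduced h).triangEnvelope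
    ((DerivedCategory.singleFunctor (Qgr 𝓔) 0).obj ((π 𝓔).obj ((termT h).obj M))) := by
  let N : Gr 𝓔 := grInd 𝓔 1 ((degF 𝓔 (-1)).obj (gm M)) (M.property.2 _)
  have h1 : IsIso ((termT h).map (evOne M)) := isIso_termT_map h _ (bijective_evOne M)
  have h2 := (isKos_grInd_one ((degF 𝓔 (-1)).obj (gm M)) (M.property.2 _)).shortExact h
  have h3 := ObjectProperty.ext_of_isTriangulatedClosed₁ (isInduced h).triangEnvelope _
    h2.singleTriangle_distinguished (prop_termR h N) (ObjectProperty.le_triangEnvelope _ _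
      ⟨1, ⟨((degF 𝓔 (-1)).obj (gm M)).obj, M.property.2 (-1)⟩, Or.inr rfl, rfl⟩)
  exact ObjectProperty.prop_of_iso _
    ((DerivedCategory.singleFunctor (Qgr 𝓔) 0).mapIso ((π 𝓔).mapIso (asIso ((termT h).map (evOne M))))) h3

lemma prop_map_bounded {F : Gr 𝓔 ⥤ Gr 𝓔} [F.Additive] [PreservesFiniteLimits F]
    [PreservesFiniteColimits F] (P : ObjectProperty (DerivedCategory (Qgr 𝓔))) [P.IsTriangulated]
    [P.IsClosedUnderIsomorphisms]
    (hF : ∀ M, P ((DerivedCategory.singleFunctor (Qgr 𝓔) 0).obj ((π 𝓔).obj (F.obj M))))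
    (K : CochainComplex (Gr 𝓔) ℤ) (hK : TStructure.t.bounded (Q.obj K)) :
    P (Q.obj (((π 𝓔).mapHomologicalComplex _).obj ((F.mapHomologicalComplex _).obj K))) := by
  have h1 := prop_of_bounded (P.inverseImage (F ⋙ π 𝓔).mapDerivedCategory) (fun V =>
    P.prop_of_iso (((F ⋙ π 𝓔).mapDerivedCategorySingleFunctor 0).app V).symm (hF V)) _ hK
  exact P.prop_of_iso ((F ⋙ π 𝓔).mapDerivedCategoryFactors.app K) h1

lemma prop_π_BB (K : CochainComplex (Gr 𝓔) ℤ) (hK : TStructure.t.bounded (Q.obj K)) :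
    (isInduced h).triangEnvelope
      (Q.obj (((π 𝓔).mapHomologicalComplex _).obj ((BB h).obj K))) := by
  refine ObjectProperty.prop_of_iso _ (Q.mapIso (mappingCone.mapHomologicalComplexIso _ (π 𝓔))).symm
    (ObjectProperty.ext_of_isTriangulatedClosed₃ _ _
      (DerivedCategory.mappingCone_triangle_distinguished _) ?_ ?_)
  · exact prop_map_bounded _ (prop_termT h) K hK
  · exact prop_map_bounded _ (prop_termR h) K hK

lemma isIso_BB_map_f {K L : CochainComplex (Gr 𝓔) ℤ} (f : K ⟶ L) (i : ℤ) (h1 : IsIso (f.f i))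
    (h2 : IsIso (f.f (i + 1))) : IsIso (((BB h).toFunctor.map f).f i) := by
  refine (congrArg (fun g => IsIso (HomologicalComplex.Hom.f g i))
    (DGFun.cone_toFunctor_map (DGFun.NatTrans.ofNatTrans (diffT h)) f)).mpr
    (isIso_mappingCone_map_f _ _ _ _ _ i ?_ ?_)
  · rw [DGFun.ofAdditive_toFunctor_map]
    exact Functor.map_isIso (termT h) _
  · rw [DGFun.ofAdditive_toFunctor_map]
    exact Functor.map_isIso (termR h) _

lemma bounded_le_triangEnvelope [(π 𝓔).IsLeftAdjoint] [EnoughInjectives (Qgr 𝓔)] :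
    (TStructure.t (C := Qgr 𝓔)).bounded ≤ (isInduced h).triangEnvelope := by
  rintro M ⟨⟨a, ha⟩, ⟨b, hb⟩⟩
  let M' : DerivedCategory.Plus (Qgr 𝓔) := ⟨M, a, ha⟩
  have : M'.IsGE a := (M'.isGE_ι_obj_iff a).1 ha
  obtain ⟨I', hI', ⟨e⟩⟩ := Plus.exists_injective_nonempty_iso M' a
  let I := (injCpx 𝓔).obj I'
  have e' : Q.obj I ≅ M := ((quotientCompQhIso _).app I).symm ≪≫ Plus.ι.mapIso e
  let K : CochainComplex (Gr 𝓔) ℤ := ((ω 𝓔).mapHomologicalComplex (.up ℤ)).obj I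
  let f : ((π 𝓔).mapHomologicalComplex (.up ℤ)).obj ((BB h).obj (K.truncLE (b + 3))) ⟶
      ((π 𝓔).mapHomologicalComplex (.up ℤ)).obj ((BB h).obj K) :=
    ((π 𝓔).mapHomologicalComplex (.up ℤ)).map ((BB h).toFunctor.map (K.ιTruncLE (b + 3)))
  let η : ((π 𝓔).mapHomologicalComplex (.up ℤ)).obj ((BB h).obj K) ⟶ I := (etaOf (augB h)).app I
  have hη : QuasiIso η := quasiIso_etaB h I fun n => (I'.obj.X n).property
  have hI : I.IsLE b := (isLE_Q_obj_iff I b).1 (TStructure.t.isLE_of_iso e'.symm b)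
  have hbd : TStructure.t.bounded (Q.obj (K.truncLE (b + 3))) := by
    have : I'.obj.IsStrictlyGE a := hI'
    have : I.IsStrictlyGE a := inferInstanceAs (CochainComplex.IsStrictlyGE
      (((InjectiveObject.ι (Qgr 𝓔)).mapHomologicalComplex (.up ℤ)).obj I'.obj) a)
    have : K.IsStrictlyGE a := inferInstanceAs (CochainComplex.IsStrictlyGE
      (((ω 𝓔).mapHomologicalComplex (.up ℤ)).obj I) a)
    have : (K.truncLE (b + 3)).IsStrictlyGE a := inferInstance
    exact ⟨⟨a, inferInstance⟩, ⟨b + 3, inferInstance⟩⟩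
  obtain ⟨r⟩ := retract_of_quasiIsoAt (f ≫ η) b fun i hi => by
    have : QuasiIsoAt f i := quasiIsoAt_of_isIso_f f (n := b + 1) (by omega) fun j hj => by
      have := isIso_BB_map_f h (K.ιTruncLE (b + 3)) j (isIso_ιTruncLE_f K (by omega))
        (isIso_ιTruncLE_f K (by omega))
      exact @Functor.map_isIso _ _ _ _ _ _ (π 𝓔) _ this
    infer_instance
  exact ObjectProperty.prop_of_iso _ e' (ObjectProperty.prop_of_retract _ r (prop_π_BB h _ hbd))

end Thick

section Orthogonal

open CochainComplex HomComplex DerivedCategory Pretriangulated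

section Derived

variable {C : Type*} [Category C] [Abelian C] [HasDerivedCategory C]

lemma isZero_Q_obj (K : CochainComplex C ℤ) (hK : ∀ n, IsZero (K.homology n)) : IsZero (Q.obj K) := by
  have h1 : QuasiIso (0 : K ⟶ K) := ⟨fun n => by
    rw [quasiIsoAt_iff_isIso_homologyMap]
    exact ⟨0, (hK n).eq_of_src _ _, (hK n).eq_of_src _ _⟩⟩
  have h2 : IsIso (Q.map (0 : K ⟶ K)) := (isIso_Q_map_iff_quasiIso C _).2 h1
  rw [Functor.map_zero] at h2
  rw [IsZero.iff_id_eq_zero, ← IsIso.hom_inv_id (0 : Q.obj K ⟶ Q.obj K), zero_comp]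

/-- A cocycle of a K-injective complex is a coboundary if there are no shifted morphisms. -/
lemma exists_coboundary (I : CochainComplex C ℤ) [I.IsKInjective] {P : C} {n : ℤ}
    (hP : ∀ f : (DerivedCategory.singleFunctor C 0).obj P ⟶ (Q.obj I)⟦n⟧, f = 0)
    (φ : P ⟶ I.X n) (hφ : φ ≫ I.d n (n + 1) = 0) :
    ∃ ψ : P ⟶ I.X (n - 1), ψ ≫ I.d (n - 1) n = φ := by
  let z : Cocycle ((CochainComplex.singleFunctor C 0).obj P) I n :=
    Cocycle.fromSingleMk φ (zero_add n) (n + 1) rfl hφ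
  have h1 : CohomologyClass.toHom (CohomologyClass.mk z) = 0 := by
    apply (CochainComplex.IsKInjective.Qh_map_bijective _ (I⟦n⟧)).injective
    let e : Q.obj (I⟦n⟧) ≅ (Q.obj I)⟦n⟧ := (Q.commShiftIso n).app I
    have h2 := hP (Qh.map (CohomologyClass.toHom (CohomologyClass.mk z)) ≫ e.hom)
    rw [Functor.map_zero]
    exact (cancel_mono e.hom).1 (h2.trans zero_comp.symm)
  rw [CohomologyClass.toHom_mk_eq_zero_iff, mem_coboundaries_iff _ (n - 1) (by omega)] at h1
  obtain ⟨β, hβ⟩ := h1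
  obtain ⟨ψ, rfl⟩ := Cochain.fromSingleMk_surjective β (n - 1) (by omega)
  refine ⟨ψ, ?_⟩
  rw [Cochain.δ_fromSingleMk ψ _ n n (by omega)] at hβ
  exact (Cochain.fromSingleEquiv (zero_add n)).symm.injective hβ

lemma comp_homologyπ_eq_zero {A : Type*} [Category A] [Abelian A] {F : A ⥤ C} {W : C ⥤ A}
    [F.Additive] [W.Additive] (adj : F ⊣ W) (I : CochainComplex C ℤ) [I.IsKInjective] {P : A} {n : ℤ}
    (hP : ∀ f : (DerivedCategory.singleFunctor C 0).obj (F.obj P) ⟶ (Q.obj I)⟦n⟧, f = 0)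
    (φ : P ⟶ ((W.mapHomologicalComplex (.up ℤ)).obj I).cycles n) :
    φ ≫ ((W.mapHomologicalComplex (.up ℤ)).obj I).homologyπ n = 0 := by
  let K := (W.mapHomologicalComplex (.up ℤ)).obj I
  let χ : P ⟶ W.obj (I.X n) := φ ≫ K.iCycles n
  have hχ : χ ≫ W.map (I.d n (n + 1)) = 0 := by
    change (φ ≫ K.iCycles n) ≫ K.d n (n + 1) = 0
    simp
  obtain ⟨ψ, hψ⟩ := exists_coboundary I hP ((adj.homEquiv _ _).symm χ) (by
    rw [← adj.homEquiv_naturality_right_symm, hχ, adj.homEquiv_counit, F.map_zero, zero_comp])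
  let ψ' : P ⟶ K.X (n - 1) := adj.homEquiv _ _ ψ
  have h1 : ψ' ≫ K.d (n - 1) n = φ ≫ K.iCycles n := by
    refine (adj.homEquiv_naturality_right ψ (I.d (n - 1) n)).symm.trans ?_
    rw [hψ]
    exact (adj.homEquiv _ _).apply_symm_apply χ
  have h2 : φ = ψ' ≫ K.toCycles (n - 1) n := by
    rw [← cancel_mono (K.iCycles n), Category.assoc, K.toCycles_i, h1]
  change φ ≫ K.homologyπ n = 0
  rw [h2, Category.assoc, K.toCycles_comp_homologyπ, comp_zero]

end Derived

variable [IsSmoothCurve s] {𝓔 : FirstOrder s} (h : TensorQC 𝓔)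

/-- The morphism `O → V` given by a section over the affine scheme `X`. -/
noncomputable def ofSection {U : X.affineOpens} (hU : ∀ W, W ≤ U) (V : OMod s) (m : Sct V U) :
    (⟨strFun s, isQCoh_strFun.1⟩ : OMod s) ⟶ V :=
  ObjectProperty.homMk
    { app x := AddCommGrpCat.ofHom (AddMonoidHom.mk'
        (fun f : Sec s x.U => Sct.map V (x := ⟨U⟩) (y := x) ⟨hU _, f⟩ m)
        (fun a b => Sct.map_add' V _ a b m))
      naturality x y g := by
        ext f
        exact Sct.map_comp V (x := ⟨U⟩) ⟨hU _, f⟩ g m }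

/-- The morphism `R(k) → M` given by a section of `M_l` over `X`, where `k + l = 0`. -/
noncomputable def indOfSection {U : X.affineOpens} (hU : ∀ W, W ≤ U) (M : Gr 𝓔) {k l : ℤ}
    (hkl : k + l = 0) (m : M.obj.obj ⟨U, l⟩) : (indQ h k).obj (strSheaf s) ⟶ M :=
  grHom (isGr_ind k _ isQCoh_strFun) M.property
    ((ind 𝓔 k).map (ofSection hU ((degF 𝓔 l).obj (gm M)) m) ≫ (ev 𝓔 k l hkl).app (gm M))

lemma exists_indOfSection_eq {U : X.affineOpens} (hU : ∀ W, W ≤ U) (M : Gr 𝓔) {k l : ℤ}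
    (hkl : k + l = 0) (m : M.obj.obj ⟨U, l⟩) :
    ∃ x, (indOfSection h hU M hkl m).hom.app ⟨U, l⟩ x = m := by
  refine ⟨Small.gen 𝓔 U k ⟨strFun s, isQCoh_strFun.1⟩ (by omega) (1 : Sec s U), ?_⟩
  exact (act_one M.obj _ _).trans (Sct.map_id ((degF 𝓔 l).obj (gm M)) ⟨U⟩ m)

lemma eq_zero_of_top {U : X.affineOpens} (hU : ∀ W, W ≤ U) (M : Gr 𝓔) (l : ℤ)
    (hM : ∀ m : M.obj.obj ⟨U, l⟩, m = 0) (W : X.affineOpens) (m : M.obj.obj ⟨W, l⟩) : m = 0 := by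
  have h1 := span_resSct (V := (degF 𝓔 l).obj (gm M)) (M.property.2 l) (hU W)
  have h2 : Set.range (Sct.res ((degF 𝓔 l).obj (gm M)) (hU W)) ⊆ {0} := by
    rintro _ ⟨x, rfl⟩
    exact (congrArg _ (hM x)).trans (map_zero _)
  have h3 : (show Sct ((degF 𝓔 l).obj (gm M)) W from m) ∈ Submodule.span (Sec s W)
      (Set.range (Sct.res ((degF 𝓔 l).obj (gm M)) (hU W))) := h1 ▸ Submodule.mem_top
  exact (Submodule.mem_bot (M := Sct ((degF 𝓔 l).obj (gm M)) W) (Sec s W)).1 (Submodule.span_le.2 h2 h3)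

lemma surjective_of_epi {M N : Gr 𝓔} (p : M ⟶ N) [Epi p] (x : RCat 𝓔) :
    Function.Surjective (p.hom.app x) := fun y =>
  (gr_exact_iff.1 ((ShortComplex.exact_iff_epi (.mk p (0 : N ⟶ N) comp_zero) rfl).2 ‹_›) x y).1 rfl

lemma isZero_termR (M : Gr 𝓔) (hM : ∀ W, ∀ m : M.obj.obj ⟨W, 0⟩, m = 0) : IsZero ((termR h).obj M) :=
  gr_isZero_iff.2 fun x m => by
    have h1 : Subsingleton (Sct ((degF 𝓔 0).obj (gm M)) x.U) :=
      subsingleton_of_forall_eq 0 (hM x.U)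
    have h2 : Subsingleton (FR 𝓔 x.U (x.deg + 0) ⊗[Sec s x.U] Sct ((degF 𝓔 0).obj (gm M)) x.U) :=
      inferInstance
    exact h2.elim _ _

lemma isZero_termT (M : Gr 𝓔) (hM : ∀ W, ∀ m : M.obj.obj ⟨W, -1⟩, m = 0) :
    IsZero ((termT h).obj M) :=
  gr_isZero_iff.2 fun x m => by
    have h1 : Subsingleton (Sct ((degF 𝓔 (-1)).obj (gm M)) x.U) :=
      subsingleton_of_forall_eq 0 (hM x.U)
    have h2 : Subsingleton (Sct ((tensorT 𝓔).obj ((degF 𝓔 (-1)).obj (gm M))) x.U) :=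
      inferInstanceAs (Subsingleton (TU 𝓔 x.U ⊗[Sec s x.U] Sct ((degF 𝓔 (-1)).obj (gm M)) x.U))
    have h3 : Subsingleton (FR 𝓔 x.U (x.deg + -1) ⊗[Sec s x.U]
      Sct ((tensorT 𝓔).obj ((degF 𝓔 (-1)).obj (gm M))) x.U) := inferInstance
    exact h3.elim _ _

variable [HasDerivedCategory (Qgr 𝓔)]

lemma isZero_Q_map {F : Gr 𝓔 ⥤ Gr 𝓔} [F.Additive] [PreservesFiniteLimits F]
    [PreservesFiniteColimits F] (K : CochainComplex (Gr 𝓔) ℤ)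
    (hK : ∀ n, IsZero (F.obj (K.homology n))) :
    IsZero (Q.obj (((π 𝓔).mapHomologicalComplex _).obj ((F.mapHomologicalComplex _).obj K))) :=
  isZero_Q_obj _ fun n => ((π 𝓔).map_isZero (hK n)).of_iso ((K.sc n).mapHomologyIso (F ⋙ π 𝓔))

lemma isZero_of_orthogonal [(π 𝓔).IsLeftAdjoint] [EnoughInjectives (Qgr 𝓔)] [IsAffine X]
    (M : DerivedCategory (Qgr 𝓔)) (hM : TStructure.t.bounded M)
    (hG : ∀ (n : ℤ) (f : (DerivedCategory.singleFunctor (Qgr 𝓔) 0).obj (G h) ⟶ M⟦n⟧), f = 0) :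
    IsZero M := by
  obtain ⟨⟨a, ha⟩, -⟩ := hM
  let M' : DerivedCategory.Plus (Qgr 𝓔) := ⟨M, a, ha⟩
  have : M'.IsGE a := (M'.isGE_ι_obj_iff a).1 ha
  obtain ⟨I', hI', ⟨e⟩⟩ := Plus.exists_injective_nonempty_iso M' a
  let I := (injCpx 𝓔).obj I'
  have e' : Q.obj I ≅ M := ((quotientCompQhIso _).app I).symm ≪≫ Plus.ι.mapIso e
  have hI : I.IsKInjective := by
    have : I'.obj.IsStrictlyGE a := hI'
    have : I.IsStrictlyGE a := inferInstanceAs (CochainComplex.IsStrictlyGE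
      (((InjectiveObject.ι (Qgr 𝓔)).mapHomologicalComplex (.up ℤ)).obj I'.obj) a)
    have : ∀ n, Injective (I.X n) := fun n => (I'.obj.X n).property
    exact isKInjective_of_injective I a
  let K : CochainComplex (Gr 𝓔) ℤ := ((ω 𝓔).mapHomologicalComplex (.up ℤ)).obj I
  have hG' : ∀ (n : ℤ) (f : (DerivedCategory.singleFunctor (Qgr 𝓔) 0).obj (G h) ⟶ (Q.obj I)⟦n⟧),
      f = 0 := fun n f =>
    (cancel_mono ((CategoryTheory.shiftFunctor _ n).map e'.hom)).1 ((hG n _).trans zero_comp.symm)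
  let U : X.affineOpens := ⟨⊤, isAffineOpen_top X⟩
  have hU : ∀ W, W ≤ U := fun W => le_top (a := W.1)
  have key : ∀ (k l : ℤ) (hkl : k + l = 0) (p : G h ⟶ (π 𝓔).obj ((indQ h k).obj (strSheaf s)))
      (_ : IsSplitEpi p) (n : ℤ) (W : X.affineOpens) (m : (K.homology n).obj.obj ⟨W, l⟩), m = 0 := by
    intro k l hkl p hp n
    refine eq_zero_of_top hU _ l fun m => ?_
    obtain ⟨y, rfl⟩ := surjective_of_epi (K.homologyπ n) ⟨U, l⟩ m
    have h1 := comp_homologyπ_eq_zero (adjπ 𝓔) I (n := n) (fun f =>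
      (cancel_epi ((DerivedCategory.singleFunctor (Qgr 𝓔) 0).map p)).1
        ((hG' n _).trans comp_zero.symm)) (indOfSection h hU (K.cycles n) hkl y)
    obtain ⟨x, hx⟩ := exists_indOfSection_eq h hU (K.cycles n) hkl y
    rw [← hx]
    exact congrArg (fun g => g.hom.app ⟨U, l⟩ x) h1
  let η : ((π 𝓔).mapHomologicalComplex (.up ℤ)).obj ((BB h).obj K) ⟶ I := (etaOf (augB h)).app I
  have hη : IsIso (Q.map η) :=
    (isIso_Q_map_iff_quasiIso _ _).2 (quasiIso_etaB h I fun n => (I'.obj.X n).property)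
  refine IsZero.of_iso ?_ (e'.symm ≪≫ (asIso (Q.map η)).symm ≪≫
    Q.mapIso (mappingCone.mapHomologicalComplexIso _ (π 𝓔)))
  refine Triangle.isZero₃_of_isZero₁₂ _ (DerivedCategory.mappingCone_triangle_distinguished _) ?_ ?_
  · exact isZero_Q_map (F := termT h) K fun n =>
      isZero_termT h _ (key 1 (-1) (by norm_num) biprod.snd (.mk' ⟨biprod.inr, biprod.inr_snd⟩) n)
  · exact isZero_Q_map (F := termR h) K fun n =>
      isZero_termR h _ (key 0 0 (by norm_num) biprod.fst (.mk' ⟨biprod.inl, biprod.inl_fst⟩) n)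

end Orthogonal

end NCBeilinson

theorem mainTheorem5 {X : Scheme.{0}} (s : X ⟶ Spec (CommRingCat.of ℂ))
    [NCBeilinson.IsSmoothCurve s] (𝓔 : NCBeilinson.FirstOrder s)
    [HasDerivedCategory (NCBeilinson.Gr 𝓔)] [HasDerivedCategory (NCBeilinson.Qgr 𝓔)] :
    ∃ (h : NCBeilinson.TensorQC 𝓔) (_ : (NCBeilinson.π 𝓔).IsLeftAdjoint)
      (_ : EnoughInjectives (NCBeilinson.Qgr 𝓔)),
      NCBeilinson.IsoIdDg (NCBeilinson.BB h) ∧ NCBeilinson.IsoIdDg (NCBeilinson.BB' h) ∧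
      NCBeilinson.IsoIdDb (NCBeilinson.BB h) ∧ NCBeilinson.IsoIdDb (NCBeilinson.BB' h) ∧
      NCBeilinson.Generates h := by
  have : (NCBeilinson.π 𝓔).IsLeftAdjoint := NCBeilinson.isLeftAdjoint_π
  have : EnoughInjectives (NCBeilinson.Qgr 𝓔) := NCBeilinson.enoughInjectives_qgr
  have h : NCBeilinson.TensorQC 𝓔 := NCBeilinson.tensorQC 𝓔
  exact ⟨h, inferInstance, inferInstance, NCBeilinson.isoIdDg_BB h, NCBeilinson.isoIdDg_BB' h,
    NCBeilinson.isoIdDb_BB h, NCBeilinson.isoIdDb_BB' h, NCBeilinson.bounded_le_triangEnvelope h,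
    fun _ => NCBeilinson.isZero_of_orthogonal h⟩
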